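/- **Proposition 4.2.** Let $0<q<1$, let $\beta\in\mathbb C$ with $\operatorname{Re}\beta>0$, and put $t=q^{\beta}$, so $|t|<1$. Write $(a;q)_\infty=\prod_{k\ge0}(1-aq^k)$. *Macdonald functions.* Let $p_r$ be the power sums and $m_\mu$ the monomial symmetric functions, and let $\langle\cdot,\cdot\rangle_{q,t}$ be the bilinear form on the ring of symmetric functions (in infinitely many variables, over $\mathbb C$) with $\langle p_\kappa,p_\mu\rangle_{q,t}=\delta_{\kappa\mu}\prod_{r}r^{m_r}m_r!\prod_i\frac{1-q^{\kappa_i}}{1-t^{\kappa_i}}$ for $\kappa=(1^{m_1}2^{m_2}\cdots)$. $P_\kappa=P_\kappa(x;q,t)$ denotes the Macdonald symmetric functions, characterized by $P_\kappa=m_\kappa+\sum_{\mu<\kappa}u_{\kappa\mu}m_\mu$ (dominance order) and $\langle P_\kappa,P_\mu\rangle_{q,t}=0$ for $\kappa\ne\mu$. For symmetric functions $f,g$ put $$\langle f,g\rangle'_{n;q,t}=\frac1{n!}\oint_{|y_j|=1}\prod_{j=1}^n\frac{dy_j}{2\pi i y_j}\,f(y_1^{-1},\dots,y_n^{-1})\,g(y_1,\dots,y_n)\prod_{i\ne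 j}\frac{(y_i/y_j;q)_\infty}{(t\,y_i/y_j;q)_\infty}.$$ *The partition.* Let $r_N>\cdots>r_1\ge1$ and $s_1,\dots,s_N\ge1$, let $\lambda=(s_N^{r_N})+\cdots+(s_1^{r_1})$ be the partition that is the row-wise sum of the rectangles $(s^r)=(s,\dots,s)$ ($r$ entries); every partition is uniquely of this form. Put $\lambda^{(a)}=(s_a^{r_a})+\cdots+(s_1^{r_1})$ and $$C^+_\lambda=\prod_{a=1}^N\frac{\langle P_{\lambda^{(a)}},P_{\lambda^{(a)}}\rangle_{q,t}}{r_a!\,\langle P_{\lambda^{(a)}},P_{\lambda^{(a)}}\rangle'_{r_a;q,t}}.$$ *Bosons.* Let $a^a_n$ ($1\le a\le N$, $n\in\mathbb Z\setminus\{0\}$) satisfy $[a^a_n,a^b_m]=\frac{n}{1-t^{|n|}}\delta_{n+m,0}\delta^{ab}$, acting on the Fock space $\mathcal F=\mathbb C[a^a_{-1},a^a_{-2},\dots]|0\rangle$ with $a^a_n|0\rangle=0$ for $n>0$; let $L_0=\sum_{a=1}^N\sum_{n\ge1}(1-t^n)a^a_{-n}a^a_n$ and $$\phi^a(z)=-\sum_{n\ne0}(1-t^{|n|})\frac{a^a_n}{n}z^{-n},\qquad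 \phi^a_-(z)=\sum_{n>0}(1-t^n)\frac{a^a_{-n}}{n}z^n,$$ where $:\ :$ moves $a^a_n$ to the right of $a^a_{-n}$ ($n>0$). Products are ordered from left to right, $\prod_{i=1}^k\mathcal O_i=\mathcal O_1\cdots\mathcal O_k$; operators are composed and traces are taken in the monomial basis of $\mathcal F$. *Contours.* Let $n\ge0$ and let $x_1,\dots,x_n\in\mathbb C$ be the first $n$ variables of $x=(x_1,x_2,\dots)$, the others being $0$; put $x^{N+1}_i=x_i$ and $r_{N+1}=n$. Let $x^a_j$ ($1\le a\le N$, $1\le j\le r_a$) run over circles centred at $0$ with radii $\rho^a_j>0$ such that, on them, $q<|x^a_j/x^a_i|<1$ for $i<j$ and $|x^{a+1}_i/x^a_j|<1$ for all $a,i,j$. Then, for every $n$, all $x_1,\dots,x_n$ and all such contours, the operator product and the trace below converge absolutely at every point of the contours, the integrand is integrable, and $$P_\lambda(x;q,t)=C^+_\lambda\,(q;q)_\infty^{N-\sum_a r_a}\,(tq;q)_\infty^{\sum_a r_a}\prod_{a=1}^N\Bigl(r_a!\prod_{k=1}^{r_a}\frac{1-t}{1-t^k}\Bigr)\oint\prod_{a=1}^N\prod_{j=1}^{r_a}\frac{dx^a_j}{2\pi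 i x^a_j}(x^a_j)^{s_a}\;\operatorname{Tr}_{\mathcal F}\Bigl(q^{L_0}\prod_{a=1}^N\prod_{j=1}^{r_a}:e^{\phi^a(x^a_j)}:\ \prod_{a=1}^N\prod_{j=1}^{r_{a+1}}e^{-\phi^a_-(x^{a+1}_j)}\Bigr).$$ As $n$ is arbitrary, this determines $P_\lambda$ as a symmetric function in infinitely many variables. -/

import Mathlib

open scoped BigOperators

noncomputable section

namespace MacdonaldBoson

/-! ### Infinite `q`-shifted factorials -/

/-- `(a; q)_∞ = ∏_{k ≥ 0} (1 - a q^k)`. -/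
def qPoch (a q : ℂ) : ℂ := ∏' k : ℕ, (1 - a * q ^ k)

/-! ### Symmetric functions -/

/-- The ring of symmetric functions over `ℂ` in infinitely many variables, presented as the
polynomial ring `ℂ[p₁, p₂, p₃, …]` in the power sums (`X r` stands for `p_r`). An element is the
same as its compatible system of realizations `toVars` in `n` variables. -/
abbrev SymFun : Type := MvPolynomial ℕ+ ℂ

/-- The image of a symmetric function in the ring of polynomials in `x_1, …, x_n`: the power sum
`p_r` is sent to `x_1^r + ⋯ + x_n^r`. -/
def toVars (n : ℕ) (f : SymFun) : MvPolynomial (Fin n) ℂ :=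
  MvPolynomial.aeval (fun r : ℕ+ => MvPolynomial.psum (Fin n) ℂ (r : ℕ)) f

/-- The value `f(x_1, …, x_n)`. -/
def evalAt {n : ℕ} (f : SymFun) (x : Fin n → ℂ) : ℂ := MvPolynomial.eval x (toVars n f)

/-- `z_κ(q,t) = ∏_r r^{m_r} m_r! ((1 - q^r) / (1 - t^r))^{m_r}` for `κ = (1^{m_1} 2^{m_2} ⋯)`. -/
def zqt (q t : ℂ) (m : ℕ+ →₀ ℕ) : ℂ :=
  m.prod fun r k =>
    ((r : ℕ) : ℂ) ^ k * (k.factorial : ℂ) * ((1 - q ^ (r : ℕ)) / (1 - t ^ (r : ℕ))) ^ k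

/-- The bilinear form `⟨f, g⟩_{q,t}` determined by `⟨p_κ, p_μ⟩_{q,t} = δ_{κ μ} z_κ(q,t)`. -/
def innerQT (q t : ℂ) (f g : SymFun) : ℂ :=
  ∑ m ∈ f.support, MvPolynomial.coeff m f * MvPolynomial.coeff m g * zqt q t m

/-- The natural (dominance) order `μ ≤ κ` on partitions of `d`: all partial sums of the
decreasingly ordered parts of `μ` are at most those of `κ`. -/
def DomLE {d : ℕ} (μ κ : d.Partition) : Prop :=
  ∀ k : ℕ, ((μ.parts.sort (· ≥ ·)).take k).sum ≤ ((κ.parts.sort (· ≥ ·)).take k).sum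

open Classical in
/-- The defining properties of the Macdonald symmetric functions `P_κ(x; q, t)`:
(A) `P_κ = m_κ + ∑_{μ < κ} u_{κ μ} m_μ`, with coefficients independent of the number `n` of
variables, and (B) `⟨P_κ, P_μ⟩_{q,t} = 0` for `κ ≠ μ`. -/
def IsMacdonaldFamily (q t : ℂ) (P : (d : ℕ) → d.Partition → SymFun) : Prop :=
  (∀ (d : ℕ) (κ : d.Partition), ∃ u : d.Partition → ℂ, ∀ n : ℕ,
      toVars n (P d κ) = MvPolynomial.msymm (Fin n) ℂ κ +
        ∑ μ : d.Partition with DomLE μ κ ∧ μ ≠ κ, u μ • MvPolynomial.msymm (Fin n) ℂ μ) ∧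
  (∀ (d e : ℕ) (κ : d.Partition) (μ : e.Partition),
      (⟨d, κ⟩ : (d : ℕ) × d.Partition) ≠ ⟨e, μ⟩ → innerQT q t (P d κ) (P e μ) = 0)

/-- The Macdonald symmetric function `P_κ(x; q, t)`: the family characterized by (A) and (B). -/
def macdonaldP (q t : ℂ) : (d : ℕ) → d.Partition → SymFun :=
  Classical.epsilon (IsMacdonaldFamily q t)

/-! ### Contour integrals over tori -/

/-- `∮ ∏_i dx_i / (2πi x_i) f(x)` over the torus `|x_i| = R_i`, where `x_i = R_i e^{iθ_i}`. -/
def torusMean {ι : Type} [Fintype ι] (R : ι → ℝ) (f : (ι → ℂ) → ℂ) : ℂ :=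
  (1 / (2 * (Real.pi : ℂ)) ^ Fintype.card ι) *
    ∫ θ in Set.Icc (0 : ι → ℝ) (fun _ => 2 * Real.pi),
      f (fun i => (R i : ℂ) * Complex.exp ((θ i : ℂ) * Complex.I))

/-- The integrand of `torusMean R f` is integrable. -/
def TorusMeanExists {ι : Type} [Fintype ι] (R : ι → ℝ) (f : (ι → ℂ) → ℂ) : Prop :=
  MeasureTheory.IntegrableOn
    (fun θ : ι → ℝ => f (fun i => (R i : ℂ) * Complex.exp ((θ i : ℂ) * Complex.I)))
    (Set.Icc (0 : ι → ℝ) (fun _ => 2 * Real.pi))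

/-- `Δ(y; q, t) = ∏_{i ≠ j} (y_i / y_j; q)_∞ / (t y_i / y_j; q)_∞`. -/
def macDelta (q t : ℂ) {n : ℕ} (y : Fin n → ℂ) : ℂ :=
  ∏ i : Fin n, ∏ j : Fin n,
    if i = j then 1 else qPoch (y i / y j) q / qPoch (t * y i / y j) q

/-- `⟨f, g⟩'_{n;q,t} = (1/n!) ∮ ∏_j dy_j / (2πi y_j) f(1/y) g(y) Δ(y; q, t)` over `|y_j| = 1`. -/
def innerPrime (q t : ℂ) (n : ℕ) (f g : SymFun) : ℂ :=
  (1 / (n.factorial : ℂ)) *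
    torusMean (fun _ : Fin n => (1 : ℝ))
      (fun y => evalAt f (fun j => (y j)⁻¹) * evalAt g y * macDelta q t y)

/-! ### Partitions as sums of rectangles -/

/-- The multiset of rows of `∑_{a ∈ S} (s_a^{r_a})`, where `(s^r) = (s, …, s)` with `r` entries
(trailing zeros allowed): row `i` (counted from `0`) has length `∑_{a ∈ S, i < r_a} s_a`. -/
def rectRows {N : ℕ} (r s : Fin N → ℕ) (S : Finset (Fin N)) : Multiset ℕ :=
  (Multiset.range (S.sup r)).map fun i => ∑ a ∈ S, if i < r a then s a else 0

/-- The Macdonald symmetric function of the partition `∑_{a ∈ S} (s_a^{r_a})`. -/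
def macdonaldRect (q t : ℂ) {N : ℕ} (r s : Fin N → ℕ) (S : Finset (Fin N)) : SymFun :=
  macdonaldP q t (rectRows r s S).sum (Nat.Partition.ofSums _ (rectRows r s S) rfl)

/-- `C⁺_λ = ∏_a ⟨P_{λ^(a)}, P_{λ^(a)}⟩_{q,t} / (r_a! ⟨P_{λ^(a)}, P_{λ^(a)}⟩'_{r_a;q,t})` with
`λ^(a) = ∑_{b ≤ a} (s_b^{r_b})`. -/
def Cplus (q t : ℂ) {N : ℕ} (r s : Fin N → ℕ) : ℂ :=
  ∏ a : Fin N,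
    innerQT q t (macdonaldRect q t r s (Finset.Iic a)) (macdonaldRect q t r s (Finset.Iic a)) /
      (((r a).factorial : ℂ) *
        innerPrime q t (r a) (macdonaldRect q t r s (Finset.Iic a))
          (macdonaldRect q t r s (Finset.Iic a)))

/-! ### Bosons -/

/-- Labels `(a, n)` of the creation operators `a^a_{-n}`, `1 ≤ a ≤ N`, `n > 0`. -/
abbrev Mode (N : ℕ) : Type := Fin N × ℕ+

/-- The Fock space `ℂ[a^a_{-1}, a^a_{-2}, …]|0⟩` of `N` bosons. -/
abbrev Fock (N : ℕ) : Type := MvPolynomial (Mode N) ℂ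

/-- The creation operator `a^a_{-n}`, `n > 0`. -/
def create {N : ℕ} (a : Fin N) (n : ℕ+) : Fock N →ₗ[ℂ] Fock N :=
  LinearMap.mulLeft ℂ (MvPolynomial.X (a, n))

/-- The annihilation operator `a^a_n = (n / (1 - t^n)) ∂ / ∂ a^a_{-n}`, `n > 0`. -/
def annih (t : ℂ) {N : ℕ} (a : Fin N) (n : ℕ+) : Fock N →ₗ[ℂ] Fock N :=
  (((n : ℕ) : ℂ) / (1 - t ^ (n : ℕ))) • (MvPolynomial.pderiv (a, n)).toLinearMap

/-- The relation `[a^a_n, a^b_{-m}] = n / (1 - t^n) δ_{n m} δ^{a b}`. -/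
theorem annih_create_comm (t : ℂ) {N : ℕ} (a b : Fin N) (n m : ℕ+) :
    annih t a n ∘ₗ create b m - create b m ∘ₗ annih t a n =
      (if n = m ∧ a = b then ((n : ℕ) : ℂ) / (1 - t ^ (n : ℕ)) else 0) • LinearMap.id := by
  ext1 p
  by_cases h : n = m ∧ a = b
  · obtain ⟨rfl, rfl⟩ := h
    ext
    simp [annih, create]
  · have h' : ¬ ((b, m) = (a, n)) := by
      intro e
      simp only [Prod.mk.injEq] at e
      exact h ⟨e.2.symm, e.1.symm⟩
    rw [if_neg h]
    ext
    simp [annih, create, MvPolynomial.pderiv_X_of_ne h']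

/-- Operators from the Fock space to its completion (and formal products of such), given by their
matrix in the basis of monomials of `Fock N`: `A i j` is the coefficient of the `i`-th monomial in
the image of the `j`-th. -/
abbrev FockOp (N : ℕ) : Type := Matrix (Mode N →₀ ℕ) (Mode N →₀ ℕ) ℂ

/-- The matrix of a linear endomorphism of the Fock space. -/
def toOp {N : ℕ} (A : Fock N →ₗ[ℂ] Fock N) : FockOp N :=
  fun i j => MvPolynomial.coeff i (A (MvPolynomial.monomial j 1))

/-- Composition of operators, summing over all intermediate monomials. -/
def opMul {N : ℕ} (A B : FockOp N) : FockOp N := fun i j => ∑' k, A i k * B k j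

/-- Powers of an operator. -/
def opPow {N : ℕ} (A : FockOp N) : ℕ → FockOp N
  | 0 => 1
  | k + 1 => opMul A (opPow A k)

/-- The exponential `∑_k A^k / k!`. -/
def opExp {N : ℕ} (A : FockOp N) : FockOp N :=
  fun i j => ∑' k : ℕ, opPow A k i j / (k.factorial : ℂ)

/-- Ordered products of operators, the head of the list standing on the left. -/
def opProd {N : ℕ} : List (FockOp N) → FockOp N
  | [] => 1
  | A :: l => opMul A (opProd l)

/-- All sums over intermediate monomials in `opProd l` converge absolutely. -/
def ProdConverges {N : ℕ} : List (FockOp N) → Prop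
  | [] => True
  | A :: l => ProdConverges l ∧ ∀ i j, Summable fun k => A i k * opProd l k j

/-- The trace over the Fock space. -/
def opTrace {N : ℕ} (A : FockOp N) : ℂ := ∑' i, A i i

/-- `φ^a_-(z) = ∑_{n > 0} (1 - t^n) (a^a_{-n} / n) z^n`, the creation part of `φ^a(z)`. -/
def phiMinus (t : ℂ) {N : ℕ} (a : Fin N) (z : ℂ) : FockOp N :=
  fun i j => ∑' n : ℕ+,
    (1 - t ^ (n : ℕ)) / ((n : ℕ) : ℂ) * z ^ (n : ℕ) * toOp (create a n) i j

/-- `-∑_{n > 0} (1 - t^n) (a^a_n / n) z^{-n}`, the annihilation part of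
`φ^a(z) = -∑_{n ≠ 0} (1 - t^{|n|}) (a^a_n / n) z^{-n}`. -/
def phiPlus (t : ℂ) {N : ℕ} (a : Fin N) (z : ℂ) : FockOp N :=
  fun i j => ∑' n : ℕ+,
    -((1 - t ^ (n : ℕ)) / ((n : ℕ) : ℂ)) * (z⁻¹) ^ (n : ℕ) * toOp (annih t a n) i j

/-- The vertex operator `:e^{φ^a(z)}:`, with all annihilation operators to the right of all
creation operators. -/
def vertexOp (t : ℂ) {N : ℕ} (a : Fin N) (z : ℂ) : FockOp N :=
  opMul (opExp (phiMinus t a z)) (opExp (phiPlus t a z))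

/-- The grading operator `L_0 = ∑_a ∑_{n > 0} (1 - t^n) a^a_{-n} a^a_n`. -/
def L0 (t : ℂ) (N : ℕ) : FockOp N :=
  fun i j => ∑ a : Fin N, ∑' n : ℕ+, (1 - t ^ (n : ℕ)) * toOp (create a n ∘ₗ annih t a n) i j

/-- `q^{L_0} = exp((log q) L_0)` for real `q > 0`. -/
def qL0 (q : ℝ) (t : ℂ) (N : ℕ) : FockOp N := opExp (((Real.log q : ℝ) : ℂ) • L0 t N)

/-! ### The trace formula -/

/-- Labels `(a, j)` of the integration variables `x^a_j`, `1 ≤ a ≤ N`, `1 ≤ j ≤ r_a`. -/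
abbrev VarIdx {N : ℕ} (r : Fin N → ℕ) : Type := (a : Fin N) × Fin (r a)

/-- The list of the variables `x^{a+1}_j`; for the last `a` these are the external
variables `x_1, …, x_n`. -/
def nextVars {N n : ℕ} (r : Fin N → ℕ) (x : Fin n → ℂ) (X : VarIdx r → ℂ) (a : Fin N) : List ℂ :=
  if h : (a : ℕ) + 1 < N then
    List.ofFn fun j : Fin (r ⟨(a : ℕ) + 1, h⟩) => X ⟨⟨(a : ℕ) + 1, h⟩, j⟩
  else List.ofFn x

/-- The factors, in order from left to right, of
`q^{L_0} ∏_a ∏_{j ≤ r_a} :e^{φ^a(x^a_j)}: ∏_a ∏_{j ≤ r_{a+1}} e^{-φ^a_-(x^{a+1}_j)}`. -/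
def traceFactors (q : ℝ) (t : ℂ) {N n : ℕ} (r : Fin N → ℕ) (x : Fin n → ℂ) (X : VarIdx r → ℂ) :
    List (FockOp N) :=
  qL0 q t N ::
    (((List.finRange N).flatMap fun a => List.ofFn fun j : Fin (r a) => vertexOp t a (X ⟨a, j⟩)) ++
      ((List.finRange N).flatMap fun a =>
        (nextVars r x X a).map fun w => opExp (-phiMinus t a w)))

/-- The trace of `q^{L_0} ∏ :e^{φ^a(x^a_j)}: ∏ e^{-φ^a_-(x^{a+1}_j)}` over the Fock space. -/
def bosonTrace (q : ℝ) (t : ℂ) {N n : ℕ} (r : Fin N → ℕ) (x : Fin n → ℂ) (X : VarIdx r → ℂ) : ℂ :=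
  opTrace (opProd (traceFactors q t r x X))

/-- The operator product and its trace converge absolutely. -/
def BosonTraceConverges (q : ℝ) (t : ℂ) {N n : ℕ} (r : Fin N → ℕ) (x : Fin n → ℂ)
    (X : VarIdx r → ℂ) : Prop :=
  ProdConverges (traceFactors q t r x X) ∧
    Summable fun i => opProd (traceFactors q t r x X) i i

/-- The contours `|x^a_j| = ρ^a_j` lie in the region of the operator product expansions:
`q < |x^a_j / x^a_i| < 1` for `i < j`, and `|x^{a+1}_i / x^a_j| < 1` for all `a, i, j`, where the
`x^{N+1}_i` are the external variables. -/
structure AdmissibleRadii (q : ℝ) {N n : ℕ} (r : Fin N → ℕ) (x : Fin n → ℂ) (ρ : VarIdx r → ℝ) :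
    Prop where
  pos : ∀ p, 0 < ρ p
  same : ∀ (a : Fin N) (i j : Fin (r a)), i < j →
    q < ρ ⟨a, j⟩ / ρ ⟨a, i⟩ ∧ ρ ⟨a, j⟩ / ρ ⟨a, i⟩ < 1
  next : ∀ (a b : Fin N), (b : ℕ) = (a : ℕ) + 1 → ∀ (i : Fin (r b)) (j : Fin (r a)),
    ρ ⟨b, i⟩ < ρ ⟨a, j⟩
  last : ∀ a : Fin N, (a : ℕ) + 1 = N → ∀ (i : Fin n) (j : Fin (r a)), ‖x i‖ < ρ ⟨a, j⟩

end MacdonaldBoson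

end

open MacdonaldBoson

open scoped BigOperators
noncomputable section

open Filter Topology MeasureTheory

namespace MacdonaldBoson

/-! ### Sums over finitely supported exponents -/

section FinsuppProd

variable {ι : Type*} [DecidableEq ι]

/-! The trace is computed in closed form, and the resulting integral is then evaluated block by
block, each block reproducing a Macdonald function in the variables of the next one.

The trace. Every factor of the operator product other than `q^{L_0}` is a Gaussian `gauss A B`, an
exponential of creation operators times an exponential of derivatives (`vertexOp_eq`,
`opExp_neg_phiMinus`). Gaussians multiply by adding their exponents, up to the scalar `exp (∑ B A')`
(`hasSum_gauss_mul_gauss`, `opProd_gauss`), and the trace of `q^{L_0}` times a Gaussian factors over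
the modes (`hasSum_trace_gauss`). Resumming the exponents into q-shifted factorials,
`bosonTrace_spec` shows that the trace converges and equals `(q;q)_∞^{-N}` times, for each block, a
self-contraction `triKernel` and the Cauchy kernel `Π` between the next variables and the inverses
of those of the block.

The integral. With the variables `y` of the last block held fixed, the integral over the earlier
blocks is by induction a constant times the Macdonald polynomial of the previous partition at `y`.
In `r_a` variables, multiplication by `∏ y_j^{s_a}` adds the rectangle `(s_a^{r_a})`
(`evalAt_macdonaldRect_succ`), and the integral over the block then carries the result to the next
variables (`torusMean_block`). For that step all circles of the block are moved to a common radius,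
which is allowed because the integrand has one Laurent series valid on both tori. On the common
torus everything but `triKernel` is symmetric, so `triKernel` may be averaged over permutations, and
`sum_perm_triKernel` turns it into the weight `Δ` times an explicit constant. Finally `Π(x, 1/y)`
expands as `∑ P_μ(x) P_μ(1/y) / ⟨P_μ, P_μ⟩`, and orthogonality on the torus leaves the single term
wanted (`torusMean_kernelPi`). Collecting constants gives the inverse of the stated prefactor
(`mul_blockConst`).

Macdonald theory. What is needed about `P_κ` comes from the generating difference operator `D_X f =
V(x)^{-1} ∑_I X^{|I|} V(t^I x) f(q^I x)`, `V` being the Vandermonde product; `macN` is `V D_X`. It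
is triangular on monomial symmetric polynomials (`exists_macN_msymm`), and its action on `Π` is
symmetric in `x` and `y` by Cauchy's determinant (`kernelDeg_macN`), so its eigenfunctions are
orthogonal for `⟨ , ⟩_{q,t}` (`IsTriangular.orthogonal_of_eigen`). Uniqueness identifies them with
the `P_κ` (`macdonaldP_spec`). It is also self-adjoint for the torus product, by shifting contours
(`innerMean_eq_zero_of_ne`).

Since `t` is complex, no positivity is at hand. Eigenvalues are separated by the moduli of
`t^{n-1-i} q^{α_i}`, and the torus norm of an eigenfunction is shown to be nonzero by contradiction:
otherwise all Fourier coefficients of `f(1/y) Δ(y)` would vanish (`innerMean_self_ne_zero`). -/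

theorem sum_finsupp_prod (g : ι → ℕ → ℂ) (T : Finset ι) (R : ι → Finset ℕ) :
    ∑ m ∈ T.finsupp R, ∏ i ∈ T, g i (m i) = ∏ i ∈ T, ∑ k ∈ R i, g i k := by
  rw [Finset.prod_sum]
  refine Finset.sum_bij' (fun m _ => fun i _ => m i) (fun p _ => Finsupp.indicator T p) ?_ ?_ ?_ ?_ ?_
  · intro m hm
    rw [Finset.mem_finsupp_iff] at hm
    exact Finset.mem_pi.2 fun i hi => hm.2 i hi
  · intro p hp
    rw [Finset.mem_pi] at hp
    rw [Finset.mem_finsupp_iff]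
    refine ⟨Finsupp.support_indicator_subset _ _, fun i hi => ?_⟩
    rw [Finsupp.indicator_of_mem hi]; exact hp i hi
  · intro m hm
    rw [Finset.mem_finsupp_iff] at hm
    ext i
    by_cases hi : i ∈ T
    · rw [Finsupp.indicator_of_mem hi]
    · rw [Finsupp.indicator_of_notMem hi]
      exact (Finsupp.notMem_support_iff.1 fun h => hi (hm.1 h)).symm
  · intro p hp
    ext i hi
    rw [Finsupp.indicator_of_mem hi]
  · intro m hm
    exact (Finset.prod_attach T (fun i => g i (m i))).symm

/-- Boxes are cofinal among the finite sets of exponents, so a sum over exponents may be taken along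
boxes, where it factors. -/
theorem subset_finsupp_range (M : Finset (ι →₀ ℕ)) :
    ∃ (T : Finset ι) (K : ℕ), M ⊆ T.finsupp (fun _ => Finset.range K) := by
  classical
  refine ⟨M.biUnion fun m => m.support, (M.sup fun m => m.support.sup m) + 1, fun m hm => ?_⟩
  rw [Finset.mem_finsupp_iff]
  refine ⟨Finset.subset_biUnion_of_mem (fun m : ι →₀ ℕ => m.support) hm, fun i _ => ?_⟩
  rw [Finset.mem_range, Nat.lt_succ_iff]
  by_cases hi : i ∈ m.support
  · exact (Finset.le_sup hi).trans (Finset.le_sup (f := fun m : ι →₀ ℕ => m.support.sup m) hm)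
  · rw [Finsupp.notMem_support_iff.1 hi]; exact Nat.zero_le _

/-- The successor keeps the exponent 0 admissible at the new indices even when the bounds are 0. -/
theorem finsupp_range_mono {T T' : Finset ι} {K K' : ℕ} (hT : T ⊆ T') (hK : K ≤ K') :
    T.finsupp (fun _ => Finset.range K) ⊆ T'.finsupp (fun _ => Finset.range (K' + 1)) := by
  intro m hm
  rw [Finset.mem_finsupp_iff] at hm ⊢
  refine ⟨hm.1.trans hT, fun i _ => ?_⟩
  by_cases h : i ∈ T
  · have := hm.2 i h
    rw [Finset.mem_range] at this ⊢; omega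
  · rw [Finsupp.notMem_support_iff.1 fun h' => h (hm.1 h')]; simp

/-- The product over all `i` of `g i (m i)`, when `g i 0 = 1` outside the finite set `S`. -/
def expProd (S : Finset ι) (g : ι → ℕ → ℂ) (m : ι →₀ ℕ) : ℂ := ∏ i ∈ S ∪ m.support, g i (m i)

theorem expProd_eq {S : Finset ι} {g : ι → ℕ → ℂ} (h1 : ∀ i ∉ S, g i 0 = 1) {m : ι →₀ ℕ}
    {T : Finset ι} (hS : S ⊆ T) (hm : m.support ⊆ T) : expProd S g m = ∏ i ∈ T, g i (m i) := by
  refine Finset.prod_subset (Finset.union_subset hS hm) fun i _ hi => ?_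
  rw [Finset.mem_union, not_or] at hi
  rw [Finsupp.notMem_support_iff.1 hi.2, h1 i hi.1]

theorem sum_expProd {S : Finset ι} {g : ι → ℕ → ℂ} (h1 : ∀ i ∉ S, g i 0 = 1)
    {T : Finset ι} (hS : S ⊆ T) (K : ℕ) :
    ∑ m ∈ T.finsupp (fun _ => Finset.range K), expProd S g m =
      ∏ i ∈ T, ∑ k ∈ Finset.range K, g i k := by
  rw [← sum_finsupp_prod g T fun _ => Finset.range K]
  refine Finset.sum_congr rfl fun m hm => ?_
  rw [Finset.mem_finsupp_iff] at hm
  exact expProd_eq h1 hS hm.1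

/-- A finite partial sum sits inside a box, where the sum is a finite product of one-index sums;
almost all of these are at most `1 + b i`, and `∏ (1 + b i) ≤ exp (∑ b i)` bounds them uniformly. -/
theorem summable_norm_expProd {S : Finset ι} {g : ι → ℕ → ℂ} (h1 : ∀ i ∉ S, g i 0 = 1)
    (hg : ∀ i, Summable fun k => ‖g i k‖) (hs : Summable fun i => ∑' k, ‖g i (k + 1)‖) :
    Summable fun m => ‖expProd S g m‖ := by
  set b : ι → ℝ := fun i => ∑' k, ‖g i (k + 1)‖ with hb
  have hb0 : ∀ i, 0 ≤ b i := fun i => tsum_nonneg fun k => norm_nonneg _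
  set c : ℝ := ∏ i ∈ S, (1 + ‖g i 0‖) with hc
  have hc1 : 0 ≤ c := Finset.prod_nonneg fun i _ => by positivity
  refine summable_of_sum_le (c := c * Real.exp (∑' i, b i)) (fun _ => norm_nonneg _) fun M => ?_
  obtain ⟨T, K, hT⟩ := subset_finsupp_range M
  have hT' : M ⊆ (S ∪ T).finsupp (fun _ => Finset.range (K + 1)) :=
    hT.trans (finsupp_range_mono Finset.subset_union_right le_rfl)
  have h2 : ∀ i ∉ S, (fun i k => ((‖g i k‖ : ℝ) : ℂ)) i 0 = 1 := fun i hi => by simp [h1 i hi]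
  have key : ∑ m ∈ (S ∪ T).finsupp (fun _ => Finset.range (K + 1)), ‖expProd S g m‖ =
      ∏ i ∈ S ∪ T, ∑ k ∈ Finset.range (K + 1), ‖g i k‖ := by
    have := sum_expProd (g := fun i k => ((‖g i k‖ : ℝ) : ℂ)) h2 (T := S ∪ T) Finset.subset_union_left (K + 1)
    simp only [expProd] at this
    have e : ∀ m, ‖expProd S g m‖ = ∏ i ∈ S ∪ m.support, ‖g i (m i)‖ := fun m => by
      rw [expProd, norm_prod]
    simp_rw [e]
    exact_mod_cast this
  have step : ∀ i, ∑ k ∈ Finset.range (K + 1), ‖g i k‖ ≤ ‖g i 0‖ + b i := by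
    intro i
    rw [Finset.sum_range_succ', add_comm]
    gcongr
    exact ((summable_nat_add_iff 1).2 (hg i)).sum_le_tsum _ fun _ _ => norm_nonneg _
  calc ∑ m ∈ M, ‖expProd S g m‖
      ≤ ∑ m ∈ (S ∪ T).finsupp (fun _ => Finset.range (K + 1)), ‖expProd S g m‖ :=
        Finset.sum_le_sum_of_subset_of_nonneg hT' fun _ _ _ => norm_nonneg _
    _ = ∏ i ∈ S ∪ T, ∑ k ∈ Finset.range (K + 1), ‖g i k‖ := key
    -- On `S` the value `g i 0` is arbitrary, and the finitely many such indices are absorbed in the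
    -- constant `c`.
    _ ≤ ∏ i ∈ S ∪ T, ((if i ∈ S then 1 + ‖g i 0‖ else 1) * Real.exp (b i)) := by
        refine Finset.prod_le_prod (fun i _ => Finset.sum_nonneg fun _ _ => norm_nonneg _)
          fun i _ => (step i).trans ?_
        have h3 : 1 + b i ≤ Real.exp (b i) := by linarith [Real.add_one_le_exp (b i)]
        split_ifs with hi
        · calc ‖g i 0‖ + b i ≤ (1 + ‖g i 0‖) * (1 + b i) := by
                nlinarith [norm_nonneg (g i 0), hb0 i, mul_nonneg (norm_nonneg (g i 0)) (hb0 i)]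
            _ ≤ _ := by gcongr
        · rw [h1 i hi, norm_one, one_mul]; exact h3
    _ = c * Real.exp (∑ i ∈ S ∪ T, b i) := by
        rw [Finset.prod_mul_distrib, Real.exp_sum, hc, Finset.prod_ite_mem,
          Finset.inter_eq_right.2 Finset.subset_union_left]
    _ ≤ c * Real.exp (∑' i, b i) := by
        gcongr
        exact hs.sum_le_tsum _ fun i _ => hb0 i

/-- Distributivity for an infinite product of series. On a box with index set `T'` the partial sum
is a product of truncated series; the truncation is removed first, with `T'` fixed. -/
theorem hasProd_tsum_expProd {S : Finset ι} {g : ι → ℕ → ℂ} (h1 : ∀ i ∉ S, g i 0 = 1)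
    (hg : ∀ i, Summable fun k => ‖g i k‖) (hs : Summable fun i => ∑' k, ‖g i (k + 1)‖) :
    HasProd (fun i => ∑' k, g i k) (∑' m, expProd S g m) := by
  have H := (summable_norm_expProd h1 hg hs).of_norm.hasSum
  rw [HasProd, SummationFilter.unconditional_filter, Metric.tendsto_atTop]
  intro ε hε
  rw [HasSum, SummationFilter.unconditional_filter, Metric.tendsto_atTop] at H
  obtain ⟨M, hM⟩ := H (ε / 2) (half_pos hε)
  obtain ⟨T, K, hT⟩ := subset_finsupp_range M
  refine ⟨S ∪ T, fun T' hT' => ?_⟩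
  have hS : S ⊆ T' := Finset.subset_union_left.trans hT'
  have ht : Tendsto (fun L => ∏ i ∈ T', ∑ k ∈ Finset.range (L + 1), g i k) atTop
      (𝓝 (∏ i ∈ T', ∑' k, g i k)) :=
    tendsto_finsetProd _ fun i _ =>
      ((hg i).of_norm.hasSum.tendsto_sum_nat).comp (tendsto_add_atTop_nat 1)
  -- Passing to the limit keeps only a non-strict inequality, hence the choice of `ε / 2`.
  have h2 := le_of_tendsto (ht.dist (tendsto_const_nhds (x := ∑' m, expProd S g m)))
    (b := ε / 2) ?_
  · linarith
  · filter_upwards [eventually_ge_atTop K] with L hL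
    rw [← sum_expProd h1 hS]
    exact (hM _ (hT.trans (finsupp_range_mono (Finset.subset_union_right.trans hT') hL))).le

end FinsuppProd

/-! ### Creation and annihilation operators as power series -/

variable {N : ℕ}

/-- `∏ A^m / m!`, the coefficient at `m` of `exp (∑ A_r X_r)`. -/
def expCoeff (A : Mode N → ℂ) : MvPowerSeries (Mode N) ℂ :=
  fun m => m.prod fun r k => A r ^ k / (k.factorial : ℂ)

/-- The linear form `∑ A_r X_r`. -/
def linForm (A : Mode N → ℂ) : MvPowerSeries (Mode N) ℂ :=
  fun m => ∑' r, if m = Finsupp.single r 1 then A r else 0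

/-- `∏ m!`. -/
def multiFact (m : Mode N →₀ ℕ) : ℂ := m.prod fun _ k => (k.factorial : ℂ)

theorem multiFact_ne_zero (m : Mode N →₀ ℕ) : multiFact m ≠ 0 :=
  Finset.prod_ne_zero_iff.2 fun _ _ => Nat.cast_ne_zero.2 (Nat.factorial_ne_zero _)

/-- Multiplication by a power series, as an operator on the Fock space. -/
def mulOp (f : MvPowerSeries (Mode N) ℂ) : FockOp N :=
  fun i j => if j ≤ i then MvPowerSeries.coeff (i - j) f else 0

/-- The differential operator `f(∂)`, for a power series `f`. -/
def diffOp (f : MvPowerSeries (Mode N) ℂ) : FockOp N :=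
  fun i j => multiFact j / multiFact i * mulOp f j i

theorem mulOp_of_not_le (f : MvPowerSeries (Mode N) ℂ) {i j : Mode N →₀ ℕ} (h : ¬ j ≤ i) :
    mulOp f i j = 0 := if_neg h

theorem diffOp_of_not_le (f : MvPowerSeries (Mode N) ℂ) {i j : Mode N →₀ ℕ} (h : ¬ i ≤ j) :
    diffOp f i j = 0 := by rw [diffOp, mulOp_of_not_le f h, mul_zero]

/-- The map `k ↦ (i - k, k - j)` identifies the interval from `j` to `i` with the antidiagonal of `i
- j`. Any finite set containing the interval is allowed, because the sums met later range over lower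
sets with other endpoints. -/
theorem sum_mulOp (f g : MvPowerSeries (Mode N) ℂ) (i j : Mode N →₀ ℕ) (s : Finset (Mode N →₀ ℕ))
    (hs : ∀ k, j ≤ k → k ≤ i → k ∈ s) :
    ∑ k ∈ s, mulOp f i k * mulOp g k j = mulOp (f * g) i j := by
  classical
  by_cases hij : j ≤ i
  · rw [mulOp, if_pos hij, MvPowerSeries.coeff_mul]
    symm
    refine Finset.sum_of_injOn (fun p => p.2 + j) ?_ ?_ ?_ ?_
    · intro p hp p' hp' h
      have hp := Finset.HasAntidiagonal.mem_antidiagonal.1 hp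
      have hp' := Finset.HasAntidiagonal.mem_antidiagonal.1 hp'
      have h2 : p.2 = p'.2 := add_right_cancel h
      have h1 : p.1 = p'.1 := by
        rw [h2, ← hp'] at hp; exact add_right_cancel hp
      exact Prod.ext h1 h2
    · intro p hp
      have hp := Finset.HasAntidiagonal.mem_antidiagonal.1 hp
      refine hs _ le_add_self ?_
      rw [← tsub_add_cancel_of_le hij, ← hp]
      exact add_le_add_left le_add_self j
    · intro k _ hk
      by_cases h1 : k ≤ i
      · by_cases h2 : j ≤ k
        · exact absurd ⟨(i - k, k - j), Finset.mem_coe.2 (Finset.HasAntidiagonal.mem_antidiagonal.2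
            (tsub_add_tsub_cancel h1 h2)), tsub_add_cancel_of_le h2⟩ hk
        · rw [mulOp_of_not_le g h2, mul_zero]
      · rw [mulOp_of_not_le f h1, zero_mul]
    · intro p hp
      have hp := Finset.HasAntidiagonal.mem_antidiagonal.1 hp
      have hi : i = p.1 + (p.2 + j) := by
        rw [← add_assoc, hp, tsub_add_cancel_of_le hij]
      simp only [mulOp]
      rw [if_pos (by rw [hi]; exact le_add_self), if_pos le_add_self, add_tsub_cancel_right]
      conv_lhs => rw [show p.1 = i - (p.2 + j) by rw [hi, add_tsub_cancel_right]]
  · rw [mulOp_of_not_le _ hij]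
    refine Finset.sum_eq_zero fun k _ => ?_
    by_cases h1 : k ≤ i
    · rw [mulOp_of_not_le g fun h2 => hij (h2.trans h1), mul_zero]
    · rw [mulOp_of_not_le f h1, zero_mul]

theorem opMul_mulOp (f g : MvPowerSeries (Mode N) ℂ) :
    opMul (mulOp f) (mulOp g) = mulOp (f * g) := by
  ext i j
  rw [opMul, tsum_eq_sum (s := Finset.Iic i),
    sum_mulOp f g i j _ fun k _ h => Finset.mem_Iic.2 h]
  intro k hk
  rw [mulOp_of_not_le f fun h => hk (Finset.mem_Iic.2 h), zero_mul]

/-- Up to conjugation by the factorials, which telescope, `diffOp` is the transpose of `mulOp`; the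
reversed order is harmless as power series commute. -/
theorem sum_diffOp (f g : MvPowerSeries (Mode N) ℂ) (i j : Mode N →₀ ℕ)
    (s : Finset (Mode N →₀ ℕ)) (hs : ∀ k, i ≤ k → k ≤ j → k ∈ s) :
    ∑ k ∈ s, diffOp f i k * diffOp g k j = diffOp (f * g) i j := by
  rw [diffOp, mul_comm f g, ← sum_mulOp g f j i s hs, Finset.mul_sum]
  refine Finset.sum_congr rfl fun k _ => ?_
  rw [diffOp, diffOp]
  field_simp [multiFact_ne_zero]

theorem opMul_diffOp (f g : MvPowerSeries (Mode N) ℂ) :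
    opMul (diffOp f) (diffOp g) = diffOp (f * g) := by
  ext i j
  rw [opMul, tsum_eq_sum (s := Finset.Iic j),
    sum_diffOp f g i j _ fun k _ h => Finset.mem_Iic.2 h]
  intro k hk
  rw [diffOp_of_not_le g fun h => hk (Finset.mem_Iic.2 h), mul_zero]

theorem mulOp_one : mulOp (1 : MvPowerSeries (Mode N) ℂ) = 1 := by
  classical
  ext i j
  rw [mulOp, Matrix.one_apply, MvPowerSeries.coeff_one]
  by_cases h : i = j
  · simp [h]
  · rw [if_neg h]
    split_ifs with h1 h2
    · exact absurd (le_antisymm (tsub_eq_zero_iff_le.1 h2) h1) h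
    · rfl
    · rfl

theorem diffOp_one : diffOp (1 : MvPowerSeries (Mode N) ℂ) = 1 := by
  classical
  ext i j
  rw [diffOp, mulOp_one, Matrix.one_apply, Matrix.one_apply]
  by_cases h : i = j
  · simp [h, multiFact_ne_zero]
  · rw [if_neg h, if_neg (Ne.symm h), mul_zero]

theorem opPow_mulOp (f : MvPowerSeries (Mode N) ℂ) (k : ℕ) :
    opPow (mulOp f) k = mulOp (f ^ k) := by
  induction k with
  | zero => rw [opPow, pow_zero, mulOp_one]
  | succ k ih => rw [opPow, ih, opMul_mulOp, pow_succ']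

theorem opPow_diffOp (f : MvPowerSeries (Mode N) ℂ) (k : ℕ) :
    opPow (diffOp f) k = diffOp (f ^ k) := by
  induction k with
  | zero => rw [opPow, pow_zero, diffOp_one]
  | succ k ih => rw [opPow, ih, opMul_diffOp, pow_succ']

/-! ### Exponentials of linear forms in infinitely many variables. -/

theorem coeff_linForm_single (A : Mode N → ℂ) (r : Mode N) :
    MvPowerSeries.coeff (Finsupp.single r 1) (linForm A) = A r := by
  change (∑' s, if Finsupp.single r 1 = Finsupp.single s 1 then A s else 0) = A r
  rw [tsum_eq_single r]
  · rw [if_pos rfl]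
  · intro s hs
    rw [if_neg fun h => hs (Finsupp.single_left_injective one_ne_zero h).symm]

theorem coeff_linForm_eq_zero (A : Mode N → ℂ) {m : Mode N →₀ ℕ}
    (h : ∀ r, m ≠ Finsupp.single r 1) : MvPowerSeries.coeff m (linForm A) = 0 := by
  change (∑' s, if m = Finsupp.single s 1 then A s else 0) = 0
  simp [h]

theorem coeff_expCoeff (A : Mode N → ℂ) (m : Mode N →₀ ℕ) :
    MvPowerSeries.coeff m (expCoeff A) = m.prod fun r k => A r ^ k / (k.factorial : ℂ) := rfl

/-- The equation `∂_r F = A_r F` for the exponential `F = exp (∑ A_s X_s)`, multiplied by `X_r` and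
read off at one coefficient. -/
theorem mul_coeff_expCoeff_sub (A : Mode N → ℂ) (m : Mode N →₀ ℕ) (r : Mode N) (hr : m r ≠ 0) :
    A r * MvPowerSeries.coeff (m - Finsupp.single r 1) (expCoeff A) =
      m r * MvPowerSeries.coeff m (expCoeff A) := by
  classical
  rw [coeff_expCoeff, coeff_expCoeff]
  have h0 : ∀ s ∈ m.support, A s ^ 0 / ((0 : ℕ).factorial : ℂ) = 1 := by simp
  rw [Finsupp.prod_of_support_subset _ (s := m.support) Finsupp.support_tsub _ h0,
    Finsupp.prod, ← Finset.mul_prod_erase _ _ (Finsupp.mem_support_iff.2 hr),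
    ← Finset.mul_prod_erase m.support _ (Finsupp.mem_support_iff.2 hr)]
  have : ∀ s ∈ m.support.erase r, A s ^ ((m - Finsupp.single r 1 : Mode N →₀ ℕ) s) /
      (((m - Finsupp.single r 1 : Mode N →₀ ℕ) s).factorial : ℂ) = A s ^ (m s) / ((m s).factorial : ℂ) := by
    intro s hs
    rw [Finsupp.tsub_apply, Finsupp.single_eq_of_ne (Finset.ne_of_mem_erase hs), tsub_zero]
  rw [Finset.prod_congr rfl this, ← mul_assoc, ← mul_assoc]
  congr 1
  rw [Finsupp.tsub_apply, Finsupp.single_eq_same]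
  obtain ⟨k, hk⟩ := Nat.exists_eq_succ_of_ne_zero hr
  rw [hk, Nat.succ_sub_one, Nat.factorial_succ]
  have := Nat.cast_ne_zero (R := ℂ).2 (Nat.factorial_ne_zero k)
  have h1 : ((k : ℂ) + 1) ≠ 0 := by exact_mod_cast Nat.succ_ne_zero k
  push_cast
  field_simp
  rw [Nat.succ_eq_add_one, pow_succ']

/-- The multinomial theorem. A coefficient involves only the variables in the support of `m`, and in
the induction `∑_r m_r` equals the degree of `m`. -/
theorem coeff_linForm_pow (A : Mode N → ℂ) (k : ℕ) (m : Mode N →₀ ℕ) :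
    MvPowerSeries.coeff m (linForm A ^ k) =
      if m.degree = k then (k.factorial : ℂ) * MvPowerSeries.coeff m (expCoeff A) else 0 := by
  classical
  induction k generalizing m with
  | zero =>
    rw [pow_zero, MvPowerSeries.coeff_one]
    simp only [Finsupp.degree_eq_zero_iff]
    split_ifs with h
    · rw [h, coeff_expCoeff]; simp
    · rfl
  | succ k ih =>
    rw [pow_succ', MvPowerSeries.coeff_mul]
    have hr : ∀ r ∈ m.support, Finsupp.single r 1 ≤ m := fun r hr => by
      rw [Finsupp.single_le_iff]
      exact Nat.one_le_iff_ne_zero.2 (Finsupp.mem_support_iff.1 hr)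
    have e : ∑ p ∈ Finset.HasAntidiagonal.antidiagonal m, MvPowerSeries.coeff p.1 (linForm A) *
        MvPowerSeries.coeff p.2 (linForm A ^ k) = ∑ r ∈ m.support,
          A r * MvPowerSeries.coeff (m - Finsupp.single r 1) (linForm A ^ k) := by
      symm
      refine Finset.sum_of_injOn (fun r => (Finsupp.single r 1, m - Finsupp.single r 1)) ?_ ?_ ?_ ?_
      · intro r _ s _ h
        exact Finsupp.single_left_injective one_ne_zero (Prod.ext_iff.1 h).1
      · intro r hr'
        exact Finset.HasAntidiagonal.mem_antidiagonal.2 (add_tsub_cancel_of_le (hr r hr'))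
      · intro p hp hp'
        have hp := Finset.HasAntidiagonal.mem_antidiagonal.1 hp
        rw [coeff_linForm_eq_zero, zero_mul]
        intro r h
        refine hp' ⟨r, ?_, ?_⟩
        · rw [Finset.mem_coe, Finsupp.mem_support_iff, ← hp, h]; simp
        · refine Prod.ext h.symm ?_
          change m - Finsupp.single r 1 = p.2
          rw [← hp, h, add_tsub_cancel_left]
      · intro r _
        rw [coeff_linForm_single]
    rw [e]
    have e2 : ∀ r ∈ m.support, A r * MvPowerSeries.coeff (m - Finsupp.single r 1) (linForm A ^ k) =
        if m.degree = k + 1 then (m r : ℂ) * ((k.factorial : ℂ) *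
          MvPowerSeries.coeff m (expCoeff A)) else 0 := by
      intro r hr'
      rw [ih]
      have hd : m.degree = (m - Finsupp.single r 1).degree + 1 := by
        conv_lhs => rw [← tsub_add_cancel_of_le (hr r hr')]
        rw [map_add, Finsupp.degree_single]
      by_cases h : m.degree = k + 1
      · rw [if_pos h, if_pos (by omega), mul_left_comm, mul_coeff_expCoeff_sub _ _ _
          (Finsupp.mem_support_iff.1 hr')]
        ring
      · rw [if_neg h, if_neg (by omega), mul_zero]
    rw [Finset.sum_congr rfl e2]
    split_ifs with h
    · rw [← Finset.sum_mul, ← Nat.cast_sum, ← Finsupp.degree_apply, h, Nat.factorial_succ]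
      push_cast; ring
    · exact Finset.sum_const_zero

theorem tsum_coeff_linForm_pow (A : Mode N → ℂ) (m : Mode N →₀ ℕ) :
    ∑' k : ℕ, MvPowerSeries.coeff m (linForm A ^ k) / (k.factorial : ℂ) =
      MvPowerSeries.coeff m (expCoeff A) := by
  rw [tsum_eq_single m.degree]
  · rw [coeff_linForm_pow, if_pos rfl, mul_div_cancel_left₀]
    exact Nat.cast_ne_zero.2 (Nat.factorial_ne_zero _)
  · intro k hk
    rw [coeff_linForm_pow, if_neg hk.symm, zero_div]

/-- Each matrix entry receives a contribution from a single power, the one equal to the degree of `i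
- j`; so no condition on `A` is needed. -/
theorem opExp_mulOp (A : Mode N → ℂ) : opExp (mulOp (linForm A)) = mulOp (expCoeff A) := by
  ext i j
  simp only [opExp, opPow_mulOp, mulOp]
  split_ifs with h
  · exact tsum_coeff_linForm_pow A _
  · simp

theorem opExp_diffOp (A : Mode N → ℂ) : opExp (diffOp (linForm A)) = diffOp (expCoeff A) := by
  ext i j
  simp only [opExp, opPow_diffOp, diffOp, mulOp]
  split_ifs with h
  · simp_rw [mul_div_assoc]
    rw [tsum_mul_left, tsum_coeff_linForm_pow]
  · simp

theorem expCoeff_zero : expCoeff (0 : Mode N → ℂ) = 1 := by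
  classical
  ext m
  rw [coeff_expCoeff, MvPowerSeries.coeff_one]
  split_ifs with h
  · rw [h, Finsupp.prod_zero_index]
  · obtain ⟨r, hr⟩ := Finsupp.support_nonempty_iff.2 h
    refine Finset.prod_eq_zero hr ?_
    simp only [Pi.zero_apply]
    rw [zero_pow (Finsupp.mem_support_iff.1 hr), zero_div]

/-- The Gaussian operator `exp (∑ A_r a_r^†) exp (∑ B_r ∂_r)`. -/
def gauss (A B : Mode N → ℂ) : FockOp N := opMul (mulOp (expCoeff A)) (diffOp (expCoeff B))

theorem gauss_zero_right (A : Mode N → ℂ) : gauss A 0 = mulOp (expCoeff A) := by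
  ext i j
  rw [gauss, expCoeff_zero, diffOp_one, opMul, tsum_eq_single j]
  · rw [Matrix.one_apply_eq, mul_one]
  · intro k hk
    rw [Matrix.one_apply_ne hk, mul_zero]

theorem gauss_zero_zero : gauss (0 : Mode N → ℂ) 0 = 1 := by
  rw [gauss_zero_right, expCoeff_zero, mulOp_one]

theorem gauss_apply (A B : Mode N → ℂ) (i j : Mode N →₀ ℕ) (s : Finset (Mode N →₀ ℕ))
    (hs : ∀ k, k ≤ i → k ≤ j → k ∈ s) :
    gauss A B i j = ∑ k ∈ s, mulOp (expCoeff A) i k * diffOp (expCoeff B) k j := by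
  rw [gauss, opMul, tsum_eq_sum]
  intro k hk
  by_cases h1 : k ≤ i
  · rw [diffOp_of_not_le _ fun h2 => hk (hs k h1 h2), mul_zero]
  · rw [mulOp_of_not_le _ h1, zero_mul]

/-! ### The frozen operators as Gaussians -/

/-- The coefficients of `φ^a_-(z)`. -/
def creA (t : ℂ) (a : Fin N) (z : ℂ) : Mode N → ℂ :=
  fun m => if m.1 = a then (1 - t ^ (m.2 : ℕ)) / ((m.2 : ℕ) : ℂ) * z ^ (m.2 : ℕ) else 0

/-- The coefficients of the annihilation part of `φ^a(z)`. -/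
def annB (a : Fin N) (z : ℂ) : Mode N → ℂ :=
  fun m => if m.1 = a then -(z⁻¹) ^ (m.2 : ℕ) else 0

theorem toOp_create (a : Fin N) (n : ℕ+) (i j : Mode N →₀ ℕ) :
    toOp (create a n) i j = if i = j + Finsupp.single (a, n) 1 then 1 else 0 := by
  classical
  rw [toOp, create, LinearMap.mulLeft_apply, MvPolynomial.X, MvPolynomial.monomial_mul,
    MvPolynomial.coeff_monomial, one_mul, add_comm]
  simp only [eq_comm]

theorem toOp_annih (t : ℂ) (a : Fin N) (n : ℕ+) (i j : Mode N →₀ ℕ) :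
    toOp (annih t a n) i j = ((n : ℕ) : ℂ) / (1 - t ^ (n : ℕ)) *
      if j = i + Finsupp.single (a, n) 1 then ((j (a, n) : ℕ) : ℂ) else 0 := by
  classical
  rw [toOp, annih, LinearMap.smul_apply, MvPolynomial.coeff_smul, smul_eq_mul]
  congr 1
  change MvPolynomial.coeff i (MvPolynomial.pderiv (a, n) (MvPolynomial.monomial j 1)) = _
  rw [MvPolynomial.pderiv_monomial, MvPolynomial.coeff_monomial, one_mul]
  by_cases h : j (a, n) = 0
  · rw [h]; simp
  · have hle : Finsupp.single (a, n) 1 ≤ j := by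
      rw [Finsupp.single_le_iff]; exact Nat.one_le_iff_ne_zero.2 h
    congr 1
    rw [eq_iff_iff]
    constructor
    · rintro rfl; exact (tsub_add_cancel_of_le hle).symm
    · intro h; rw [h, add_tsub_cancel_right]

theorem mulOp_linForm_apply (A : Mode N → ℂ) (i j : Mode N →₀ ℕ) :
    mulOp (linForm A) i j = ∑' r, if i = j + Finsupp.single r 1 then A r else 0 := by
  by_cases h : ∃ r, i = j + Finsupp.single r 1
  · obtain ⟨r, rfl⟩ := h
    rw [mulOp, if_pos le_self_add, add_tsub_cancel_left, coeff_linForm_single, tsum_eq_single r]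
    · rw [if_pos rfl]
    · intro s hs
      rw [if_neg fun h => hs (Finsupp.single_left_injective one_ne_zero
        (add_left_cancel h)).symm]
  · push Not at h
    simp only [h, if_false, tsum_zero]
    by_cases h1 : j ≤ i
    · rw [mulOp, if_pos h1, coeff_linForm_eq_zero]
      intro r hr
      exact h r (by rw [← hr, add_tsub_cancel_of_le h1])
    · exact mulOp_of_not_le _ h1

theorem tsum_mode_eq (a : Fin N) (f : Mode N → ℂ) (h : ∀ b n, b ≠ a → f (b, n) = 0) :
    ∑' m, f m = ∑' n : ℕ+, f (a, n) := by
  have hinj : Function.Injective fun n : ℕ+ => ((a, n) : Mode N) := fun n n' h =>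
    (Prod.ext_iff.1 h).2
  refine (hinj.tsum_eq ?_).symm
  rintro ⟨b, n⟩ hm
  by_cases hb : b = a
  · exact ⟨n, by rw [hb]⟩
  · exact absurd (h b n hb) hm

theorem phiMinus_eq (t : ℂ) (a : Fin N) (z : ℂ) :
    phiMinus t a z = mulOp (linForm (creA t a z)) := by
  ext i j
  rw [mulOp_linForm_apply, tsum_mode_eq a]
  · rw [phiMinus]
    refine tsum_congr fun n => ?_
    rw [toOp_create, creA, if_pos rfl]
    split_ifs <;> simp
  · intro b n hb
    simp [creA, hb]

theorem linForm_neg (A : Mode N → ℂ) : linForm (-A) = -linForm A := by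
  ext m
  change (∑' s, if m = Finsupp.single s 1 then (-A) s else 0) =
    -(∑' s, if m = Finsupp.single s 1 then A s else 0)
  rw [← tsum_neg]
  exact tsum_congr fun s => by split_ifs <;> simp

theorem neg_phiMinus_eq (t : ℂ) (a : Fin N) (z : ℂ) :
    -phiMinus t a z = mulOp (linForm (-creA t a z)) := by
  rw [phiMinus_eq, linForm_neg]
  ext i j
  rw [Matrix.neg_apply, mulOp, mulOp]
  split_ifs <;> simp

theorem opExp_neg_phiMinus (t : ℂ) (a : Fin N) (z : ℂ) :
    opExp (-phiMinus t a z) = gauss (-creA t a z) 0 := by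
  rw [neg_phiMinus_eq, opExp_mulOp, gauss_zero_right]

theorem multiFact_add_single (i : Mode N →₀ ℕ) (r : Mode N) :
    multiFact (i + Finsupp.single r 1) = (i r + 1 : ℕ) * multiFact i := by
  classical
  have h1 : ∀ s ∈ insert r i.support, (fun (_ : Mode N) (k : ℕ) => (k.factorial : ℂ)) s 0 = 1 := by
    simp
  rw [multiFact, multiFact, Finsupp.prod_of_support_subset (i + Finsupp.single r 1)
      (s := insert r i.support) ?_ (fun (_ : Mode N) (k : ℕ) => (k.factorial : ℂ)) h1,
    Finsupp.prod_of_support_subset i (s := insert r i.support) (Finset.subset_insert _ _)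
      (fun (_ : Mode N) (k : ℕ) => (k.factorial : ℂ)) h1,
    ← Finset.mul_prod_erase _ _ (Finset.mem_insert_self r _),
    ← Finset.mul_prod_erase _ _ (Finset.mem_insert_self r _), ← mul_assoc]
  · congr 1
    · rw [Finsupp.add_apply, Finsupp.single_eq_same, Nat.factorial_succ]; push_cast; ring
    · refine Finset.prod_congr rfl fun s hs => ?_
      rw [Finsupp.add_apply, Finsupp.single_eq_of_ne (Finset.ne_of_mem_erase hs), add_zero]
  · refine Finsupp.support_add.trans (Finset.union_subset (Finset.subset_insert _ _) ?_)
    exact Finsupp.support_single_subset.trans (by simp)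

/-- The normalization `n / (1 - t^n)` of the commutator cancels the factor `(1 - t^n) / n` of the
field, which leaves `-z^{-n} ∂`. -/
theorem phiPlus_eq {t : ℂ} (ht : ∀ n : ℕ+, t ^ (n : ℕ) ≠ 1) (a : Fin N) (z : ℂ) :
    phiPlus t a z = diffOp (linForm (annB a z)) := by
  ext i j
  rw [diffOp, mulOp_linForm_apply, tsum_mode_eq a]
  · rw [phiPlus, ← tsum_mul_left]
    refine tsum_congr fun n => ?_
    rw [toOp_annih, annB, if_pos rfl]
    have h1 : (1 - t ^ (n : ℕ)) ≠ 0 := sub_ne_zero.2 (ht n).symm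
    have h2 : ((n : ℕ) : ℂ) ≠ 0 := Nat.cast_ne_zero.2 n.ne_zero
    split_ifs with h
    · rw [h, multiFact_add_single, mul_div_assoc, div_self (multiFact_ne_zero i), mul_one,
        Finsupp.add_apply, Finsupp.single_eq_same]
      field_simp
    · simp
  · intro b n hb
    simp [annB, hb]

theorem vertexOp_eq {t : ℂ} (ht : ∀ n : ℕ+, t ^ (n : ℕ) ≠ 1) (a : Fin N) (z : ℂ) :
    vertexOp t a z = gauss (creA t a z) (annB a z) := by
  rw [vertexOp, phiMinus_eq, phiPlus_eq ht, opExp_mulOp, opExp_diffOp, gauss]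

/-! ### Composition of Gaussians -/

theorem HasSum.of_eq {ι α : Type*} [AddCommMonoid α] [TopologicalSpace α] {f g : ι → α} {a b : α}
    (h : HasSum f a) (hfg : ∀ i, f i = g i) (hab : a = b) : HasSum g b := by
  rw [← funext hfg, ← hab]; exact h

theorem hasSum_pow_div_factorial (z : ℂ) :
    HasSum (fun k : ℕ => z ^ k / (k.factorial : ℂ)) (Complex.exp z) := by
  rw [Complex.exp_eq_exp_ℂ]; exact NormedSpace.expSeries_div_hasSum_exp z

theorem tsum_norm_pow_div_factorial_succ (z : ℂ) :
    ∑' k : ℕ, ‖z ^ (k + 1) / ((k + 1).factorial : ℂ)‖ = Real.exp ‖z‖ - 1 := by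
  have h : HasSum (fun k : ℕ => ‖z‖ ^ k / (k.factorial : ℝ)) (Real.exp ‖z‖) := by
    rw [Real.exp_eq_exp_ℝ]; exact NormedSpace.expSeries_div_hasSum_exp ‖z‖
  have h2 := (hasSum_nat_add_iff' 1).2 h
  simp only [Finset.range_one, Finset.sum_singleton, pow_zero, Nat.factorial_zero, Nat.cast_one,
    div_one] at h2
  rw [← h2.tsum_eq]
  simp [norm_pow]

theorem exp_sub_one_le (x : ℝ) : Real.exp x - 1 ≤ x * Real.exp x := by
  have h := Real.add_one_le_exp (-x)
  have h2 : Real.exp (-x) * Real.exp x = 1 := by rw [← Real.exp_add]; simp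
  nlinarith [Real.exp_pos x]

theorem Summable.exp_sub_one {ι : Type*} {x : ι → ℝ} (hx : ∀ i, 0 ≤ x i) (h : Summable x) :
    Summable fun i => Real.exp (x i) - 1 := by
  refine Summable.of_nonneg_of_le (fun i => by linarith [Real.add_one_le_exp (x i), hx i])
    (fun i => ?_) (h.mul_right (Real.exp (∑' i, x i)))
  refine (exp_sub_one_le (x i)).trans ?_
  gcongr
  · exact hx i
  · exact h.le_tsum i fun j _ => hx j

/-- The matrix of multiplication by `exp (a x)`, in one variable. -/
def mulEntry (a : ℂ) (κ p : ℕ) : ℂ :=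
  if p ≤ κ then a ^ (κ - p) / ((κ - p).factorial : ℂ) else 0

/-- The matrix of `exp (b ∂)`, in one variable. -/
def diffEntry (b : ℂ) (l κ : ℕ) : ℂ :=
  (κ.factorial : ℂ) / (l.factorial : ℂ) * mulEntry b κ l

theorem mulEntry_add (a : ℂ) (p s : ℕ) : mulEntry a (p + s) p = a ^ s / (s.factorial : ℂ) := by
  rw [mulEntry, if_pos le_self_add, Nat.add_sub_cancel_left]

theorem diffEntry_of_le (b : ℂ) {l κ : ℕ} (h : l ≤ κ) :
    diffEntry b l κ = (κ.choose l : ℂ) * b ^ (κ - l) := by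
  rw [diffEntry, mulEntry, if_pos h, Nat.cast_choose ℂ h]
  field_simp

theorem diffEntry_of_lt (b : ℂ) {l κ : ℕ} (h : κ < l) : diffEntry b l κ = 0 := by
  rw [diffEntry, mulEntry, if_neg (not_le.2 h), mul_zero]

/-- The one-mode relation `e^{b∂} e^{ax} = e^{ab} e^{ax} e^{b∂}` in matrix form. Vandermonde's
convolution splits the binomial coefficient of `∂`, and each piece then sums to an exponential
series. -/
theorem hasSum_diffEntry_mul_mulEntry (a b : ℂ) (l p : ℕ) :
    HasSum (fun κ => diffEntry b l κ * mulEntry a κ p)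
      (Complex.exp (b * a) * ∑ m ∈ Finset.range (l + 1), mulEntry a l m * diffEntry b m p) := by
  have hlow : ∑ κ ∈ Finset.range p, diffEntry b l κ * mulEntry a κ p = 0 :=
    Finset.sum_eq_zero fun κ hκ => by
      rw [mulEntry, if_neg (not_le.2 (Finset.mem_range.1 hκ)), mul_zero]
  -- Terms with `κ < p` vanish, so the summation variable becomes `s = κ - p`.
  rw [← hasSum_nat_add_iff' p, hlow, sub_zero, Finset.mul_sum]
  -- Here `choose (p + s) l` is expanded by Vandermonde's convolution. The guard `l ≤ s + p`
  -- protects the truncated subtraction; beyond it all the binomial products vanish anyway.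
  have hterm : ∀ s, diffEntry b l (s + p) * mulEntry a (s + p) p =
      ∑ m ∈ Finset.range (l + 1), (p.choose m : ℂ) * (s.choose (l - m) : ℂ) *
        (if l ≤ s + p then b ^ (s + p - l) else 0) * (a ^ s / (s.factorial : ℂ)) := by
    intro s
    rw [add_comm s p, mulEntry_add, ← Finset.sum_mul, ← Finset.sum_mul]
    congr 1
    have h := Nat.add_choose_eq p s l
    rw [Finset.Nat.sum_antidiagonal_eq_sum_range_succ_mk] at h
    have h' : ((p + s).choose l : ℂ) = ∑ m ∈ Finset.range (l + 1), (p.choose m : ℂ) *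
        (s.choose (l - m) : ℂ) := by
      rw [h]; push_cast; rfl
    rw [← h']
    split_ifs with hl
    · rw [diffEntry_of_le b hl]
    · rw [diffEntry_of_lt b (not_le.1 hl), mul_zero]
  simp_rw [hterm]
  refine hasSum_sum fun m hm => ?_
  have hm : m ≤ l := Nat.lt_succ_iff.1 (Finset.mem_range.1 hm)
  -- For fixed `m` the terms with `s < l - m` vanish, and `v = s - (l - m)` runs through an
  -- exponential series in `b * a`.
  rw [← hasSum_nat_add_iff' (l - m)]
  have hlow2 : ∑ s ∈ Finset.range (l - m), (p.choose m : ℂ) * (s.choose (l - m) : ℂ) *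
        (if l ≤ s + p then b ^ (s + p - l) else 0) * (a ^ s / (s.factorial : ℂ)) = 0 :=
    Finset.sum_eq_zero fun s hs => by
      rw [Nat.choose_eq_zero_of_lt (Finset.mem_range.1 hs)]; simp
  rw [hlow2, sub_zero]
  by_cases hp : m ≤ p
  · have e : ∀ v : ℕ, (p.choose m : ℂ) * ((v + (l - m)).choose (l - m) : ℂ) *
        (if l ≤ v + (l - m) + p then b ^ (v + (l - m) + p - l) else 0) *
          (a ^ (v + (l - m)) / ((v + (l - m)).factorial : ℂ)) =
        (b * a) ^ v / (v.factorial : ℂ) * (mulEntry a l m * diffEntry b m p) := by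
      intro v
      rw [if_pos (by omega), show v + (l - m) + p - l = v + (p - m) by omega,
        diffEntry_of_le b hp, mulEntry, if_pos hm, Nat.cast_choose ℂ (Nat.le_add_left _ _), Nat.add_sub_cancel]
      have h1 := Nat.cast_ne_zero (R := ℂ).2 (Nat.factorial_ne_zero v)
      have h2 := Nat.cast_ne_zero (R := ℂ).2 (Nat.factorial_ne_zero (l - m))
      have h3 := Nat.cast_ne_zero (R := ℂ).2 (Nat.factorial_ne_zero (v + (l - m)))
      field_simp
      ring
    simp_rw [e]
    exact (hasSum_pow_div_factorial (b * a)).mul_right _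
  · rw [Nat.choose_eq_zero_of_lt (not_le.1 hp), diffEntry_of_lt b (not_le.1 hp)]
    simp

variable {N : ℕ}

theorem mulOp_expCoeff_eq_prod (A : Mode N → ℂ) (k p : Mode N →₀ ℕ) (T : Finset (Mode N))
    (hk : k.support ⊆ T) (hp : p.support ⊆ T) :
    mulOp (expCoeff A) k p = ∏ i ∈ T, mulEntry (A i) (k i) (p i) := by
  by_cases h : p ≤ k
  · rw [mulOp, if_pos h, coeff_expCoeff, Finsupp.prod_of_support_subset _
      (Finsupp.support_tsub.trans hk) _ (by simp)]
    refine Finset.prod_congr rfl fun i _ => ?_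
    rw [mulEntry, if_pos (h i), Finsupp.tsub_apply]
  · rw [mulOp_of_not_le _ h]
    rw [Finsupp.le_def] at h
    push Not at h
    obtain ⟨i, hi⟩ := h
    refine (Finset.prod_eq_zero (i := i) (hp ?_) ?_).symm
    · rw [Finsupp.mem_support_iff]; omega
    · rw [mulEntry, if_neg (not_le.2 hi)]

theorem diffOp_expCoeff_eq_prod (B : Mode N → ℂ) (l k : Mode N →₀ ℕ) (T : Finset (Mode N))
    (hl : l.support ⊆ T) (hk : k.support ⊆ T) :
    diffOp (expCoeff B) l k = ∏ i ∈ T, diffEntry (B i) (l i) (k i) := by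
  rw [diffOp, mulOp_expCoeff_eq_prod B k l T hk hl, multiFact, multiFact,
    Finsupp.prod_of_support_subset _ hk _ (by simp),
    Finsupp.prod_of_support_subset _ hl _ (by simp), ← Finset.prod_div_distrib,
    ← Finset.prod_mul_distrib]
  rfl

/-- The modes decouple. Outside the supports of `l` and `p` a mode contributes `∑ (B A)^κ / κ!` on
one side and only the vacuum term on the other, so both sides are convergent infinite products that
agree factor by factor by the one-mode relation. -/
theorem hasSum_diffOp_mulOp (A B : Mode N → ℂ) (h : Summable fun m => B m * A m)
    (l p : Mode N →₀ ℕ) :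
    HasSum (fun k => diffOp (expCoeff B) l k * mulOp (expCoeff A) k p)
      (Complex.exp (∑' m, B m * A m) *
        ∑ m ∈ Finset.Iic l, mulOp (expCoeff A) l m * diffOp (expCoeff B) m p) := by
  classical
  set S := l.support ∪ p.support with hS
  set g : Mode N → ℕ → ℂ := fun i κ => diffEntry (B i) (l i) κ * mulEntry (A i) κ (p i) with hg
  set g' : Mode N → ℕ → ℂ := fun i κ => mulEntry (A i) (l i) κ * diffEntry (B i) κ (p i) with hg'
  have h0 : ∀ i ∉ S, l i = 0 ∧ p i = 0 := fun i hi => by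
    rw [hS, Finset.mem_union, not_or] at hi
    exact ⟨Finsupp.notMem_support_iff.1 hi.1, Finsupp.notMem_support_iff.1 hi.2⟩
  have hg0 : ∀ i ∉ S, ∀ κ, g i κ = (B i * A i) ^ κ / (κ.factorial : ℂ) := fun i hi κ => by
    simp only [hg]
    rw [(h0 i hi).1, (h0 i hi).2, diffEntry_of_le _ (Nat.zero_le _), mulEntry, if_pos (Nat.zero_le _)]
    simp only [Nat.choose_zero_right, Nat.cast_one, one_mul, tsub_zero, mul_pow]
    ring
  have hg'0 : ∀ i ∉ S, ∀ κ, g' i κ = if κ = 0 then 1 else 0 := fun i hi κ => by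
    simp only [hg']
    rw [(h0 i hi).1, (h0 i hi).2]
    rcases κ with _ | κ
    · simp [mulEntry, diffEntry]
    · simp [mulEntry]
  have hsum : ∀ i, Summable fun κ => ‖g i κ‖ := fun i =>
    (hasSum_diffEntry_mul_mulEntry _ _ _ _).summable.norm
  have hfin : ∀ i κ, κ ∉ Finset.range (l i + 1) → g' i κ = 0 := fun i κ hκ => by
    simp only [hg']
    rw [mulEntry, if_neg fun h => hκ (Finset.mem_range.2 (Nat.lt_succ_iff.2 h)), zero_mul]
  have hsum' : ∀ i, Summable fun κ => ‖g' i κ‖ := fun i =>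
    summable_of_ne_finset_zero (s := Finset.range (l i + 1)) fun κ hκ => by
      rw [hfin i κ hκ, norm_zero]
  have hs : Summable fun i => ∑' k, ‖g i (k + 1)‖ := by
    have : Summable fun i => Real.exp ‖B i * A i‖ - 1 :=
      Summable.exp_sub_one (fun _ => norm_nonneg _) h.norm
    refine (summable_congr_cofinite ?_).1 this
    filter_upwards [S.finite_toSet.compl_mem_cofinite] with i hi
    rw [← tsum_norm_pow_div_factorial_succ]
    exact tsum_congr fun k => by rw [hg0 i hi]
  have hs' : Summable fun i => ∑' k, ‖g' i (k + 1)‖ := by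
    refine summable_of_ne_finset_zero (s := S) fun i hi => ?_
    simp [hg'0 i hi]
  have h1 : ∀ i ∉ S, g i 0 = 1 := fun i hi => by rw [hg0 i hi]; simp
  have h1' : ∀ i ∉ S, g' i 0 = 1 := fun i hi => by rw [hg'0 i hi]; simp
  have P := hasProd_tsum_expProd h1 hsum hs
  have P' := hasProd_tsum_expProd h1' hsum' hs'
  -- The scalar is written as an infinite product as well, one factor `exp (B m * A m)` per mode, so
  -- that the comparison can be made mode by mode.
  have PE := (h.hasSum.cexp).mul P'
  have e : ∀ i, (Complex.exp ∘ fun m => B m * A m) i * ∑' k, g' i k = ∑' k, g i k := fun i => by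
    rw [(hasSum_diffEntry_mul_mulEntry _ _ _ _).tsum_eq, tsum_eq_sum (hfin i)]
    rfl
  simp_rw [e] at PE
  have key := P.unique PE
  have t1 : ∀ k, diffOp (expCoeff B) l k * mulOp (expCoeff A) k p = expProd S g k := fun k => by
    rw [expProd, Finset.prod_mul_distrib, ← mulOp_expCoeff_eq_prod, ← diffOp_expCoeff_eq_prod]
    all_goals grind
  have t2 : ∑ m ∈ Finset.Iic l, mulOp (expCoeff A) l m * diffOp (expCoeff B) m p =
      ∑' m, expProd S g' m := by
    rw [tsum_eq_sum (s := Finset.Iic l)]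
    · refine Finset.sum_congr rfl fun m _ => ?_
      rw [expProd, Finset.prod_mul_distrib, ← mulOp_expCoeff_eq_prod, ← diffOp_expCoeff_eq_prod]
      all_goals grind
    · intro m hm
      have : mulOp (expCoeff A) l m * diffOp (expCoeff B) m p = expProd S g' m := by
        rw [expProd, Finset.prod_mul_distrib, ← mulOp_expCoeff_eq_prod, ← diffOp_expCoeff_eq_prod]
        all_goals grind
      rw [← this, mulOp_of_not_le _ fun h => hm (Finset.mem_Iic.2 h), zero_mul]
  simp_rw [t1, t2]
  rw [← key]
  exact (summable_norm_expProd h1 hsum hs).of_norm.hasSum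

theorem linForm_add (A A' : Mode N → ℂ) : linForm (A + A') = linForm A + linForm A' := by
  ext m
  rw [map_add]
  by_cases h : ∃ r, m = Finsupp.single r 1
  · obtain ⟨r, rfl⟩ := h
    simp only [coeff_linForm_single, Pi.add_apply]
  · push Not at h
    simp only [coeff_linForm_eq_zero _ h, add_zero]

/-- The coefficient at `m` is compared inside the single power of degree `m.degree` of the linear
form, where the binomial theorem applies. -/
theorem expCoeff_add (A A' : Mode N → ℂ) : expCoeff (A + A') = expCoeff A * expCoeff A' := by
  classical
  ext m
  have hf : ∀ k : ℕ, (k.factorial : ℂ) ≠ 0 := fun k => Nat.cast_ne_zero.2 (Nat.factorial_ne_zero k)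
  have h := coeff_linForm_pow (A + A') m.degree m
  rw [if_pos rfl, linForm_add, add_pow, map_sum] at h
  rw [← mul_right_inj' (hf m.degree), ← h, MvPowerSeries.coeff_mul, Finset.mul_sum]
  have e : ∀ k ∈ Finset.range (m.degree + 1), MvPowerSeries.coeff m (linForm A ^ k *
      linForm A' ^ (m.degree - k) * ((m.degree.choose k : ℕ) : MvPowerSeries (Mode N) ℂ)) =
      ∑ p ∈ Finset.HasAntidiagonal.antidiagonal m, if p.1.degree = k then (m.degree.factorial : ℂ) *
        (MvPowerSeries.coeff p.1 (expCoeff A) * MvPowerSeries.coeff p.2 (expCoeff A')) else 0 := by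
    intro k hk
    have hk := Nat.lt_succ_iff.1 (Finset.mem_range.1 hk)
    have hc : ((m.degree.choose k : ℕ) : MvPowerSeries (Mode N) ℂ) =
      MvPowerSeries.C ((m.degree.choose k : ℕ) : ℂ) := by simp
    rw [hc, MvPowerSeries.coeff_mul_C, MvPowerSeries.coeff_mul, Finset.sum_mul]
    refine Finset.sum_congr rfl fun p hp => ?_
    have hp := Finset.HasAntidiagonal.mem_antidiagonal.1 hp
    have hd : p.1.degree + p.2.degree = m.degree := by rw [← map_add, hp]
    rw [coeff_linForm_pow, coeff_linForm_pow]
    by_cases h1 : p.1.degree = k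
    · rw [if_pos h1, if_pos h1, if_pos (by omega), Nat.cast_choose ℂ hk]
      field_simp [hf]
    · rw [if_neg h1, if_neg h1, zero_mul, zero_mul]
  rw [Finset.sum_congr rfl e, Finset.sum_comm]
  refine Finset.sum_congr rfl fun p hp => ?_
  have hp := Finset.HasAntidiagonal.mem_antidiagonal.1 hp
  rw [Finset.sum_ite_eq, if_pos]
  rw [Finset.mem_range, ← hp, map_add]
  omega

/-- Normal ordering. Only the inner pair, annihilation then creation, has to be exchanged; the two
outer factors are triangular and enter through finite sums. -/
theorem hasSum_gauss_mul_gauss (A B A' B' : Mode N → ℂ) (h : Summable fun m => B m * A' m)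
    (i j : Mode N →₀ ℕ) :
    HasSum (fun k => gauss A B i k * gauss A' B' k j)
      (Complex.exp (∑' m, B m * A' m) * gauss (A + A') (B + B') i j) := by
  have e : ∀ k, gauss A B i k * gauss A' B' k j =
      ∑ l ∈ Finset.Iic i, ∑ p ∈ Finset.Iic j, mulOp (expCoeff A) i l * diffOp (expCoeff B') p j *
        (diffOp (expCoeff B) l k * mulOp (expCoeff A') k p) := by
    intro k
    rw [gauss_apply A B i k (Finset.Iic i) fun _ h _ => Finset.mem_Iic.2 h,
      gauss_apply A' B' k j (Finset.Iic j) fun _ _ h => Finset.mem_Iic.2 h, Finset.sum_mul_sum]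
    refine Finset.sum_congr rfl fun l _ => Finset.sum_congr rfl fun p _ => ?_
    ring
  simp_rw [e]
  have H := hasSum_sum (s := Finset.Iic i) fun l _ => hasSum_sum (s := Finset.Iic j) fun p _ =>
    (hasSum_diffOp_mulOp A' B h l p).mul_left
      (mulOp (expCoeff A) i l * diffOp (expCoeff B') p j)
  suffices hE : Complex.exp (∑' m, B m * A' m) * gauss (A + A') (B + B') i j = _ from hE ▸ H
  rw [gauss_apply _ _ i j (Finset.Iic i) fun _ h _ => Finset.mem_Iic.2 h, expCoeff_add,
    expCoeff_add]
  have e2 : ∀ m ∈ Finset.Iic i, mulOp (expCoeff A * expCoeff A') i m *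
      diffOp (expCoeff B * expCoeff B') m j =
      ∑ l ∈ Finset.Iic i, ∑ p ∈ Finset.Iic j, mulOp (expCoeff A) i l * diffOp (expCoeff B') p j *
        (mulOp (expCoeff A') l m * diffOp (expCoeff B) m p) := by
    intro m _
    rw [← sum_mulOp _ _ i m (Finset.Iic i) fun _ _ h => Finset.mem_Iic.2 h,
      ← sum_diffOp _ _ m j (Finset.Iic j) fun _ _ h => Finset.mem_Iic.2 h, Finset.sum_mul_sum]
    refine Finset.sum_congr rfl fun l _ => Finset.sum_congr rfl fun p _ => ?_
    ring
  rw [Finset.sum_congr rfl e2, Finset.sum_comm, Finset.mul_sum]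
  refine Finset.sum_congr rfl fun l hl => ?_
  rw [Finset.sum_comm, Finset.mul_sum]
  refine Finset.sum_congr rfl fun p _ => ?_
  rw [← Finset.mul_sum, mul_left_comm]
  congr 2
  -- The reordered factor vanishes unless `m ≤ l`, so the range of `m` can be enlarged to the lower
  -- set of `i` used on the left.
  symm
  refine Finset.sum_subset (Finset.Iic_subset_Iic.2 (Finset.mem_Iic.1 hl)) fun m _ hm => ?_
  rw [mulOp_of_not_le _ fun h => hm (Finset.mem_Iic.2 h), zero_mul]

/-! ### Ordered products of Gaussians -/

variable {N : ℕ}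

/-- The exponent produced by normal ordering a product of Gaussians. -/
def pairExp : List ((Mode N → ℂ) × (Mode N → ℂ)) → ℂ
  | [] => 0
  | p :: l => (l.map fun p' => ∑' m, p.2 m * p'.1 m).sum + pairExp l

theorem list_sum_apply (l : List (Mode N → ℂ)) (m : Mode N) :
    l.sum m = (l.map fun f => f m).sum := by
  induction l with
  | nil => rfl
  | cons a l ih => simp [ih]

theorem summable_list_sum {ι : Type*} (l : List (ι → ℂ)) (h : ∀ f ∈ l, Summable f) :
    HasSum (fun m => (l.map fun f => f m).sum) (l.map fun f => ∑' m, f m).sum := by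
  induction l with
  | nil => simp
  | cons f l ih =>
    simp only [List.map_cons, List.sum_cons]
    exact (h f (by simp)).hasSum.add (ih fun g hg => h g (by simp [hg]))

/-- Factors are attached from the left, so each new annihilation part meets only the creation parts
of later factors. Summability in ℂ is absolute convergence, so the sums over intermediate states
converge absolutely. -/
theorem opProd_gauss (l : List ((Mode N → ℂ) × (Mode N → ℂ)))
    (hl : l.Pairwise fun p p' => Summable fun m => p.2 m * p'.1 m) :
    ProdConverges (l.map fun p => gauss p.1 p.2) ∧
      ∀ i j, opProd (l.map fun p => gauss p.1 p.2) i j =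
        Complex.exp (pairExp l) * gauss (l.map Prod.fst).sum (l.map Prod.snd).sum i j := by
  induction l with
  | nil =>
    refine ⟨trivial, fun i j => ?_⟩
    simp [opProd, pairExp, gauss_zero_zero]
  | cons p l ih =>
    rw [List.pairwise_cons] at hl
    obtain ⟨ih1, ih2⟩ := ih hl.2
    have hs : HasSum (fun m => p.2 m * (l.map Prod.fst).sum m)
        (l.map fun p' => ∑' m, p.2 m * p'.1 m).sum := by
      have := summable_list_sum (l.map fun p' => fun m => p.2 m * p'.1 m) (by
        intro f hf
        obtain ⟨p', hp', rfl⟩ := List.mem_map.1 hf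
        exact hl.1 p' hp')
      rw [List.map_map] at this
      refine this.of_eq (fun m => ?_) rfl
      rw [list_sum_apply, List.map_map, List.map_map, ← List.sum_map_mul_left]
      rfl
    have H := fun i j => (hasSum_gauss_mul_gauss p.1 p.2 (l.map Prod.fst).sum
      (l.map Prod.snd).sum hs.summable i j).mul_left (Complex.exp (pairExp l))
    have e : ∀ i j k, gauss p.1 p.2 i k * opProd (l.map fun p => gauss p.1 p.2) k j =
        Complex.exp (pairExp l) * (gauss p.1 p.2 i k *
          gauss (l.map Prod.fst).sum (l.map Prod.snd).sum k j) := by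
      intro i j k
      rw [ih2]; ring
    refine ⟨⟨ih1, fun i j => ?_⟩, fun i j => ?_⟩
    · simp_rw [e]
      exact (H i j).summable
    · rw [List.map_cons, opProd, opMul]
      simp_rw [e]
      rw [(H i j).tsum_eq, hs.tsum_eq, pairExp, Complex.exp_add]
      simp only [List.map_cons, List.sum_cons]
      ring

/-! ### The operator `q^{L_0}` -/

/-- The energy `∑ n m_{(a,n)}` of a monomial. -/
def energy (m : Mode N →₀ ℕ) : ℕ := m.sum fun r k => k * (r.2 : ℕ)

/-- The weights `1 - t^n` undo the normalization of the bosons: `(1 - t^n) a_{-n} a_n` is `n` times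
the number operator of the mode. -/
theorem L0_apply {t : ℂ} (ht : ∀ n : ℕ+, t ^ (n : ℕ) ≠ 1) (i j : Mode N →₀ ℕ) :
    L0 t N i j = if i = j then (energy i : ℂ) else 0 := by
  classical
  have e : ∀ (a : Fin N) (n : ℕ+), (1 - t ^ (n : ℕ)) * toOp (create a n ∘ₗ annih t a n) i j =
      if i = j then (i (a, n) : ℂ) * ((n : ℕ) : ℂ) else 0 := by
    intro a n
    have h1 : (1 - t ^ (n : ℕ)) ≠ 0 := sub_ne_zero.2 (ht n).symm
    have h2 : toOp (create a n ∘ₗ annih t a n) i j = ((n : ℕ) : ℂ) / (1 - t ^ (n : ℕ)) *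
        if i = j then (i (a, n) : ℂ) else 0 := by
      have h3 : create a n (annih t a n (MvPolynomial.monomial j 1)) =
        (((n : ℕ) : ℂ) / (1 - t ^ (n : ℕ))) • ((MvPolynomial.X (a, n) : Fock N) *
        MvPolynomial.pderiv (a, n) (MvPolynomial.monomial j (1 : ℂ))) := by
        rw [annih, LinearMap.smul_apply, map_smul]; rfl
      rw [toOp, LinearMap.comp_apply, h3, MvPolynomial.coeff_smul, smul_eq_mul, MvPolynomial.pderiv_monomial,
        MvPolynomial.X, MvPolynomial.monomial_mul, MvPolynomial.coeff_monomial, one_mul, one_mul]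
      congr 1
      by_cases hj : j (a, n) = 0
      · rw [hj]
        by_cases hij : i = j
        · rw [if_pos hij, hij, hj]; simp
        · rw [if_neg hij]; simp
      · have hle : Finsupp.single (a, n) 1 ≤ j := by
          rw [Finsupp.single_le_iff]; exact Nat.one_le_iff_ne_zero.2 hj
        rw [add_tsub_cancel_of_le hle]
        by_cases hij : i = j
        · rw [if_pos hij.symm, if_pos hij, hij]
        · rw [if_neg (Ne.symm hij), if_neg hij]
    rw [h2]
    split_ifs <;> field_simp
    simp
  rw [L0]
  simp_rw [e]
  split_ifs with hij
  · have hsum : Summable fun m : Mode N => (i m : ℂ) * ((m.2 : ℕ) : ℂ) :=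
      summable_of_ne_finset_zero (s := i.support) fun m hm => by
        rw [Finsupp.notMem_support_iff.1 hm]; simp
    have := hsum.tsum_prod' fun a => hsum.comp_injective fun n n' h => (Prod.ext_iff.1 h).2
    rw [tsum_fintype (L := _) (f := fun b : Fin N => ∑' c : ℕ+, (i (b, c) : ℂ) * ((c : ℕ) : ℂ))]
      at this
    rw [← this, tsum_eq_sum (s := i.support), energy, Finsupp.sum]
    · push_cast; rfl
    · intro m hm
      rw [Finsupp.notMem_support_iff.1 hm]; simp
  · simp

theorem opExp_diagonal (d : (Mode N →₀ ℕ) → ℂ) (D : FockOp N)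
    (hD : ∀ i j, D i j = if i = j then d i else 0) (i j : Mode N →₀ ℕ) :
    opExp D i j = if i = j then Complex.exp (d i) else 0 := by
  classical
  have hp : ∀ k i j, opPow D k i j = if i = j then d i ^ k else 0 := by
    intro k
    induction k with
    | zero => intro i j; rw [opPow, Matrix.one_apply, pow_zero]
    | succ k ih =>
      intro i j
      rw [opPow, opMul, tsum_eq_single i]
      · rw [hD, if_pos rfl, ih, pow_succ']; split_ifs <;> simp
      · intro l hl
        rw [hD, if_neg hl.symm, zero_mul]
  rw [opExp]
  simp_rw [hp]
  split_ifs with h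
  · exact (hasSum_pow_div_factorial (d i)).tsum_eq
  · simp

theorem qL0_apply {q : ℝ} (hq : 0 < q) {t : ℂ} (ht : ∀ n : ℕ+, t ^ (n : ℕ) ≠ 1)
    (i j : Mode N →₀ ℕ) : qL0 q t N i j = if i = j then (q : ℂ) ^ energy i else 0 := by
  rw [qL0, opExp_diagonal fun i => (energy i : ℂ) * ((Real.log q : ℝ) : ℂ)]
  · congr 1
    rw [Complex.exp_nat_mul, ← Complex.ofReal_exp, Real.exp_log hq]
  · intro i j
    rw [Matrix.smul_apply, L0_apply ht, smul_eq_mul]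
    split_ifs <;> ring

/-! ### Traces of Gaussians -/

/-- Diagonal matrix elements of a one-variable Gaussian. -/
def diagEntry (u : ℂ) (κ : ℕ) : ℂ :=
  ∑ p ∈ Finset.HasAntidiagonal.antidiagonal κ, (κ.choose p.1 : ℂ) * (u ^ p.2 / (p.2.factorial : ℂ))

theorem sum_mulEntry_mul_diffEntry (a b : ℂ) (κ : ℕ) :
    ∑ k ∈ Finset.range (κ + 1), mulEntry a κ k * diffEntry b k κ = diagEntry (a * b) κ := by
  rw [diagEntry, Finset.Nat.sum_antidiagonal_eq_sum_range_succ_mk]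
  refine Finset.sum_congr rfl fun k hk => ?_
  have hk := Nat.lt_succ_iff.1 (Finset.mem_range.1 hk)
  rw [mulEntry, if_pos hk, diffEntry_of_le b hk, mul_pow]
  ring

/-- Summing first over the number of quanta not touched by the Gaussian gives `∑_k choose (k + d) k
y^k = (1 - y)^{-d-1}`; the sum over `d` is then an exponential series in `u y / (1 - y)`. -/
theorem hasSum_diagEntry (u : ℂ) {y : ℂ} (hy : ‖y‖ < 1) :
    HasSum (fun κ => y ^ κ * diagEntry u κ) (Complex.exp (u * y / (1 - y)) / (1 - y)) := by
  have hS : ∀ (u : ℂ) {y : ℂ}, ‖y‖ < 1 → ∀ d : ℕ, HasSum (fun k : ℕ => ((k + d).choose k : ℂ) *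
      (u ^ d / (d.factorial : ℂ)) * y ^ (k + d))
      ((u * y / (1 - y)) ^ d / (d.factorial : ℂ) * (1 / (1 - y))) := by
    intro u y hy d
    have h1 : 1 - y ≠ 0 := sub_ne_zero.2 fun h => by rw [← h] at hy; simp at hy
    have := (hasSum_choose_mul_geometric_of_norm_lt_one d hy).mul_left
      (u ^ d / (d.factorial : ℂ) * y ^ d)
    have hd := Nat.cast_ne_zero (R := ℂ).2 (Nat.factorial_ne_zero d)
    refine this.of_eq (fun k => ?_) ?_
    · rw [Nat.choose_symm_add]; ring
    · rw [div_pow, mul_pow, pow_succ]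
      field_simp
  have hf : Summable fun p : ℕ × ℕ => ((p.2 + p.1).choose p.2 : ℂ) *
      (u ^ p.1 / (p.1.factorial : ℂ)) * y ^ (p.2 + p.1) := by
    -- The same row sums at `‖u‖` and `‖y‖` give the absolute convergence that justifies exchanging
    -- the two summations.
    have hy' : ‖((‖y‖ : ℝ) : ℂ)‖ < 1 := by simpa using hy
    have hr : ∀ d : ℕ, HasSum (fun k : ℕ => ((k + d).choose k : ℝ) *
      (‖u‖ ^ d / (d.factorial : ℝ)) * ‖y‖ ^ (k + d))
      ((‖u‖ * ‖y‖ / (1 - ‖y‖)) ^ d / (d.factorial : ℝ) * (1 / (1 - ‖y‖))) := by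
      intro d
      have := hS ((‖u‖ : ℝ) : ℂ) hy' d
      exact_mod_cast this
    refine Summable.of_norm_bounded (g := fun p : ℕ × ℕ => ((p.2 + p.1).choose p.2 : ℝ) *
      (‖u‖ ^ p.1 / (p.1.factorial : ℝ)) * ‖y‖ ^ (p.2 + p.1)) ?_ fun p => by
        simp [norm_pow]
    rw [summable_prod_of_nonneg fun p => by positivity]
    refine ⟨fun d => (hr d).summable, ?_⟩
    simp_rw [fun d => (hr d).tsum_eq]
    exact (Real.summable_pow_div_factorial _).mul_right _
  have hP := HasSum.prod_fiberwise hf.hasSum (fun d => hS u hy d)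
  have hT := (hasSum_pow_div_factorial (u * y / (1 - y))).mul_right (1 / (1 - y))
  have hV := hf.hasSum
  rw [hP.unique hT] at hV
  have hV2 := (Finset.HasAntidiagonal.sigmaAntidiagonalEquivProd.hasSum_iff.2
    ((Equiv.prodComm ℕ ℕ).hasSum_iff.2 hV)).sigma fun n => hasSum_fintype _
  refine hV2.of_eq (fun κ => ?_) (mul_one_div _ _)
  rw [diagEntry, Finset.mul_sum, ← Finset.sum_coe_sort (Finset.HasAntidiagonal.antidiagonal κ)]
  refine Finset.sum_congr rfl fun p _ => ?_
  have hp := Finset.HasAntidiagonal.mem_antidiagonal.1 p.2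
  simp only [Function.comp, Finset.HasAntidiagonal.sigmaAntidiagonalEquivProd, Equiv.coe_fn_mk,
    Equiv.prodComm_apply, Prod.swap]
  rw [hp]
  ring

theorem summable_norm_diagEntry (u : ℂ) {y : ℂ} (hy : ‖y‖ < 1) :
    ∃ b : ℕ → ℝ, (∀ κ, ‖y ^ κ * diagEntry u κ‖ ≤ b κ) ∧ b 0 = 1 ∧
      HasSum b (Real.exp (‖u‖ * ‖y‖ / (1 - ‖y‖)) / (1 - ‖y‖)) := by
  refine ⟨fun κ => ‖y‖ ^ κ * ∑ p ∈ Finset.HasAntidiagonal.antidiagonal κ,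
    (κ.choose p.1 : ℝ) * (‖u‖ ^ p.2 / (p.2.factorial : ℝ)), fun κ => ?_, by simp, ?_⟩
  · rw [norm_mul, norm_pow, diagEntry]
    refine mul_le_mul_of_nonneg_left ?_ (by positivity)
    refine (norm_sum_le _ _).trans (Finset.sum_le_sum fun p _ => ?_)
    simp [norm_pow]
  · have := hasSum_diagEntry ((‖u‖ : ℝ) : ℂ) (y := ((‖y‖ : ℝ) : ℂ)) (by simpa using hy)
    simp only [diagEntry] at this
    exact_mod_cast this

/-- The exponents below `i` form a box over the support of `i`, so the intermediate sum factors over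
the modes. -/
theorem gauss_diag (A B : Mode N → ℂ) (i : Mode N →₀ ℕ) :
    gauss A B i i = ∏ m ∈ i.support, diagEntry (A m * B m) (i m) := by
  classical
  have e : Finset.Iic i = i.support.finsupp fun m => Finset.range (i m + 1) := by
    ext k
    rw [Finset.mem_Iic, Finset.mem_finsupp_iff]
    refine ⟨fun h => ⟨Finsupp.support_mono h, fun m _ =>
      Finset.mem_range.2 (Nat.lt_succ_of_le (h m))⟩, fun h m => ?_⟩
    by_cases hm : m ∈ i.support
    · exact Nat.lt_succ_iff.1 (Finset.mem_range.1 (h.2 m hm))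
    · rw [Finsupp.notMem_support_iff.1 fun h' => hm (h.1 h')]; exact Nat.zero_le _
  rw [gauss_apply A B i i (Finset.Iic i) fun _ h _ => Finset.mem_Iic.2 h]
  simp_rw [← sum_mulEntry_mul_diffEntry]
  rw [← sum_finsupp_prod, ← e]
  refine Finset.sum_congr rfl fun k hk => ?_
  have hk := Finsupp.support_mono (Finset.mem_Iic.1 hk)
  rw [Finset.prod_mul_distrib, ← mulOp_expCoeff_eq_prod _ _ _ _ le_rfl hk,
    ← diffOp_expCoeff_eq_prod _ _ _ _ hk le_rfl]

theorem summable_exp_div_sub_one {ι : Type*} {x y : ι → ℝ} {c : ℝ} (hx0 : ∀ i, 0 ≤ x i)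
    (hy0 : ∀ i, 0 ≤ y i) (hc : c < 1) (hyc : ∀ i, y i ≤ c) (hx : Summable x) (hy : Summable y) :
    Summable fun i => Real.exp (x i / (1 - y i)) / (1 - y i) - 1 := by
  have h1 : ∀ i, 0 < 1 - y i := fun i => by linarith [hyc i]
  have hx' : Summable fun i => x i / (1 - y i) := by
    refine Summable.of_nonneg_of_le (fun i => div_nonneg (hx0 i) (h1 i).le) (fun i => ?_)
      (hx.div_const (1 - c))
    have := hyc i
    have := hx0 i
    gcongr
  have e : (fun i => Real.exp (x i / (1 - y i)) / (1 - y i) - 1) =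
      fun i => (Real.exp (x i / (1 - y i)) - 1 + y i) / (1 - y i) := by
    ext i
    have := (h1 i).ne'
    field_simp
    ring
  rw [e]
  have hs := (Summable.exp_sub_one (fun i => div_nonneg (hx0 i) (h1 i).le) hx').add hy
  have h0 : ∀ i, 0 ≤ Real.exp (x i / (1 - y i)) - 1 + y i := fun i => by
    have := Real.add_one_le_exp (x i / (1 - y i))
    have := div_nonneg (hx0 i) (h1 i).le
    linarith [hy0 i]
  refine Summable.of_nonneg_of_le (fun i => div_nonneg (h0 i) (h1 i).le) (fun i => ?_)
    (hs.div_const (1 - c))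
  have := hyc i
  have := h0 i
  gcongr

theorem summable_qpow_mode {q : ℝ} (hq0 : 0 < q) (hq1 : q < 1) :
    Summable fun m : Mode N => q ^ (m.2 : ℕ) := by
  have h : Summable fun n : ℕ+ => q ^ (n : ℕ) :=
    (summable_geometric_of_lt_one hq0.le hq1).comp_injective PNat.coe_injective
  rw [summable_prod_of_nonneg fun m => by positivity]
  exact ⟨fun _ => h, (hasSum_fintype _).summable⟩

/-- With `y = q^n` the weight `q^{L_0}` is a product over modes, as are the diagonal entries, so the
trace is an infinite product of one-mode traces. The value is left as some `S` that is at once the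
sum and the product; the product is identified later by uniqueness. -/
theorem hasSum_trace_gauss {q : ℝ} (hq0 : 0 < q) (hq1 : q < 1) (A B : Mode N → ℂ)
    (h : Summable fun m => A m * B m * (q : ℂ) ^ (m.2 : ℕ)) :
    ∃ S : ℂ, HasSum (fun i => (q : ℂ) ^ energy i * gauss A B i i) S ∧
      HasProd (fun m : Mode N => Complex.exp (A m * B m * (q : ℂ) ^ (m.2 : ℕ) /
        (1 - (q : ℂ) ^ (m.2 : ℕ))) / (1 - (q : ℂ) ^ (m.2 : ℕ))) S := by
  classical
  set y : Mode N → ℂ := fun m => (q : ℂ) ^ (m.2 : ℕ) with hy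
  have hny : ∀ m, ‖y m‖ = q ^ (m.2 : ℕ) := fun m => by
    simp only [hy, norm_pow, Complex.norm_real, Real.norm_of_nonneg hq0.le]
  have hyq : ∀ m, ‖y m‖ ≤ q := fun m => by
    rw [hny]; exact pow_le_of_le_one hq0.le hq1.le m.2.ne_zero
  have hy1 : ∀ m, ‖y m‖ < 1 := fun m => (hyq m).trans_lt hq1
  set g : Mode N → ℕ → ℂ := fun m κ => y m ^ κ * diagEntry (A m * B m) κ with hg
  have hg0 : ∀ m ∉ (∅ : Finset (Mode N)), g m 0 = 1 := fun m _ => by simp [hg, diagEntry]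
  have hgs : ∀ m, Summable fun κ => ‖g m κ‖ := fun m => (hasSum_diagEntry _ (hy1 m)).summable.norm
  have hs : Summable fun m => ∑' k, ‖g m (k + 1)‖ := by
    have hx : Summable fun m => ‖A m * B m‖ * ‖y m‖ := by
      simpa only [norm_mul] using h.norm
    have hyS : Summable fun m => ‖y m‖ := by simp_rw [hny]; exact summable_qpow_mode hq0 hq1
    refine Summable.of_nonneg_of_le (fun m => tsum_nonneg fun k => norm_nonneg _) (fun m => ?_)
      (summable_exp_div_sub_one (fun m => by positivity) (fun m => norm_nonneg (y m)) hq1 hyq hx hyS)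
    obtain ⟨b, hb, hb0, hbs⟩ := summable_norm_diagEntry (A m * B m) (hy1 m)
    have h1 := (hasSum_nat_add_iff' 1).2 hbs
    rw [Finset.sum_range_one, hb0] at h1
    rw [← h1.tsum_eq]
    exact ((summable_nat_add_iff 1).2 (hgs m)).tsum_le_tsum (fun k => hb _) h1.summable
  refine ⟨∑' i, expProd ∅ g i, ?_, ?_⟩
  · refine (summable_norm_expProd hg0 hgs hs).of_norm.hasSum.of_eq (fun i => ?_) rfl
    rw [expProd, Finset.empty_union, Finset.prod_mul_distrib, gauss_diag]
    congr 1
    rw [energy, Finsupp.sum, ← Finset.prod_pow_eq_pow_sum]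
    refine Finset.prod_congr rfl fun m _ => ?_
    rw [hy, ← pow_mul, mul_comm]
  · have P := hasProd_tsum_expProd hg0 hgs hs
    simp_rw [hg, fun m => (hasSum_diagEntry (A m * B m) (hy1 m)).tsum_eq] at P
    exact P

theorem hasProd_mode (f : ℕ+ → ℂ) (c : ℂ) (hf : HasProd f c) :
    HasProd (fun m : Mode N => f m.2) (c ^ N) := by
  have h : ∀ b : Fin N, HasProd (fun m : Mode N => if m.1 = b then f m.2 else 1) c := by
    intro b
    have hinj : Function.Injective fun n : ℕ+ => ((b, n) : Mode N) := fun n n' h =>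
      (Prod.ext_iff.1 h).2
    rw [← hinj.hasProd_iff]
    · simpa [Function.comp_def] using hf
    · rintro ⟨b', n⟩ hm
      rw [if_neg]
      rintro rfl
      exact hm ⟨n, rfl⟩
  have h2 := hasProd_prod (s := (Finset.univ : Finset (Fin N))) fun b _ => h b
  simpa using h2

/-! ### Exponential formulas for `q`-shifted factorials -/

theorem norm_qpow_lt_one {q : ℝ} (hq0 : 0 < q) (hq1 : q < 1) (n : ℕ+) : ‖(q : ℂ) ^ (n : ℕ)‖ < 1 := by
  rw [norm_pow, Complex.norm_real, Real.norm_of_nonneg hq0.le]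
  exact pow_lt_one₀ hq0.le hq1 n.ne_zero

theorem one_sub_ne_zero_of_norm_lt {z : ℂ} (h : ‖z‖ < 1) : 1 - z ≠ 0 :=
  sub_ne_zero.2 fun e => by rw [← e, norm_one] at h; exact lt_irrefl _ h

/-- The double series `∑ (u q^k)^n / n` is summed in two ways: over `k` it is geometric, over `n` it
is `-log (1 - u q^k)`. Stating the result with an exponential avoids choosing a logarithm of the
infinite product. -/
theorem hasSum_log_qPoch {q : ℝ} (hq0 : 0 < q) (hq1 : q < 1) {u : ℂ} (hu : ‖u‖ < 1) :
    ∃ S : ℂ, HasSum (fun n : ℕ+ => u ^ (n : ℕ) / ((n : ℕ) : ℂ) / (1 - (q : ℂ) ^ (n : ℕ))) S ∧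
      HasProd (fun k : ℕ => 1 - u * (q : ℂ) ^ k) (Complex.exp (-S)) := by
  have hqn : ‖(q : ℂ)‖ = q := by rw [Complex.norm_real, Real.norm_of_nonneg hq0.le]
  have hF : Summable fun p : ℕ+ × ℕ => (u * (q : ℂ) ^ p.2) ^ (p.1 : ℕ) / ((p.1 : ℕ) : ℂ) := by
    have h1 : Summable fun n : ℕ+ => ‖u‖ ^ (n : ℕ) :=
      (summable_geometric_of_lt_one (norm_nonneg _) hu).comp_injective PNat.coe_injective
    have h2 := summable_geometric_of_lt_one hq0.le hq1
    have h3 := Summable.mul_of_nonneg h1 h2 (fun _ => by positivity) fun _ => by positivity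
    refine Summable.of_norm_bounded h3 fun p => ?_
    rw [norm_div, norm_pow, norm_mul, norm_pow, hqn, mul_pow, Complex.norm_natCast]
    have hp : (1 : ℝ) ≤ ((p.1 : ℕ) : ℝ) := by exact_mod_cast p.1.pos
    refine (div_le_self (by positivity) hp).trans ?_
    gcongr
    exact pow_le_of_le_one (by positivity) (pow_le_one₀ hq0.le hq1.le) p.1.ne_zero
  have hrow : ∀ n : ℕ+, HasSum (fun k : ℕ => (u * (q : ℂ) ^ k) ^ (n : ℕ) / ((n : ℕ) : ℂ))
      (u ^ (n : ℕ) / ((n : ℕ) : ℂ) / (1 - (q : ℂ) ^ (n : ℕ))) := by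
    intro n
    have := (hasSum_geometric_of_norm_lt_one (norm_qpow_lt_one hq0 hq1 n)).mul_left
      (u ^ (n : ℕ) / ((n : ℕ) : ℂ))
    refine this.of_eq (fun k => ?_) (by rw [div_eq_mul_inv _ (1 - (q : ℂ) ^ (n : ℕ))])
    rw [mul_pow, ← pow_mul, ← pow_mul, mul_comm k]
    ring
  have hk1 : ∀ k : ℕ, ‖u * (q : ℂ) ^ k‖ < 1 := fun k => by
    rw [norm_mul, norm_pow, hqn]
    exact (mul_le_of_le_one_right (norm_nonneg _) (pow_le_one₀ hq0.le hq1.le)).trans_lt hu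
  have hcol : ∀ k : ℕ, HasSum (fun n : ℕ+ => (u * (q : ℂ) ^ k) ^ (n : ℕ) / ((n : ℕ) : ℂ))
      (-Complex.log (1 - u * (q : ℂ) ^ k)) := by
    intro k
    have h := Complex.hasSum_taylorSeries_neg_log (hk1 k)
    rw [← PNat.coe_injective.hasSum_iff] at h
    · exact h
    · intro n hn
      have : n = 0 := by
        by_contra h0
        exact hn ⟨⟨n, Nat.pos_of_ne_zero h0⟩, rfl⟩
      rw [this]; simp
  have hA := hF.hasSum.prod_fiberwise hrow
  have hB := ((Equiv.prodComm ℕ ℕ+).hasSum_iff.2 hF.hasSum).prod_fiberwise hcol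
  refine ⟨_, hA, ?_⟩
  have hC := hB.neg.cexp
  have e : (Complex.exp ∘ fun k : ℕ => -(-Complex.log (1 - u * (q : ℂ) ^ k))) =
      fun k : ℕ => 1 - u * (q : ℂ) ^ k := by
    ext k
    rw [Function.comp, neg_neg, Complex.exp_log (one_sub_ne_zero_of_norm_lt (hk1 k))]
  rwa [e] at hC

theorem qPoch_ne_zero {q : ℝ} (hq0 : 0 < q) (hq1 : q < 1) {u : ℂ} (hu : ‖u‖ < 1) :
    qPoch u q ≠ 0 := by
  obtain ⟨S, -, h⟩ := hasSum_log_qPoch hq0 hq1 hu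
  rw [qPoch, h.tprod_eq]
  exact Complex.exp_ne_zero _

theorem hasSum_log_qPoch_div {q : ℝ} (hq0 : 0 < q) (hq1 : q < 1) {t u : ℂ} (ht : ‖t‖ < 1)
    (hu : ‖u‖ < 1) :
    ∃ S : ℂ, HasSum (fun n : ℕ+ => (1 - t ^ (n : ℕ)) / ((n : ℕ) : ℂ) * u ^ (n : ℕ) /
        (1 - (q : ℂ) ^ (n : ℕ))) S ∧ Complex.exp S = qPoch (t * u) q / qPoch u q := by
  obtain ⟨S, hS, hS'⟩ := hasSum_log_qPoch hq0 hq1 hu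
  have htu : ‖t * u‖ < 1 := by
    rw [norm_mul]; nlinarith [norm_nonneg t, norm_nonneg u]
  obtain ⟨T, hT, hT'⟩ := hasSum_log_qPoch hq0 hq1 htu
  refine ⟨S - T, (hS.sub hT).of_eq (fun n => ?_) rfl, ?_⟩
  · rw [mul_pow]; ring
  · rw [qPoch, qPoch, hS'.tprod_eq, hT'.tprod_eq, ← Complex.exp_sub]
    congr 1; ring

theorem hasProd_qPoch_inv {q : ℝ} (hq0 : 0 < q) (hq1 : q < 1) :
    HasProd (fun n : ℕ+ => (1 - (q : ℂ) ^ (n : ℕ))⁻¹) (qPoch q q)⁻¹ := by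
  have hqn : ‖(q : ℂ)‖ < 1 := by rwa [Complex.norm_real, Real.norm_of_nonneg hq0.le]
  obtain ⟨S, -, h⟩ := hasSum_log_qPoch hq0 hq1 hqn
  have h0 := qPoch_ne_zero hq0 hq1 hqn
  rw [qPoch, h.tprod_eq] at h0 ⊢
  have h2 : HasProd (fun n : ℕ+ => 1 - (q : ℂ) ^ (n : ℕ)) (Complex.exp (-S)) := by
    rw [← Equiv.pnatEquivNat.symm.hasProd_iff]
    convert h using 2 with k
    simp [pow_succ']
  exact h2.inv₀ h0

/-! ### Contractions of vertex operators -/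

variable {N : ℕ}

theorem hasSum_mode (f : Mode N → ℂ) (s : Fin N → ℂ)
    (h : ∀ b, HasSum (fun n : ℕ+ => f (b, n)) (s b)) : HasSum f (∑ b, s b) := by
  have h1 : ∀ b : Fin N, HasSum (fun m : Mode N => if m.1 = b then f m else 0) (s b) := by
    intro b
    have hinj : Function.Injective fun n : ℕ+ => ((b, n) : Mode N) := fun n n' h =>
      (Prod.ext_iff.1 h).2
    rw [← hinj.hasSum_iff]
    · simpa [Function.comp_def] using h b
    · rintro ⟨b', n⟩ hm
      rw [if_neg]
      rintro rfl
      exact hm ⟨n, rfl⟩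
  have h2 := hasSum_sum (s := (Finset.univ : Finset (Fin N))) fun b _ => h1 b
  simpa using h2

theorem hasSum_contraction {t u : ℂ} (ht : ‖t‖ < 1) (hu : ‖u‖ < 1) :
    Summable fun n : ℕ+ => (1 - t ^ (n : ℕ)) / ((n : ℕ) : ℂ) * u ^ (n : ℕ) := by
  have h1 : Summable fun n : ℕ+ => ‖u‖ ^ (n : ℕ) :=
    (summable_geometric_of_lt_one (norm_nonneg _) hu).comp_injective PNat.coe_injective
  refine Summable.of_norm_bounded (h1.mul_left 2) fun n => ?_
  rw [norm_mul, norm_div, norm_pow, Complex.norm_natCast]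
  gcongr
  have hp : (1 : ℝ) ≤ ((n : ℕ) : ℝ) := by exact_mod_cast n.pos
  refine (div_le_self (norm_nonneg _) hp).trans ((norm_sub_le _ _).trans ?_)
  rw [norm_one, norm_pow]
  have := pow_le_one₀ (n := (n : ℕ)) (norm_nonneg t) ht.le
  linarith

/-- `∑_n (1 - t^n) u^n / n`. -/
def contr (t u : ℂ) : ℂ := ∑' n : ℕ+, (1 - t ^ (n : ℕ)) / ((n : ℕ) : ℂ) * u ^ (n : ℕ)

/-- `∑_n (1 - t^n) u^n / n · q^n / (1 - q^n)`. -/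
def thermal (q : ℝ) (t u : ℂ) : ℂ :=
  ∑' n : ℕ+, (1 - t ^ (n : ℕ)) / ((n : ℕ) : ℂ) * (q * u) ^ (n : ℕ) / (1 - (q : ℂ) ^ (n : ℕ))

theorem exp_neg_thermal {q : ℝ} (hq0 : 0 < q) (hq1 : q < 1) {t u : ℂ} (ht : ‖t‖ < 1)
    (hu : ‖q * u‖ < 1) :
    Complex.exp (-thermal q t u) = qPoch (q * u) q / qPoch (t * (q * u)) q := by
  obtain ⟨S, hS, hS'⟩ := hasSum_log_qPoch_div hq0 hq1 ht hu
  rw [thermal, hS.tsum_eq, Complex.exp_neg, hS', inv_div]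

/-- Because `1 + q^n / (1 - q^n) = 1 / (1 - q^n)`, the contraction from normal ordering and the one
produced by the trace combine into a single quotient of q-shifted factorials. -/
theorem exp_contr_add_thermal {q : ℝ} (hq0 : 0 < q) (hq1 : q < 1) {t u : ℂ} (ht : ‖t‖ < 1)
    (hu : ‖u‖ < 1) :
    Complex.exp (contr t u + thermal q t u) = qPoch (t * u) q / qPoch u q := by
  have hqu : ‖(q : ℂ) * u‖ < 1 := by
    rw [norm_mul, Complex.norm_real, Real.norm_of_nonneg hq0.le]
    nlinarith [norm_nonneg u]
  obtain ⟨S, hS, hS'⟩ := hasSum_log_qPoch_div hq0 hq1 ht hu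
  obtain ⟨T, hT, -⟩ := hasSum_log_qPoch_div hq0 hq1 ht hqu
  have h := (hasSum_contraction ht hu).hasSum.add hT
  rw [contr, thermal, hT.tsum_eq, ← hS']
  congr 1
  refine h.unique (hS.of_eq (fun n => ?_) rfl)
  have := one_sub_ne_zero_of_norm_lt (norm_qpow_lt_one hq0 hq1 n)
  rw [mul_pow]
  field_simp
  ring

theorem hasSum_annB_mul_creA {t z w : ℂ} (ht : ‖t‖ < 1) (a : Fin N) (h : ‖w / z‖ < 1) :
    HasSum (fun m : Mode N => annB a z m * creA t a w m) (-contr t (w / z)) := by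
  have := hasSum_mode (fun m : Mode N => annB a z m * creA t a w m)
    (fun b => if b = a then -contr t (w / z) else 0) fun b => by
      split_ifs with hb
      · refine (hasSum_contraction ht h).hasSum.neg.of_eq (fun n => ?_) rfl
        simp only [annB, creA, hb, if_true, inv_pow, div_pow]
        ring
      · simp [annB, hb]
  simpa using this

theorem annB_mul_creA_of_ne (t z w : ℂ) {a b : Fin N} (h : a ≠ b) (m : Mode N) :
    annB a z m * creA t b w m = 0 := by
  rw [annB, creA]
  split_ifs with h1 h2
  · exact absurd (h1.symm.trans h2) h
  all_goals simp

theorem pairExp_append (l l' : List ((Mode N → ℂ) × (Mode N → ℂ))) :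
    pairExp (l ++ l') = pairExp l + pairExp l' +
      (l.map fun p => (l'.map fun p' => ∑' m, p.2 m * p'.1 m).sum).sum := by
  induction l with
  | nil => simp [pairExp]
  | cons p l ih =>
    simp only [List.cons_append, pairExp, List.map_append, List.sum_append, ih, List.map_cons,
      List.sum_cons]
    ring

theorem pairExp_ofFn {k : ℕ} (g : Fin k → (Mode N → ℂ) × (Mode N → ℂ)) :
    pairExp (List.ofFn g) = ∑ i, ∑ j, if i < j then ∑' m, (g i).2 m * (g j).1 m else 0 := by
  induction k with
  | zero => simp [pairExp]
  | succ k ih =>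
    rw [List.ofFn_succ, pairExp, ih, List.map_ofFn, List.sum_ofFn, Fin.sum_univ_succ]
    congr 1
    · rw [Fin.sum_univ_succ]
      simp
    · refine Finset.sum_congr rfl fun i _ => ?_
      rw [Fin.sum_univ_succ]
      simp

theorem pairExp_flatMap {α : Type*} (L : List α) (g : α → List ((Mode N → ℂ) × (Mode N → ℂ)))
    (h : L.Pairwise fun a b => ∀ p ∈ g a, ∀ p' ∈ g b, ∑' m, p.2 m * p'.1 m = 0) :
    pairExp (L.flatMap g) = (L.map fun a => pairExp (g a)).sum := by
  induction L with
  | nil => simp [pairExp]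
  | cons a L ih =>
    rw [List.pairwise_cons] at h
    rw [List.flatMap_cons, pairExp_append, ih h.2, List.map_cons, List.sum_cons, add_eq_left]
    refine List.sum_eq_zero fun x hx => ?_
    obtain ⟨p, hp, rfl⟩ := List.mem_map.1 hx
    refine List.sum_eq_zero fun y hy => ?_
    obtain ⟨p', hp', rfl⟩ := List.mem_map.1 hy
    obtain ⟨b, hb, hp'⟩ := List.mem_flatMap.1 hp'
    exact h.1 b hb p hp p' hp'

theorem pairExp_eq_zero (l : List ((Mode N → ℂ) × (Mode N → ℂ))) (h : ∀ p ∈ l, p.2 = 0) :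
    pairExp l = 0 := by
  induction l with
  | nil => rfl
  | cons p l ih =>
    rw [pairExp, ih fun p' hp' => h p' (by simp [hp']), h p (by simp)]
    simp

/-! ### The trace of the product of vertex operators -/

variable {N n : ℕ}

/-- The self-contraction of `k` vertex operators inside the trace. -/
def triKernel (q t : ℂ) {k : ℕ} (z : Fin k → ℂ) : ℂ :=
  ∏ i, ∏ j, if i < j then qPoch (z j / z i) q / qPoch (t * (z j / z i)) q
    else qPoch (q * (z j / z i)) q / qPoch (t * (q * (z j / z i))) q

/-- `∏_j (t w / z_j; q)_∞ / (w / z_j; q)_∞`. -/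
def cauchyFactor (q t w : ℂ) {k : ℕ} (z : Fin k → ℂ) : ℂ :=
  ∏ j, qPoch (t * (w / z j)) q / qPoch (w / z j) q

/-- The Gaussian data of the factors of the operator product. -/
def vertexData (t : ℂ) (r : Fin N → ℕ) (x : Fin n → ℂ) (X : VarIdx r → ℂ) :
    List ((Mode N → ℂ) × (Mode N → ℂ)) :=
  ((List.finRange N).flatMap fun a => List.ofFn fun j : Fin (r a) =>
      (creA t a (X ⟨a, j⟩), annB a (X ⟨a, j⟩))) ++
    (List.finRange N).flatMap fun a => (nextVars r x X a).map fun w => (-creA t a w, 0)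

theorem traceFactors_eq {q : ℝ} {t : ℂ} (ht : ∀ n : ℕ+, t ^ (n : ℕ) ≠ 1) (r : Fin N → ℕ)
    (x : Fin n → ℂ) (X : VarIdx r → ℂ) :
    traceFactors q t r x X =
      qL0 q t N :: (vertexData t r x X).map fun p => gauss p.1 p.2 := by
  rw [traceFactors, vertexData, List.map_append, List.map_flatMap, List.map_flatMap]
  congr 2
  · refine List.flatMap_congr fun a _ => ?_
    rw [List.map_ofFn]
    congr 1
    ext1 j
    exact vertexOp_eq ht a _
  · refine List.flatMap_congr fun a _ => ?_
    rw [List.map_map]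
    exact List.map_congr_left fun w _ => opExp_neg_phiMinus t a w

/-- The radial ordering under which the operator product and its trace converge. -/
structure RadiallyOrdered (q : ℝ) (r : Fin N → ℕ) (x : Fin n → ℂ) (X : VarIdx r → ℂ) : Prop where
  lt : ∀ (a : Fin N) (i j : Fin (r a)), i < j → ‖X ⟨a, j⟩ / X ⟨a, i⟩‖ < 1
  lt_inv : ∀ (a : Fin N) (i j : Fin (r a)), ‖q * (X ⟨a, j⟩ / X ⟨a, i⟩)‖ < 1
  next : ∀ (a : Fin N) (w) (_ : w ∈ nextVars r x X a) (j : Fin (r a)), ‖w / X ⟨a, j⟩‖ < 1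

theorem vertexData_pairwise {q : ℝ} {t : ℂ} (ht : ‖t‖ < 1) {r : Fin N → ℕ} {x : Fin n → ℂ}
    {X : VarIdx r → ℂ} (hX : RadiallyOrdered q r x X) :
    (vertexData t r x X).Pairwise fun p p' => Summable fun m => p.2 m * p'.1 m := by
  rw [vertexData, List.pairwise_append, List.pairwise_flatMap, List.pairwise_flatMap]
  refine ⟨⟨fun a _ => ?_, ?_⟩, ⟨fun a _ => ?_, ?_⟩, ?_⟩
  · rw [List.pairwise_ofFn]
    intro i j hij
    exact (hasSum_annB_mul_creA ht a (hX.lt a i j hij)).summable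
  · refine (List.nodup_finRange N).imp fun {a b} hab => ?_
    intro p hp p' hp'
    obtain ⟨i, rfl⟩ := List.mem_ofFn.1 hp
    obtain ⟨j, rfl⟩ := List.mem_ofFn.1 hp'
    simp only [annB_mul_creA_of_ne t _ _ hab]
    exact summable_zero
  · refine List.pairwise_map.2 (List.pairwise_of_forall fun _ _ => ?_)
    simp
  · refine (List.nodup_finRange N).imp fun {a b} hab => ?_
    intro p hp p' _
    obtain ⟨w, -, rfl⟩ := List.mem_map.1 hp
    simp
  · intro p hp p' hp'
    obtain ⟨a, -, hp⟩ := List.mem_flatMap.1 hp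
    obtain ⟨b, -, hp'⟩ := List.mem_flatMap.1 hp'
    obtain ⟨i, rfl⟩ := List.mem_ofFn.1 hp
    obtain ⟨w, hw, rfl⟩ := List.mem_map.1 hp'
    simp only [Pi.neg_apply, mul_neg]
    by_cases hab : a = b
    · subst hab
      exact (hasSum_annB_mul_creA ht a (hX.next a w hw i)).summable.neg
    · simp only [annB_mul_creA_of_ne t _ _ hab, neg_zero]
      exact summable_zero

theorem list_sum_flatMap {α : Type*} (L : List α) (g : α → List ℂ) :
    (L.flatMap g).sum = (L.map fun a => (g a).sum).sum := by
  induction L with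
  | nil => rfl
  | cons a L ih => rw [List.flatMap_cons, List.sum_append, ih, List.map_cons, List.sum_cons]

/-- Different species do not contract, and the trailing exponentials contain no annihilation
operators. What remains are pairs of vertex operators of one species, and vertex operators with the
trailing factors of the same species, with the opposite sign. -/
theorem pairExp_vertexData {q : ℝ} {t : ℂ} (ht : ‖t‖ < 1) {r : Fin N → ℕ} {x : Fin n → ℂ}
    {X : VarIdx r → ℂ} (hX : RadiallyOrdered q r x X) :
    pairExp (vertexData t r x X) = ∑ a, ((∑ i, ∑ j, if i < j then
      -contr t (X ⟨a, j⟩ / X ⟨a, i⟩) else 0) +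
        ∑ j, ((nextVars r x X a).map fun w => contr t (w / X ⟨a, j⟩)).sum) := by
  rw [vertexData, pairExp_append, pairExp_flatMap, pairExp_eq_zero (List.flatMap _ _), add_zero,
    Finset.sum_add_distrib]
  · congr 1
    · rw [← List.ofFn_eq_map, List.sum_ofFn]
      refine Finset.sum_congr rfl fun a _ => ?_
      rw [pairExp_ofFn]
      refine Finset.sum_congr rfl fun i _ => Finset.sum_congr rfl fun j _ => ?_
      split_ifs with hij
      · exact (hasSum_annB_mul_creA ht a (hX.lt a i j hij)).tsum_eq
      · rfl
    · rw [List.map_flatMap, list_sum_flatMap, ← List.ofFn_eq_map, List.sum_ofFn]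
      refine Finset.sum_congr rfl fun a _ => ?_
      rw [List.map_ofFn, List.sum_ofFn]
      refine Finset.sum_congr rfl fun j _ => ?_
      simp only [Function.comp]
      rw [List.map_flatMap, list_sum_flatMap, ← List.ofFn_eq_map, List.sum_ofFn,
        Finset.sum_eq_single a]
      · rw [List.map_map]
        congr 1
        refine List.map_congr_left fun w hw => ?_
        simp only [Function.comp, Pi.neg_apply, mul_neg, tsum_neg]
        rw [(hasSum_annB_mul_creA ht a (hX.next a w hw j)).tsum_eq, neg_neg]
      · intro b _ hb
        rw [List.map_map]
        refine List.sum_eq_zero fun y hy => ?_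
        obtain ⟨w, -, rfl⟩ := List.mem_map.1 hy
        simp only [Function.comp, Pi.neg_apply, mul_neg,
          annB_mul_creA_of_ne t _ _ (Ne.symm hb), neg_zero, tsum_zero]
      · intro h; exact absurd (Finset.mem_univ a) h
  · intro p hp
    obtain ⟨a, -, hp⟩ := List.mem_flatMap.1 hp
    obtain ⟨w, -, rfl⟩ := List.mem_map.1 hp
    rfl
  · refine (List.nodup_finRange N).imp fun {a b} hab => ?_
    intro p hp p' hp'
    obtain ⟨i, rfl⟩ := List.mem_ofFn.1 hp
    obtain ⟨j, rfl⟩ := List.mem_ofFn.1 hp'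
    simp only [annB_mul_creA_of_ne t _ _ hab, tsum_zero]

theorem sum_creA_vertexData (t : ℂ) (r : Fin N → ℕ) (x : Fin n → ℂ) (X : VarIdx r → ℂ)
    (b : Fin N) (k : ℕ+) :
    ((vertexData t r x X).map Prod.fst).sum (b, k) = (1 - t ^ (k : ℕ)) / ((k : ℕ) : ℂ) *
      (∑ j, X ⟨b, j⟩ ^ (k : ℕ) - ((nextVars r x X b).map fun w => w ^ (k : ℕ)).sum) := by
  rw [list_sum_apply, vertexData, List.map_append, List.map_append, List.sum_append, mul_sub,
    sub_eq_add_neg]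
  congr 1
  · rw [List.map_flatMap, List.map_flatMap, list_sum_flatMap, ← List.ofFn_eq_map, List.sum_ofFn,
      Finset.sum_eq_single b]
    · rw [List.map_ofFn, List.map_ofFn, List.sum_ofFn, Finset.mul_sum]
      exact Finset.sum_congr rfl fun j _ => by simp [creA]
    · intro a _ ha
      rw [List.map_ofFn, List.map_ofFn, List.sum_ofFn]
      exact Finset.sum_eq_zero fun j _ => by simp [creA, Ne.symm ha]
    · intro h; exact absurd (Finset.mem_univ b) h
  · rw [List.map_flatMap, List.map_flatMap, list_sum_flatMap, ← List.ofFn_eq_map, List.sum_ofFn,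
      Finset.sum_eq_single b]
    · rw [List.map_map, List.map_map, ← List.sum_map_mul_left, neg_eq_neg_one_mul, ← List.sum_map_mul_left]
      congr 1
      exact List.map_congr_left fun w _ => by simp [creA]
    · intro a _ ha
      rw [List.map_map, List.map_map]
      refine List.sum_eq_zero fun y hy => ?_
      obtain ⟨w, -, rfl⟩ := List.mem_map.1 hy
      simp [creA, Ne.symm ha]
    · intro h; exact absurd (Finset.mem_univ b) h

theorem sum_annB_vertexData (t : ℂ) (r : Fin N → ℕ) (x : Fin n → ℂ) (X : VarIdx r → ℂ)
    (b : Fin N) (k : ℕ+) :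
    ((vertexData t r x X).map Prod.snd).sum (b, k) = -∑ j, ((X ⟨b, j⟩)⁻¹) ^ (k : ℕ) := by
  rw [list_sum_apply, vertexData, List.map_append, List.map_append, List.sum_append,
    ← add_zero (-∑ j, _)]
  congr 1
  · rw [List.map_flatMap, List.map_flatMap, list_sum_flatMap, ← List.ofFn_eq_map, List.sum_ofFn,
      Finset.sum_eq_single b]
    · rw [List.map_ofFn, List.map_ofFn, List.sum_ofFn, ← Finset.sum_neg_distrib]
      exact Finset.sum_congr rfl fun j _ => by simp [annB]
    · intro a _ ha
      rw [List.map_ofFn, List.map_ofFn, List.sum_ofFn]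
      exact Finset.sum_eq_zero fun j _ => by simp [annB, Ne.symm ha]
    · intro h; exact absurd (Finset.mem_univ b) h
  · refine List.sum_eq_zero fun y hy => ?_
    rw [List.map_map] at hy
    obtain ⟨p, hp, rfl⟩ := List.mem_map.1 hy
    obtain ⟨a, -, hp⟩ := List.mem_flatMap.1 hp
    obtain ⟨w, -, rfl⟩ := List.mem_map.1 hp
    rfl

theorem hasSum_list {ι : Type*} {κ : Type*} (L : List κ) (f : κ → ι → ℂ) (s : κ → ℂ)
    (h : ∀ k ∈ L, HasSum (f k) (s k)) : HasSum (fun i => (L.map fun k => f k i).sum)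
      (L.map s).sum := by
  induction L with
  | nil => simp
  | cons k L ih =>
    simp only [List.map_cons, List.sum_cons]
    exact (h k (by simp)).add (ih fun k' hk' => h k' (by simp [hk']))

theorem hasSum_thermal {q : ℝ} (hq0 : 0 < q) (hq1 : q < 1) {t u : ℂ} (ht : ‖t‖ < 1)
    (hu : ‖q * u‖ < 1) :
    HasSum (fun k : ℕ+ => (1 - t ^ (k : ℕ)) / ((k : ℕ) : ℂ) * (q * u) ^ (k : ℕ) /
      (1 - (q : ℂ) ^ (k : ℕ))) (thermal q t u) := by
  obtain ⟨S, hS, -⟩ := hasSum_log_qPoch_div hq0 hq1 ht hu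
  exact hS.summable.hasSum

/-- Inside the trace each annihilation part meets every creation part, in either order and including
its own, so the double sum over `i`, `j` is unrestricted. -/
theorem hasSum_vertexData_thermal {q : ℝ} (hq0 : 0 < q) (hq1 : q < 1) {t : ℂ} (ht : ‖t‖ < 1)
    {r : Fin N → ℕ} {x : Fin n → ℂ} {X : VarIdx r → ℂ} (hX : RadiallyOrdered q r x X) :
    HasSum (fun m : Mode N => ((vertexData t r x X).map Prod.fst).sum m *
      ((vertexData t r x X).map Prod.snd).sum m * (q : ℂ) ^ (m.2 : ℕ) / (1 - (q : ℂ) ^ (m.2 : ℕ)))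
      (∑ a, ((∑ i, ∑ j, -thermal q t (X ⟨a, j⟩ / X ⟨a, i⟩)) +
        ∑ j, ((nextVars r x X a).map fun w => thermal q t (w / X ⟨a, j⟩)).sum)) := by
  refine hasSum_mode _ _ fun b => ?_
  have h1 := hasSum_sum (s := Finset.univ) fun i _ => hasSum_sum (s := Finset.univ) fun j _ =>
    (hasSum_thermal hq0 hq1 ht (hX.lt_inv b i j)).neg
  have h2 := hasSum_sum (s := Finset.univ) fun j _ => hasSum_list (nextVars r x X b) _ _
    fun w hw => hasSum_thermal hq0 hq1 ht (u := w / X ⟨b, j⟩) (by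
      rw [norm_mul, Complex.norm_real, Real.norm_of_nonneg hq0.le]
      nlinarith [hX.next b w hw j, norm_nonneg (w / X ⟨b, j⟩)])
  refine (h1.add h2).of_eq (fun k => ?_) rfl
  simp only []
  rw [sum_creA_vertexData, sum_annB_vertexData]
  have e1 : ∀ i j, -((1 - t ^ (k : ℕ)) / ((k : ℕ) : ℂ) * (q * (X ⟨b, j⟩ / X ⟨b, i⟩)) ^ (k : ℕ) /
      (1 - (q : ℂ) ^ (k : ℕ))) = (-((1 - t ^ (k : ℕ)) / ((k : ℕ) : ℂ) * (q : ℂ) ^ (k : ℕ) /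
      (1 - (q : ℂ) ^ (k : ℕ)))) * (((X ⟨b, i⟩)⁻¹) ^ (k : ℕ) * X ⟨b, j⟩ ^ (k : ℕ)) := by
    intro i j
    rw [div_eq_mul_inv (X ⟨b, j⟩), mul_pow, mul_pow]; ring
  have e2 : ∀ j, ((nextVars r x X b).map fun w => (1 - t ^ (k : ℕ)) / ((k : ℕ) : ℂ) *
      (q * (w / X ⟨b, j⟩)) ^ (k : ℕ) / (1 - (q : ℂ) ^ (k : ℕ))).sum =
      ((1 - t ^ (k : ℕ)) / ((k : ℕ) : ℂ) * (q : ℂ) ^ (k : ℕ) / (1 - (q : ℂ) ^ (k : ℕ))) *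
      (((X ⟨b, j⟩)⁻¹) ^ (k : ℕ) * ((nextVars r x X b).map fun w => w ^ (k : ℕ)).sum) := by
    intro j
    rw [← List.sum_map_mul_left, ← List.sum_map_mul_left]
    congr 1
    refine List.map_congr_left fun w _ => ?_
    rw [div_eq_mul_inv w, mul_pow, mul_pow]; ring
  simp_rw [e1, e2, ← Finset.mul_sum, ← Finset.sum_mul]
  ring

/-- An ordered pair with `i < j` receives both the normal-ordering and the thermal contraction,
every other pair only the thermal one; this accounts for the two cases of `triKernel`. The factors
`1 / (1 - q^n)` of the modes multiply to `(q; q)_∞^{-N}`. -/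
theorem bosonTrace_spec {q : ℝ} (hq0 : 0 < q) (hq1 : q < 1) {t : ℂ} (ht : ‖t‖ < 1)
    {r : Fin N → ℕ} {x : Fin n → ℂ} {X : VarIdx r → ℂ} (hX : RadiallyOrdered q r x X) :
    BosonTraceConverges q t r x X ∧
      bosonTrace q t r x X = ((qPoch q q)⁻¹) ^ N * ∏ a, (triKernel q t (fun j => X ⟨a, j⟩) *
        ((nextVars r x X a).map fun w => cauchyFactor q t w fun j => X ⟨a, j⟩).prod) := by
  have ht1 : ∀ k : ℕ+, t ^ (k : ℕ) ≠ 1 := fun k h => by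
    have := pow_lt_one₀ (norm_nonneg t) ht k.ne_zero
    rw [← norm_pow, h, norm_one] at this
    exact lt_irrefl _ this
  obtain ⟨hc, hv⟩ := opProd_gauss (vertexData t r x X) (vertexData_pairwise ht hX)
  set l := vertexData t r x X with hl
  have hth := hasSum_vertexData_thermal hq0 hq1 ht hX
  -- The trace lemma asks for summability before division by `1 - q^n`; multiplying back costs at
  -- most a factor 2.
  have hsm : Summable fun m : Mode N => (l.map Prod.fst).sum m * (l.map Prod.snd).sum m *
      (q : ℂ) ^ (m.2 : ℕ) := by
    refine Summable.of_norm_bounded (hth.summable.norm.mul_right 2) fun m => ?_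
    rw [norm_div, div_mul_eq_mul_div, le_div_iff₀ (norm_pos_iff.2
      (one_sub_ne_zero_of_norm_lt (norm_qpow_lt_one hq0 hq1 m.2)))]
    gcongr
    refine (norm_sub_le _ _).trans ?_
    rw [norm_one]
    linarith [norm_qpow_lt_one hq0 hq1 m.2]
  obtain ⟨S, hS, hS'⟩ := hasSum_trace_gauss hq0 hq1 _ _ hsm
  have hrow : ∀ i j, HasSum (fun k => qL0 q t N i k * opProd (l.map fun p => gauss p.1 p.2) k j)
      ((q : ℂ) ^ energy i * (Complex.exp (pairExp l) *
        gauss (l.map Prod.fst).sum (l.map Prod.snd).sum i j)) := by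
    intro i j
    rw [← hv]
    have := hasSum_single (f := fun k => qL0 q t N i k *
      opProd (l.map fun p => gauss p.1 p.2) k j) i fun k hk => by
        rw [qL0_apply hq0 ht1, if_neg hk.symm, zero_mul]
    simpa [qL0_apply hq0 ht1] using this
  have hdiag : ∀ i, opProd (traceFactors q t r x X) i i = Complex.exp (pairExp l) *
      ((q : ℂ) ^ energy i * gauss (l.map Prod.fst).sum (l.map Prod.snd).sum i i) := by
    intro i
    rw [traceFactors_eq ht1, opProd, opMul, (hrow i i).tsum_eq]
    ring
  have hT := hS.mul_left (Complex.exp (pairExp l))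
  refine ⟨⟨?_, ?_⟩, ?_⟩
  · rw [traceFactors_eq ht1]
    exact ⟨hc, fun i j => (hrow i j).summable⟩
  · simp_rw [hdiag]
    exact hT.summable
  · rw [bosonTrace, opTrace]
    simp_rw [hdiag]
    rw [hT.tsum_eq]
    have hP := hth.cexp.mul (hasProd_mode (N := N) _ _ (hasProd_qPoch_inv hq0 hq1))
    rw [hS'.unique hP, ← mul_assoc, mul_comm, ← Complex.exp_add, pairExp_vertexData ht hX,
      ← Finset.sum_add_distrib, Complex.exp_sum]
    congr 1
    refine Finset.prod_congr rfl fun a _ => ?_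
    rw [add_add_add_comm, Complex.exp_add]
    congr 1
    · rw [← Finset.sum_add_distrib, Complex.exp_sum, triKernel]
      refine Finset.prod_congr rfl fun i _ => ?_
      rw [← Finset.sum_add_distrib, Complex.exp_sum]
      refine Finset.prod_congr rfl fun j _ => ?_
      split_ifs with hij
      · rw [← neg_add, Complex.exp_neg, exp_contr_add_thermal hq0 hq1 ht (hX.lt a i j hij), inv_div]
      · rw [zero_add, exp_neg_thermal hq0 hq1 ht (hX.lt_inv a i j)]
    · rw [← Finset.sum_add_distrib, Complex.exp_sum]
      have e : ∀ j, Complex.exp (((nextVars r x X a).map fun w => contr t (w / X ⟨a, j⟩)).sum +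
          ((nextVars r x X a).map fun w => thermal q t (w / X ⟨a, j⟩)).sum) =
          ((nextVars r x X a).map fun w =>
            qPoch (t * (w / X ⟨a, j⟩)) q / qPoch (w / X ⟨a, j⟩) q).prod := by
        intro j
        rw [← List.sum_map_add, Complex.exp_list_sum, List.map_map]
        congr 1
        exact List.map_congr_left fun w hw => exp_contr_add_thermal hq0 hq1 ht (hX.next a w hw j)
      simp_rw [e, cauchyFactor]
      generalize nextVars r x X a = L
      induction L with
      | nil => simp
      | cons w L ih => simp only [List.map_cons, List.prod_cons, Finset.prod_mul_distrib, ih]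

/-! ### Power series of `q`-shifted factorials -/

theorem differentiableOn_qPoch {q : ℝ} (hq0 : 0 < q) (hq1 : q < 1) (R : ℝ) :
    DifferentiableOn ℂ (fun u => qPoch u q) (Metric.ball 0 R) := by
  have hu : Summable fun k : ℕ => R * q ^ k := (summable_geometric_of_lt_one hq0.le hq1).mul_left R
  have h := Summable.hasProdLocallyUniformlyOn_one_add (f := fun (k : ℕ) (u : ℂ) => -(u * (q : ℂ) ^ k))
    (K := Metric.ball (0 : ℂ) R) Metric.isOpen_ball hu (Eventually.of_forall fun k u hu => by
      rw [norm_neg, norm_mul, norm_pow, Complex.norm_real, Real.norm_of_nonneg hq0.le]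
      have : ‖u‖ < R := by simpa using hu
      gcongr) (fun k => by fun_prop)
  rw [hasProdLocallyUniformlyOn_iff_tendstoLocallyUniformlyOn] at h
  refine (h.differentiableOn (Eventually.of_forall fun s => ?_) Metric.isOpen_ball).congr
    fun u _ => by simp only [qPoch, sub_eq_add_neg]
  fun_prop

/-- The coefficients are Taylor coefficients at 0, hence the same on every ball; the radius `‖u‖ +
1` is only chosen to contain `u`. -/
theorem qPoch_powerSeries {q : ℝ} (hq0 : 0 < q) (hq1 : q < 1) :
    ∃ c : ℕ → ℂ, ∀ u : ℂ, HasSum (fun k => c k * u ^ k) (qPoch u q) := by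
  refine ⟨fun k => (k.factorial : ℂ)⁻¹ * iteratedDeriv k (fun u => qPoch u q) 0, fun u => ?_⟩
  have h := Complex.hasSum_taylorSeries_on_ball (differentiableOn_qPoch hq0 hq1 (‖u‖ + 1))
    (z := u) (by simp)
  refine h.of_eq (fun k => ?_) rfl
  simp only [smul_eq_mul, sub_zero]
  ring

theorem qPoch_inv_powerSeries {q : ℝ} (hq0 : 0 < q) (hq1 : q < 1) :
    ∃ c : ℕ → ℂ, ∀ u : ℂ, ‖u‖ < 1 → HasSum (fun k => c k * u ^ k) (qPoch u q)⁻¹ := by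
  refine ⟨fun k => (k.factorial : ℂ)⁻¹ * iteratedDeriv k (fun u => (qPoch u q)⁻¹) 0, fun u hu => ?_⟩
  have h := Complex.hasSum_taylorSeries_on_ball (f := fun u => (qPoch u q)⁻¹)
    ((differentiableOn_qPoch hq0 hq1 1).inv fun v hv => qPoch_ne_zero hq0 hq1 (by simpa using hv))
    (z := u) (by simpa using hu)
  refine h.of_eq (fun k => ?_) rfl
  simp only [smul_eq_mul, sub_zero]
  ring

/-! ### Torus integrals of absolutely convergent Laurent series -/

section Torus

variable {ι : Type}

/-- The point of the torus of radii `R` with angles `θ`. -/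
def torusPoint (R : ι → ℝ) (θ : ι → ℝ) (i : ι) : ℂ :=
  (R i : ℂ) * Complex.exp ((θ i : ℂ) * Complex.I)

theorem norm_torusPoint {R : ι → ℝ} (hR : ∀ i, 0 < R i) (θ : ι → ℝ) (i : ι) :
    ‖torusPoint R θ i‖ = R i := by
  rw [torusPoint, norm_mul, Complex.norm_exp_ofReal_mul_I, mul_one, Complex.norm_real,
    Real.norm_of_nonneg (hR i).le]

theorem continuous_torusPoint (R : ι → ℝ) (i : ι) : Continuous fun θ => torusPoint R θ i := by
  unfold torusPoint; fun_prop

variable [Fintype ι]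

theorem torusMean_eq (R : ι → ℝ) (f : (ι → ℂ) → ℂ) :
    torusMean R f = (1 / (2 * (Real.pi : ℂ)) ^ Fintype.card ι) *
      ∫ θ in Set.Icc (0 : ι → ℝ) (fun _ => 2 * Real.pi), f (torusPoint R θ) := rfl

theorem torusMeanExists_iff (R : ι → ℝ) (f : (ι → ℂ) → ℂ) :
    TorusMeanExists R f ↔ IntegrableOn (fun θ => f (torusPoint R θ))
      (Set.Icc (0 : ι → ℝ) (fun _ => 2 * Real.pi)) := Iff.rfl

theorem torusMean_congr {R : ι → ℝ} (hR : ∀ i, 0 < R i) {f g : (ι → ℂ) → ℂ}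
    (h : ∀ x, (∀ i, ‖x i‖ = R i) → f x = g x) : torusMean R f = torusMean R g := by
  rw [torusMean_eq, torusMean_eq]
  simp only [h _ (norm_torusPoint hR _)]

theorem TorusMeanExists.congr {R : ι → ℝ} (hR : ∀ i, 0 < R i) {f g : (ι → ℂ) → ℂ}
    (hf : TorusMeanExists R f) (h : ∀ x, (∀ i, ‖x i‖ = R i) → f x = g x) : TorusMeanExists R g := by
  rw [torusMeanExists_iff] at hf ⊢
  simpa only [h _ (norm_torusPoint hR _)] using hf

theorem torusMean_const_mul (R : ι → ℝ) (c : ℂ) (f : (ι → ℂ) → ℂ) :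
    torusMean R (fun x => c * f x) = c * torusMean R f := by
  rw [torusMean_eq, torusMean_eq, integral_const_mul]; ring

theorem torusMean_sum {κ : Type*} (s : Finset κ) (R : ι → ℝ) (f : κ → (ι → ℂ) → ℂ)
    (h : ∀ k ∈ s, TorusMeanExists R (f k)) :
    torusMean R (fun x => ∑ k ∈ s, f k x) = ∑ k ∈ s, torusMean R (f k) := by
  simp only [torusMean_eq]
  rw [integral_finsetSum s fun k hk => (torusMeanExists_iff R (f k)).1 (h k hk), Finset.mul_sum]

theorem TorusMeanExists.const_mul {R : ι → ℝ} {f : (ι → ℂ) → ℂ} (h : TorusMeanExists R f) (c : ℂ) :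
    TorusMeanExists R fun x => c * f x :=
  Integrable.const_mul h c

theorem torusPoint_zpow_integral (R : ℝ) (n : ℤ) :
    ∫ θ in Set.Icc (0 : ℝ) (2 * Real.pi), ((R : ℂ) * Complex.exp ((θ : ℂ) * Complex.I)) ^ n =
      if n = 0 then 2 * (Real.pi : ℂ) else 0 := by
  rw [integral_Icc_eq_integral_Ioc, ← intervalIntegral.integral_of_le (by positivity)]
  split_ifs with h
  · simp [h]
  · have e : ∀ θ : ℝ, ((R : ℂ) * Complex.exp ((θ : ℂ) * Complex.I)) ^ n =
        (R : ℂ) ^ n * Complex.exp (((n : ℂ) * Complex.I) * θ) := by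
      intro θ
      rw [mul_zpow, ← Complex.exp_int_mul]
      congr 2; ring
    simp_rw [e]
    rw [intervalIntegral.integral_const_mul, integral_exp_mul_complex (by simp [h])]
    have : Complex.exp ((n : ℂ) * Complex.I * ((2 * Real.pi : ℝ) : ℂ)) = 1 := by
      rw [Complex.exp_eq_one_iff]; exact ⟨n, by push_cast; ring⟩
    rw [this]; simp

theorem torusMean_monomial (R : ι → ℝ) (α : ι → ℤ) :
    torusMean R (fun x => ∏ i, x i ^ α i) = if α = 0 then 1 else 0 := by
  rw [torusMean_eq]
  have e : (volume : Measure (ι → ℝ)).restrict (Set.Icc 0 fun _ => 2 * Real.pi) =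
      Measure.pi fun _ : ι => (volume : Measure ℝ).restrict (Set.Icc 0 (2 * Real.pi)) := by
    rw [← Set.pi_univ_Icc, volume_pi, Measure.restrict_pi_pi]; rfl
  rw [e]
  have h2 := integral_fintype_prod_eq_prod (μ := fun _ : ι => (volume : Measure ℝ).restrict
    (Set.Icc 0 (2 * Real.pi))) (fun i (θ : ℝ) =>
      ((R i : ℂ) * Complex.exp ((θ : ℂ) * Complex.I)) ^ α i)
  simp only [torusPoint]
  rw [h2]
  simp_rw [torusPoint_zpow_integral _]
  have hpi : (2 * (Real.pi : ℂ)) ≠ 0 := by simp [Real.pi_ne_zero]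
  split_ifs with h
  · simp [h, hpi]
  · obtain ⟨i, hi⟩ := Function.ne_iff.1 h
    rw [Finset.prod_eq_zero (Finset.mem_univ i) (if_neg hi), mul_zero]

/-- `F` is given, at all points whose radii lie in `Ω`, by one absolutely convergent series of
Laurent monomials. -/
def LaurentOn (Ω : Set (ι → ℝ)) (F : (ι → ℂ) → ℂ) : Prop :=
  ∃ (κ : Type) (_ : Countable κ) (c : κ → ℂ) (α : κ → ι → ℤ), ∀ x : ι → ℂ, (fun i => ‖x i‖) ∈ Ω →
    HasSum (fun k => c k * ∏ i, x i ^ α k i) (F x)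

theorem LaurentOn.mono {Ω Ω' : Set (ι → ℝ)} {F : (ι → ℂ) → ℂ} (h : LaurentOn Ω F) (hs : Ω' ⊆ Ω) :
    LaurentOn Ω' F := by
  obtain ⟨κ, hκ, c, α, H⟩ := h
  exact ⟨κ, hκ, c, α, fun x hx => H x (hs hx)⟩

theorem LaurentOn.congr {Ω : Set (ι → ℝ)} {F G : (ι → ℂ) → ℂ} (h : LaurentOn Ω F)
    (hs : ∀ x, (fun i => ‖x i‖) ∈ Ω → F x = G x) : LaurentOn Ω G := by
  obtain ⟨κ, hκ, c, α, H⟩ := h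
  exact ⟨κ, hκ, c, α, fun x hx => hs x hx ▸ H x hx⟩

theorem laurentOn_monomial (Ω : Set (ι → ℝ)) (c : ℂ) (α : ι → ℤ) :
    LaurentOn Ω fun x => c * ∏ i, x i ^ α i :=
  ⟨Unit, inferInstance, fun _ => c, fun _ => α, fun x _ => by
    simp⟩

theorem laurentOn_const (Ω : Set (ι → ℝ)) (c : ℂ) : LaurentOn Ω fun _ => c := by
  simpa using laurentOn_monomial Ω c 0

theorem HasSum.laurent_mul {κ κ' : Type} {c : κ → ℂ} {c' : κ' → ℂ} {α : κ → ι → ℤ}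
    {α' : κ' → ι → ℤ} {x : ι → ℂ} (hx : ∀ i, x i ≠ 0) {a b : ℂ}
    (h1 : HasSum (fun k => c k * ∏ i, x i ^ α k i) a)
    (h2 : HasSum (fun k => c' k * ∏ i, x i ^ α' k i) b) :
    HasSum (fun p : κ × κ' => c p.1 * c' p.2 * ∏ i, x i ^ (α p.1 i + α' p.2 i)) (a * b) := by
  have h3 : Summable fun p : κ × κ' =>
      (c p.1 * ∏ i, x i ^ α p.1 i) * (c' p.2 * ∏ i, x i ^ α' p.2 i) :=
    summable_mul_of_summable_norm (f := fun k => c k * ∏ i, x i ^ α k i)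
      (g := fun k => c' k * ∏ i, x i ^ α' k i) h1.summable.norm h2.summable.norm
  have h4 := HasSum.mul h1 h2 h3
  have e : ∀ p : κ × κ', (c p.1 * ∏ i, x i ^ α p.1 i) * (c' p.2 * ∏ i, x i ^ α' p.2 i) =
      c p.1 * c' p.2 * ∏ i, x i ^ (α p.1 i + α' p.2 i) := by
    intro p
    have e2 : ∏ i, x i ^ (α p.1 i + α' p.2 i) = (∏ i, x i ^ α p.1 i) * ∏ i, x i ^ α' p.2 i := by
      rw [← Finset.prod_mul_distrib]
      exact Finset.prod_congr rfl fun i _ => zpow_add₀ (hx i) _ _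
    rw [e2]; ring
  simp_rw [e] at h4
  exact h4

theorem LaurentOn.mul {Ω : Set (ι → ℝ)} (hΩ : ∀ R ∈ Ω, ∀ i, 0 < R i) {F G : (ι → ℂ) → ℂ}
    (hF : LaurentOn Ω F) (hG : LaurentOn Ω G) : LaurentOn Ω fun x => F x * G x := by
  obtain ⟨κ, hκ, c, α, H⟩ := hF
  obtain ⟨κ', hκ', c', α', H'⟩ := hG
  exact ⟨κ × κ', inferInstance, fun p => c p.1 * c' p.2, fun p i => α p.1 i + α' p.2 i,
    fun x hx => HasSum.laurent_mul (fun i => norm_pos_iff.1 (hΩ _ hx i)) (H x hx) (H' x hx)⟩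

theorem LaurentOn.prod {Ω : Set (ι → ℝ)} (hΩ : ∀ R ∈ Ω, ∀ i, 0 < R i) {κ : Type*} (s : Finset κ)
    {F : κ → (ι → ℂ) → ℂ} (hF : ∀ k ∈ s, LaurentOn Ω (F k)) :
    LaurentOn Ω fun x => ∏ k ∈ s, F k x := by
  classical
  induction s using Finset.induction_on with
  | empty => simpa using laurentOn_const Ω 1
  | insert k s hk ih =>
    simp_rw [Finset.prod_insert hk]
    exact (hF k (by simp)).mul hΩ (ih fun k' hk' => hF k' (by simp [hk']))

theorem LaurentOn.add {Ω : Set (ι → ℝ)} {F G : (ι → ℂ) → ℂ}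
    (hF : LaurentOn Ω F) (hG : LaurentOn Ω G) : LaurentOn Ω fun x => F x + G x := by
  obtain ⟨κ, hκ, c, α, H⟩ := hF
  obtain ⟨κ', hκ', c', α', H'⟩ := hG
  refine ⟨κ ⊕ κ', inferInstance, Sum.elim c c', Sum.elim α α', fun x hx => ?_⟩
  exact HasSum.sum (f := fun k => Sum.elim c c' k * ∏ i, x i ^ Sum.elim α α' k i) (H x hx) (H' x hx)

theorem LaurentOn.sum {Ω : Set (ι → ℝ)} {κ : Type*} (s : Finset κ)
    {F : κ → (ι → ℂ) → ℂ} (hF : ∀ k ∈ s, LaurentOn Ω (F k)) :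
    LaurentOn Ω fun x => ∑ k ∈ s, F k x := by
  classical
  induction s using Finset.induction_on with
  | empty => simpa using laurentOn_const Ω 0
  | insert k s hk ih =>
    simp_rw [Finset.sum_insert hk]
    exact (hF k (by simp)).add (ih fun k' hk' => hF k' (by simp [hk']))

theorem laurentOn_powerSeries {Ω : Set (ι → ℝ)} (f : ℂ → ℂ) (c : ℕ → ℂ) (a : ℂ) (α : ι → ℤ)
    (h : ∀ x : ι → ℂ, (fun i => ‖x i‖) ∈ Ω →
      HasSum (fun k => c k * (a * ∏ i, x i ^ α i) ^ k) (f (a * ∏ i, x i ^ α i))) :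
    LaurentOn Ω fun x => f (a * ∏ i, x i ^ α i) := by
  refine ⟨ℕ, inferInstance, fun k => c k * a ^ k, fun k i => α i * k, fun x hx => ?_⟩
  refine (h x hx).of_eq (fun k => ?_) rfl
  rw [mul_pow, ← Finset.prod_pow, ← mul_assoc]
  congr 1
  exact Finset.prod_congr rfl fun i _ => by rw [zpow_mul, zpow_natCast]

theorem prod_zpow_single_sub [DecidableEq ι] {x : ι → ℂ} (i j : ι) (hj : x i ≠ 0 ∨ i ≠ j) :
    ∏ l, x l ^ ((Pi.single i 1 - Pi.single j 1 : ι → ℤ) l) = x i / x j := by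
  by_cases hij : i = j
  · subst hij
    simp only [sub_self, Pi.zero_apply, zpow_zero, Finset.prod_const_one]
    rw [div_self]
    exact hj.resolve_right fun h => h rfl
  · have e : ∀ l, x l ^ ((Pi.single i 1 - Pi.single j 1 : ι → ℤ) l) =
        (if l = i then x i else 1) * (if l = j then (x j)⁻¹ else 1) := by
      intro l
      by_cases h1 : l = i
      · subst h1; simp [hij]
      · by_cases h2 : l = j
        · subst h2; simp [h1]
        · simp [h1, h2]
    rw [Finset.prod_congr rfl fun l _ => e l, Finset.prod_mul_distrib]
    simp [div_eq_mul_inv]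

theorem laurentOn_qPoch_ratio {q : ℝ} (hq0 : 0 < q) (hq1 : q < 1) {Ω : Set (ι → ℝ)}
    (hΩ : ∀ R ∈ Ω, ∀ i, 0 < R i) (a : ℂ) (i j : ι) :
    LaurentOn Ω fun x => qPoch (a * (x i / x j)) q := by
  classical
  obtain ⟨c, hc⟩ := qPoch_powerSeries hq0 hq1
  refine (laurentOn_powerSeries (fun u => qPoch u q) c a (Pi.single i 1 - Pi.single j 1)
    fun x _ => hc _).congr fun x hx => ?_
  rw [prod_zpow_single_sub i j (Or.inl (norm_pos_iff.1 (hΩ _ hx i)))]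

theorem laurentOn_qPoch_ratio_inv {q : ℝ} (hq0 : 0 < q) (hq1 : q < 1) {Ω : Set (ι → ℝ)}
    (hΩ : ∀ R ∈ Ω, ∀ i, 0 < R i) (a : ℂ) (i j : ι) (h : ∀ R ∈ Ω, ‖a‖ * (R i / R j) < 1) :
    LaurentOn Ω fun x => (qPoch (a * (x i / x j)) q)⁻¹ := by
  classical
  obtain ⟨c, hc⟩ := qPoch_inv_powerSeries hq0 hq1
  refine (laurentOn_powerSeries (fun u => (qPoch u q)⁻¹) c a (Pi.single i 1 - Pi.single j 1)
    fun x hx => hc _ ?_).congr fun x hx => ?_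
  · rw [prod_zpow_single_sub i j (Or.inl (norm_pos_iff.1 (hΩ _ hx i))), norm_mul, norm_div]
    exact h _ hx
  · rw [prod_zpow_single_sub i j (Or.inl (norm_pos_iff.1 (hΩ _ hx i)))]

theorem laurentOn_coord_zpow (Ω : Set (ι → ℝ)) (i : ι) (k : ℤ) : LaurentOn Ω fun x => x i ^ k := by
  classical
  refine (laurentOn_monomial Ω 1 (Pi.single i k)).congr fun x _ => ?_
  rw [one_mul, Finset.prod_eq_single i]
  · simp
  · intro j _ hj; simp [hj]
  · intro h; exact absurd (Finset.mem_univ i) h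

theorem laurentOn_coord_pow (Ω : Set (ι → ℝ)) (i : ι) (k : ℕ) : LaurentOn Ω fun x => x i ^ k := by
  simpa using laurentOn_coord_zpow Ω i k

theorem laurentOn_coord_inv (Ω : Set (ι → ℝ)) (i : ι) : LaurentOn Ω fun x => (x i)⁻¹ := by
  simpa using laurentOn_coord_zpow Ω i (-1)

theorem laurentOn_coord (Ω : Set (ι → ℝ)) (i : ι) : LaurentOn Ω fun x => x i := by
  simpa using laurentOn_coord_zpow Ω i 1

theorem LaurentOn.pow {Ω : Set (ι → ℝ)} (hΩ : ∀ R ∈ Ω, ∀ i, 0 < R i) {F : (ι → ℂ) → ℂ}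
    (hF : LaurentOn Ω F) (k : ℕ) : LaurentOn Ω fun x => F x ^ k := by
  simpa using LaurentOn.prod hΩ (Finset.range k) (F := fun _ => F) fun _ _ => hF

theorem laurentOn_eval {Ω : Set (ι → ℝ)} (hΩ : ∀ R ∈ Ω, ∀ i, 0 < R i) {σ : Type*} [Fintype σ]
    (f : MvPolynomial σ ℂ) (φ : (ι → ℂ) → σ → ℂ) (hφ : ∀ s, LaurentOn Ω fun x => φ x s) :
    LaurentOn Ω fun x => MvPolynomial.eval (φ x) f := by
  simp_rw [MvPolynomial.eval_eq']
  exact LaurentOn.sum _ fun d _ => (laurentOn_const Ω _).mul hΩ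
    (LaurentOn.prod hΩ _ fun s _ => (hφ s).pow hΩ _)

/-- On a torus each Laurent monomial has constant modulus, so convergence at one point gives a
uniform majorant: the sum is continuous and can be integrated term by term, and only exponents equal
to zero survive. -/
theorem torusMean_of_hasSum {κ : Type} [Countable κ] {Ω : Set (ι → ℝ)} {F : (ι → ℂ) → ℂ} {c : κ → ℂ}
    {α : κ → ι → ℤ}
    (H : ∀ x : ι → ℂ, (fun i => ‖x i‖) ∈ Ω → HasSum (fun k => c k * ∏ i, x i ^ α k i) (F x))
    {R : ι → ℝ} (hR : R ∈ Ω) (hpos : ∀ i, 0 < R i) :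
    TorusMeanExists R F ∧ torusMean R F = ∑' k, if α k = 0 then c k else 0 := by
  have hmem : ∀ θ, (fun i => ‖torusPoint R θ i‖) ∈ Ω := fun θ => by
    simp_rw [norm_torusPoint hpos]; exact hR
  have hn : ∀ k θ, ‖c k * ∏ i, torusPoint R θ i ^ α k i‖ = ‖c k‖ * ∏ i, R i ^ α k i := by
    intro k θ
    rw [norm_mul, norm_prod]
    simp_rw [norm_zpow, norm_torusPoint hpos]
  have hS : Summable fun k => ‖c k‖ * ∏ i, R i ^ α k i := by
    have := (H (torusPoint R 0) (hmem 0)).summable.norm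
    simpa only [hn] using this
  have hcont : ∀ k, Continuous fun θ => c k * ∏ i, torusPoint R θ i ^ α k i := by
    intro k
    refine continuous_const.mul (continuous_finsetProd _ fun i _ => ?_)
    refine (continuous_torusPoint R i).zpow₀ _ fun θ => Or.inl ?_
    rw [← norm_pos_iff, norm_torusPoint hpos]; exact hpos i
  have hFc : Continuous fun θ => F (torusPoint R θ) := by
    have : (fun θ => F (torusPoint R θ)) = fun θ => ∑' k, c k * ∏ i, torusPoint R θ i ^ α k i :=
      funext fun θ => ((H _ (hmem θ)).tsum_eq).symm
    rw [this]
    exact continuous_tsum hcont hS fun k θ => (hn k θ).le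
  refine ⟨hFc.continuousOn.integrableOn_compact isCompact_Icc, ?_⟩
  have hI := hasSum_integral_of_summable_integral_norm
    (μ := volume.restrict (Set.Icc (0 : ι → ℝ) (fun _ => 2 * Real.pi)))
    (F := fun k θ => c k * ∏ i, torusPoint R θ i ^ α k i)
    (fun k => (hcont k).continuousOn.integrableOn_compact isCompact_Icc) (by
      simp_rw [hn]
      simp only [integral_const, smul_eq_mul]
      exact hS.mul_left _)
  have h2 := (hI.mul_left (1 / (2 * (Real.pi : ℂ)) ^ Fintype.card ι))
  rw [torusMean_eq]
  simp_rw [fun θ => (H _ (hmem θ)).tsum_eq] at h2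
  rw [← h2.tsum_eq]
  refine tsum_congr fun k => ?_
  have := torusMean_const_mul R (c k) (fun x => ∏ i, x i ^ α k i)
  rw [torusMean_monomial, torusMean_eq] at this
  rw [this]
  split_ifs <;> simp

/-- The sum of the constant terms does not involve the radii. This is what moves contours
throughout: a single Laurent series valid on two tori gives equal means, and nothing is required of
the radii in between. -/
theorem LaurentOn.torusMean {Ω : Set (ι → ℝ)} {F : (ι → ℂ) → ℂ} (hF : LaurentOn Ω F) :
    ∃ M : ℂ, ∀ R ∈ Ω, (∀ i, 0 < R i) → TorusMeanExists R F ∧ torusMean R F = M := by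
  obtain ⟨κ, _, c, α, H⟩ := hF
  exact ⟨_, fun R hR hpos => torusMean_of_hasSum H hR hpos⟩

theorem LaurentOn.exists_mean {Ω : Set (ι → ℝ)} {F : (ι → ℂ) → ℂ} (hF : LaurentOn Ω F)
    {R : ι → ℝ} (hR : R ∈ Ω) (hpos : ∀ i, 0 < R i) : TorusMeanExists R F :=
  let ⟨_, h⟩ := hF.torusMean; (h R hR hpos).1

theorem LaurentOn.mean_eq {Ω : Set (ι → ℝ)} {F : (ι → ℂ) → ℂ} (hF : LaurentOn Ω F)
    {R R' : ι → ℝ} (hR : R ∈ Ω) (hR' : R' ∈ Ω) (hpos : ∀ i, 0 < R i) (hpos' : ∀ i, 0 < R' i) :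
    MacdonaldBoson.torusMean R F = MacdonaldBoson.torusMean R' F :=
  let ⟨_, h⟩ := hF.torusMean; (h R hR hpos).2.trans (h R' hR' hpos').2.symm

end Torus

open MvPolynomial (rename aeval eval coeff monomial)

/-! ### The Vandermonde product -/

/-- `∏_{i < j} (x_i - x_j)`. -/
def vd {R : Type*} [CommRing R] {n : ℕ} (x : Fin n → R) : R :=
  ∏ i, ∏ j ∈ Finset.Ioi i, (x i - x j)

theorem vd_eq_det {R : Type*} [CommRing R] {n : ℕ} (x : Fin n → R) :
    vd x = (Matrix.vandermonde fun i => -x i).det := by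
  rw [Matrix.det_vandermonde, vd]
  exact Finset.prod_congr rfl fun i _ => Finset.prod_congr rfl fun j _ => by ring

theorem vd_comp_perm {R : Type*} [CommRing R] {n : ℕ} (x : Fin n → R) (σ : Equiv.Perm (Fin n)) :
    vd (fun i => x (σ i)) = ((Equiv.Perm.sign σ : ℤ) : R) * vd x := by
  rw [vd_eq_det, vd_eq_det, ← Matrix.det_permute]
  rfl

theorem map_vd {R S : Type*} [CommRing R] [CommRing S] (φ : R →+* S) {n : ℕ} (x : Fin n → R) :
    φ (vd x) = vd fun i => φ (x i) := by
  simp [vd]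

theorem vd_ne_zero_iff {R : Type*} [CommRing R] [IsDomain R] {n : ℕ} {x : Fin n → R} :
    vd x ≠ 0 ↔ Function.Injective x := by
  rw [vd_eq_det, Matrix.det_vandermonde_ne_zero_iff]
  exact ⟨fun h i j e => h (by simp [e]), fun h i j e => h (neg_injective e)⟩

/-- The Vandermonde polynomial. -/
def vdPoly (n : ℕ) : MvPolynomial (Fin n) ℂ := vd MvPolynomial.X

theorem vdPoly_ne_zero (n : ℕ) : vdPoly n ≠ 0 := vd_ne_zero_iff.2 (MvPolynomial.X_injective)

theorem eval_vdPoly {n : ℕ} (x : Fin n → ℂ) : eval x (vdPoly n) = vd x := by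
  rw [vdPoly, map_vd]; simp

/-! ### Rescaling of variables -/

/-- The substitution `x_i ↦ c_i x_i`. -/
def scaleVars {n : ℕ} (c : Fin n → ℂ) : MvPolynomial (Fin n) ℂ →ₐ[ℂ] MvPolynomial (Fin n) ℂ :=
  aeval fun i => MvPolynomial.C (c i) * MvPolynomial.X i

theorem eval_scaleVars {n : ℕ} (c x : Fin n → ℂ) (f : MvPolynomial (Fin n) ℂ) :
    eval x (scaleVars c f) = eval (fun i => c i * x i) f := by
  have : (MvPolynomial.aeval x : MvPolynomial (Fin n) ℂ →ₐ[ℂ] ℂ).comp (scaleVars c) =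
      MvPolynomial.aeval fun i => c i * x i := by
    ext i
    simp [scaleVars]
  simpa using DFunLike.congr_fun this f

theorem scaleVars_monomial {n : ℕ} (c : Fin n → ℂ) (α : Fin n →₀ ℕ) (a : ℂ) :
    scaleVars c (monomial α a) = monomial α (a * ∏ i, c i ^ α i) := by
  rw [scaleVars, MvPolynomial.aeval_monomial, MvPolynomial.monomial_eq]
  simp only [mul_pow, Finsupp.prod_mul, MvPolynomial.algebraMap_eq, map_mul, map_prod, map_pow]
  rw [Finsupp.prod_fintype (h := fun i => by simp), mul_assoc]

theorem coeff_scaleVars {n : ℕ} (c : Fin n → ℂ) (α : Fin n →₀ ℕ) (f : MvPolynomial (Fin n) ℂ) :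
    coeff α (scaleVars c f) = (∏ i, c i ^ α i) * coeff α f := by
  induction f using MvPolynomial.induction_on' with
  | monomial β a =>
    rw [scaleVars_monomial, MvPolynomial.coeff_monomial, MvPolynomial.coeff_monomial]
    split_ifs with h
    · rw [h, mul_comm]
    · rw [mul_zero]
  | add p r hp hr => rw [map_add, MvPolynomial.coeff_add, hp, hr, MvPolynomial.coeff_add, mul_add]

theorem rename_scaleVars {n : ℕ} (c : Fin n → ℂ) (σ : Equiv.Perm (Fin n))
    (f : MvPolynomial (Fin n) ℂ) :
    rename σ (scaleVars c f) = scaleVars (fun i => c (σ.symm i)) (rename σ f) := by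
  have : ((rename σ : MvPolynomial (Fin n) ℂ →ₐ[ℂ] _).comp (scaleVars c)) =
      (scaleVars fun i => c (σ.symm i)).comp (rename σ) := by
    ext i
    simp [scaleVars]
  exact DFunLike.congr_fun this f

/-! ### Macdonald's generating operator, multiplied by the Vandermonde product -/

/-- The vector with entry `a` on `I` and `1` off `I`. -/
def onSet {n : ℕ} (I : Finset (Fin n)) (a : ℂ) (i : Fin n) : ℂ := if i ∈ I then a else 1

/-- `∑_I X^{|I|} V(t^I x) f(q^I x)`, where `V` is the Vandermonde product. -/
def macN (q t X : ℂ) {n : ℕ} (f : MvPolynomial (Fin n) ℂ) : MvPolynomial (Fin n) ℂ :=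
  ∑ I : Finset (Fin n),
    MvPolynomial.C (X ^ I.card) * (scaleVars (onSet I t) (vdPoly n) * scaleVars (onSet I q) f)

theorem macN_add (q t X : ℂ) {n : ℕ} (f g : MvPolynomial (Fin n) ℂ) :
    macN q t X (f + g) = macN q t X f + macN q t X g := by
  simp only [macN, map_add, mul_add, Finset.sum_add_distrib]

theorem macN_smul (q t X a : ℂ) {n : ℕ} (f : MvPolynomial (Fin n) ℂ) :
    macN q t X (a • f) = a • macN q t X f := by
  simp only [macN, map_smul, Finset.smul_sum, mul_smul_comm]

theorem macN_sum (q t X : ℂ) {n : ℕ} {κ : Type*} (s : Finset κ) (f : κ → MvPolynomial (Fin n) ℂ) :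
    macN q t X (∑ k ∈ s, f k) = ∑ k ∈ s, macN q t X (f k) := by
  simp only [macN, map_sum, Finset.mul_sum]
  rw [Finset.sum_comm]

/-- A permutation of the variables permutes the subsets `I`, and the only sign comes from the
Vandermonde factor. -/
theorem rename_macN (q t X : ℂ) {n : ℕ} {f : MvPolynomial (Fin n) ℂ} (hf : f.IsSymmetric)
    (σ : Equiv.Perm (Fin n)) :
    rename σ (macN q t X f) = ((Equiv.Perm.sign σ : ℤ) : MvPolynomial (Fin n) ℂ) * macN q t X f := by
  have hV : rename σ (vdPoly n) = ((Equiv.Perm.sign σ : ℤ) : MvPolynomial (Fin n) ℂ) * vdPoly n := by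
    rw [vdPoly, ← vd_comp_perm]
    have := map_vd (rename σ : MvPolynomial (Fin n) ℂ →ₐ[ℂ] MvPolynomial (Fin n) ℂ).toRingHom
      (MvPolynomial.X : Fin n → MvPolynomial (Fin n) ℂ)
    refine this.trans ?_
    congr 1; funext i; simp
  have hs : ∀ (I : Finset (Fin n)) (a : ℂ),
      (fun i => onSet I a (σ.symm i)) = onSet (I.map σ.toEmbedding) a := by
    intro I a; funext i
    simp only [onSet, Finset.mem_map_equiv]
  rw [macN, map_sum, Finset.mul_sum]
  refine Fintype.sum_equiv σ.finsetCongr _ _ fun I => ?_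
  rw [map_mul, map_mul, rename_scaleVars, rename_scaleVars, hV, hf σ, hs, hs, MvPolynomial.rename_C,
    map_mul, map_intCast, Equiv.finsetCongr_apply, Finset.card_map]
  ring

/-- Modulo the ideal generated by `X_i - X_j`, substituting `X_i` for `X_j` is the identity. -/
theorem X_sub_X_dvd_of_eval_eq {n : ℕ} (i j : Fin n) (p : MvPolynomial (Fin n) ℂ)
    (h : aeval (fun k => if k = j then (MvPolynomial.X i : MvPolynomial (Fin n) ℂ)
      else MvPolynomial.X k) p = 0) :
    (MvPolynomial.X i - MvPolynomial.X j : MvPolynomial (Fin n) ℂ) ∣ p := by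
  rw [← Ideal.mem_span_singleton, ← Ideal.Quotient.eq_zero_iff_mem]
  set J := Ideal.span {(MvPolynomial.X i - MvPolynomial.X j : MvPolynomial (Fin n) ℂ)}
  have e : (Ideal.Quotient.mkₐ ℂ J).comp (aeval (fun k => if k = j then
      (MvPolynomial.X i : MvPolynomial (Fin n) ℂ) else MvPolynomial.X k)) =
      Ideal.Quotient.mkₐ ℂ J := by
    ext k
    simp only [AlgHom.comp_apply, MvPolynomial.aeval_X]
    split_ifs with hk
    · subst hk
      exact (Ideal.Quotient.eq).2 (Ideal.mem_span_singleton_self _)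
    · rfl
  have := DFunLike.congr_fun e p
  rw [AlgHom.comp_apply, h, map_zero] at this
  exact this.symm

/-- After the substitution `X_j = X_i` the swap is invisible, so `p` and `-p` have the same image,
and 2 is not a zero divisor. -/
theorem X_sub_X_dvd_of_antisymm {n : ℕ} {i j : Fin n} (hij : i ≠ j) (p : MvPolynomial (Fin n) ℂ)
    (h : rename (Equiv.swap i j) p = -p) :
    (MvPolynomial.X i - MvPolynomial.X j : MvPolynomial (Fin n) ℂ) ∣ p := by
  refine X_sub_X_dvd_of_eval_eq i j p ?_
  set φ : MvPolynomial (Fin n) ℂ →ₐ[ℂ] MvPolynomial (Fin n) ℂ :=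
    aeval (fun k => if k = j then (MvPolynomial.X i : MvPolynomial (Fin n) ℂ) else MvPolynomial.X k)
  have e : φ.comp (rename (Equiv.swap i j)) = φ := by
    ext k
    simp only [AlgHom.comp_apply, MvPolynomial.rename_X, φ, MvPolynomial.aeval_X]
    congr 1
    by_cases h1 : k = i
    · subst h1; simp [hij]
    · by_cases h2 : k = j
      · subst h2; simp [hij]
      · rw [Equiv.swap_apply_of_ne_of_ne h1 h2]
  have := DFunLike.congr_fun e p
  rw [AlgHom.comp_apply, h, map_neg] at this
  have h2 : (2 : MvPolynomial (Fin n) ℂ) * φ p = 0 := by linear_combination -this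
  exact (mul_eq_zero.1 h2).resolve_left two_ne_zero

theorem irreducible_X_sub_X {n : ℕ} {i j : Fin n} (hij : i ≠ j) :
    Irreducible (MvPolynomial.X i - MvPolynomial.X j : MvPolynomial (Fin n) ℂ) := by
  have hne : Finsupp.single i 1 ≠ (Finsupp.single j 1 : Fin n →₀ ℕ) := fun h =>
    hij (Finsupp.single_left_injective one_ne_zero h)
  have hc : coeff (Finsupp.single i 1)
      (MvPolynomial.X i - MvPolynomial.X j : MvPolynomial (Fin n) ℂ) = 1 := by
    rw [MvPolynomial.coeff_sub, MvPolynomial.coeff_X, MvPolynomial.coeff_X, if_neg hne.symm]; simp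
  refine MvPolynomial.irreducible_of_totalDegree_eq_one ?_ fun x hx => ?_
  · have hh : (MvPolynomial.X i - MvPolynomial.X j : MvPolynomial (Fin n) ℂ).IsHomogeneous 1 :=
      (MvPolynomial.isHomogeneous_X _ _).sub (MvPolynomial.isHomogeneous_X _ _)
    refine hh.totalDegree fun h0 => ?_
    rw [h0] at hc; simp at hc
  · have := hx (Finsupp.single i 1)
    rw [hc] at this
    exact isUnit_of_dvd_one this

/-- Each difference `X_i - X_j` divides `p`, and the differences for distinct pairs are relatively
prime, being irreducible with none dividing another. -/
theorem vdPoly_dvd_of_antisymm {n : ℕ} (p : MvPolynomial (Fin n) ℂ)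
    (h : ∀ i j : Fin n, i ≠ j → rename (Equiv.swap i j) p = -p) : vdPoly n ∣ p := by
  have : vdPoly n = ∏ s ∈ (Finset.univ : Finset (Fin n)).sigma fun i => Finset.Ioi i,
      (MvPolynomial.X s.1 - MvPolynomial.X s.2 : MvPolynomial (Fin n) ℂ) := by
    rw [Finset.prod_sigma]; rfl
  rw [this]
  refine Finset.prod_dvd_of_isRelPrime ?_ ?_
  · rintro ⟨i, j⟩ hi ⟨k, l⟩ hk hne
    simp only [Finset.coe_sigma, Set.mem_sigma_iff, Finset.coe_Ioi, Set.mem_Ioi] at hi hk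
    have hij : i < j := hi.2
    have hkl : k < l := hk.2
    refine (Irreducible.isRelPrime_iff_not_dvd (irreducible_X_sub_X hij.ne)).2 ?_
    rintro ⟨g, hg⟩
    -- At the point `x_m = m`, altered only by `x_j = i`, the difference `X_i - X_j` vanishes, while
    -- `X_k - X_l` with `k < l` vanishes only for the same pair.
    have h1 := congrArg (eval fun m : Fin n => if m = j then ((i : ℕ) : ℂ) else ((m : ℕ) : ℂ)) hg
    simp only [map_sub, MvPolynomial.eval_X, map_mul, if_neg hij.ne, if_true, sub_self,
      zero_mul] at h1
    rw [sub_eq_zero] at h1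
    have h2 : (if k = j then i else k) = (if l = j then i else l) := by
      apply Fin.ext
      split_ifs at h1 ⊢ <;> exact_mod_cast h1
    apply hne
    split_ifs at h2 with a b b
    · exact absurd (a.trans b.symm) hkl.ne
    · subst a; subst h2; exact absurd (hkl.trans hij) (lt_irrefl _)
    · subst b; subst h2; rfl
    · exact absurd h2 hkl.ne
  · rintro ⟨i, j⟩ hi
    have hij : i < j := by simpa using hi
    exact X_sub_X_dvd_of_antisymm hij.ne p (h i j hij.ne)

/-- The quotient `g` is `D_X f`. Working with the multiple by the Vandermonde product keeps the
operator inside polynomials. -/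
theorem exists_macN_eq (q t X : ℂ) {n : ℕ} {f : MvPolynomial (Fin n) ℂ} (hf : f.IsSymmetric) :
    ∃ g : MvPolynomial (Fin n) ℂ, g.IsSymmetric ∧ macN q t X f = vdPoly n * g := by
  obtain ⟨g, hg⟩ := vdPoly_dvd_of_antisymm (macN q t X f) fun i j hij => by
    rw [rename_macN q t X hf, Equiv.Perm.sign_swap hij]; simp
  refine ⟨g, fun σ => ?_, hg⟩
  have h1 := rename_macN q t X hf σ
  have hV : rename σ (vdPoly n) = ((Equiv.Perm.sign σ : ℤ) : MvPolynomial (Fin n) ℂ) * vdPoly n := by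
    rw [vdPoly, ← vd_comp_perm]
    have := map_vd (rename σ : MvPolynomial (Fin n) ℂ →ₐ[ℂ] MvPolynomial (Fin n) ℂ).toRingHom
      (MvPolynomial.X : Fin n → MvPolynomial (Fin n) ℂ)
    refine this.trans ?_
    congr 1; funext i; simp
  rw [hg, map_mul, hV, mul_assoc] at h1
  have hs : ((Equiv.Perm.sign σ : ℤ) : MvPolynomial (Fin n) ℂ) ≠ 0 := by
    rcases Int.units_eq_one_or (Equiv.Perm.sign σ) with h | h <;> simp [h]
  exact mul_left_cancel₀ (vdPoly_ne_zero n) (mul_left_cancel₀ hs h1)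

/-! ### Degrees with respect to weights -/

/-- The substitution `x_i ↦ T^{w_i} x_i`. -/
def weightHom {n : ℕ} (w : Fin n → ℕ) :
    MvPolynomial (Fin n) ℂ →ₐ[ℂ] Polynomial (MvPolynomial (Fin n) ℂ) :=
  aeval fun i => Polynomial.C (MvPolynomial.X i) * Polynomial.X ^ w i

theorem weightHom_monomial {n : ℕ} (w : Fin n → ℕ) (α : Fin n →₀ ℕ) (a : ℂ) :
    weightHom w (monomial α a) =
      Polynomial.C (monomial α a) * Polynomial.X ^ (∑ i, w i * α i) := by
  rw [weightHom, MvPolynomial.aeval_monomial, MvPolynomial.monomial_eq]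
  simp only [mul_pow, Finsupp.prod_mul, map_mul, ← pow_mul]
  rw [Finsupp.prod_fintype (h := fun i => by simp), Finsupp.prod_fintype (h := fun i => by simp),
    Finsupp.prod_fintype (h := fun i => by simp), Finset.prod_pow_eq_pow_sum, ← mul_assoc]
  simp only [map_prod, map_pow]
  rfl

theorem coeff_coeff_weightHom {n : ℕ} (w : Fin n → ℕ) (f : MvPolynomial (Fin n) ℂ) (k : ℕ)
    (α : Fin n →₀ ℕ) :
    coeff α ((weightHom w f).coeff k) = if ∑ i, w i * α i = k then coeff α f else 0 := by
  induction f using MvPolynomial.induction_on' with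
  | monomial β a =>
    rw [weightHom_monomial, Polynomial.coeff_C_mul, Polynomial.coeff_X_pow]
    by_cases h : k = ∑ i, w i * β i
    · rw [if_pos h, mul_one, MvPolynomial.coeff_monomial]
      by_cases h2 : β = α
      · subst h2; simp [h]
      · simp [h2]
    · rw [if_neg h, mul_zero, MvPolynomial.coeff_zero, MvPolynomial.coeff_monomial]
      by_cases h2 : β = α
      · subst h2; rw [if_neg fun h' => h h'.symm]
      · simp [h2]
  | add p r hp hr =>
    rw [map_add, Polynomial.coeff_add, MvPolynomial.coeff_add, hp, hr, MvPolynomial.coeff_add]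
    split_ifs <;> simp

/-- If `V g` is a combination of products of rescalings of `V` and `f`, then the exponents of `g`
have at most the weight of those of `f`. -/
theorem weight_le_of_macN {q t X : ℂ} {n : ℕ} {f g : MvPolynomial (Fin n) ℂ}
    (h : macN q t X f = vdPoly n * g) (w : Fin n → ℕ) {B : ℕ}
    (hB : ∀ α ∈ f.support, ∑ i, w i * α i ≤ B) {α : Fin n →₀ ℕ} (hα : α ∈ g.support) :
    ∑ i, w i * α i ≤ B := by
  -- The degree in the auxiliary variable is the largest weight of an exponent occurring in `p`.
  have key : ∀ (p : MvPolynomial (Fin n) ℂ) (M : ℕ), (weightHom w p).natDegree ≤ M ↔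
      ∀ α ∈ p.support, ∑ i, w i * α i ≤ M := by
    intro p M
    rw [Polynomial.natDegree_le_iff_coeff_eq_zero]
    constructor
    · intro H α hα
      by_contra hlt
      have := congrArg (coeff α) (H _ (not_le.1 hlt))
      rw [coeff_coeff_weightHom, if_pos rfl] at this
      exact MvPolynomial.mem_support_iff.1 hα (by simpa using this)
    · intro H k hk
      ext α
      rw [coeff_coeff_weightHom]
      split_ifs with h1
      · by_contra h2
        exact absurd (H α (MvPolynomial.mem_support_iff.2 (by simpa using h2))) (by omega)
      · simp
  have hsc : ∀ (c : Fin n → ℂ) (p : MvPolynomial (Fin n) ℂ) (M : ℕ),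
      (weightHom w p).natDegree ≤ M → (weightHom w (scaleVars c p)).natDegree ≤ M := by
    intro c p M
    rw [key, key]
    intro H α hα
    refine H α (MvPolynomial.mem_support_iff.2 fun h0 => MvPolynomial.mem_support_iff.1 hα ?_)
    rw [coeff_scaleVars, h0, mul_zero]
  by_cases hg : g = 0
  · simp [hg] at hα
  have hinj : ∀ p : MvPolynomial (Fin n) ℂ, p ≠ 0 → weightHom w p ≠ 0 := by
    intro p hp h0
    obtain ⟨α, hα⟩ := MvPolynomial.ne_zero_iff.1 hp
    have := coeff_coeff_weightHom w p (∑ i, w i * α i) α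
    rw [h0, if_pos rfl] at this
    exact hα (by simpa using this.symm)
  have hle : (weightHom w (macN q t X f)).natDegree ≤ (weightHom w (vdPoly n)).natDegree + B := by
    rw [macN, map_sum]
    refine Polynomial.natDegree_sum_le_of_forall_le _ _ fun I _ => ?_
    rw [map_mul, map_mul]
    have h1 : weightHom w (MvPolynomial.C (X ^ I.card)) =
        Polynomial.C (MvPolynomial.C (X ^ I.card)) := (weightHom w).commutes _
    rw [h1]
    refine (Polynomial.natDegree_C_mul_le _ _).trans (Polynomial.natDegree_mul_le.trans ?_)
    exact Nat.add_le_add (hsc _ _ _ le_rfl) (hsc _ _ _ ((key f B).2 hB))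
  -- Degrees add exactly in a domain, and rescaling variables creates no new exponents, so the
  -- contribution of the Vandermonde product cancels.
  rw [h, map_mul, Polynomial.natDegree_mul (hinj _ (vdPoly_ne_zero n)) (hinj _ hg)] at hle
  exact (key g B).1 (by omega) α hα

/-! ### Leading exponents -/

/-- The eigenvalue `∏_i (1 + X t^{n-1-i} q^{α_i})` of Macdonald's generating operator. -/
def macEps (q t X : ℂ) {n : ℕ} (α : Fin n → ℕ) : ℂ :=
  ∏ i : Fin n, (1 + X * (t ^ (n - 1 - (i : ℕ)) * q ^ α i))

/-- The exponent `(n - 1, n - 2, …, 0)`. -/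
def staircase (n : ℕ) : Fin n →₀ ℕ := Finsupp.equivFunOnFinite.symm fun i => n - 1 - (i : ℕ)

theorem staircase_apply {n : ℕ} (i : Fin n) : staircase n i = n - 1 - (i : ℕ) := rfl

open MonomialOrder in
theorem vdPoly_lex (n : ℕ) : (lex (σ := Fin n)).degree (vdPoly n) = staircase n ∧
    (lex (σ := Fin n)).Monic (vdPoly n) := by
  have hd : ∀ i j : Fin n, i < j → (lex (σ := Fin n)).degree
      (MvPolynomial.X j : MvPolynomial (Fin n) ℂ) ≺[lex] (lex (σ := Fin n)).degree
      (MvPolynomial.X i : MvPolynomial (Fin n) ℂ) := by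
    intro i j hij
    rw [degree_X, degree_X, MonomialOrder.lex_lt_iff]
    refine ⟨i, fun k hk => ?_, ?_⟩
    · simp [hk.ne', (hk.trans hij).ne']
    · simp [hij.ne']
  have hm : ∀ i j : Fin n, i < j → (lex (σ := Fin n)).Monic
      (MvPolynomial.X i - MvPolynomial.X j : MvPolynomial (Fin n) ℂ) := by
    intro i j hij
    rw [Monic, leadingCoeff_sub_of_lt (hd i j hij), leadingCoeff_X]
  have hM : (lex (σ := Fin n)).Monic (vdPoly n) :=
    Monic.prod fun i _ => Monic.prod fun j hj => hm i j (Finset.mem_Ioi.1 hj)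
  refine ⟨?_, hM⟩
  have hne : ∀ i j : Fin n, j ∈ Finset.Ioi i →
      (MvPolynomial.X i - MvPolynomial.X j : MvPolynomial (Fin n) ℂ) ≠ 0 :=
    fun i j hj => (hm i j (Finset.mem_Ioi.1 hj)).ne_zero
  rw [vdPoly, vd, degree_prod fun i _ => Finset.prod_ne_zero_iff.2 fun j hj => hne i j hj]
  have : ∀ i : Fin n, (lex (σ := Fin n)).degree (∏ j ∈ Finset.Ioi i,
      (MvPolynomial.X i - MvPolynomial.X j : MvPolynomial (Fin n) ℂ)) =
      Finsupp.single i (n - 1 - (i : ℕ)) := by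
    intro i
    rw [degree_prod fun j hj => hne i j hj, Finset.sum_congr rfl fun j hj => by
      rw [degree_sub_of_lt (hd i j (Finset.mem_Ioi.1 hj)), degree_X], Finset.sum_const,
      Fin.card_Ioi]
    simp
  rw [Finset.sum_congr rfl fun i _ => this i]
  ext k
  rw [Finsupp.finsetSum_apply, Finset.sum_eq_single k]
  · simp [staircase_apply]
  · intro i _ hik; simp [hik]
  · simp

open MonomialOrder in
/-- The leading coefficient of `D_X f`. -/
theorem coeff_macN_lex {q t X : ℂ} {n : ℕ} {f g : MvPolynomial (Fin n) ℂ}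
    (h : macN q t X f = vdPoly n * g) :
    coeff ((lex (σ := Fin n)).degree f) g =
      macEps q t X ((lex (σ := Fin n)).degree f) * coeff ((lex (σ := Fin n)).degree f) f := by
  set α := (lex (σ := Fin n)).degree f with hα
  have hsc : ∀ (c : Fin n → ℂ) (p : MvPolynomial (Fin n) ℂ),
      (lex (σ := Fin n)).degree (scaleVars c p) ≼[lex] (lex (σ := Fin n)).degree p := by
    intro c p
    rw [degree_le_iff]
    intro β hβ
    refine le_degree (MvPolynomial.mem_support_iff.2 fun h0 => MvPolynomial.mem_support_iff.1 hβ ?_)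
    rw [coeff_scaleVars, h0, mul_zero]
  obtain ⟨hVd, hVm⟩ := vdPoly_lex n
  have hV1 : coeff (staircase n) (vdPoly n) = 1 := by rw [← hVd]; exact hVm
  -- the coefficient on the left
  have hL : coeff (staircase n + α) (macN q t X f) = macEps q t X α * coeff α f := by
    -- Expanding the eigenvalue over subsets `I` matches the operator term by term: rescaling
    -- multiplies the leading term by `t^{n-1-i} q^{α_i}` for each `i` in `I`.
    rw [macN, MvPolynomial.coeff_sum, macEps, Finset.prod_one_add, Finset.sum_mul]
    rw [Finset.powerset_univ]
    refine Finset.sum_congr rfl fun I _ => ?_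
    rw [MvPolynomial.coeff_C_mul, coeff_mul_of_add_of_degree_le (m := lex) (hVd ▸ hsc _ _) (hsc _ _),
      coeff_scaleVars, coeff_scaleVars, hV1, Finset.prod_mul_distrib, Finset.prod_const,
      Finset.prod_mul_distrib]
    have e : ∀ (a : ℂ) (β : Fin n → ℕ), ∏ i, onSet I a i ^ β i = ∏ i ∈ I, a ^ β i := by
      intro a β
      simp only [onSet, ite_pow, one_pow, Finset.prod_ite_mem, Finset.univ_inter]
    rw [e, e]
    simp only [staircase_apply]
    ring
  have hdeg : (lex (σ := Fin n)).degree (macN q t X f) ≼[lex] (staircase n + α) := by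
    refine degree_sum_le.trans (Finset.sup_le fun I _ => ?_)
    refine degree_mul_le.trans ?_
    rw [degree_C, zero_add]
    refine degree_mul_le.trans ?_
    rw [map_add, map_add]
    exact add_le_add (hVd ▸ hsc _ _) (hsc _ _)
  have hgd : (lex (σ := Fin n)).degree g ≼[lex] α := by
    by_cases hg : g = 0
    · rw [hg, degree_zero, map_zero]; exact bot_le
    · rw [h, degree_mul (vdPoly_ne_zero n) hg, hVd, map_add, map_add] at hdeg
      exact le_of_add_le_add_left hdeg
  rw [h, coeff_mul_of_add_of_degree_le (m := lex) (le_of_eq (congrArg _ hVd)) hgd, hV1, one_mul] at hL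
  exact hL

open MvPolynomial (rename aeval eval coeff monomial msymm)

/-! ### Partitions and exponents -/

/-- The nonzero values of an exponent, with multiplicity. -/
def expParts {n : ℕ} (α : Fin n → ℕ) : Multiset ℕ := (Finset.univ.val.map α).filter (· ≠ 0)

/-- The parts of a partition in decreasing order, as an exponent in `n` variables. -/
def rowOf (n : ℕ) {d : ℕ} (κ : d.Partition) : Fin n →₀ ℕ :=
  Finsupp.equivFunOnFinite.symm fun i => (κ.parts.sort (· ≥ ·)).getD i 0

theorem rowOf_apply (n : ℕ) {d : ℕ} (κ : d.Partition) (i : Fin n) :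
    rowOf n κ i = (κ.parts.sort (· ≥ ·)).getD i 0 := rfl

theorem map_getD_eq {n : ℕ} (l : List ℕ) (h : l.length ≤ n) :
    (Finset.univ.val.map fun i : Fin n => l.getD i 0) =
      (l : Multiset ℕ) + Multiset.replicate (n - l.length) 0 := by
  have : (List.ofFn fun i : Fin n => l.getD i 0) = l ++ List.replicate (n - l.length) 0 := by
    refine List.ext_getElem (by simp; omega) fun i h1 h2 => ?_
    simp only [List.getElem_ofFn]
    by_cases hi : i < l.length
    · rw [List.getElem_append_left hi, List.getD_eq_getElem _ _ hi]
    · rw [List.getElem_append_right (by omega), List.getElem_replicate,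
        List.getD_eq_default _ _ (by omega)]
  rw [Fin.univ_val_map, this, ← Multiset.coe_add, Multiset.coe_replicate]

theorem length_sort_parts {d : ℕ} (κ : d.Partition) :
    (κ.parts.sort (· ≥ ·)).length = Multiset.card κ.parts := Multiset.length_sort _

theorem card_parts_le {d : ℕ} (κ : d.Partition) : Multiset.card κ.parts ≤ d := by
  conv_rhs => rw [← κ.parts_sum]
  simpa using Multiset.card_nsmul_le_sum (s := κ.parts) (a := 1) fun i hi => κ.parts_pos hi

theorem expParts_rowOf {n d : ℕ} (κ : d.Partition) (h : Multiset.card κ.parts ≤ n) :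
    expParts (rowOf n κ) = κ.parts := by
  have h1 : expParts (rowOf n κ) = (((κ.parts.sort (· ≥ ·) : List ℕ) : Multiset ℕ) +
      Multiset.replicate (n - (κ.parts.sort (· ≥ ·)).length) 0 : Multiset ℕ).filter (· ≠ 0) := by
    rw [← map_getD_eq _ (by rwa [length_sort_parts])]; rfl
  rw [h1, Multiset.filter_add, Multiset.sort_eq]
  have h2 : (Multiset.replicate (n - (κ.parts.sort (· ≥ ·)).length) 0).filter (· ≠ 0) = 0 :=
    Multiset.filter_eq_nil.2 fun a ha => by simp [Multiset.eq_of_mem_replicate ha]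
  rw [h2, add_zero, Multiset.filter_eq_self]
  exact fun a ha => (κ.parts_pos ha).ne'

theorem card_expParts_le {n : ℕ} (α : Fin n → ℕ) : Multiset.card (expParts α) ≤ n := by
  refine (Multiset.card_le_card (Multiset.filter_le _ _)).trans ?_
  simp

/-- Both exponents have `n` entries, so equal nonzero parts force equally many zeros; bijections
between the fibres are then glued to a permutation. -/
theorem exists_perm_of_expParts {n : ℕ} {α β : Fin n → ℕ} (h : expParts α = expParts β) :
    ∃ σ : Equiv.Perm (Fin n), α = β ∘ σ := by
  suffices hm : Finset.univ.val.map α = Finset.univ.val.map β by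
    have hc : ∀ v, Nonempty ({i // α i = v} ≃ {i // β i = v}) := by
      intro v
      have := congrArg (Multiset.count v) hm
      rw [Multiset.count_map, Multiset.count_map] at this
      refine ⟨Fintype.equivOfCardEq ?_⟩
      rw [Fintype.card_subtype, Fintype.card_subtype]
      simpa [Finset.card, eq_comm] using this
    refine ⟨Equiv.ofFiberEquiv fun v => (hc v).some, funext fun i => ?_⟩
    exact (Equiv.ofFiberEquiv_map (fun v => (hc v).some) i).symm
  have e : ∀ α : Fin n → ℕ, Finset.univ.val.map α =
      expParts α + Multiset.replicate (n - Multiset.card (expParts α)) 0 := by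
    intro α
    have h1 : (Finset.univ.val.map α).filter (· ≠ 0) + (Finset.univ.val.map α).filter (¬ · ≠ 0) =
      Finset.univ.val.map α := Multiset.filter_add_not _ _
    have h2 : (Finset.univ.val.map α).filter (¬ · ≠ 0) = Multiset.replicate
        (Multiset.card ((Finset.univ.val.map α).filter (¬ · ≠ 0))) 0 :=
      Multiset.eq_replicate_card.2 fun b hb => by simpa using (Multiset.mem_filter.1 hb).2
    have h3 := congrArg Multiset.card h1
    rw [Multiset.card_add, Multiset.card_map, Finset.card_val, Finset.card_univ,
      Fintype.card_fin] at h3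
    have h4 : Multiset.card ((Finset.univ.val.map α).filter (¬ · ≠ 0)) =
        n - Multiset.card (expParts α) := by
      rw [expParts]; omega
    rw [h4] at h2
    rw [← h2]; exact h1.symm
  rw [e α, e β, h]

theorem coeff_eq_of_expParts {n : ℕ} {f : MvPolynomial (Fin n) ℂ} (hf : f.IsSymmetric)
    {α β : Fin n →₀ ℕ} (h : expParts α = expParts β) : coeff α f = coeff β f := by
  obtain ⟨σ, hσ⟩ := exists_perm_of_expParts h
  have e : β = Finsupp.mapDomain σ α := by
    ext i
    rw [Finsupp.mapDomain_equiv_apply]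
    simp [hσ]
  conv_rhs => rw [← hf σ, e, MvPolynomial.coeff_rename_mapDomain _ σ.injective]

theorem sum_expParts {n : ℕ} (α : Fin n → ℕ) : (expParts α).sum = ∑ i, α i := by
  have h1 : (Finset.univ.val.map α).filter (· ≠ 0) + (Finset.univ.val.map α).filter (¬ · ≠ 0) =
      Finset.univ.val.map α := Multiset.filter_add_not _ _
  have h2 : ((Finset.univ.val.map α).filter (¬ · ≠ 0)).sum = 0 :=
    Multiset.sum_eq_zero fun b hb => by simpa using (Multiset.mem_filter.1 hb).2
  have h3 := congrArg Multiset.sum h1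
  rw [Multiset.sum_add, h2, add_zero] at h3
  exact h3

theorem coeff_msymm {n d : ℕ} (κ : d.Partition) (α : Fin n →₀ ℕ) :
    coeff α (msymm (Fin n) ℂ κ) = if expParts α = κ.parts then 1 else 0 := by
  classical
  have hm : ∀ s : Multiset (Fin n), (s.map (MvPolynomial.X : Fin n → MvPolynomial (Fin n) ℂ)).prod =
      monomial (Multiset.toFinsupp s) 1 := by
    intro s
    induction s using Multiset.induction_on with
    | empty => simp
    | cons a s ih =>
      rw [Multiset.map_cons, Multiset.prod_cons, ih, MvPolynomial.X, MvPolynomial.monomial_mul,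
        one_mul, ← Multiset.singleton_add, map_add, Multiset.toFinsupp_singleton]
  have hp : ∀ s : Sym (Fin n) d, (Nat.Partition.ofSym s).parts =
      expParts (Multiset.toFinsupp s.1) := by
    intro s
    have h1 : expParts (Multiset.toFinsupp s.1) =
        (Finset.univ.val.filter fun i => Multiset.count i s.1 ≠ 0).map
          fun i => Multiset.count i s.1 := by
      rw [expParts, Multiset.filter_map]; rfl
    have h2 : (Finset.univ.val.filter fun i : Fin n => Multiset.count i s.1 ≠ 0) =
        s.1.dedup := by
      have : (Finset.univ.filter fun i : Fin n => Multiset.count i s.1 ≠ 0) = s.1.toFinset := by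
        ext i; simp
      exact congrArg Finset.val this
    rw [h1, h2]; rfl
  rw [msymm, MvPolynomial.coeff_sum]
  simp only [hm, MvPolynomial.coeff_monomial]
  split_ifs with h
  · have hc : Multiset.card (Finsupp.toMultiset α) = d := by
      rw [Finsupp.card_toMultiset, Finsupp.sum_fintype _ _ (fun _ => rfl)]
      exact (sum_expParts α).symm.trans (by rw [h, κ.parts_sum])
    have hs : Nat.Partition.ofSym (⟨Finsupp.toMultiset α, hc⟩ : Sym (Fin n) d) = κ := by
      refine Nat.Partition.ext ?_
      refine (hp ⟨Finsupp.toMultiset α, hc⟩).trans ?_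
      simpa using h
    rw [Fintype.sum_eq_single ⟨⟨Finsupp.toMultiset α, hc⟩, hs⟩]
    · simp
    · rintro ⟨s, hs'⟩ hne
      refine if_neg fun h1 => hne ?_
      refine Subtype.ext (Subtype.ext ?_)
      simp only [← h1]
      simp
  · refine Finset.sum_eq_zero fun s _ => if_neg fun h1 => h ?_
    have := hp s.1
    rw [h1, s.2] at this
    exact this.symm

theorem weight_one_eq_sum {n : ℕ} (α : Fin n →₀ ℕ) :
    Finsupp.weight (1 : Fin n → ℕ) α = ∑ i, α i := by
  rw [Finsupp.weight_apply, Finsupp.sum_fintype _ _ (by simp)]; simp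

theorem isHomogeneous_msymm {n d : ℕ} (κ : d.Partition) : (msymm (Fin n) ℂ κ).IsHomogeneous d := by
  intro α hα
  rw [coeff_msymm] at hα
  have : expParts α = κ.parts := by by_contra h; simp [h] at hα
  rw [weight_one_eq_sum]
  rw [← sum_expParts, this, κ.parts_sum]

theorem msymm_eq_zero {n d : ℕ} (κ : d.Partition) (h : n < Multiset.card κ.parts) :
    msymm (Fin n) ℂ κ = 0 := by
  ext α
  rw [coeff_msymm, if_neg, MvPolynomial.coeff_zero]
  intro h1
  have := card_expParts_le α
  rw [h1] at this; omega

/-- A symmetric homogeneous polynomial is a combination of monomial symmetric polynomials. -/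
theorem eq_sum_msymm {n d : ℕ} {f : MvPolynomial (Fin n) ℂ} (hf : f.IsSymmetric)
    (hd : f.IsHomogeneous d) :
    f = ∑ κ : d.Partition, coeff (rowOf n κ) f • msymm (Fin n) ℂ κ := by
  ext α
  simp only [MvPolynomial.coeff_sum, MvPolynomial.coeff_smul, coeff_msymm, smul_eq_mul]
  by_cases h : coeff α f = 0
  · rw [h]
    refine (Finset.sum_eq_zero fun κ _ => ?_).symm
    split_ifs with h1
    · rw [← h, mul_one]
      exact coeff_eq_of_expParts hf (by rw [expParts_rowOf _ (h1 ▸ card_expParts_le α), h1])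
    · simp
  · have hα := hd h
    rw [weight_one_eq_sum] at hα
    set κ : d.Partition := ⟨expParts α, fun hi => Nat.pos_of_ne_zero (Multiset.mem_filter.1 hi).2,
      by rw [sum_expParts, hα]⟩ with hκ
    rw [Fintype.sum_eq_single κ]
    · rw [if_pos rfl, mul_one]
      exact coeff_eq_of_expParts hf (by rw [expParts_rowOf _ (card_expParts_le α)])
    · intro μ hμ
      rw [if_neg, mul_zero]
      intro h1
      exact hμ (Nat.Partition.ext h1.symm)

theorem msymm_linearIndependent {n d : ℕ} (h : d ≤ n) (c : d.Partition → ℂ)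
    (h0 : ∑ κ, c κ • msymm (Fin n) ℂ κ = 0) (κ : d.Partition) : c κ = 0 := by
  have h1 := congrArg (coeff (rowOf n κ)) h0
  simp only [MvPolynomial.coeff_sum, MvPolynomial.coeff_smul, coeff_msymm, smul_eq_mul,
    MvPolynomial.coeff_zero] at h1
  rw [expParts_rowOf _ ((card_parts_le κ).trans h), Fintype.sum_eq_single κ] at h1
  · simpa using h1
  · intro μ hμ
    rw [if_neg fun e => hμ (Nat.Partition.ext e.symm), mul_zero]

/-! ### Decreasing exponents and the dominance order. -/

theorem antitone_rowOf (n : ℕ) {d : ℕ} (κ : d.Partition) : Antitone (rowOf n κ) := by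
  intro i j hij
  rw [rowOf_apply, rowOf_apply]
  by_cases hj : (j : ℕ) < (κ.parts.sort (· ≥ ·)).length
  · have hi : (i : ℕ) < (κ.parts.sort (· ≥ ·)).length := lt_of_le_of_lt hij hj
    rw [List.getD_eq_getElem _ _ hj, List.getD_eq_getElem _ _ hi]
    rcases eq_or_lt_of_le hij with rfl | hlt
    · exact le_rfl
    · exact List.pairwise_iff_getElem.1 (Multiset.pairwise_sort κ.parts (· ≥ ·)) _ _ hi hj hlt
  · rw [List.getD_eq_default _ _ (not_lt.1 hj)]; exact Nat.zero_le _

theorem eq_of_antitone_of_expParts {n : ℕ} {α β : Fin n → ℕ} (hα : Antitone α) (hβ : Antitone β)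
    (h : expParts α = expParts β) : α = β := by
  obtain ⟨σ, hσ⟩ := exists_perm_of_expParts h
  have := Tuple.unique_monotone (f := OrderDual.toDual ∘ β) (σ := σ) (τ := 1)
    (fun i j hij => by simpa [hσ] using hα hij) (fun i j hij => by simpa using hβ hij)
  rw [hσ]
  simpa [Function.comp_def, funext_iff] using this

theorem sum_take_eq (l : List ℕ) (n k : ℕ) (h : l.length ≤ n) :
    ∑ i : Fin n, (if (i : ℕ) < k then 1 else 0) * l.getD i 0 = (l.take k).sum := by
  rw [Fin.sum_univ_eq_sum_range fun i => (if i < k then 1 else 0) * l.getD i 0]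
  induction l generalizing n k with
  | nil => simp
  | cons a l ih =>
    obtain ⟨n, rfl⟩ : ∃ m, n = m + 1 := ⟨n - 1, by simp at h; omega⟩
    cases k with
    | zero => simp
    | succ k =>
      rw [Finset.sum_range_succ', List.take_succ_cons, List.sum_cons,
        ← ih n k (by simpa using h), add_comm]
      simp

/-- Dominance is rewritten as inequalities for the weights `(1, …, 1, 0, …, 0)`, the form in which
`weight_le_of_macN` controls the difference operator. -/
theorem domLE_iff {n d : ℕ} (h : d ≤ n) (μ κ : d.Partition) :
    DomLE μ κ ↔ ∀ k : ℕ, ∑ i : Fin n, (if (i : ℕ) < k then 1 else 0) * rowOf n μ i ≤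
      ∑ i : Fin n, (if (i : ℕ) < k then 1 else 0) * rowOf n κ i := by
  have e : ∀ (μ : d.Partition) (k : ℕ),
      ∑ i : Fin n, (if (i : ℕ) < k then 1 else 0) * rowOf n μ i =
        ((μ.parts.sort (· ≥ ·)).take k).sum := fun μ k => sum_take_eq _ n k
      (by rw [length_sort_parts]; exact (card_parts_le μ).trans h)
  simp only [e, DomLE]

theorem rowOf_injective {n d : ℕ} (h : d ≤ n) {μ κ : d.Partition}
    (e : (rowOf n μ : Fin n → ℕ) = rowOf n κ) : μ = κ := by
  refine Nat.Partition.ext ?_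
  rw [← expParts_rowOf μ ((card_parts_le μ).trans h), e,
    expParts_rowOf κ ((card_parts_le κ).trans h)]

theorem DomLE.antisymm {d : ℕ} {μ κ : d.Partition} (h1 : DomLE μ κ) (h2 : DomLE κ μ) : μ = κ := by
  refine rowOf_injective le_rfl (funext fun i => ?_)
  rw [domLE_iff le_rfl] at h1 h2
  have e := fun k => le_antisymm (h1 k) (h2 k)
  have step : ∀ ν : d.Partition, ∑ j : Fin d, (if (j : ℕ) < i + 1 then 1 else 0) * rowOf d ν j =
      ∑ j : Fin d, (if (j : ℕ) < i then 1 else 0) * rowOf d ν j + rowOf d ν i := by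
    intro ν
    have : rowOf d ν i = ∑ j : Fin d, (if j = i then 1 else 0) * rowOf d ν j := by simp
    rw [this, ← Finset.sum_add_distrib]
    refine Finset.sum_congr rfl fun j _ => ?_
    rw [← add_mul]
    congr 1
    have := Fin.ext_iff (a := j) (b := i)
    split_ifs <;> first | rfl | omega
  have := e (i + 1)
  rw [step, step, e i] at this
  exact Nat.add_left_cancel this

theorem DomLE.trans {d : ℕ} {μ κ ν : d.Partition} (h1 : DomLE μ κ) (h2 : DomLE κ ν) : DomLE μ ν :=
  fun k => (h1 k).trans (h2 k)

theorem DomLE.refl {d : ℕ} (κ : d.Partition) : DomLE κ κ := fun _ => le_rfl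

theorem DomLE.wellFounded (d : ℕ) :
    WellFounded fun μ κ : d.Partition => DomLE μ κ ∧ μ ≠ κ := by
  have h1 : IsTrans d.Partition fun μ κ => DomLE μ κ ∧ μ ≠ κ := ⟨fun a b c hab hbc =>
    ⟨hab.1.trans hbc.1, fun e => by subst e; exact hab.2 (hab.1.antisymm hbc.1)⟩⟩
  have h2 : Std.Irrefl fun μ κ : d.Partition => DomLE μ κ ∧ μ ≠ κ := ⟨fun a h => h.2 rfl⟩
  exact Finite.wellFounded_of_trans_of_irrefl _

/-- By the rearrangement inequality, a permutation of the parts has its largest initial sums when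
they are in decreasing order. -/
theorem weight_support_msymm {n d : ℕ} (κ : d.Partition) (hn : d ≤ n) (k : ℕ) {α : Fin n →₀ ℕ}
    (hα : α ∈ (msymm (Fin n) ℂ κ).support) :
    ∑ i : Fin n, (if (i : ℕ) < k then 1 else 0) * α i ≤
      ∑ i : Fin n, (if (i : ℕ) < k then 1 else 0) * rowOf n κ i := by
  rw [MvPolynomial.mem_support_iff, coeff_msymm] at hα
  have h : expParts α = expParts (rowOf n κ) := by
    rw [expParts_rowOf κ ((card_parts_le κ).trans hn)]
    by_contra h; simp [h] at hα
  obtain ⟨σ, hσ⟩ := exists_perm_of_expParts h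
  have hmv : Monovary (fun i : Fin n => if (i : ℕ) < k then 1 else 0) (rowOf n κ) := by
    refine Antitone.monovary (fun i j hij => ?_) (antitone_rowOf n κ)
    have : (i : ℕ) ≤ j := hij
    split_ifs <;> omega
  have := hmv.sum_mul_comp_perm_le_sum_mul (σ := σ)
  simpa [hσ] using this

/-! ### Triangularity of Macdonald's operator -/

theorem scaleVars_homogeneous {n e : ℕ} (a : ℂ) {p : MvPolynomial (Fin n) ℂ}
    (hp : p.IsHomogeneous e) : scaleVars (fun _ => a) p = a ^ e • p := by
  ext α
  rw [coeff_scaleVars, MvPolynomial.coeff_smul, smul_eq_mul, Finset.prod_pow_eq_pow_sum]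
  by_cases h : coeff α p = 0
  · simp [h]
  · have := hp h
    rw [weight_one_eq_sum] at this
    rw [this]

/-- One scaling factor suffices, since distinct powers of 2 are distinct. -/
theorem isHomogeneous_of_scaleVars {n e : ℕ} {p : MvPolynomial (Fin n) ℂ}
    (h : scaleVars (fun _ => 2) p = (2 : ℂ) ^ e • p) : p.IsHomogeneous e := by
  intro α hα
  have := congrArg (coeff α) h
  rw [coeff_scaleVars, MvPolynomial.coeff_smul, smul_eq_mul, Finset.prod_pow_eq_pow_sum] at this
  have h2 := mul_right_cancel₀ hα this
  rw [weight_one_eq_sum]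
  have h3 : (2 : ℕ) ^ (∑ i, α i) = 2 ^ e := by exact_mod_cast h2
  exact Nat.pow_right_injective le_rfl h3

theorem scaleVars_comm {n : ℕ} (a b : Fin n → ℂ) (p : MvPolynomial (Fin n) ℂ) :
    scaleVars a (scaleVars b p) = scaleVars b (scaleVars a p) := by
  ext α; simp only [coeff_scaleVars]; ring

theorem isHomogeneous_vdPoly (n : ℕ) :
    (vdPoly n).IsHomogeneous (∑ i : Fin n, ∑ _j ∈ Finset.Ioi i, 1) :=
  MvPolynomial.IsHomogeneous.prod _ _ _ fun _ _ => MvPolynomial.IsHomogeneous.prod _ _ _ fun _ _ =>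
    (MvPolynomial.isHomogeneous_X _ _).sub (MvPolynomial.isHomogeneous_X _ _)

theorem isHomogeneous_of_macN {q t X : ℂ} {n d : ℕ} {f g : MvPolynomial (Fin n) ℂ}
    (h : macN q t X f = vdPoly n * g) (hf : f.IsHomogeneous d) : g.IsHomogeneous d := by
  set C := ∑ i : Fin n, ∑ _j ∈ Finset.Ioi i, 1
  have h1 : scaleVars (fun _ => 2) (macN q t X f) = ((2 : ℂ) ^ C * 2 ^ d) • macN q t X f := by
    rw [macN, map_sum, Finset.smul_sum]
    refine Finset.sum_congr rfl fun I _ => ?_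
    rw [map_mul, map_mul, scaleVars_comm, scaleVars_homogeneous 2 (isHomogeneous_vdPoly n),
      scaleVars_comm, scaleVars_homogeneous 2 hf, map_smul, map_smul]
    have : scaleVars (fun _ : Fin n => (2 : ℂ)) (MvPolynomial.C (X ^ I.card)) =
        MvPolynomial.C (X ^ I.card) := (scaleVars _).commutes _
    rw [this]
    simp only [smul_mul_assoc, mul_smul_comm, smul_smul]
    rw [mul_comm]
  rw [h, map_mul, scaleVars_homogeneous 2 (isHomogeneous_vdPoly n), mul_smul, smul_mul_assoc,
    ← mul_smul_comm] at h1
  have h2 : vdPoly n * scaleVars (fun _ => 2) g = vdPoly n * ((2 : ℂ) ^ d • g) := by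
    refine smul_right_injective (MvPolynomial (Fin n) ℂ) (pow_ne_zero C (two_ne_zero' ℂ)) ?_
    simp only [← mul_smul_comm] at h1 ⊢
    exact h1
  exact isHomogeneous_of_scaleVars (mul_left_cancel₀ (vdPoly_ne_zero n) h2)

/-- If an earlier entry of the leading exponent were smaller than a later one, swapping the two
would give a lexicographically larger exponent, which occurs in `f` by symmetry. -/
theorem lex_degree_antitone {n : ℕ} {f : MvPolynomial (Fin n) ℂ} (hf : f.IsSymmetric) :
    Antitone ((MonomialOrder.lex (σ := Fin n)).degree f) := by
  by_cases h0 : f = 0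
  · rw [h0, MonomialOrder.degree_zero]; exact fun _ _ _ => le_rfl
  by_contra hA
  simp only [Antitone] at hA
  push Not at hA
  obtain ⟨i, j, hij, hlt⟩ := hA
  set α := (MonomialOrder.lex (σ := Fin n)).degree f with hα
  have hc : coeff α f ≠ 0 := MonomialOrder.coeff_degree_ne_zero_iff.2 h0
  have hij' : i < j := lt_of_le_of_ne hij fun e => by subst e; exact lt_irrefl _ hlt
  have hmem : Finsupp.mapDomain (Equiv.swap i j) α ∈ f.support := by
    rw [MvPolynomial.mem_support_iff]
    conv_lhs => rw [← hf (Equiv.swap i j), MvPolynomial.coeff_rename_mapDomain _ (Equiv.injective _)]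
    exact hc
  have hle := MonomialOrder.le_degree (m := MonomialOrder.lex) hmem
  rw [← hα] at hle
  refine absurd hle (not_le.2 ?_)
  rw [MonomialOrder.lex_lt_iff]
  refine ⟨i, fun k hk => ?_, ?_⟩
  · simp only [ofLex_toLex, Finsupp.mapDomain_equiv_apply, Equiv.symm_swap]
    rw [Equiv.swap_apply_of_ne_of_ne hk.ne (hk.trans hij').ne]
  · simp only [ofLex_toLex, Finsupp.mapDomain_equiv_apply, Equiv.symm_swap, Equiv.swap_apply_left]
    exact hlt

theorem lex_degree_msymm {n d : ℕ} (hn : d ≤ n) (κ : d.Partition) :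
    (MonomialOrder.lex (σ := Fin n)).degree (msymm (Fin n) ℂ κ) = rowOf n κ := by
  have h0 : msymm (Fin n) ℂ κ ≠ 0 := by
    intro h
    have := congrArg (coeff (rowOf n κ)) h
    rw [coeff_msymm, if_pos (expParts_rowOf κ ((card_parts_le κ).trans hn))] at this
    simp at this
  have hc := MonomialOrder.coeff_degree_ne_zero_iff (m := MonomialOrder.lex).2 h0
  rw [coeff_msymm] at hc
  refine DFunLike.coe_injective (eq_of_antitone_of_expParts
    (lex_degree_antitone (MvPolynomial.msymm_isSymmetric _ _ κ)) (antitone_rowOf n κ) ?_)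
  rw [expParts_rowOf κ ((card_parts_le κ).trans hn)]
  by_contra h; simp [h] at hc

/-- Triangularity follows from the weights of initial segments, the diagonal entries from the
lexicographic leading coefficient. -/
theorem exists_macN_msymm (q t X : ℂ) {n d : ℕ} (hn : d ≤ n) :
    ∃ c : d.Partition → d.Partition → ℂ,
      (∀ κ, macN q t X (msymm (Fin n) ℂ κ) = vdPoly n * ∑ μ, c κ μ • msymm (Fin n) ℂ μ) ∧
      (∀ κ μ, c κ μ ≠ 0 → DomLE μ κ) ∧ ∀ κ, c κ κ = macEps q t X (rowOf n κ) := by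
  choose g hgs hg using fun κ : d.Partition =>
    exists_macN_eq q t X (n := n) (MvPolynomial.msymm_isSymmetric (Fin n) ℂ κ)
  refine ⟨fun κ μ => coeff (rowOf n μ) (g κ), fun κ => ?_, fun κ μ h => ?_, fun κ => ?_⟩
  · rw [← eq_sum_msymm (hgs κ) (isHomogeneous_of_macN (hg κ) (isHomogeneous_msymm κ)), hg]
  · rw [domLE_iff hn]
    intro k
    exact weight_le_of_macN (hg κ) (fun i => if (i : ℕ) < k then 1 else 0)
      (fun α hα => weight_support_msymm κ hn k hα) (MvPolynomial.mem_support_iff.2 h)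
  · have := coeff_macN_lex (hg κ)
    rw [lex_degree_msymm hn, coeff_msymm,
      if_pos (expParts_rowOf κ ((card_parts_le κ).trans hn)), mul_one] at this
    exact this

/-- A triangular matrix with distinct diagonal entries has unitriangular eigenvectors. -/
theorem exists_triangular_eigenvectors {ι : Type*} [Fintype ι] [DecidableEq ι] (r : ι → ι → Prop)
    (hr : WellFounded r) (htr : ∀ a b c, r a b → r b c → r a c) (c : ι → ι → ℂ)
    (hc : ∀ κ μ, c κ μ ≠ 0 → μ = κ ∨ r μ κ) (hd : ∀ κ μ, r μ κ → c κ κ ≠ c μ μ) :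
    ∃ u : ι → ι → ℂ, (∀ κ, u κ κ = 1) ∧ (∀ κ μ, u κ μ ≠ 0 → μ = κ ∨ r μ κ) ∧
      ∀ κ ν, ∑ μ, u κ μ * c μ ν = c κ κ * u κ ν := by
  suffices H : ∀ κ, ∃ w : ι → ℂ, w κ = 1 ∧ (∀ μ, w μ ≠ 0 → μ = κ ∨ r μ κ) ∧
      ∀ ν, ∑ μ, w μ * c μ ν = c κ κ * w ν by
    choose u h1 h2 h3 using H
    exact ⟨u, h1, h2, h3⟩
  classical
  intro κ
  have hirr : ∀ a, ¬ r a a := fun a h => hr.irrefl.irrefl a h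
  let L : ({μ // r μ κ} → ℂ) →ₗ[ℂ] ({μ // r μ κ} → ℂ) :=
    { toFun := fun y ν => ∑ μ, y μ * c μ.1 ν.1 - c κ κ * y ν
      map_add' := fun y z => by
        funext ν; simp only [Pi.add_apply, add_mul, Finset.sum_add_distrib]; ring
      map_smul' := fun a y => by
        funext ν
        simp only [Pi.smul_apply, smul_eq_mul, RingHom.id_apply, mul_sub, Finset.mul_sum, mul_assoc]
        congr 1; ring }
  have hL : Function.Injective L := by
    -- At a maximal `ν` in the support of a kernel vector only the diagonal term contributes, and it
    -- cannot vanish because the diagonal entries at `ν` and `κ` differ.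
    rw [← LinearMap.ker_eq_bot, LinearMap.ker_eq_bot']
    intro y hy
    by_contra hne
    obtain ⟨ν₀, hν₀⟩ := Function.ne_iff.1 hne
    have hwf : WellFounded fun a b : {μ // r μ κ} => r b.1 a.1 := by
      have h1 : IsTrans {μ // r μ κ} fun a b => r b.1 a.1 := ⟨fun a b c hab hbc => htr _ _ _ hbc hab⟩
      have h2 : Std.Irrefl fun a b : {μ // r μ κ} => r b.1 a.1 := ⟨fun a h => hirr _ h⟩
      exact Finite.wellFounded_of_trans_of_irrefl _
    obtain ⟨ν, hν, hmax⟩ := hwf.has_min {ν | y ν ≠ 0} ⟨ν₀, hν₀⟩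
    have h1 : ∑ μ, y μ * c μ.1 ν.1 - c κ κ * y ν = 0 := congrFun hy ν
    rw [Fintype.sum_eq_single ν] at h1
    · have : y ν * (c ν.1 ν.1 - c κ κ) = 0 := by linear_combination h1
      rcases mul_eq_zero.1 this with h | h
      · exact hν h
      · exact hd κ ν.1 ν.2 (sub_eq_zero.1 h).symm
    · intro μ hμ
      by_contra h0
      rcases hc μ.1 ν.1 (right_ne_zero_of_mul h0) with h | h
      · exact hμ (Subtype.ext h.symm)
      · exact hmax μ (left_ne_zero_of_mul h0) h
  -- The entry at `κ` is normalized to 1, so the eigenvector equation below `κ` is an inhomogeneous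
  -- linear system.
  obtain ⟨y, hy⟩ := (LinearMap.injective_iff_surjective.1 hL) fun ν => -c κ ν.1
  let w : ι → ℂ := fun μ => if μ = κ then 1 else if h : r μ κ then y ⟨μ, h⟩ else 0
  have hw : ∀ ν, ∑ μ, w μ * c μ ν = c κ ν + ∑ μ : {μ // r μ κ}, y μ * c μ.1 ν := by
    intro ν
    rw [← Finset.add_sum_erase _ _ (Finset.mem_univ κ)]
    congr 1
    · simp [w]
    · have h1 := Finset.sum_subtype (F := inferInstance) (Finset.univ.filter fun μ => r μ κ) (p := fun μ => r μ κ)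
        (by simp) fun μ => w μ * c μ ν
      have h2 : ∑ μ ∈ Finset.univ.filter fun μ => r μ κ, w μ * c μ ν =
          ∑ μ ∈ Finset.univ.erase κ, w μ * c μ ν := by
        refine Finset.sum_subset (fun μ hμ => ?_) fun μ hμ hμ' => ?_
        · have := (Finset.mem_filter.1 hμ).2
          exact Finset.mem_erase.2 ⟨fun e => hirr κ (e ▸ this), Finset.mem_univ _⟩
        · have h3 : μ ≠ κ := Finset.ne_of_mem_erase hμ
          have h4 : ¬ r μ κ := by simpa using hμ'
          simp [w, h3, h4]
      rw [← h2, h1]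
      refine Finset.sum_congr rfl fun μ _ => ?_
      have h3 : μ.1 ≠ κ := fun e => hirr κ (by simpa [e] using μ.2)
      simp [w, h3, μ.2]
  refine ⟨w, by simp [w], fun μ h => ?_, fun ν => ?_⟩
  · by_contra hcon
    push Not at hcon
    exact h (by simp [w, hcon.1, hcon.2])
  · rw [hw]
    by_cases h1 : ν = κ
    · subst h1
      rw [Finset.sum_eq_zero, add_zero]
      · simp [w]
      · intro μ _
        by_contra h0
        rcases hc μ.1 ν (right_ne_zero_of_mul h0) with h | h
        · have hμ := μ.2
          rw [← h] at hμ
          exact hirr _ hμ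
        · exact hirr _ (htr _ _ _ h μ.2)
    · by_cases h2 : r ν κ
      · have h3 : ∑ μ, y μ * c μ.1 ν - c κ κ * y ⟨ν, h2⟩ = -c κ ν := congrFun hy ⟨ν, h2⟩
        simp only [w, if_neg h1, dif_pos h2]
        linear_combination h3
      · have h3 : c κ ν = 0 := by
          by_contra h0
          exact (hc κ ν h0).elim h1 h2
        simp only [w, if_neg h1, dif_neg h2, h3, mul_zero, zero_add]
        refine Finset.sum_eq_zero fun μ _ => ?_
        by_contra h0
        rcases hc μ.1 ν (right_ne_zero_of_mul h0) with h | h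
        · exact h2 (h ▸ μ.2)
        · exact h2 (htr _ _ _ h μ.2)

open MvPolynomial (rename aeval eval coeff monomial msymm psum esymm)

/-! ### Algebraic independence of the power sums -/

/-- The kernels of the iterates increase, hence stabilize. An element killed by `f` is the image of
some `b` under a high iterate, and `b` already lies in the kernel of that iterate. -/
theorem RingHom.injective_of_surjective_of_noetherian {A : Type*} [CommRing A] [IsNoetherianRing A]
    (f : A →+* A) (hf : Function.Surjective f) : Function.Injective f := by
  let g : ℕ →o Ideal A :=
    { toFun := fun k => RingHom.ker (f ^ k)
      monotone' := monotone_nat_of_le_succ fun k x hx => by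
        rw [RingHom.mem_ker] at hx ⊢
        rw [pow_succ', RingHom.mul_def, RingHom.comp_apply, hx, map_zero] }
  obtain ⟨k, hk⟩ := monotone_stabilizes_iff_noetherian.2 (inferInstance : IsNoetherian A A) g
  rw [injective_iff_map_eq_zero]
  intro a ha
  have hs : Function.Surjective (f ^ k) := by
    rw [RingHom.coe_pow]; exact hf.iterate k
  obtain ⟨b, rfl⟩ := hs a
  have h1 : b ∈ g (k + 1) := by
    change b ∈ RingHom.ker (f ^ (k + 1))
    rw [RingHom.mem_ker, pow_succ', RingHom.mul_def, RingHom.comp_apply, ha]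
  rw [← hk (k + 1) (by omega)] at h1
  exact h1

/-- The first `n` power sums in `n` variables are algebraically independent. -/
theorem psum_aeval_injective (n : ℕ) : Function.Injective
    (aeval (fun i : Fin n => psum (Fin n) ℂ ((i : ℕ) + 1)) :
      MvPolynomial (Fin n) ℂ →ₐ[ℂ] MvPolynomial (Fin n) ℂ) := by
  set ψ : MvPolynomial (Fin n) ℂ →ₐ[ℂ] MvPolynomial (Fin n) ℂ :=
    aeval (fun i : Fin n => psum (Fin n) ℂ ((i : ℕ) + 1)) with hψ
  set θ : MvPolynomial (Fin n) ℂ →ₐ[ℂ] MvPolynomial (Fin n) ℂ :=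
    aeval (fun i : Fin n => esymm (Fin n) ℂ ((i : ℕ) + 1)) with hθ
  have hθi : Function.Injective θ := by
    intro a b h
    refine MvPolynomial.esymmAlgHom_fin_injective ℂ (le_refl n) (Subtype.ext ?_)
    exact (MvPolynomial.esymmAlgHom_apply _).trans (h.trans (MvPolynomial.esymmAlgHom_apply _).symm)
  -- Newton's identities express the elementary symmetric polynomials through power sums, division
  -- by `k` being allowed over ℂ.
  have hψr : ∀ k, k ≤ n → esymm (Fin n) ℂ k ∈ ψ.range := by
    intro k
    induction k using Nat.strong_induction_on with
    | _ k ih =>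
      intro hk
      rcases Nat.eq_zero_or_pos k with rfl | hpos
      · rw [MvPolynomial.esymm_zero]; exact one_mem _
      have h := MvPolynomial.mul_esymm_eq_sum (Fin n) ℂ k
      have hm : (k : MvPolynomial (Fin n) ℂ) * esymm (Fin n) ℂ k ∈ ψ.range := by
        rw [h]
        refine mul_mem (pow_mem (neg_mem (one_mem _)) _) (sum_mem fun a ha => ?_)
        rw [Finset.mem_filter, Finset.HasAntidiagonal.mem_antidiagonal] at ha
        refine mul_mem (mul_mem (pow_mem (neg_mem (one_mem _)) _) (ih _ ha.2 (by omega))) ?_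
        refine ⟨MvPolynomial.X ⟨a.2 - 1, by omega⟩, ?_⟩
        have e : a.2 - 1 + 1 = a.2 := by omega
        simp [hψ, e]
      have h2 := Subalgebra.smul_mem _ hm ((k : ℂ)⁻¹)
      rwa [← nsmul_eq_mul, ← Nat.cast_smul_eq_nsmul ℂ, smul_smul,
        inv_mul_cancel₀ (by exact_mod_cast hpos.ne'), one_smul] at h2
  choose g hg using fun i : Fin n => hψr (i + 1) i.2
  have hp : ∀ i : Fin n, ∃ h, θ h = psum (Fin n) ℂ ((i : ℕ) + 1) := by
    intro i
    obtain ⟨h, hh⟩ := MvPolynomial.esymmAlgHom_fin_surjective ℂ (le_refl n)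
      ⟨psum (Fin n) ℂ ((i : ℕ) + 1), MvPolynomial.psum_isSymmetric _ _ _⟩
    refine ⟨h, ?_⟩
    have := congrArg Subtype.val hh
    rw [MvPolynomial.esymmAlgHom_apply] at this
    exact this
  choose h hh using hp
  have e1 : ψ.comp (aeval g) = θ := by
    ext i : 1
    have h1 : ψ (g i) = esymm (Fin n) ℂ ((i : ℕ) + 1) := hg i
    simp [h1, hθ]
  have e2 : θ.comp (aeval h) = ψ := by
    ext i : 1
    simp [hh, hψ]
  -- The substitutions `g` and `h` translate elementary symmetric polynomials and power sums into
  -- each other. Injectivity of `θ` makes one composite the identity; the surjective factor is then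
  -- injective by noetherianity, and so is `ψ`.
  have hGH : Function.LeftInverse (aeval h : MvPolynomial (Fin n) ℂ →ₐ[ℂ] MvPolynomial (Fin n) ℂ)
      (aeval g) := by
    intro x
    apply hθi
    have h1 := DFunLike.congr_fun e2 (aeval g x)
    have h2 := DFunLike.congr_fun e1 x
    exact h1.trans h2
  have hH := RingHom.injective_of_surjective_of_noetherian
    (aeval h : MvPolynomial (Fin n) ℂ →ₐ[ℂ] MvPolynomial (Fin n) ℂ).toRingHom hGH.surjective
  rw [← e2]
  exact hθi.comp hH

/-- A symmetric function involving only `p_1, …, p_n` is determined by its values in `n`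
variables. -/
theorem eq_zero_of_toVars {n : ℕ} {f : SymFun} (hv : ∀ r ∈ f.vars, (r : ℕ) ≤ n)
    (h : toVars n f = 0) : f = 0 := by
  obtain ⟨p, rfl⟩ := MvPolynomial.exists_rename_eq_of_vars_subset_range f
    (fun i : Fin n => Nat.succPNat i)
    (fun i j hij => Fin.ext (Nat.succPNat_injective hij)) (by
      intro r hr
      have h1 := hv r hr
      have h2 := r.pos
      exact ⟨⟨(r : ℕ) - 1, by omega⟩, PNat.eq (by rw [Nat.succPNat_coe]; simp only; omega)⟩)
  rw [toVars, MvPolynomial.aeval_rename] at h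
  have : p = 0 := psum_aeval_injective n (by rw [map_zero]; exact h)
  rw [this, map_zero]

/-! ### Symmetric functions in finitely many variables. -/

theorem toVars_add (n : ℕ) (f g : SymFun) : toVars n (f + g) = toVars n f + toVars n g := map_add _ _ _

theorem toVars_sub (n : ℕ) (f g : SymFun) : toVars n (f - g) = toVars n f - toVars n g := map_sub _ _ _

theorem toVars_mul (n : ℕ) (f g : SymFun) : toVars n (f * g) = toVars n f * toVars n g := map_mul _ _ _

theorem toVars_smul (n : ℕ) (a : ℂ) (f : SymFun) : toVars n (a • f) = a • toVars n f := map_smul _ _ _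

theorem toVars_sum (n : ℕ) {κ : Type*} (s : Finset κ) (f : κ → SymFun) :
    toVars n (∑ k ∈ s, f k) = ∑ k ∈ s, toVars n (f k) := map_sum _ _ _

theorem toVars_X (n : ℕ) (r : ℕ+) : toVars n (MvPolynomial.X r) = psum (Fin n) ℂ r :=
  MvPolynomial.aeval_X _ _

theorem toVars_isSymmetric (n : ℕ) (f : SymFun) : (toVars n f).IsSymmetric := by
  intro σ
  have : (rename σ : MvPolynomial (Fin n) ℂ →ₐ[ℂ] MvPolynomial (Fin n) ℂ).comp
      (aeval fun r : ℕ+ => psum (Fin n) ℂ (r : ℕ)) = aeval fun r : ℕ+ => psum (Fin n) ℂ (r : ℕ) := by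
    ext r : 1
    simp
  exact DFunLike.congr_fun this f

theorem symFun_ext {f g : SymFun} (h : ∀ n, toVars n f = toVars n g) : f = g := by
  rw [← sub_eq_zero]
  refine eq_zero_of_toVars (n := (f - g).vars.sup fun r => (r : ℕ))
    (fun r hr => Finset.le_sup (f := fun r : ℕ+ => (r : ℕ)) hr) ?_
  rw [toVars_sub, h, sub_self]

/-! ### Weights -/

/-- `f` is a symmetric function of degree `d`. -/
def HasDegree (f : SymFun) (d : ℕ) : Prop :=
  MvPolynomial.IsWeightedHomogeneous (fun r : ℕ+ => (r : ℕ)) f d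

theorem weight_pnat (m : ℕ+ →₀ ℕ) :
    Finsupp.weight (fun r : ℕ+ => (r : ℕ)) m = m.sum fun r k => k * (r : ℕ) := by
  rw [Finsupp.weight_apply]; rfl

theorem le_of_weight {m : ℕ+ →₀ ℕ} {r : ℕ+} (h : m r ≠ 0) :
    (r : ℕ) * m r ≤ Finsupp.weight (fun r : ℕ+ => (r : ℕ)) m := by
  rw [weight_pnat, Finsupp.sum, mul_comm]
  exact Finset.single_le_sum (f := fun r : ℕ+ => m r * (r : ℕ)) (fun _ _ => Nat.zero_le _)
    (Finsupp.mem_support_iff.2 h)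

theorem finite_weight (d : ℕ) :
    {m : ℕ+ →₀ ℕ | Finsupp.weight (fun r : ℕ+ => (r : ℕ)) m = d}.Finite := by
  refine (Set.finite_Iic (Finsupp.indicator (Finset.Icc 1 (Nat.succPNat d)) fun _ _ => d :
    ℕ+ →₀ ℕ)).subset fun m hm r => ?_
  have hm : Finsupp.weight (fun r : ℕ+ => (r : ℕ)) m = d := hm
  by_cases h : m r = 0
  · rw [h]; exact Nat.zero_le _
  · have h1 := le_of_weight h
    rw [hm] at h1
    have h2 : (r : ℕ) ≤ d := (Nat.le_mul_of_pos_right _ (Nat.pos_of_ne_zero h)).trans h1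
    have h3 : m r ≤ d := (Nat.le_mul_of_pos_left _ r.pos).trans h1
    rw [Finsupp.indicator_of_mem]
    · exact h3
    · rw [Finset.mem_Icc]
      exact ⟨one_le, by rw [← PNat.coe_le_coe, Nat.succPNat_coe]; omega⟩

/-- The exponents of monomials in the power sums of degree `d`. -/
def wtSet (d : ℕ) : Finset (ℕ+ →₀ ℕ) := (finite_weight d).toFinset

theorem mem_wtSet {d : ℕ} {m : ℕ+ →₀ ℕ} :
    m ∈ wtSet d ↔ Finsupp.weight (fun r : ℕ+ => (r : ℕ)) m = d := by simp [wtSet]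

theorem HasDegree.support_subset {f : SymFun} {d : ℕ} (h : HasDegree f d) : f.support ⊆ wtSet d :=
  fun _ hm => mem_wtSet.2 (h (MvPolynomial.mem_support_iff.1 hm))

theorem HasDegree.eq_sum {f : SymFun} {d : ℕ} (h : HasDegree f d) :
    f = ∑ m ∈ wtSet d, coeff m f • monomial m 1 := by
  conv_lhs => rw [MvPolynomial.as_sum f]
  rw [Finset.sum_subset h.support_subset]
  · refine Finset.sum_congr rfl fun m _ => ?_
    rw [MvPolynomial.smul_monomial, smul_eq_mul, mul_one]
  · intro m _ hm
    rw [MvPolynomial.notMem_support_iff.1 hm, map_zero]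

theorem HasDegree.vars_le {f : SymFun} {d : ℕ} (h : HasDegree f d) {r : ℕ+} (hr : r ∈ f.vars) :
    (r : ℕ) ≤ d := by
  obtain ⟨m, hm, hrm⟩ := (MvPolynomial.mem_vars_iff_mem_support _).1 hr
  have h1 := le_of_weight (Finsupp.mem_support_iff.1 hrm)
  rw [h (MvPolynomial.mem_support_iff.1 hm)] at h1
  exact (Nat.le_mul_of_pos_right _ (Nat.pos_of_ne_zero (Finsupp.mem_support_iff.1 hrm))).trans h1

theorem HasDegree.smul {f : SymFun} {d : ℕ} (h : HasDegree f d) (a : ℂ) : HasDegree (a • f) d :=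
  (MvPolynomial.weightedHomogeneousSubmodule ℂ _ d).smul_mem a h

theorem HasDegree.add {f g : SymFun} {d : ℕ} (h : HasDegree f d) (h' : HasDegree g d) :
    HasDegree (f + g) d := MvPolynomial.IsWeightedHomogeneous.add h h'

theorem HasDegree.sum {κ : Type*} (s : Finset κ) {f : κ → SymFun} {d : ℕ}
    (h : ∀ k ∈ s, HasDegree (f k) d) : HasDegree (∑ k ∈ s, f k) d :=
  MvPolynomial.IsWeightedHomogeneous.sum s f d h

/-- In at least `d` variables, a symmetric function of degree `d` is determined by its values. -/
theorem HasDegree.eq_zero {f : SymFun} {d n : ℕ} (h : HasDegree f d) (hn : d ≤ n)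
    (h0 : toVars n f = 0) : f = 0 :=
  eq_zero_of_toVars (fun _ hr => (h.vars_le hr).trans hn) h0

/-! ### Monomial symmetric functions in terms of power sums -/

/-- The symmetric function `∑ x_{i_1}^{μ_1} ⋯ x_{i_k}^{μ_k}` over distinct `i_1, …, i_k`. -/
def augSym : (k : ℕ) → (Fin k → ℕ+) → SymFun
  | 0, _ => 1
  | k + 1, μ => MvPolynomial.X (μ 0) * augSym k (Fin.tail μ) -
      ∑ i, augSym k (Function.update (Fin.tail μ) i (Fin.tail μ i + μ 0))

-- Multiplication by `p_{μ_0}` inserts a new index without restriction; the subtracted terms are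
-- those where it coincides with an old index, in which case the exponents add.
open Classical in
theorem toVars_augSym (n : ℕ) (k : ℕ) (μ : Fin k → ℕ+) :
    toVars n (augSym k μ) = ∑ f : Fin k → Fin n,
      if Function.Injective f then ∏ i, (MvPolynomial.X (f i) : MvPolynomial (Fin n) ℂ) ^ (μ i : ℕ)
      else 0 := by
  induction k with
  | zero =>
    rw [augSym, Fintype.sum_unique, if_pos (Function.injective_of_subsingleton _)]
    simp [toVars]
  | succ k ih =>
    rw [augSym, toVars_sub, toVars_mul, toVars_X, toVars_sum]
    simp only [ih]
    rw [← (Fin.consEquiv fun _ : Fin (k + 1) => Fin n).sum_comp, Fintype.sum_prod_type, psum,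
      Finset.sum_mul_sum]
    refine (congrArg₂ (· - ·) Finset.sum_comm Finset.sum_comm).trans (Eq.trans ?_ Finset.sum_comm)
    rw [← Finset.sum_sub_distrib]
    refine Finset.sum_congr rfl fun f _ => ?_
    have hcons : ∀ j : Fin n, (Fin.consEquiv fun _ : Fin (k + 1) => Fin n) (j, f) =
        (Fin.cons j f : Fin (k + 1) → Fin n) := fun _ => rfl
    simp only [hcons, Fin.cons_injective_iff, Fin.prod_univ_succ, Fin.cons_zero, Fin.cons_succ]
    by_cases hf : Function.Injective f
    · simp only [hf, if_true, and_true]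
      have e : ∀ i : Fin k, ∏ l, (MvPolynomial.X (f l) : MvPolynomial (Fin n) ℂ) ^
          (Function.update (Fin.tail μ) i (Fin.tail μ i + μ 0) l : ℕ) =
          MvPolynomial.X (f i) ^ (μ 0 : ℕ) * ∏ l, MvPolynomial.X (f l) ^ (Fin.tail μ l : ℕ) := by
        intro i
        rw [← Finset.mul_prod_erase _ _ (Finset.mem_univ i),
          ← Finset.mul_prod_erase _ (fun l => (MvPolynomial.X (f l) : MvPolynomial (Fin n) ℂ) ^
            (Fin.tail μ l : ℕ)) (Finset.mem_univ i), Function.update_self, PNat.add_coe, pow_add]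
        rw [Finset.prod_congr rfl fun l hl => by
          rw [Function.update_of_ne (Finset.ne_of_mem_erase hl)]]
        ring
      simp only [e]
      rw [← Finset.sum_mul, ← Finset.sum_mul, ← sub_mul]
      have h1 : ∑ i, (MvPolynomial.X (f i) : MvPolynomial (Fin n) ℂ) ^ (μ 0 : ℕ) =
          ∑ j, if j ∈ Set.range f then (MvPolynomial.X j : MvPolynomial (Fin n) ℂ) ^ (μ 0 : ℕ)
            else 0 := by
        rw [← Finset.sum_filter]
        refine (Finset.sum_map Finset.univ ⟨f, hf⟩
          fun j => (MvPolynomial.X j : MvPolynomial (Fin n) ℂ) ^ (μ 0 : ℕ)).symm.trans ?_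
        refine Finset.sum_congr ?_ fun _ _ => rfl
        ext j; simp
      rw [h1, ← Finset.sum_sub_distrib, Finset.sum_mul]
      refine Finset.sum_congr rfl fun j _ => ?_
      by_cases hj : j ∈ Set.range f
      · rw [if_pos hj, if_neg (not_not.2 hj), sub_self, zero_mul]
      · rw [if_neg hj, if_pos hj, sub_zero]; rfl
    · simp [hf]

theorem hasDegree_augSym (k : ℕ) (μ : Fin k → ℕ+) : HasDegree (augSym k μ) (∑ i, (μ i : ℕ)) := by
  induction k with
  | zero => exact MvPolynomial.isWeightedHomogeneous_one _ _
  | succ k ih =>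
    rw [augSym, Fin.sum_univ_succ]
    refine MvPolynomial.IsWeightedHomogeneous.sub
      (MvPolynomial.IsWeightedHomogeneous.mul (MvPolynomial.isWeightedHomogeneous_X _ _ _)
        (ih (Fin.tail μ))) (HasDegree.sum _ fun i _ => ?_)
    have := ih (Function.update (Fin.tail μ) i (Fin.tail μ i + μ 0))
    have e : ∑ l, (Function.update (Fin.tail μ) i (Fin.tail μ i + μ 0) l : ℕ) =
        μ 0 + ∑ l, (μ (Fin.succ l) : ℕ) := by
      rw [← Finset.add_sum_erase _ _ (Finset.mem_univ i),
        ← Finset.add_sum_erase _ (fun l => (μ (Fin.succ l) : ℕ)) (Finset.mem_univ i),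
        Function.update_self, PNat.add_coe]
      rw [Finset.sum_congr rfl fun l hl => by
          rw [Function.update_of_ne (Finset.ne_of_mem_erase hl)]]
      simp only [Fin.tail]
      ring
    rwa [e] at this

/-- The parts of a partition in decreasing order. -/
def partFn {d : ℕ} (κ : d.Partition) (i : Fin (Multiset.card κ.parts)) : ℕ+ :=
  ⟨(κ.parts.sort (· ≥ ·))[(i : ℕ)]'(by rw [length_sort_parts]; exact i.2),
    κ.parts_pos (Multiset.mem_sort _ |>.1 (List.getElem_mem _))⟩

theorem map_partFn {d : ℕ} (κ : d.Partition) :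
    (Finset.univ.val.map fun i => (partFn κ i : ℕ)) = κ.parts := by
  rw [Fin.univ_val_map]
  conv_rhs => rw [← Multiset.sort_eq κ.parts (· ≥ ·)]
  congr 1
  exact List.ext_getElem (by simp) fun i h1 h2 => by simp [partFn]

theorem sum_partFn {d : ℕ} (κ : d.Partition) : ∑ i, (partFn κ i : ℕ) = d :=
  (congrArg Multiset.sum (map_partFn κ)).trans κ.parts_sum

/-- The exponent of `∏_i x_{f i}^{μ_i}`. -/
def expOf {n k : ℕ} (μ : Fin k → ℕ+) (f : Fin k → Fin n) : Fin n →₀ ℕ :=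
  ∑ i, Finsupp.single (f i) (μ i : ℕ)

theorem expOf_apply {n k : ℕ} (μ : Fin k → ℕ+) {f : Fin k → Fin n} (hf : Function.Injective f)
    (i : Fin k) : expOf μ f (f i) = μ i := by
  rw [expOf, Finsupp.finsetSum_apply, Finset.sum_eq_single i]
  · simp
  · intro j _ hj; simp [hf.ne hj]
  · simp

theorem expOf_apply_of_notMem {n k : ℕ} (μ : Fin k → ℕ+) {f : Fin k → Fin n} {x : Fin n}
    (hx : ∀ i, f i ≠ x) : expOf μ f x = 0 := by
  rw [expOf, Finsupp.finsetSum_apply]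
  exact Finset.sum_eq_zero fun i _ => by simp [hx i]

theorem expParts_expOf {n d : ℕ} (κ : d.Partition) {f : Fin (Multiset.card κ.parts) → Fin n}
    (hf : Function.Injective f) : expParts (expOf (partFn κ) f) = κ.parts := by
  have h1 : (Finset.univ.filter fun x => expOf (partFn κ) f x ≠ 0) = Finset.univ.map ⟨f, hf⟩ := by
    ext x
    simp only [Finset.mem_filter, Finset.mem_univ, true_and, Finset.mem_map,
      Function.Embedding.coeFn_mk]
    constructor
    · intro h
      by_contra hcon
      push Not at hcon
      exact h (expOf_apply_of_notMem _ hcon)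
    · rintro ⟨i, rfl⟩
      rw [expOf_apply _ hf]; exact (partFn κ i).ne_zero
  have h2 : expParts (expOf (partFn κ) f) =
      (Finset.univ.filter fun x => expOf (partFn κ) f x ≠ 0).val.map (expOf (partFn κ) f) := by
    rw [expParts, Multiset.filter_map]; rfl
  rw [h2, h1, Finset.map_val, Multiset.map_map]
  exact (Multiset.map_congr rfl fun i _ => expOf_apply _ hf i).trans (map_partFn κ)

-- The injections with a given exponent are obtained from one of them by exactly those permutations
-- that preserve the parts, so every coefficient is the order of this stabilizer or zero.
open Classical in
theorem coeff_toVars_augSym (n : ℕ) {d : ℕ} (κ : d.Partition) :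
    toVars n (augSym _ (partFn κ)) = ((Finset.univ.filter
      fun σ : Equiv.Perm (Fin (Multiset.card κ.parts)) => ∀ i, partFn κ (σ i) = partFn κ i).card : ℂ) •
        msymm (Fin n) ℂ κ := by
  ext α
  have hmon : ∀ f : Fin (Multiset.card κ.parts) → Fin n,
      ∏ i, (MvPolynomial.X (f i) : MvPolynomial (Fin n) ℂ) ^ (partFn κ i : ℕ) =
        monomial (expOf (partFn κ) f) 1 := by
    intro f
    rw [expOf, MvPolynomial.monomial_sum_one]
    exact Finset.prod_congr rfl fun i _ => MvPolynomial.X_pow_eq_monomial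
  rw [toVars_augSym, MvPolynomial.coeff_sum, MvPolynomial.coeff_smul, coeff_msymm]
  have e : ∀ f : Fin (Multiset.card κ.parts) → Fin n,
      coeff α (if Function.Injective f then
        ∏ i, (MvPolynomial.X (f i) : MvPolynomial (Fin n) ℂ) ^ (partFn κ i : ℕ) else 0) =
      if Function.Injective f ∧ expOf (partFn κ) f = α then 1 else 0 := by
    intro f
    by_cases hf : Function.Injective f
    · rw [if_pos hf, hmon, MvPolynomial.coeff_monomial]; simp [hf]
    · simp [hf]
  rw [Finset.sum_congr rfl fun f _ => e f, Finset.sum_boole]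
  by_cases h : expParts α = κ.parts
  · rw [if_pos h, smul_eq_mul, mul_one]
    congr 1
    have hk : Multiset.card κ.parts ≤ n := h ▸ card_expParts_le α
    obtain ⟨τ, hτ⟩ := exists_perm_of_expParts (h.trans (expParts_rowOf κ hk).symm)
    set f₀ : Fin (Multiset.card κ.parts) → Fin n := fun i => τ.symm (Fin.castLE hk i)
    have hf₀ : Function.Injective f₀ :=
      τ.symm.injective.comp (Fin.castLE_injective hk)
    have hαf : ∀ i, α (f₀ i) = partFn κ i := by
      intro i
      have : α (f₀ i) = rowOf n κ (Fin.castLE hk i) := by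
        have := congrFun hτ (f₀ i)
        simpa [f₀] using this
      rw [this, rowOf_apply, Fin.val_castLE, List.getD_eq_getElem _ _
        (by rw [length_sort_parts]; exact i.2)]
      rfl
    have hα0 : ∀ x, (∀ i, f₀ i ≠ x) → α x = 0 := by
      intro x hx
      have h1 := congrFun hτ x
      rw [h1, Function.comp_apply, rowOf_apply]
      refine List.getD_eq_default _ _ ?_
      rw [length_sort_parts]
      by_contra hlt
      exact hx ⟨_, not_le.1 hlt⟩ (by simp [f₀, Fin.castLE])
    have hα : ∀ f : Fin (Multiset.card κ.parts) → Fin n, Function.Injective f →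
        (∀ i, α (f i) = partFn κ i) → (∀ x, (∀ i, f i ≠ x) → α x = 0) →
        expOf (partFn κ) f = α := by
      intro f hf h1 h2
      ext x
      by_cases hx : ∃ i, f i = x
      · obtain ⟨i, rfl⟩ := hx
        rw [expOf_apply _ hf, h1]
      · push Not at hx
        rw [expOf_apply_of_notMem _ hx, h2 x hx]
    symm
    refine Finset.card_bij (fun σ _ => f₀ ∘ σ) ?_ ?_ ?_
    · intro σ hσ
      simp only [Finset.mem_filter, Finset.mem_univ, true_and] at hσ ⊢
      refine ⟨hf₀.comp σ.injective, hα _ (hf₀.comp σ.injective) (fun i => ?_) fun x hx => ?_⟩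
      · rw [Function.comp_apply, hαf, hσ]
      · exact hα0 x fun i => by simpa using hx (σ.symm i)
    · intro σ _ σ' _ hs
      ext1 i
      exact hf₀ (congrFun hs i)
    · intro f hf
      simp only [Finset.mem_filter, Finset.mem_univ, true_and] at hf
      obtain ⟨hfi, hfe⟩ := hf
      have hex : ∀ i, ∃ j, f₀ j = f i := by
        intro i
        by_contra hcon
        push Not at hcon
        have h1 := hα0 _ hcon
        rw [← hfe, expOf_apply _ hfi] at h1
        exact (partFn κ i).ne_zero h1
      choose s hs using hex
      have hsi : Function.Injective s := fun i j hij => hfi (by rw [← hs, ← hs, hij])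
      refine ⟨Equiv.ofBijective s (Finite.injective_iff_bijective.1 hsi), ?_, ?_⟩
      · simp only [Finset.mem_filter, Finset.mem_univ, true_and, Equiv.ofBijective_apply]
        intro i
        refine PNat.eq ?_
        rw [← hαf, hs, ← hfe, expOf_apply _ hfi]
      · funext i; exact hs i
  · rw [if_neg h, smul_zero, Nat.cast_eq_zero, Finset.card_eq_zero, Finset.filter_eq_empty_iff]
    rintro f - ⟨hf, he⟩
    exact h (he ▸ expParts_expOf κ hf)

/-- The monomial symmetric functions exist. -/
theorem exists_monoSym {d : ℕ} (κ : d.Partition) :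
    ∃ M : SymFun, HasDegree M d ∧ ∀ n, toVars n M = msymm (Fin n) ℂ κ := by
  classical
  set N : ℂ := ((Finset.univ.filter fun σ : Equiv.Perm (Fin (Multiset.card κ.parts)) =>
    ∀ i, partFn κ (σ i) = partFn κ i).card : ℂ) with hN
  have hN0 : N ≠ 0 := by
    rw [hN, Nat.cast_ne_zero, Finset.card_ne_zero]
    exact ⟨1, by simp⟩
  refine ⟨N⁻¹ • augSym _ (partFn κ), ?_, fun n => ?_⟩
  · have := hasDegree_augSym _ (partFn κ)
    rw [sum_partFn] at this
    exact this.smul _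
  · rw [toVars_smul, coeff_toVars_augSym, smul_smul, inv_mul_cancel₀ hN0, one_smul]

/-- The monomial symmetric function `m_κ`. -/
def monoSym {d : ℕ} (κ : d.Partition) : SymFun := (exists_monoSym κ).choose

theorem hasDegree_monoSym {d : ℕ} (κ : d.Partition) : HasDegree (monoSym κ) d :=
  (exists_monoSym κ).choose_spec.1

theorem toVars_monoSym {d : ℕ} (κ : d.Partition) (n : ℕ) :
    toVars n (monoSym κ) = msymm (Fin n) ℂ κ := (exists_monoSym κ).choose_spec.2 n

/-! ### Values of symmetric functions -/

theorem evalAt_smul {n : ℕ} (a : ℂ) (f : SymFun) (x : Fin n → ℂ) :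
    evalAt (a • f) x = a * evalAt f x := by simp [evalAt, toVars]

theorem evalAt_sum {n : ℕ} {κ : Type*} (s : Finset κ) (f : κ → SymFun) (x : Fin n → ℂ) :
    evalAt (∑ k ∈ s, f k) x = ∑ k ∈ s, evalAt (f k) x := by simp [evalAt, toVars]

/-- The value of `p_r`. -/
def powSum {n : ℕ} (r : ℕ) (x : Fin n → ℂ) : ℂ := ∑ i, x i ^ r

theorem evalAt_monomial {n : ℕ} (m : ℕ+ →₀ ℕ) (x : Fin n → ℂ) :
    evalAt (monomial m 1) x = m.prod fun r k => powSum (r : ℕ) x ^ k := by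
  rw [evalAt, toVars, MvPolynomial.aeval_monomial, map_one, one_mul, Finsupp.prod, map_prod]
  refine Finset.prod_congr rfl fun r _ => ?_
  rw [map_pow, psum, map_sum]
  simp [powSum]

theorem powSum_smul {n : ℕ} (r : ℕ) (s : ℂ) (x : Fin n → ℂ) :
    powSum r (fun i => s * x i) = s ^ r * powSum r x := by
  simp only [powSum, mul_pow, Finset.mul_sum]

theorem evalAt_monomial_smul {n : ℕ} (m : ℕ+ →₀ ℕ) (s : ℂ) (x : Fin n → ℂ) :
    evalAt (monomial m 1) (fun i => s * x i) =
      s ^ Finsupp.weight (fun r : ℕ+ => (r : ℕ)) m * evalAt (monomial m 1) x := by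
  rw [evalAt_monomial, evalAt_monomial, weight_pnat, Finsupp.sum, ← Finset.prod_pow_eq_pow_sum,
    Finsupp.prod, Finsupp.prod, ← Finset.prod_mul_distrib]
  refine Finset.prod_congr rfl fun r _ => ?_
  rw [powSum_smul, mul_pow, ← pow_mul, mul_comm (r : ℕ)]

theorem HasDegree.evalAt_smul {f : SymFun} {d : ℕ} (h : HasDegree f d) {n : ℕ} (s : ℂ)
    (x : Fin n → ℂ) : evalAt f (fun i => s * x i) = s ^ d * evalAt f x := by
  rw [h.eq_sum, evalAt_sum, evalAt_sum, Finset.mul_sum]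
  refine Finset.sum_congr rfl fun m hm => ?_
  rw [MacdonaldBoson.evalAt_smul, MacdonaldBoson.evalAt_smul, evalAt_monomial_smul, mem_wtSet.1 hm]
  ring

theorem evalAt_perm {n : ℕ} (f : SymFun) (x : Fin n → ℂ) (σ : Equiv.Perm (Fin n)) :
    evalAt f (fun i => x (σ i)) = evalAt f x := by
  have := congrArg (eval x) (toVars_isSymmetric n f σ)
  rw [MvPolynomial.eval_rename] at this
  exact this

/-! ### The reproducing kernel -/

theorem hasSum_expProd_exp {ι : Type*} [DecidableEq ι] {c : ι → ℂ} {C : ℂ} (hc : HasSum c C) :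
    HasSum (fun m : ι →₀ ℕ => m.prod fun i k => c i ^ k / (k.factorial : ℂ)) (Complex.exp C) ∧
    Summable fun m : ι →₀ ℕ => ‖m.prod fun i k => c i ^ k / (k.factorial : ℂ)‖ := by
  have h1 : ∀ i ∉ (∅ : Finset ι), (fun k : ℕ => c i ^ k / (k.factorial : ℂ)) 0 = 1 := by simp
  have hg : ∀ i, Summable fun k : ℕ => ‖c i ^ k / (k.factorial : ℂ)‖ :=
    fun i => (hasSum_pow_div_factorial (c i)).summable.norm
  have hs : Summable fun i => ∑' k : ℕ, ‖c i ^ (k + 1) / ((k + 1).factorial : ℂ)‖ := by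
    refine Summable.of_norm_bounded_eventually (g := fun i => 2 * ‖c i‖) (hc.summable.norm.mul_left 2) ?_
    have hev : ∀ᶠ i in cofinite, ‖c i‖ < 1 / 2 := by
      have := hc.summable.norm.tendsto_cofinite_zero
      exact this.eventually (gt_mem_nhds (by norm_num))
    filter_upwards [hev] with i hi
    have hgeo : HasSum (fun k : ℕ => ‖c i‖ * ‖c i‖ ^ k) (‖c i‖ * (1 - ‖c i‖)⁻¹) :=
      (hasSum_geometric_of_lt_one (norm_nonneg _) (by linarith)).mul_left _
    have hle : ∀ k : ℕ, ‖c i ^ (k + 1) / ((k + 1).factorial : ℂ)‖ ≤ ‖c i‖ * ‖c i‖ ^ k := by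
      intro k
      rw [norm_div, norm_pow, pow_succ', Complex.norm_natCast]
      exact div_le_self (by positivity) (by exact_mod_cast Nat.succ_le_of_lt (Nat.factorial_pos _))
    rw [Real.norm_of_nonneg (tsum_nonneg fun k => norm_nonneg _)]
    have h2 := (Summable.of_nonneg_of_le (fun k => norm_nonneg _) hle hgeo.summable).tsum_le_tsum hle
      hgeo.summable
    rw [hgeo.tsum_eq] at h2
    refine h2.trans ?_
    rw [mul_comm]
    refine mul_le_mul_of_nonneg_right ?_ (norm_nonneg _)
    rw [inv_le_comm₀ (by linarith) (by norm_num)]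
    linarith
  have e : ∀ m : ι →₀ ℕ, expProd ∅ (fun i k => c i ^ k / (k.factorial : ℂ)) m =
      m.prod fun i k => c i ^ k / (k.factorial : ℂ) := fun m => by
    rw [expProd, Finset.empty_union]; rfl
  have hn := summable_norm_expProd h1 hg hs
  have hp := hasProd_tsum_expProd h1 hg hs
  simp only [e] at hn hp
  have hp2 : HasProd (fun i => Complex.exp (c i)) (Complex.exp C) := hc.cexp
  have e2 : (fun i => ∑' k : ℕ, c i ^ k / (k.factorial : ℂ)) = fun i => Complex.exp (c i) :=
    funext fun i => (hasSum_pow_div_factorial (c i)).tsum_eq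
  rw [e2] at hp
  rw [← hp.unique hp2] at *
  exact ⟨hn.of_norm.hasSum, hn⟩

/-- `Π(x, y) = ∏_{i,j} (t x_i y_j; q)_∞ / (x_i y_j; q)_∞`. -/
def kernelPi (q t : ℂ) {n m : ℕ} (x : Fin n → ℂ) (y : Fin m → ℂ) : ℂ :=
  ∏ i, ∏ j, qPoch (t * (x i * y j)) q / qPoch (x i * y j) q

theorem prod_div_zqt {q t : ℂ} {n k : ℕ} (x : Fin n → ℂ) (y : Fin k → ℂ) (m : ℕ+ →₀ ℕ) :
    evalAt (monomial m 1) x * evalAt (monomial m 1) y / zqt q t m =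
      m.prod fun r k => ((1 - t ^ (r : ℕ)) / ((r : ℕ) : ℂ) * (powSum (r : ℕ) x * powSum (r : ℕ) y) /
        (1 - q ^ (r : ℕ))) ^ k / (k.factorial : ℂ) := by
  rw [evalAt_monomial, evalAt_monomial, zqt, Finsupp.prod, Finsupp.prod, Finsupp.prod, Finsupp.prod,
    ← Finset.prod_mul_distrib, ← Finset.prod_div_distrib]
  refine Finset.prod_congr rfl fun r _ => ?_
  simp only [mul_pow, div_eq_mul_inv, mul_inv, inv_inv, inv_pow]
  ring

/-- The logarithm of the kernel is `∑_r (1 - t^r) / (r (1 - q^r)) p_r(x) p_r(y)`; expanding its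
exponential over all exponents produces the denominators `z_κ(q,t)`. -/
theorem hasSum_kernelPi {q : ℝ} (hq0 : 0 < q) (hq1 : q < 1) {t : ℂ} (ht : ‖t‖ < 1) {n k : ℕ}
    {x : Fin n → ℂ} {y : Fin k → ℂ} (h : ∀ i j, ‖x i * y j‖ < 1) :
    HasSum (fun m : ℕ+ →₀ ℕ => evalAt (monomial m 1) x * evalAt (monomial m 1) y / zqt q t m)
      (kernelPi q t x y) := by
  choose S hS hS' using fun i j => hasSum_log_qPoch_div hq0 hq1 ht (h i j)
  have h1 : HasSum (fun r : ℕ+ => (1 - t ^ (r : ℕ)) / ((r : ℕ) : ℂ) *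
      (powSum (r : ℕ) x * powSum (r : ℕ) y) / (1 - (q : ℂ) ^ (r : ℕ))) (∑ i, ∑ j, S i j) := by
    refine (hasSum_sum fun i _ => hasSum_sum fun j _ => hS i j).of_eq (fun r => ?_) rfl
    rw [powSum, powSum, Finset.sum_mul_sum, Finset.mul_sum, Finset.sum_div]
    refine Finset.sum_congr rfl fun i _ => ?_
    rw [Finset.mul_sum, Finset.sum_div]
    exact Finset.sum_congr rfl fun j _ => by rw [mul_pow]
  refine (hasSum_expProd_exp h1).1.of_eq (fun m => (prod_div_zqt x y m).symm) ?_
  rw [kernelPi, Complex.exp_sum]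
  refine Finset.prod_congr rfl fun i _ => ?_
  rw [Complex.exp_sum]
  exact Finset.prod_congr rfl fun j _ => hS' i j

/-- The part of degree `d` of the kernel `Π(x, y)`. -/
def kernelDeg (q t : ℂ) (d : ℕ) {n m : ℕ} (x : Fin n → ℂ) (y : Fin m → ℂ) : ℂ :=
  ∑ m ∈ wtSet d, evalAt (monomial m 1) x * evalAt (monomial m 1) y / zqt q t m

theorem hasSum_kernelDeg {q : ℝ} (hq0 : 0 < q) (hq1 : q < 1) {t : ℂ} (ht : ‖t‖ < 1) {n k : ℕ}
    {x : Fin n → ℂ} {y : Fin k → ℂ} (h : ∀ i j, ‖x i * y j‖ < 1) :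
    HasSum (fun d => kernelDeg q t d x y) (kernelPi q t x y) := by
  set F : (ℕ+ →₀ ℕ) → ℂ := fun m =>
    evalAt (monomial m 1) x * evalAt (monomial m 1) y / zqt q t m with hF
  set w : (ℕ+ →₀ ℕ) → ℕ := fun m => Finsupp.weight (fun r : ℕ+ => (r : ℕ)) m with hw
  have h1 : HasSum F (kernelPi q t x y) := hasSum_kernelPi hq0 hq1 ht h
  have h2 : HasSum (F ∘ Equiv.sigmaFiberEquiv w) (kernelPi q t x y) :=
    (Equiv.sigmaFiberEquiv w).hasSum_iff.2 h1
  refine HasSum.sigma h2 fun d => ?_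
  have h3 : HasSum (fun m : wtSet d => F m.1) (∑ m ∈ wtSet d, F m) := Finset.hasSum (wtSet d) F
  have e : ∀ m, m ∈ wtSet d ↔ w m = d := fun m => mem_wtSet
  exact (Equiv.subtypeEquivRight e).hasSum_iff.1 h3

theorem qPoch_mul_q {q : ℝ} (hq0 : 0 < q) (hq1 : q < 1) (u : ℂ) :
    qPoch u q = (1 - u) * qPoch (u * q) q := by
  have hm' : Multipliable fun k : ℕ => (1 - u * (q : ℂ) ^ (k + 1)) := by
    have := multipliable_one_add_of_summable (f := fun k : ℕ => -(u * (q : ℂ) ^ (k + 1))) (by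
      have h := ((summable_geometric_of_lt_one hq0.le hq1).mul_left ‖u * q‖)
      refine h.congr fun k => ?_
      rw [norm_neg, norm_mul, norm_mul, norm_pow, pow_succ, Complex.norm_real,
        Real.norm_of_nonneg hq0.le]
      ring)
    simpa only [sub_eq_add_neg] using this
  rw [qPoch, tprod_eq_zero_mul' (f := fun k : ℕ => 1 - u * (q : ℂ) ^ k) hm', qPoch]
  congr 1
  · simp
  · exact tprod_congr fun k => by ring

/-! ### Cauchy's determinant and the kernel identity -/

/-- `∏_{k ≠ j} (1 - y_k T)`. -/
def cauchyNum {n : ℕ} (y : Fin n → ℂ) (j : Fin n) : Polynomial ℂ :=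
  ∏ k ∈ Finset.univ.erase j, (1 - Polynomial.C (y k) * Polynomial.X)

theorem natDegree_cauchyNum {n : ℕ} (y : Fin n → ℂ) (j : Fin n) : (cauchyNum y j).natDegree < n := by
  have h : (cauchyNum y j).natDegree ≤ ∑ _k ∈ (Finset.univ : Finset (Fin n)).erase j, 1 := by
    refine (Polynomial.natDegree_prod_le _ _).trans (Finset.sum_le_sum fun k _ => ?_)
    compute_degree
  have := j.pos
  simp at h
  omega

/-- The factor `K(y)` in `det(∏_{k ≠ j} (1 - x_i y_k)) = V(x) K(y)`. -/
def cauchyK {n : ℕ} (y : Fin n → ℂ) : ℂ :=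
  (Matrix.of fun k j : Fin n => (-1) ^ (k : ℕ) * (cauchyNum y j).coeff k).det

/-- The columns are values of polynomials of degree below `n`, so the matrix is a Vandermonde matrix
times a coefficient matrix; the signs arise because the Vandermonde matrix is taken at `-x`. -/
theorem det_cauchyNum {n : ℕ} (x y : Fin n → ℂ) :
    (Matrix.of fun i j => (cauchyNum y j).eval (x i)).det = vd x * cauchyK y := by
  rw [vd_eq_det, cauchyK, ← Matrix.det_mul]
  congr 1
  ext i j
  rw [Matrix.of_apply, Polynomial.eval_eq_sum_range' (natDegree_cauchyNum y j), Matrix.mul_apply,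
    ← Fin.sum_univ_eq_sum_range fun k => (cauchyNum y j).coeff k * x i ^ k]
  refine Finset.sum_congr rfl fun k _ => ?_
  rw [Matrix.vandermonde_apply, Matrix.of_apply, neg_pow]
  have : ((-1 : ℂ) ^ (k : ℕ)) * (-1) ^ (k : ℕ) = 1 := by rw [← mul_pow]; simp
  linear_combination (-(cauchyNum y j).coeff k * x i ^ (k : ℕ)) * this

theorem eval_cauchyNum {n : ℕ} (y : Fin n → ℂ) (j : Fin n) (x : ℂ) :
    (cauchyNum y j).eval x = ∏ k ∈ Finset.univ.erase j, (1 - y k * x) := by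
  simp [cauchyNum, Polynomial.eval_prod]

/-- At `x_i = 1 / y_i` the matrix becomes diagonal with nonzero entries, so no explicit formula for
the factor is needed. -/
theorem cauchyK_ne_zero {n : ℕ} {y : Fin n → ℂ} (hy : Function.Injective y) (h0 : ∀ i, y i ≠ 0) :
    cauchyK y ≠ 0 := by
  have h := det_cauchyNum (fun i => (y i)⁻¹) y
  have hd : (Matrix.of fun i j => (cauchyNum y j).eval ((y i)⁻¹)) =
      Matrix.diagonal fun i => (cauchyNum y i).eval ((y i)⁻¹) := by
    ext i j
    by_cases hij : i = j
    · subst hij; simp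
    · rw [Matrix.diagonal_apply_ne _ hij, Matrix.of_apply, eval_cauchyNum]
      exact Finset.prod_eq_zero (Finset.mem_erase.2 ⟨hij, Finset.mem_univ _⟩) (by simp [h0])
  rw [hd, Matrix.det_diagonal] at h
  intro hK
  rw [hK, mul_zero, Finset.prod_eq_zero_iff] at h
  obtain ⟨i, -, hi⟩ := h
  rw [eval_cauchyNum, Finset.prod_eq_zero_iff] at hi
  obtain ⟨k, hk, hk'⟩ := hi
  refine Finset.ne_of_mem_erase hk (hy ?_)
  have := h0 i
  field_simp at hk'
  linear_combination -hk'

/-- The Cauchy determinant. -/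
theorem det_cauchy {n : ℕ} (x y : Fin n → ℂ) (h : ∀ i j, 1 - x i * y j ≠ 0) :
    (∏ i, ∏ j, (1 - x i * y j)) * (Matrix.of fun i j => 1 / (1 - x i * y j)).det =
      vd x * cauchyK y := by
  rw [← det_cauchyNum, ← Matrix.det_mul_column]
  congr 1
  ext i j
  rw [Matrix.of_apply, Matrix.of_apply, Matrix.of_apply, eval_cauchyNum,
    ← Finset.mul_prod_erase _ _ (Finset.mem_univ j)]
  have := h i j
  field_simp

/-- Transposition exchanges `x` and `y` in the Cauchy matrix. This symmetry stands in for the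
explicit value of `cauchyK`. -/
theorem det_cauchy_symm {n : ℕ} (s : ℂ) (x y : Fin n → ℂ) (h : ∀ i j, 1 - x i * (s * y j) ≠ 0) :
    vd x * cauchyK (fun j => s * y j) = vd y * cauchyK (fun j => s * x j) := by
  rw [← det_cauchy x _ h, ← det_cauchy y _ fun i j => by
      have := h j i
      rwa [show y i * (s * x j) = x j * (s * y i) by ring],
    Finset.prod_comm, ← Matrix.det_transpose]
  congr 1
  · exact Finset.prod_congr rfl fun i _ => Finset.prod_congr rfl fun j _ => by ring
  · refine congrArg Matrix.det ?_
    ext i j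
    simp only [Matrix.transpose_apply, Matrix.of_apply]
    congr 2; ring

theorem det_add_smul {n : ℕ} (X : ℂ) (A B : Fin n → Fin n → ℂ) :
    (Matrix.of fun i j => A i j + X * B i j).det =
      ∑ I : Finset (Fin n), X ^ I.card * (Matrix.of fun i j => if i ∈ I then B i j else A i j).det := by
  have h := (Matrix.detRowAlternating (R := ℂ) (n := Fin n)).toMultilinearMap.map_add_univ
    (fun i j => X * B i j) A
  have e : (Matrix.of fun i j => A i j + X * B i j) = (fun i j => X * B i j) + A := by
    ext i j; simp [add_comm]
  rw [e]
  refine h.trans (Finset.sum_congr rfl fun I _ => ?_)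
  have e2 : X ^ I.card = ∏ i, if i ∈ I then X else 1 := by simp
  rw [e2, ← Matrix.det_mul_column]
  refine congrArg Matrix.det ?_
  funext i j
  by_cases hi : i ∈ I <;> simp [Finset.piecewise, hi]

/-- By `(u; q)_∞ = (1 - u)(qu; q)_∞`, replacing `x_i` by `q x_i` multiplies the factor of the kernel
at `u = x_i y_j` by `(1 - u) / (1 - t u)`. -/
theorem kernelPi_shift {q : ℝ} (hq0 : 0 < q) (hq1 : q < 1) {t : ℂ} {n : ℕ}
    {x y : Fin n → ℂ} (h : ∀ i j, ‖x i * y j‖ < 1) (I : Finset (Fin n)) :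
    (∏ i, ∏ j, (1 - onSet I t i * x i * y j)) * kernelPi q t (fun i => onSet I q i * x i) y =
      (∏ i, ∏ j, (1 - x i * y j)) * kernelPi q t x y := by
  simp only [kernelPi, ← Finset.prod_mul_distrib]
  refine Finset.prod_congr rfl fun i _ => Finset.prod_congr rfl fun j _ => ?_
  by_cases hi : i ∈ I
  · simp only [onSet, if_pos hi]
    have h1 := qPoch_mul_q hq0 hq1 (t * (x i * y j))
    have h2 := qPoch_mul_q hq0 hq1 (x i * y j)
    have h3 : qPoch (x i * y j) q ≠ 0 := qPoch_ne_zero hq0 hq1 (h i j)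
    have e1 : t * (↑q * x i * y j) = t * (x i * y j) * q := by ring
    have e2 : ↑q * x i * y j = x i * y j * q := by ring
    rw [e1, e2]
    rw [h2] at h3
    rw [h1, h2]
    have h4 := right_ne_zero_of_mul h3
    have h5 := left_ne_zero_of_mul h3
    field_simp
  · simp only [onSet, if_neg hi, one_mul]

/-- Symmetry of the kernel under Macdonald's operator. -/
theorem kernelPi_macN {q : ℝ} (hq0 : 0 < q) (hq1 : q < 1) {t : ℂ} (ht : ‖t‖ < 1) (X : ℂ) {n : ℕ}
    {x y : Fin n → ℂ} (h : ∀ i j, ‖x i * y j‖ < 1) :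
    cauchyK y * ∑ I : Finset (Fin n), X ^ I.card * (vd (fun i => onSet I t i * x i) *
        kernelPi q t (fun i => onSet I q i * x i) y) =
      (∏ i, ∏ j, (1 - x i * y j)) * kernelPi q t x y *
        (Matrix.of fun i j => 1 / (1 - x i * y j) + X * (1 / (1 - t * (x i * y j)))).det := by
  rw [det_add_smul, Finset.mul_sum, Finset.mul_sum]
  refine Finset.sum_congr rfl fun I _ => ?_
  have hne : ∀ i j, 1 - onSet I t i * x i * y j ≠ 0 := by
    intro i j
    refine one_sub_ne_zero_of_norm_lt ?_
    rw [mul_assoc, norm_mul]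
    have : ‖onSet I t i‖ ≤ 1 := by
      simp only [onSet]; split_ifs
      · exact ht.le
      · simp
    nlinarith [h i j, norm_nonneg (x i * y j), norm_nonneg (onSet I t i)]
  have h1 := det_cauchy (fun i => onSet I t i * x i) y hne
  have h2 := kernelPi_shift hq0 hq1 (t := t) h I
  have h3 : (Matrix.of fun i j => if i ∈ I then 1 / (1 - t * (x i * y j)) else 1 / (1 - x i * y j)) =
      Matrix.of fun i j => 1 / (1 - onSet I t i * x i * y j) := by
    ext i j
    by_cases hi : i ∈ I <;> simp [onSet, hi, mul_assoc]
  rw [h3, ← h2]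
  linear_combination (-(X ^ I.card * kernelPi (q : ℂ) t (fun i => onSet I q i * x i) y)) * h1

/-! ### The kernel identity in each degree -/

/-- The point `s = 0` is excluded from the hypothesis; multiplying the series by `s` supplies it,
which is why the coefficients are shifted by one. -/
theorem eq_zero_of_hasSum_pow {a : ℕ → ℂ} {r : ℝ} (hr : 0 < r)
    (h : ∀ s : ℂ, s ≠ 0 → ‖s‖ < r → HasSum (fun k => a k * s ^ k) 0) (k : ℕ) : a k = 0 := by
  set b : ℕ → ℂ := fun k => if k = 0 then 0 else a (k - 1) with hb
  have h1 : ∀ s : ℂ, ‖s‖ < r → HasSum (fun k => s ^ k • b k) 0 := by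
    intro s hs
    by_cases h0 : s = 0
    · have : (fun k => s ^ k • b k) = fun _ => 0 := by
        funext k
        cases k with
        | zero => simp [hb]
        | succ k => simp [h0]
      rw [this]; exact hasSum_zero
    · rw [← hasSum_nat_add_iff' 1]
      refine ((h s h0 hs).mul_left s).of_eq (fun k => ?_) (by simp [hb])
      simp [hb, pow_succ]; ring
  have h2 : HasFPowerSeriesAt (fun _ : ℂ => (0 : ℂ)) (FormalMultilinearSeries.ofScalars ℂ b) 0 := by
    rw [hasFPowerSeriesAt_iff]
    filter_upwards [Metric.ball_mem_nhds (0 : ℂ) hr] with s hs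
    simpa only [FormalMultilinearSeries.coeff_ofScalars] using h1 s (by simpa using hs)
  have h3 : FormalMultilinearSeries.ofScalars ℂ b = 0 := HasFPowerSeriesAt.eq_zero h2
  have h4 : (FormalMultilinearSeries.ofScalars ℂ b).coeff (k + 1) = 0 := by rw [h3]; rfl
  rw [FormalMultilinearSeries.coeff_ofScalars] at h4
  simpa [hb] using h4

theorem kernelDeg_smul_right (q t s : ℂ) (d : ℕ) {n m : ℕ} (x : Fin n → ℂ) (y : Fin m → ℂ) :
    kernelDeg q t d x (fun j => s * y j) = s ^ d * kernelDeg q t d x y := by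
  rw [kernelDeg, kernelDeg, Finset.mul_sum]
  refine Finset.sum_congr rfl fun m hm => ?_
  rw [evalAt_monomial_smul, mem_wtSet.1 hm]; ring

theorem kernelDeg_comm (q t : ℂ) (d : ℕ) {n m : ℕ} (x : Fin n → ℂ) (y : Fin m → ℂ) :
    kernelDeg q t d x y = kernelDeg q t d y x :=
  Finset.sum_congr rfl fun m _ => by rw [mul_comm (evalAt (monomial m 1) x)]

theorem norm_onSet_le {n : ℕ} (I : Finset (Fin n)) {a : ℂ} (ha : ‖a‖ ≤ 1) (i : Fin n) :
    ‖onSet I a i‖ ≤ 1 := by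
  simp only [onSet]; split_ifs
  · exact ha
  · simp

/-- The identity for the whole kernel, a determinant symmetric in `x` and `y`, holds only where the
kernel converges. Scaling one set of variables by a small `s` and comparing coefficients of `s^d`
extends each homogeneous part to all generic points. -/
theorem kernelDeg_macN {q : ℝ} (hq0 : 0 < q) (hq1 : q < 1) {t : ℂ} (ht : ‖t‖ < 1) (X : ℂ) (d : ℕ)
    {n : ℕ} {x y : Fin n → ℂ} (hx : Function.Injective x) (hx0 : ∀ i, x i ≠ 0)
    (hy : Function.Injective y) (hy0 : ∀ i, y i ≠ 0) :
    vd y * ∑ I : Finset (Fin n), X ^ I.card * (vd (fun i => onSet I t i * x i) *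
        kernelDeg q t d (fun i => onSet I q i * x i) y) =
      vd x * ∑ I : Finset (Fin n), X ^ I.card * (vd (fun i => onSet I t i * y i) *
        kernelDeg q t d (fun i => onSet I q i * y i) x) := by
  have hqn : ‖(q : ℂ)‖ ≤ 1 := by rw [Complex.norm_real, Real.norm_of_nonneg hq0.le]; exact hq1.le
  -- Any `s` with `‖s‖ < 1 / M` brings all products `x_i s y_j` into the unit disc; the summand 1
  -- keeps `M` positive.
  set M : ℝ := 1 + ∑ i, ∑ j, ‖x i * y j‖ with hM
  have hM0 : 0 < M := by positivity
  have hMle : ∀ i j, ‖x i * y j‖ ≤ M := by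
    intro i j
    have h1 := Finset.single_le_sum (f := fun j => ‖x i * y j‖) (fun _ _ => norm_nonneg _)
      (Finset.mem_univ j)
    have h2 := Finset.single_le_sum (f := fun i => ∑ j, ‖x i * y j‖)
      (fun _ _ => Finset.sum_nonneg fun _ _ => norm_nonneg _) (Finset.mem_univ i)
    linarith
  rw [← sub_eq_zero]
  refine eq_zero_of_hasSum_pow (a := fun d => vd y * ∑ I : Finset (Fin n), X ^ I.card *
      (vd (fun i => onSet I t i * x i) * kernelDeg q t d (fun i => onSet I q i * x i) y) -
      vd x * ∑ I : Finset (Fin n), X ^ I.card * (vd (fun i => onSet I t i * y i) *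
        kernelDeg q t d (fun i => onSet I q i * y i) x)) (r := 1 / M) (by positivity)
    (fun s hs0 hs => ?_) d
  have hsm : ∀ i j, ‖x i * (s * y j)‖ < 1 := by
    intro i j
    rw [show x i * (s * y j) = s * (x i * y j) by ring, norm_mul]
    rw [lt_div_iff₀ hM0] at hs
    nlinarith [hMle i j, norm_nonneg s]
  have hsm' : ∀ i j, ‖y i * (s * x j)‖ < 1 := fun i j => by
    rw [show y i * (s * x j) = x j * (s * y i) by ring]; exact hsm j i
  have hon : ∀ (z w : Fin n → ℂ), (∀ i j, ‖z i * (s * w j)‖ < 1) → ∀ (I : Finset (Fin n)),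
      ∀ i j, ‖onSet I q i * z i * (s * w j)‖ < 1 := by
    intro z w h I i j
    rw [mul_assoc, norm_mul]
    have := norm_onSet_le I hqn i
    nlinarith [h i j, norm_nonneg (z i * (s * w j)), norm_nonneg (onSet I (q : ℂ) i)]
  have key : ∀ (z w : Fin n → ℂ), (∀ i j, ‖z i * (s * w j)‖ < 1) →
      HasSum (fun d => (∑ I : Finset (Fin n), X ^ I.card * (vd (fun i => onSet I t i * z i) *
        kernelDeg q t d (fun i => onSet I q i * z i) w)) * s ^ d)
      (∑ I : Finset (Fin n), X ^ I.card * (vd (fun i => onSet I t i * z i) *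
        kernelPi q t (fun i => onSet I q i * z i) fun j => s * w j)) := by
    intro z w h
    have h1 := hasSum_sum (s := Finset.univ) fun (I : Finset (Fin n)) _ =>
      ((hasSum_kernelDeg hq0 hq1 ht (hon z w h I)).mul_left
        (vd fun i => onSet I t i * z i)).mul_left (X ^ I.card)
    refine h1.of_eq (fun d => ?_) rfl
    rw [Finset.sum_mul]
    refine Finset.sum_congr rfl fun I _ => ?_
    rw [kernelDeg_smul_right]; ring
  refine (((key x y hsm).mul_left (vd y)).sub ((key y x hsm').mul_left (vd x))).of_eq
    (fun d => by ring) ?_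
  have e1 := kernelPi_macN hq0 hq1 ht X hsm
  have e2 := kernelPi_macN hq0 hq1 ht X hsm'
  have e3 := det_cauchy_symm s x y fun i j => one_sub_ne_zero_of_norm_lt (hsm i j)
  have hKy : cauchyK (fun j => s * y j) ≠ 0 := cauchyK_ne_zero
    (fun i j h => hy (mul_left_cancel₀ hs0 h)) fun i => mul_ne_zero hs0 (hy0 i)
  have hKx : cauchyK (fun j => s * x j) ≠ 0 := cauchyK_ne_zero
    (fun i j h => hx (mul_left_cancel₀ hs0 h)) fun i => mul_ne_zero hs0 (hx0 i)
  have e4 : (∏ i, ∏ j, (1 - x i * (s * y j))) * kernelPi q t x (fun j => s * y j) *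
        (Matrix.of fun i j => 1 / (1 - x i * (s * y j)) + X * (1 / (1 - t * (x i * (s * y j))))).det =
      (∏ i, ∏ j, (1 - y i * (s * x j))) * kernelPi q t y (fun j => s * x j) *
        (Matrix.of fun i j => 1 / (1 - y i * (s * x j)) + X * (1 / (1 - t * (y i * (s * x j))))).det := by
    have hc : ∀ i j, x i * (s * y j) = y j * (s * x i) := fun i j => by ring
    congr 1
    · congr 1
      · rw [Finset.prod_comm]
        simp only [hc]
      · rw [kernelPi, kernelPi, Finset.prod_comm]
        simp only [hc]
    · rw [← Matrix.det_transpose]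
      refine congrArg Matrix.det ?_
      ext i j
      simp only [Matrix.transpose_apply, Matrix.of_apply, hc]
  rw [sub_eq_zero]
  -- Each side is known only after multiplication by its own factor `cauchyK`; the relation between
  -- these factors lets both be cancelled.
  refine mul_left_cancel₀ (mul_ne_zero hKy hKx) ?_
  linear_combination (vd y * cauchyK (fun j => s * x j)) * (e1.trans e4) -
    vd x * cauchyK (fun j => s * y j) * e2 -
    ((∏ i, ∏ j, (1 - y i * (s * x j))) * kernelPi q t y (fun j => s * x j) *
        (Matrix.of fun i j => 1 / (1 - y i * (s * x j)) +
          X * (1 / (1 - t * (y i * (s * x j))))).det) * e3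

theorem eval_macN (q t X : ℂ) {n : ℕ} (p : MvPolynomial (Fin n) ℂ) (x : Fin n → ℂ) :
    eval x (macN q t X p) = ∑ I : Finset (Fin n), X ^ I.card *
      (vd (fun i => onSet I t i * x i) * eval (fun i => onSet I q i * x i) p) := by
  rw [macN, map_sum]
  refine Finset.sum_congr rfl fun I _ => ?_
  rw [map_mul, map_mul, eval_scaleVars, eval_scaleVars, eval_vdPoly, MvPolynomial.eval_C]

/-- The product of `p` with the Vandermonde product and all the variables vanishes everywhere, and
polynomials form a domain. -/
theorem eq_zero_of_generic {n : ℕ} {p : MvPolynomial (Fin n) ℂ}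
    (h : ∀ x : Fin n → ℂ, Function.Injective x → (∀ i, x i ≠ 0) → eval x p = 0) : p = 0 := by
  have h1 : p * (vdPoly n * ∏ i, MvPolynomial.X i) = 0 := by
    refine MvPolynomial.funext fun x => ?_
    rw [map_mul, map_mul, eval_vdPoly, map_prod, map_zero]
    by_cases hx : Function.Injective x
    · by_cases h0 : ∀ i, x i ≠ 0
      · rw [h x hx h0, zero_mul]
      · push Not at h0
        obtain ⟨i, hi⟩ := h0
        rw [Finset.prod_eq_zero (Finset.mem_univ i) (by simpa using hi), mul_zero, mul_zero]
    · rw [not_ne_iff.1 (mt vd_ne_zero_iff.1 hx), zero_mul, mul_zero]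
  refine (mul_eq_zero.1 h1).resolve_right (mul_ne_zero (vdPoly_ne_zero n) ?_)
  exact Finset.prod_ne_zero_iff.2 fun i _ => MvPolynomial.X_ne_zero i

/-! ### The bilinear form -/

theorem innerQT_eq_sum (q t : ℂ) {f : SymFun} (g : SymFun) {S : Finset (ℕ+ →₀ ℕ)}
    (h : f.support ⊆ S) : innerQT q t f g = ∑ m ∈ S, coeff m f * coeff m g * zqt q t m := by
  refine Finset.sum_subset h fun m _ hm => ?_
  rw [MvPolynomial.notMem_support_iff.1 hm, zero_mul, zero_mul]

theorem innerQT_comm (q t : ℂ) (f g : SymFun) : innerQT q t f g = innerQT q t g f := by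
  classical
  rw [innerQT_eq_sum q t g (Finset.subset_union_left (s₂ := g.support)),
    innerQT_eq_sum q t f (Finset.subset_union_right (s₁ := f.support))]
  exact Finset.sum_congr rfl fun m _ => by ring

theorem innerQT_sum_right (q t : ℂ) (f : SymFun) {κ : Type*} (s : Finset κ) (c : κ → ℂ)
    (g : κ → SymFun) :
    innerQT q t f (∑ k ∈ s, c k • g k) = ∑ k ∈ s, c k * innerQT q t f (g k) := by
  simp only [innerQT, MvPolynomial.coeff_sum, MvPolynomial.coeff_smul, smul_eq_mul, Finset.mul_sum,
    Finset.sum_mul]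
  rw [Finset.sum_comm]
  exact Finset.sum_congr rfl fun k _ => Finset.sum_congr rfl fun m _ => by ring

theorem innerQT_sum_left (q t : ℂ) (f : SymFun) {κ : Type*} (s : Finset κ) (c : κ → ℂ)
    (g : κ → SymFun) :
    innerQT q t (∑ k ∈ s, c k • g k) f = ∑ k ∈ s, c k * innerQT q t (g k) f := by
  rw [innerQT_comm, innerQT_sum_right]
  exact Finset.sum_congr rfl fun k _ => by rw [innerQT_comm]

theorem innerQT_sub_right (q t : ℂ) (f g h : SymFun) :
    innerQT q t f (g - h) = innerQT q t f g - innerQT q t f h := by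
  simp only [innerQT, MvPolynomial.coeff_sub, mul_sub, sub_mul, Finset.sum_sub_distrib]

theorem innerQT_of_degree_ne (q t : ℂ) {f g : SymFun} {d e : ℕ} (hf : HasDegree f d)
    (hg : HasDegree g e) (h : d ≠ e) : innerQT q t f g = 0 := by
  refine Finset.sum_eq_zero fun m hm => ?_
  by_cases h0 : coeff m g = 0
  · rw [h0, mul_zero, zero_mul]
  · exact absurd ((hf (MvPolynomial.mem_support_iff.1 hm)).symm.trans (hg h0)) h

theorem zqt_ne_zero {q : ℝ} (hq0 : 0 < q) (hq1 : q < 1) {t : ℂ} (ht : ‖t‖ < 1) (m : ℕ+ →₀ ℕ) :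
    zqt q t m ≠ 0 := by
  refine Finset.prod_ne_zero_iff.2 fun r _ => ?_
  have h1 : (1 : ℂ) - (q : ℂ) ^ (r : ℕ) ≠ 0 := one_sub_ne_zero_of_norm_lt (norm_qpow_lt_one hq0 hq1 r)
  have h2 : (1 : ℂ) - t ^ (r : ℕ) ≠ 0 := one_sub_ne_zero_of_norm_lt (by
    rw [norm_pow]; exact pow_lt_one₀ (norm_nonneg _) ht r.ne_zero)
  refine mul_ne_zero (mul_ne_zero (pow_ne_zero _ (by exact_mod_cast r.ne_zero))
    (by exact_mod_cast Nat.factorial_ne_zero _)) (pow_ne_zero _ (div_ne_zero h1 h2))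

/-! ### Unitriangular families -/

/-- `P_κ = m_κ + ∑_{μ < κ} u_{κ μ} m_μ` in degree `d`. -/
def IsTriangular {d : ℕ} (P : d.Partition → SymFun) : Prop :=
  ∃ u : d.Partition → d.Partition → ℂ, (∀ κ, u κ κ = 1) ∧ (∀ κ μ, u κ μ ≠ 0 → DomLE μ κ) ∧
    ∀ κ, P κ = ∑ μ, u κ μ • monoSym μ

theorem IsTriangular.hasDegree {d : ℕ} {P : d.Partition → SymFun} (h : IsTriangular P)
    (κ : d.Partition) : HasDegree (P κ) d := by
  obtain ⟨u, -, -, hP⟩ := h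
  rw [hP]
  exact HasDegree.sum _ fun μ _ => (hasDegree_monoSym μ).smul _

/-- At a dominance-maximal partition with nonzero coefficient the relation reduces to that
coefficient alone. -/
theorem eq_zero_of_unitriangular {d : ℕ} {u : d.Partition → d.Partition → ℂ} (h1 : ∀ κ, u κ κ = 1)
    (h2 : ∀ κ μ, u κ μ ≠ 0 → DomLE μ κ) (c : d.Partition → ℂ) (h : ∀ μ, ∑ κ, c κ * u κ μ = 0) :
    c = 0 := by
  by_contra hne
  obtain ⟨κ₀, hκ₀⟩ := Function.ne_iff.1 hne
  have hwf : WellFounded fun a b : d.Partition => DomLE b a ∧ b ≠ a := by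
    have i1 : IsTrans d.Partition fun a b => DomLE b a ∧ b ≠ a := ⟨fun a b c hab hbc =>
      ⟨hbc.1.trans hab.1, fun e => by subst e; exact hab.2 (hab.1.antisymm hbc.1)⟩⟩
    have i2 : Std.Irrefl fun a b : d.Partition => DomLE b a ∧ b ≠ a := ⟨fun a h => h.2 rfl⟩
    exact Finite.wellFounded_of_trans_of_irrefl _
  obtain ⟨κ, hκ, hmax⟩ := hwf.has_min {κ | c κ ≠ 0} ⟨κ₀, hκ₀⟩
  have := h κ
  rw [Fintype.sum_eq_single κ, h1, mul_one] at this
  · exact hκ this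
  · intro ν hν
    by_contra h0
    exact hmax ν (left_ne_zero_of_mul h0) ⟨h2 ν κ (right_ne_zero_of_mul h0), hν.symm⟩

theorem IsTriangular.eq_zero {d n : ℕ} {P : d.Partition → SymFun} (h : IsTriangular P) (hn : d ≤ n)
    (c : d.Partition → ℂ) (h0 : ∑ κ, c κ • toVars n (P κ) = 0) : c = 0 := by
  obtain ⟨u, hu1, hu2, hP⟩ := h
  refine eq_zero_of_unitriangular hu1 hu2 c fun μ => ?_
  refine msymm_linearIndependent hn (fun μ => ∑ κ, c κ * u κ μ) ?_ μ
  rw [← h0]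
  simp only [hP, toVars_sum, toVars_smul, toVars_monoSym, Finset.smul_sum, smul_smul, Finset.sum_smul]
  exact Finset.sum_comm

theorem IsTriangular.exists_inverse {d : ℕ} {P : d.Partition → SymFun} (h : IsTriangular P) :
    ∃ w : d.Partition → d.Partition → ℂ, (∀ κ μ, w κ μ ≠ 0 → DomLE μ κ) ∧
      ∀ κ, monoSym κ = ∑ μ, w κ μ • P μ := by
  classical
  obtain ⟨u, hu1, hu2, hP⟩ := h
  suffices H : ∀ κ : d.Partition, ∃ w : d.Partition → ℂ, (∀ μ, w μ ≠ 0 → DomLE μ κ) ∧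
      monoSym κ = ∑ μ, w μ • P μ by
    choose w h1 h2 using H
    exact ⟨w, h1, h2⟩
  intro κ
  induction κ using (DomLE.wellFounded d).induction with
  | _ κ ih =>
    choose! w hw1 hw2 using ih
    have hlt : ∀ μ, μ ≠ κ → u κ μ ≠ 0 → DomLE μ κ ∧ μ ≠ κ := fun μ h1 h2 => ⟨hu2 κ μ h2, h1⟩
    refine ⟨fun ν => (if ν = κ then 1 else 0) - ∑ μ ∈ Finset.univ.erase κ, u κ μ * w μ ν,
      fun ν hν => ?_, ?_⟩
    · by_cases h1 : ν = κ
      · rw [h1]; exact DomLE.refl κ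
      · beta_reduce at hν
        rw [if_neg h1, zero_sub, neg_ne_zero] at hν
        obtain ⟨μ, hμ, hne⟩ := Finset.exists_ne_zero_of_sum_ne_zero hν
        have h2 := hlt μ (Finset.ne_of_mem_erase hμ) (left_ne_zero_of_mul hne)
        exact (hw1 μ h2 ν (right_ne_zero_of_mul hne)).trans h2.1
    · have h1 : P κ = monoSym κ + ∑ μ ∈ Finset.univ.erase κ, u κ μ • monoSym μ := by
        rw [hP κ, ← Finset.add_sum_erase _ _ (Finset.mem_univ κ), hu1, one_smul]
      have h2 : ∑ μ ∈ Finset.univ.erase κ, u κ μ • monoSym μ =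
          ∑ ν, (∑ μ ∈ Finset.univ.erase κ, u κ μ * w μ ν) • P ν := by
        simp only [Finset.sum_smul]
        rw [Finset.sum_comm]
        refine Finset.sum_congr rfl fun μ hμ => ?_
        by_cases h0 : u κ μ = 0
        · simp [h0]
        · rw [hw2 μ (hlt μ (Finset.ne_of_mem_erase hμ) h0), Finset.smul_sum]
          simp only [smul_smul]
      simp only [sub_smul, Finset.sum_sub_distrib, ← h2, ite_smul, one_smul, zero_smul,
        Finset.sum_ite_eq', Finset.mem_univ, if_true]
      rw [h1]; abel

/-- The family is determined by orthogonality and triangularity. -/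
theorem IsTriangular.unique {q t : ℂ} {d : ℕ} {P P' : d.Partition → SymFun} (h : IsTriangular P)
    (h' : IsTriangular P') (ho : ∀ κ μ, κ ≠ μ → innerQT q t (P κ) (P μ) = 0)
    (ho' : ∀ κ μ, κ ≠ μ → innerQT q t (P' κ) (P' μ) = 0)
    (hn : ∀ κ, innerQT q t (P κ) (P κ) ≠ 0) : P' = P := by
  obtain ⟨w, hw, hwP⟩ := h.exists_inverse
  obtain ⟨w', hw', hwP'⟩ := h'.exists_inverse
  obtain ⟨u, hu1, hu2, hP⟩ := h
  obtain ⟨u', hu1', hu2', hP'⟩ := h'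
  funext κ
  rw [← sub_eq_zero]
  -- The leading terms cancel in the difference, which is therefore a combination of the `P ν` with
  -- `ν` strictly below `κ`.
  set v : d.Partition → ℂ := fun ν => ∑ μ, (u' κ μ - u κ μ) * w μ ν with hv
  have hdiff : P' κ - P κ = ∑ ν, v ν • P ν := by
    rw [hP', hP, ← Finset.sum_sub_distrib]
    simp only [hv, Finset.sum_smul, ← sub_smul]
    rw [Finset.sum_comm]
    refine Finset.sum_congr rfl fun μ _ => ?_
    simp only [mul_smul]
    rw [← Finset.smul_sum, ← hwP]
  have hvlt : ∀ ν, v ν ≠ 0 → DomLE ν κ ∧ ν ≠ κ := by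
    intro ν hν
    obtain ⟨μ, -, hne⟩ := Finset.exists_ne_zero_of_sum_ne_zero hν
    have h1 := left_ne_zero_of_mul hne
    have hμκ : μ ≠ κ := by rintro rfl; exact h1 (by rw [hu1, hu1', sub_self])
    have h2 : DomLE μ κ := by
      by_cases h3 : u κ μ = 0
      · rw [h3, sub_zero] at h1; exact hu2' κ μ h1
      · exact hu2 κ μ h3
    have h3 := hw μ ν (right_ne_zero_of_mul hne)
    exact ⟨h3.trans h2, fun e => hμκ (h2.antisymm (e ▸ h3))⟩
  -- For `ν` strictly below `κ`, the function `P ν` is a combination of `P' ρ` with `ρ ≤ ν`, and `ρ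
  -- = κ` is excluded by antisymmetry.
  have hPP' : ∀ ν, DomLE ν κ → ν ≠ κ → innerQT q t (P ν) (P' κ) = 0 := by
    intro ν h1 h2
    have e : P ν = ∑ ρ, (∑ μ, u ν μ * w' μ ρ) • P' ρ := by
      rw [hP]
      simp only [Finset.sum_smul, mul_smul]
      rw [Finset.sum_comm]
      exact Finset.sum_congr rfl fun μ _ => by rw [← Finset.smul_sum, ← hwP']
    rw [e, innerQT_sum_left]
    refine Finset.sum_eq_zero fun ρ _ => ?_
    by_cases hρ : ρ = κ
    · subst hρ
      rw [Finset.sum_eq_zero, zero_mul]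
      intro μ _
      by_contra hne
      have h3 := hu2 ν μ (left_ne_zero_of_mul hne)
      have h4 := hw' μ ρ (right_ne_zero_of_mul hne)
      exact h2 (h1.antisymm (h4.trans h3))
    · rw [ho' ρ κ hρ, mul_zero]
  have hv0 : ∀ ν, v ν = 0 := by
    intro ν
    by_contra hne
    obtain ⟨h1, h2⟩ := hvlt ν hne
    have h3 : innerQT q t (P ν) (P' κ - P κ) = 0 := by
      rw [innerQT_sub_right, hPP' ν h1 h2, ho ν κ h2, sub_zero]
    rw [hdiff, innerQT_sum_right, Fintype.sum_eq_single ν] at h3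
    · exact (mul_ne_zero hne (hn ν)) h3
    · intro μ hμ; rw [ho ν μ hμ.symm, mul_zero]
  rw [hdiff]
  simp [hv0]

/-! ### Existence of the Macdonald functions -/

theorem evalAt_eq {n : ℕ} (f : SymFun) (x : Fin n → ℂ) : evalAt f x = eval x (toVars n f) := rfl

theorem HasDegree.isHomogeneous {f : SymFun} {d : ℕ} (h : HasDegree f d) (n : ℕ) :
    (toVars n f).IsHomogeneous d := by
  refine isHomogeneous_of_scaleVars (MvPolynomial.funext fun x => ?_)
  rw [eval_scaleVars, MvPolynomial.smul_eval]
  exact h.evalAt_smul 2 x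

theorem HasDegree.eq_sum_monoSym {f : SymFun} {d : ℕ} (h : HasDegree f d) :
    f = ∑ κ : d.Partition, coeff (rowOf d κ) (toVars d f) • monoSym κ := by
  rw [← sub_eq_zero]
  refine HasDegree.eq_zero (d := d) ?_ le_rfl ?_
  · rw [sub_eq_add_neg, ← neg_one_smul ℂ]
    exact h.add (HasDegree.smul (HasDegree.sum _ fun κ _ => (hasDegree_monoSym κ).smul _) _)
  · rw [toVars_sub, toVars_sum, sub_eq_zero]
    simp only [toVars_smul, toVars_monoSym]
    exact eq_sum_msymm (toVars_isSymmetric d f) (h.isHomogeneous d)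

theorem IsTriangular.exists_expansion {d : ℕ} {P : d.Partition → SymFun} (h : IsTriangular P)
    {f : SymFun} (hf : HasDegree f d) : ∃ b : d.Partition → ℂ, f = ∑ κ, b κ • P κ := by
  obtain ⟨w, -, hw⟩ := h.exists_inverse
  refine ⟨fun μ => ∑ κ, coeff (rowOf d κ) (toVars d f) * w κ μ, ?_⟩
  conv_lhs => rw [hf.eq_sum_monoSym]
  simp only [Finset.sum_smul]
  rw [Finset.sum_comm]
  refine Finset.sum_congr rfl fun κ _ => ?_
  conv_lhs => rw [hw κ]
  simp only [Finset.smul_sum, smul_smul]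

theorem innerQT_monomial {q t : ℂ} (m : ℕ+ →₀ ℕ) (f : SymFun) :
    innerQT q t (monomial m 1) f = coeff m f * zqt q t m := by
  classical
  rw [innerQT_eq_sum q t f (S := {m}) MvPolynomial.support_monomial_subset]
  simp

/-- The reproducing kernel in a triangular basis. -/
theorem IsTriangular.exists_kernel_matrix {q : ℝ} (hq0 : 0 < q) (hq1 : q < 1) {t : ℂ}
    (ht : ‖t‖ < 1) {d : ℕ} {P : d.Partition → SymFun} (h : IsTriangular P) :
    ∃ c : d.Partition → d.Partition → ℂ,
      (∀ (n m : ℕ) (x : Fin n → ℂ) (y : Fin m → ℂ), kernelDeg q t d x y =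
        ∑ κ, ∑ μ, c κ μ * (evalAt (P κ) x * evalAt (P μ) y)) ∧
      ∀ κ ν, ∑ μ, c κ μ * innerQT q t (P μ) (P ν) = if κ = ν then 1 else 0 := by
  have h1 : ∀ m ∈ wtSet d, ∃ b : d.Partition → ℂ, (monomial m 1 : SymFun) = ∑ κ, b κ • P κ := by
    intro m hm
    exact h.exists_expansion (MvPolynomial.isWeightedHomogeneous_monomial _ _ _ (mem_wtSet.1 hm))
  choose! b hb using h1
  refine ⟨fun κ μ => ∑ m ∈ wtSet d, b m κ * b m μ / zqt q t m, fun n m x y => ?_, fun κ ν => ?_⟩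
  · rw [kernelDeg]
    have : ∀ m ∈ wtSet d, evalAt (monomial m 1) x * evalAt (monomial m 1) y / zqt q t m =
        ∑ κ, ∑ μ, b m κ * b m μ / zqt q t m * (evalAt (P κ) x * evalAt (P μ) y) := by
      intro m hm
      rw [hb m hm, evalAt_sum, evalAt_sum, Finset.sum_mul_sum, Finset.sum_div]
      refine Finset.sum_congr rfl fun κ _ => ?_
      rw [Finset.sum_div]
      refine Finset.sum_congr rfl fun μ _ => ?_
      rw [evalAt_smul, evalAt_smul]; ring
    rw [Finset.sum_congr rfl this, Finset.sum_comm]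
    refine Finset.sum_congr rfl fun κ _ => ?_
    rw [Finset.sum_comm]
    refine Finset.sum_congr rfl fun μ _ => ?_
    rw [Finset.sum_mul]
  -- The coefficient of a power-sum monomial is its pairing with the function divided by `z_κ(q,t)`;
  -- re-expanding `P ν` in this way shows that the kernel matrix inverts the Gram matrix.
  · have h2 : P ν = ∑ κ, (∑ μ, (∑ m ∈ wtSet d, b m κ * b m μ / zqt q t m) *
        innerQT q t (P μ) (P ν)) • P κ := by
      conv_lhs => rw [(h.hasDegree ν).eq_sum]
      have : ∀ m ∈ wtSet d, coeff m (P ν) • (monomial m 1 : SymFun) =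
          ∑ κ, (∑ μ, b m κ * b m μ / zqt q t m * innerQT q t (P μ) (P ν)) • P κ := by
        intro m hm
        have h3 : coeff m (P ν) = (∑ μ, b m μ * innerQT q t (P μ) (P ν)) / zqt q t m := by
          rw [← innerQT_sum_left, ← hb m hm, innerQT_monomial,
            mul_div_cancel_right₀ _ (zqt_ne_zero hq0 hq1 ht m)]
        rw [h3]
        conv_lhs => rw [hb m hm]
        rw [Finset.smul_sum]
        refine Finset.sum_congr rfl fun κ _ => ?_
        rw [smul_smul, Finset.sum_div, Finset.sum_mul]
        refine congrArg (· • P κ) (Finset.sum_congr rfl fun μ _ => by ring)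
      rw [Finset.sum_congr rfl this, Finset.sum_comm]
      refine Finset.sum_congr rfl fun κ _ => ?_
      rw [← Finset.sum_smul, Finset.sum_comm]
      simp only [Finset.sum_mul]
    have h4 := h.eq_zero (le_refl d) (fun κ => (∑ μ, (∑ m ∈ wtSet d, b m κ * b m μ / zqt q t m) *
        innerQT q t (P μ) (P ν)) - if κ = ν then 1 else 0) (by
      have h5 := congrArg (toVars d) h2
      rw [toVars_sum] at h5
      simp only [toVars_smul] at h5
      simp only [sub_smul, Finset.sum_sub_distrib, ite_smul, one_smul, zero_smul,
        Finset.sum_ite_eq', Finset.mem_univ, if_true]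
      rw [← h5, sub_self])
    exact sub_eq_zero.1 (congrFun h4 κ)

theorem exists_eigenfamily (q t X : ℂ) {n d : ℕ} (hn : d ≤ n)
    (hsep : ∀ κ μ : d.Partition, κ ≠ μ →
      macEps q t X (rowOf n κ) ≠ macEps q t X (rowOf n μ)) :
    ∃ P : d.Partition → SymFun, IsTriangular P ∧ ∀ κ,
      macN q t X (toVars n (P κ)) = vdPoly n * (macEps q t X (rowOf n κ) • toVars n (P κ)) := by
  classical
  obtain ⟨c, hc1, hc2, hc3⟩ := exists_macN_msymm q t X hn
  obtain ⟨u, hu1, hu2, hu3⟩ := exists_triangular_eigenvectors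
    (fun μ κ : d.Partition => DomLE μ κ ∧ μ ≠ κ) (DomLE.wellFounded d)
    (fun a b c h1 h2 => ⟨h1.1.trans h2.1, fun e => h2.2 ((DomLE.antisymm (e ▸ h1.1) h2.1).symm)⟩)
    c (fun κ μ h => (em (μ = κ)).imp_right fun h' => ⟨hc2 κ μ h, h'⟩)
    (fun κ μ h => by rw [hc3, hc3]; exact hsep κ μ h.2.symm)
  refine ⟨fun κ => ∑ μ, u κ μ • monoSym μ, ⟨u, hu1, fun κ μ h => ?_, fun κ => rfl⟩, fun κ => ?_⟩
  · rcases hu2 κ μ h with rfl | h'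
    exacts [DomLE.refl _, h'.1]
  · simp only [toVars_sum, toVars_smul, toVars_monoSym, macN_sum, macN_smul, hc1]
    simp only [← mul_smul_comm, ← Finset.mul_sum]
    refine congrArg (vdPoly n * ·) ?_
    simp only [Finset.smul_sum, smul_smul]
    rw [Finset.sum_comm]
    refine Finset.sum_congr rfl fun ν _ => ?_
    rw [← Finset.sum_smul, hu3, hc3]

/-- Acting with the operator on either set of variables of the kernel gives the same result, so `c κ
μ (e κ - e μ) = 0` and the kernel matrix is diagonal. Its inverse, the Gram matrix, is then diagonal
with nonzero entries. -/
theorem IsTriangular.orthogonal_of_eigen {q : ℝ} (hq0 : 0 < q) (hq1 : q < 1) {t : ℂ} (ht : ‖t‖ < 1)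
    {X : ℂ} {n d : ℕ} (hn : d ≤ n) {P : d.Partition → SymFun} (h : IsTriangular P)
    {e : d.Partition → ℂ} (he : Function.Injective e)
    (heig : ∀ κ, macN q t X (toVars n (P κ)) = vdPoly n * (e κ • toVars n (P κ))) :
    (∀ κ μ, κ ≠ μ → innerQT q t (P κ) (P μ) = 0) ∧ ∀ κ, innerQT q t (P κ) (P κ) ≠ 0 := by
  obtain ⟨c, hc1, hc2⟩ := h.exists_kernel_matrix hq0 hq1 ht
  have hE : ∀ κ (x : Fin n → ℂ), ∑ I : Finset (Fin n), X ^ I.card *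
      (vd (fun i => onSet I t i * x i) * evalAt (P κ) (fun i => onSet I q i * x i)) =
      vd x * (e κ * evalAt (P κ) x) := by
    intro κ x
    have := congrArg (eval x) (heig κ)
    rwa [eval_macN, map_mul, eval_vdPoly, MvPolynomial.smul_eval] at this
  have hdiag : ∀ κ μ, κ ≠ μ → c κ μ = 0 := by
    have key : ∀ x y : Fin n → ℂ, Function.Injective x → (∀ i, x i ≠ 0) → Function.Injective y →
        (∀ i, y i ≠ 0) →
        ∑ κ, ∑ μ, c κ μ * (e κ - e μ) * (evalAt (P κ) x * evalAt (P μ) y) = 0 := by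
      intro x y hx hx0 hy hy0
      have h1 := kernelDeg_macN hq0 hq1 ht X d hx hx0 hy hy0
      have h2 : ∑ I : Finset (Fin n), X ^ I.card * (vd (fun i => onSet I t i * x i) *
          kernelDeg q t d (fun i => onSet I q i * x i) y) =
          vd x * ∑ κ, ∑ μ, c κ μ * e κ * (evalAt (P κ) x * evalAt (P μ) y) := by
        simp only [hc1, Finset.mul_sum]
        rw [Finset.sum_comm]
        refine Finset.sum_congr rfl fun κ _ => ?_
        rw [Finset.sum_comm]
        refine Finset.sum_congr rfl fun μ _ => ?_
        rw [show vd x * (c κ μ * e κ * (evalAt (P κ) x * evalAt (P μ) y)) =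
          c κ μ * evalAt (P μ) y * (vd x * (e κ * evalAt (P κ) x)) by ring, ← hE, Finset.mul_sum]
        exact Finset.sum_congr rfl fun I _ => by ring
      have h3 : ∑ I : Finset (Fin n), X ^ I.card * (vd (fun i => onSet I t i * y i) *
          kernelDeg q t d (fun i => onSet I q i * y i) x) =
          vd y * ∑ κ, ∑ μ, c κ μ * e μ * (evalAt (P κ) x * evalAt (P μ) y) := by
        simp only [kernelDeg_comm _ _ _ _ x, hc1, Finset.mul_sum]
        rw [Finset.sum_comm]
        refine Finset.sum_congr rfl fun κ _ => ?_
        rw [Finset.sum_comm]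
        refine Finset.sum_congr rfl fun μ _ => ?_
        rw [show vd y * (c κ μ * e μ * (evalAt (P κ) x * evalAt (P μ) y)) =
          c κ μ * evalAt (P κ) x * (vd y * (e μ * evalAt (P μ) y)) by ring, ← hE, Finset.mul_sum]
        exact Finset.sum_congr rfl fun I _ => by ring
      rw [h2, h3, ← sub_eq_zero] at h1
      have h4 : vd x * vd y *
          ∑ κ, ∑ μ, c κ μ * (e κ - e μ) * (evalAt (P κ) x * evalAt (P μ) y) = 0 := by
        rw [← h1]
        simp only [mul_sub, sub_mul, Finset.sum_sub_distrib]
        ring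
      exact (mul_eq_zero.1 h4).resolve_left
        (mul_ne_zero (vd_ne_zero_iff.2 hx) (vd_ne_zero_iff.2 hy))
    -- Linear independence is applied in the variables `x` first, for each fixed `y`, and afterwards
    -- in `y`.
    have key2 : ∀ y : Fin n → ℂ, Function.Injective y → (∀ i, y i ≠ 0) → ∀ κ,
        ∑ μ, c κ μ * (e κ - e μ) * evalAt (P μ) y = 0 := by
      intro y hy hy0 κ
      refine congrFun (h.eq_zero hn (fun κ => ∑ μ, c κ μ * (e κ - e μ) * evalAt (P μ) y) ?_) κ
      refine eq_zero_of_generic fun x hx hx0 => ?_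
      rw [map_sum, ← key x y hx hx0 hy hy0]
      refine Finset.sum_congr rfl fun κ _ => ?_
      rw [MvPolynomial.smul_eval, ← evalAt_eq, Finset.sum_mul]
      exact Finset.sum_congr rfl fun μ _ => by ring
    intro κ μ hne
    have h5 := congrFun (h.eq_zero hn (fun μ => c κ μ * (e κ - e μ)) (by
      refine eq_zero_of_generic fun y hy hy0 => ?_
      rw [map_sum, ← key2 y hy hy0 κ]
      exact Finset.sum_congr rfl fun μ _ => by rw [MvPolynomial.smul_eval, ← evalAt_eq])) μ
    exact (mul_eq_zero.1 h5).resolve_right (sub_ne_zero.2 fun h6 => hne (he h6))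
  have h6 : ∀ κ ν, c κ κ * innerQT q t (P κ) (P ν) = if κ = ν then 1 else 0 := by
    intro κ ν
    rw [← hc2 κ ν, Finset.sum_eq_single κ (fun μ _ hμ => by rw [hdiag κ μ hμ.symm, zero_mul])
      (fun hκ => absurd (Finset.mem_univ κ) hκ)]
  have h7 : ∀ κ, c κ κ ≠ 0 := by
    intro κ h0
    have := h6 κ κ
    rw [h0, zero_mul, if_pos rfl] at this
    exact zero_ne_one this
  refine ⟨fun κ μ hne => ?_, fun κ h0 => ?_⟩
  · have := h6 κ μ
    rw [if_neg hne] at this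
    exact (mul_eq_zero.1 this).resolve_left (h7 κ)
  · have := h6 κ κ
    rw [h0, mul_zero, if_pos rfl] at this
    exact zero_ne_one this

/-- The reproducing kernel in an orthogonal basis. -/
theorem IsTriangular.kernelDeg_eq {q : ℝ} (hq0 : 0 < q) (hq1 : q < 1) {t : ℂ} (ht : ‖t‖ < 1) {d : ℕ}
    {P : d.Partition → SymFun} (h : IsTriangular P)
    (ho : ∀ κ μ, κ ≠ μ → innerQT q t (P κ) (P μ) = 0)
    (hn : ∀ κ, innerQT q t (P κ) (P κ) ≠ 0) {n m : ℕ} (x : Fin n → ℂ) (y : Fin m → ℂ) :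
    kernelDeg q t d x y =
      ∑ κ, evalAt (P κ) x * evalAt (P κ) y / innerQT q t (P κ) (P κ) := by
  obtain ⟨c, hc1, hc2⟩ := h.exists_kernel_matrix hq0 hq1 ht
  have h1 : ∀ κ ν, c κ ν = if κ = ν then 1 / innerQT q t (P ν) (P ν) else 0 := by
    intro κ ν
    have := hc2 κ ν
    rw [Finset.sum_eq_single ν (fun μ _ hμ => by rw [ho μ ν hμ, mul_zero])
      (fun hκ => absurd (Finset.mem_univ ν) hκ)] at this
    rw [eq_div_of_mul_eq (hn ν) this, ite_div, zero_div]
  rw [hc1]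
  refine Finset.sum_congr rfl fun κ _ => ?_
  simp only [h1, ite_mul, zero_mul, Finset.sum_ite_eq, Finset.mem_univ, if_true]
  ring

/-- For complex `t` the numbers `t^{n-1-i} q^{α_i}` are not ordered, but their moduli are, strictly
since `‖t‖ < 1`. -/
theorem norm_row_strictMono {q : ℝ} (hq0 : 0 < q) (hq1 : q < 1) {t : ℂ} (ht0 : t ≠ 0)
    (ht : ‖t‖ < 1) {n : ℕ} {α : Fin n → ℕ} (hα : Antitone α) :
    StrictMono fun i : Fin n => ‖t ^ (n - 1 - (i : ℕ)) * (q : ℂ) ^ α i‖ := by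
  intro i j hij
  simp only [norm_mul, norm_pow, Complex.norm_real, Real.norm_eq_abs, abs_of_pos hq0]
  have h1 : (i : ℕ) < j := hij
  have h2 := j.2
  exact mul_lt_mul (pow_lt_pow_right_of_lt_one₀ (norm_pos_iff.2 ht0) ht (by omega))
    (pow_le_pow_of_le_one hq0.le hq1.le (hα hij.le)) (by positivity) (by positivity)

/-! ### The Macdonald functions as eigenfunctions -/

/-- As polynomials in `X` the two eigenvalues can coincide only if they have the same roots. The
roots determine the set of moduli, and a strictly increasing sequence is determined by its range. -/
theorem finite_macEps_eq {q : ℝ} (hq0 : 0 < q) (hq1 : q < 1) {t : ℂ} (ht0 : t ≠ 0)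
    (ht : ‖t‖ < 1) {n : ℕ} {α β : Fin n → ℕ} (hα : Antitone α) (hβ : Antitone β) (hne : α ≠ β) :
    {X : ℂ | macEps q t X α = macEps q t X β}.Finite := by
  set A : (Fin n → ℕ) → Fin n → ℂ := fun γ i => t ^ (n - 1 - (i : ℕ)) * (q : ℂ) ^ γ i with hA
  have hA0 : ∀ γ i, A γ i ≠ 0 := fun γ i =>
    mul_ne_zero (pow_ne_zero _ ht0) (pow_ne_zero _ (by exact_mod_cast hq0.ne'))
  set p : (Fin n → ℕ) → Polynomial ℂ := fun γ => ∏ i, (1 + Polynomial.X * Polynomial.C (A γ i))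
  have hp : ∀ γ X, (p γ).eval X = macEps q t X γ := by
    intro γ X
    simp [p, Polynomial.eval_prod, macEps, hA]
  by_contra hinf
  have hpp : p α = p β := by
    refine Polynomial.eq_of_infinite_eval_eq _ _ ?_
    simp only [hp]
    exact hinf
  have hsub : ∀ γ δ, p γ = p δ → Set.range (fun i => ‖A γ i‖) ⊆ Set.range (fun i => ‖A δ i‖) := by
    rintro γ δ h _ ⟨i, rfl⟩
    have h1 : macEps q t (-(A γ i)⁻¹) γ = 0 :=
      Finset.prod_eq_zero (Finset.mem_univ i) (by
        change 1 + -(A γ i)⁻¹ * A γ i = 0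
        rw [neg_mul, inv_mul_cancel₀ (hA0 γ i)]; ring)
    rw [← hp, h, hp, macEps, Finset.prod_eq_zero_iff] at h1
    obtain ⟨j, -, hj⟩ := h1
    refine ⟨j, congrArg norm ?_⟩
    change 1 + -(A γ i)⁻¹ * A δ j = 0 at hj
    have := hA0 γ i
    field_simp at hj
    linear_combination -hj
  have hr := StrictMono.range_inj (norm_row_strictMono hq0 hq1 ht0 ht hα)
    (norm_row_strictMono hq0 hq1 ht0 ht hβ) |>.1
    (Set.Subset.antisymm (hsub α β hpp) (hsub β α hpp.symm))
  refine hne (funext fun i => ?_)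
  have h2 := congrFun hr i
  simp only [norm_mul, norm_pow, Complex.norm_real, Real.norm_eq_abs, abs_of_pos hq0] at h2
  have h3 := mul_left_cancel₀ (pow_ne_zero _ (norm_ne_zero_iff.2 ht0)) h2
  exact pow_right_injective₀ hq0 hq1.ne h3

theorem finite_not_injective_macEps {q : ℝ} (hq0 : 0 < q) (hq1 : q < 1) {t : ℂ} (ht0 : t ≠ 0)
    (ht : ‖t‖ < 1) {n d : ℕ} (hn : d ≤ n) :
    {X : ℂ | ¬ Function.Injective fun κ : d.Partition => macEps q t X (rowOf n κ)}.Finite := by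
  have h : {X : ℂ | ¬ Function.Injective fun κ : d.Partition => macEps q t X (rowOf n κ)} ⊆
      ⋃ p ∈ {p : d.Partition × d.Partition | p.1 ≠ p.2},
        {X : ℂ | macEps q t X (rowOf n p.1) = macEps q t X (rowOf n p.2)} := by
    intro X hX
    simp only [Set.mem_ofPred_eq, Function.Injective] at hX
    push Not at hX
    obtain ⟨κ, μ, h1, h2⟩ := hX
    exact Set.mem_biUnion (x := (κ, μ)) h2 h1
  refine Set.Finite.subset (Set.Finite.biUnion (Set.toFinite _) fun p hp => ?_) h
  exact finite_macEps_eq hq0 hq1 ht0 ht (antitone_rowOf n p.1) (antitone_rowOf n p.2)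
    fun e => hp (rowOf_injective hn e)

theorem eq_of_cofinite {f g : ℂ → ℂ} (hf : Continuous f) (hg : Continuous g) {S : Set ℂ}
    (hS : S.Finite) (h : ∀ X, X ∉ S → f X = g X) (X : ℂ) : f X = g X := by
  have : Dense Sᶜ := hS.countable.dense_compl ℂ
  exact congrFun (Continuous.ext_on this hf hg fun X hX => h X hX) X

theorem continuous_macEps (q t : ℂ) {n : ℕ} (α : Fin n → ℕ) :
    Continuous fun X => macEps q t X α := by
  unfold macEps; fun_prop

theorem continuous_eval_macN (q t : ℂ) {n : ℕ} (p : MvPolynomial (Fin n) ℂ) (x : Fin n → ℂ) :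
    Continuous fun X => eval x (macN q t X p) := by
  simp only [eval_macN]; fun_prop

/-- For a value of `X` separating the eigenvalues the eigenfunctions form an orthogonal triangular
family. By uniqueness it depends neither on `X` nor on the number of variables, and continuity
covers the finitely many exceptional values of `X`. -/
theorem exists_macdonald_degree {q : ℝ} (hq0 : 0 < q) (hq1 : q < 1) {t : ℂ} (ht0 : t ≠ 0)
    (ht : ‖t‖ < 1) (d : ℕ) : ∃ P : d.Partition → SymFun, IsTriangular P ∧
      (∀ κ μ, κ ≠ μ → innerQT q t (P κ) (P μ) = 0) ∧ (∀ κ, innerQT q t (P κ) (P κ) ≠ 0) ∧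
      ∀ n, d ≤ n → ∀ X κ, macN q t X (toVars n (P κ)) =
        vdPoly n * (macEps q t X (rowOf n κ) • toVars n (P κ)) := by
  have hgood : ∀ n, d ≤ n → ∀ X, (Function.Injective fun κ : d.Partition =>
      macEps q t X (rowOf n κ)) → ∃ P : d.Partition → SymFun, IsTriangular P ∧
      (∀ κ μ, κ ≠ μ → innerQT q t (P κ) (P μ) = 0) ∧ (∀ κ, innerQT q t (P κ) (P κ) ≠ 0) ∧
      ∀ κ, macN q t X (toVars n (P κ)) =
        vdPoly n * (macEps q t X (rowOf n κ) • toVars n (P κ)) := by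
    intro n hn X hX
    obtain ⟨P, hP, hE⟩ := exists_eigenfamily (q : ℂ) t X hn fun κ μ h e => h (hX e)
    obtain ⟨h1, h2⟩ := hP.orthogonal_of_eigen hq0 hq1 ht hn hX hE
    exact ⟨P, hP, h1, h2, hE⟩
  obtain ⟨X₀, hX₀⟩ := (finite_not_injective_macEps hq0 hq1 ht0 ht (le_refl d)).exists_notMem
  obtain ⟨P, hP, ho, hn0, -⟩ := hgood d le_rfl X₀ (not_not.1 hX₀)
  refine ⟨P, hP, ho, hn0, fun n hn X κ => MvPolynomial.funext fun x => ?_⟩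
  refine eq_of_cofinite (f := fun X => eval x (macN q t X (toVars n (P κ))))
    (g := fun X => eval x (vdPoly n * (macEps q t X (rowOf n κ) • toVars n (P κ))))
    (continuous_eval_macN _ _ _ _) ?_
    (finite_not_injective_macEps hq0 hq1 ht0 ht hn) (fun X hX => ?_) X
  · simp only [map_mul, MvPolynomial.smul_eval]
    have := continuous_macEps q t (rowOf n κ)
    fun_prop
  · obtain ⟨P', hP', ho', hn', hE⟩ := hgood n hn X (not_not.1 hX)
    have : P' = P := hP.unique hP' ho ho' hn0
    subst this
    exact congrArg (eval x) (hE κ)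

/-- The properties of the Macdonald functions of a given degree. -/
structure IsMacdonaldDegree (q t : ℂ) {d : ℕ} (P : d.Partition → SymFun) : Prop where
  triangular : IsTriangular P
  orthogonal : ∀ κ μ, κ ≠ μ → innerQT q t (P κ) (P μ) = 0
  norm_ne_zero : ∀ κ, innerQT q t (P κ) (P κ) ≠ 0
  eigen : ∀ n, d ≤ n → ∀ X κ, macN q t X (toVars n (P κ)) =
    vdPoly n * (macEps q t X (rowOf n κ) • toVars n (P κ))

open Classical in
theorem sum_filter_ne {d : ℕ} {M : Type*} [AddCommMonoid M] [Module ℂ M]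
    {u : d.Partition → ℂ} {κ : d.Partition} (h1 : u κ = 1) (h2 : ∀ μ, u μ ≠ 0 → DomLE μ κ)
    (f : d.Partition → M) :
    ∑ μ, u μ • f μ = f κ + ∑ μ : d.Partition with DomLE μ κ ∧ μ ≠ κ, u μ • f μ := by
  rw [← Finset.add_sum_erase _ _ (Finset.mem_univ κ), h1, one_smul]
  congr 1
  symm
  refine Finset.sum_subset (fun μ hμ => ?_) fun μ hμ hμ' => ?_
  · simp only [Finset.mem_filter] at hμ
    exact Finset.mem_erase.2 ⟨hμ.2.2, Finset.mem_univ _⟩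
  · have : u μ = 0 := by
      by_contra h
      exact hμ' (Finset.mem_filter.2 ⟨Finset.mem_univ _, h2 μ h, Finset.ne_of_mem_erase hμ⟩)
    rw [this, zero_smul]

/-- The eigenfunctions show that a family with the defining properties exists, so the chosen one has
these properties too, and in each degree uniqueness makes the two equal. -/
theorem macdonaldP_spec {q : ℝ} (hq0 : 0 < q) (hq1 : q < 1) {t : ℂ} (ht0 : t ≠ 0)
    (ht : ‖t‖ < 1) (d : ℕ) : IsMacdonaldDegree q t (macdonaldP q t d) := by
  classical
  choose Q hQ1 hQ2 hQ3 hQ4 using exists_macdonald_degree hq0 hq1 ht0 ht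
  have hfam : IsMacdonaldFamily q t Q := by
    refine ⟨fun d κ => ?_, fun d e κ μ hne => ?_⟩
    · obtain ⟨u, hu1, hu2, hu3⟩ := hQ1 d
      refine ⟨u κ, fun n => ?_⟩
      rw [hu3 κ, toVars_sum]
      simp only [toVars_smul, toVars_monoSym]
      convert sum_filter_ne (hu1 κ) (hu2 κ) (fun μ => msymm (Fin n) ℂ μ)
    · by_cases h : d = e
      · subst h
        exact hQ2 d κ μ fun h => hne (h ▸ rfl)
      · exact innerQT_of_degree_ne _ _ ((hQ1 d).hasDegree κ) ((hQ1 e).hasDegree μ) h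
  have hmac : IsMacdonaldFamily q t (macdonaldP q t) := Classical.epsilon_spec ⟨Q, hfam⟩
  have htri : IsTriangular (macdonaldP q t d) := by
    choose u hu using hmac.1 d
    -- The coefficients given by property (A) carry information only strictly below `κ`; elsewhere
    -- they are overwritten by 1 on the diagonal and 0 off the order.
    refine ⟨fun κ μ => if μ = κ then 1 else if DomLE μ κ then u κ μ else 0, fun κ => if_pos rfl,
      fun κ μ h => ?_, fun κ => symFun_ext fun n => ?_⟩
    · by_cases h1 : μ = κ
      · rw [h1]; exact DomLE.refl κ
      · by_contra h2
        simp [h1, h2] at h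
    · rw [hu κ n, toVars_sum]
      simp only [toVars_smul, toVars_monoSym]
      rw [sum_filter_ne (κ := κ) (by simp) (fun μ h => ?_)]
      · congr 1
        refine Finset.sum_congr (by ext; simp) fun μ hμ => ?_
        simp only [Finset.mem_filter] at hμ
        rw [if_neg hμ.2.2, if_pos hμ.2.1]
      · by_cases h1 : μ = κ
        · rw [h1]; exact DomLE.refl κ
        · by_contra h2
          simp [h1, h2] at h
  have heq : macdonaldP q t d = Q d := (hQ1 d).unique htri (hQ2 d)
    (fun κ μ h => hmac.2 d d κ μ fun e => h (by simpa using e)) (hQ3 d)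
  rw [heq]
  exact ⟨hQ1 d, hQ2 d, hQ3 d, hQ4 d⟩

/-! ### Fewer variables -/

/-- The parts of `μ` already exhaust `d`, so a longer `κ` would have a smaller initial sum at the
length of `μ`. -/
theorem DomLE.card_le {d : ℕ} {μ κ : d.Partition} (h : DomLE μ κ) :
    Multiset.card κ.parts ≤ Multiset.card μ.parts := by
  by_contra hlt
  push Not at hlt
  have h1 := h (Multiset.card μ.parts)
  rw [List.take_of_length_le (length_sort_parts μ).le] at h1
  have h2 : (μ.parts.sort (· ≥ ·)).sum = d := by
    rw [← Multiset.sum_coe, Multiset.sort_eq, μ.parts_sum]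
  have h3 : ((κ.parts.sort (· ≥ ·)).take (Multiset.card μ.parts)).sum +
      ((κ.parts.sort (· ≥ ·)).drop (Multiset.card μ.parts)).sum = d := by
    rw [List.sum_take_add_sum_drop, ← Multiset.sum_coe, Multiset.sort_eq, κ.parts_sum]
  have h4 : 0 < ((κ.parts.sort (· ≥ ·)).drop (Multiset.card μ.parts)).sum := by
    refine List.sum_pos _ (fun a ha => ?_) ?_
    · exact κ.parts_pos ((Multiset.mem_sort (· ≥ ·)).1 (List.mem_of_mem_drop ha))
    · rw [Ne, List.drop_eq_nil_iff, length_sort_parts]; omega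
  omega

theorem IsTriangular.toVars_eq_zero {d : ℕ} {P : d.Partition → SymFun} (h : IsTriangular P)
    (κ : d.Partition) {n : ℕ} (hn : n < Multiset.card κ.parts) : toVars n (P κ) = 0 := by
  obtain ⟨u, -, hu2, hu3⟩ := h
  rw [hu3 κ, toVars_sum]
  refine Finset.sum_eq_zero fun μ _ => ?_
  rw [toVars_smul, toVars_monoSym]
  by_cases h0 : u κ μ = 0
  · rw [h0, zero_smul]
  · rw [msymm_eq_zero μ (hn.trans_le (hu2 κ μ h0).card_le), smul_zero]

theorem evalAt_snoc_zero {n : ℕ} (f : SymFun) (x : Fin n → ℂ) :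
    evalAt f (Fin.snoc x 0 : Fin (n + 1) → ℂ) = evalAt f x := by
  unfold evalAt
  induction f using MvPolynomial.induction_on with
  | C a => simp [toVars]
  | add f g hf hg => rw [toVars_add, toVars_add, map_add, map_add, hf, hg]
  | mul_X f r hf =>
    rw [toVars_mul, toVars_mul, map_mul, map_mul, hf, toVars_X, toVars_X]
    congr 1
    simp [psum, Fin.sum_univ_castSucc]

theorem vd_eq_prod_ite {R : Type*} [CommRing R] {n : ℕ} (x : Fin n → R) :
    vd x = ∏ i, ∏ j, if i < j then x i - x j else 1 := by
  unfold vd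
  refine Finset.prod_congr rfl fun i _ => ?_
  rw [← Finset.prod_filter]
  exact Finset.prod_congr (by ext; simp) fun _ _ => rfl

theorem vd_snoc_zero {n : ℕ} (x : Fin n → ℂ) :
    vd (Fin.snoc x 0 : Fin (n + 1) → ℂ) = (∏ i, x i) * vd x := by
  rw [vd_eq_prod_ite, vd_eq_prod_ite, Fin.prod_univ_castSucc]
  simp only [Fin.prod_univ_castSucc (n := n), Fin.snoc_castSucc, Fin.snoc_last,
    Fin.castSucc_lt_castSucc_iff, Fin.castSucc_lt_last, if_true, sub_zero, lt_irrefl, if_false,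
    mul_one, Finset.prod_mul_distrib]
  rw [Finset.prod_eq_one (s := Finset.univ) (f := fun i : Fin n =>
    if Fin.last n < i.castSucc then (0 : ℂ) - x i else 1) fun i _ =>
      if_neg (not_lt.2 (Fin.le_last _))]
  ring

theorem sum_finset_castSucc {n : ℕ} {M : Type*} [AddCommMonoid M] (F : Finset (Fin (n + 1)) → M) :
    ∑ I, F I = ∑ J : Finset (Fin n), (F (J.map Fin.castSuccEmb) +
      F (insert (Fin.last n) (J.map Fin.castSuccEmb))) := by
  have h : (Finset.univ : Finset (Fin (n + 1))) =
      insert (Fin.last n) (Finset.univ.map Fin.castSuccEmb) := by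
    ext i
    simp only [Finset.mem_univ, Finset.mem_insert, Finset.mem_map, true_and, true_iff]
    exact (Fin.eq_castSucc_or_eq_last i).symm.imp_right fun ⟨j, hj⟩ => ⟨j, hj.symm⟩
  rw [← Finset.powerset_univ, h, Finset.sum_powerset_insert (by simp), ← Finset.sum_add_distrib]
  symm
  refine Finset.sum_nbij (fun J => J.map Fin.castSuccEmb) (fun J _ => ?_) (fun J _ J' _ e => ?_)
    (fun S hS => ?_) fun J _ => rfl
  · exact Finset.mem_powerset.2 (Finset.map_subset_map.2 (Finset.subset_univ J))
  · exact Finset.map_injective _ e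
  · obtain ⟨J, -, hJ⟩ := Finset.subset_map_iff.1 (Finset.mem_powerset.1 (Finset.mem_coe.1 hS))
    exact ⟨J, Finset.mem_coe.2 (Finset.mem_univ J), hJ.symm⟩

theorem onSet_mul_snoc {n : ℕ} (I : Finset (Fin (n + 1))) (J : Finset (Fin n))
    (h : ∀ i : Fin n, i.castSucc ∈ I ↔ i ∈ J) (a : ℂ) (x : Fin n → ℂ) :
    (fun i => onSet I a i * (Fin.snoc x 0 : Fin (n + 1) → ℂ) i) =
      (Fin.snoc (fun i => onSet J a i * x i) 0 : Fin (n + 1) → ℂ) := by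
  funext i
  refine Fin.lastCases ?_ (fun i => ?_) i
  · simp
  · simp [onSet, h]

theorem macEps_succ (q t X : ℂ) {n : ℕ} {α : Fin (n + 1) → ℕ} (hα : α (Fin.last n) = 0) :
    macEps q t X α = (1 + X) * macEps q t (X * t) fun i : Fin n => α i.castSucc := by
  rw [macEps, macEps, Fin.prod_univ_castSucc, mul_comm]
  congr 1
  · simp [hα]
  · refine Finset.prod_congr rfl fun i _ => ?_
    have := i.2
    rw [Fin.val_castSucc, show n + 1 - 1 - (i : ℕ) = (n - 1 - i) + 1 by omega, pow_succ]
    ring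

theorem prod_onSet_mul {n : ℕ} (J : Finset (Fin n)) (a : ℂ) (x : Fin n → ℂ) :
    ∏ i, onSet J a i * x i = a ^ J.card * ∏ i, x i := by
  simp only [onSet, Finset.prod_mul_distrib, Finset.prod_ite_mem, Finset.univ_inter,
    Finset.prod_const]

/-- At last variable 0 the Vandermonde product is `∏ x_i` times the one in fewer variables, so a
subset `J` acquires `t^{|J|}`; this is compensated by using `X / t`. Adding the last index to `J` or
not gives `1 + X / t`, a factor the eigenvalue has as well. -/
theorem macN_of_snoc_zero {q t : ℂ} (ht0 : t ≠ 0) {f : SymFun} {n : ℕ} {α : Fin (n + 1) → ℕ}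
    (hα : α (Fin.last n) = 0)
    (h : ∀ X, macN q t X (toVars (n + 1) f) =
      vdPoly (n + 1) * (macEps q t X α • toVars (n + 1) f)) (X : ℂ) :
    macN q t X (toVars n f) =
      vdPoly n * (macEps q t X (fun i : Fin n => α i.castSucc) • toVars n f) := by
  rw [← sub_eq_zero]
  refine eq_zero_of_generic fun x _ hx0 => ?_
  rw [map_sub, sub_eq_zero]
  refine eq_of_cofinite (f := fun X => eval x (macN q t X (toVars n f)))
    (g := fun X => eval x (vdPoly n * (macEps q t X (fun i : Fin n => α i.castSucc) • toVars n f)))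
    (continuous_eval_macN _ _ _ _) ?_ (Set.finite_singleton (-t)) (fun X hX => ?_) X
  · simp only [map_mul, MvPolynomial.smul_eval]
    have := continuous_macEps q t (fun i : Fin n => α i.castSucc)
    fun_prop
  -- Only `X = -t` is lost on cancelling this factor, and both sides are continuous in `X`.
  have hY : 1 + X / t ≠ 0 := by
    intro h0
    field_simp at h0
    exact hX (by rw [Set.mem_singleton_iff]; linear_combination h0)
  have h1 := congrArg (eval (Fin.snoc x 0 : Fin (n + 1) → ℂ)) (h (X / t))
  rw [eval_macN, map_mul, eval_vdPoly, MvPolynomial.smul_eval, sum_finset_castSucc,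
    macEps_succ _ _ _ hα, div_mul_cancel₀ _ ht0, ← evalAt_eq, evalAt_snoc_zero, vd_snoc_zero] at h1
  have h2 : ∀ J : Finset (Fin n),
      (X / t) ^ (J.map Fin.castSuccEmb).card *
        (vd (fun i => onSet (J.map Fin.castSuccEmb) t i * (Fin.snoc x 0 : Fin (n + 1) → ℂ) i) *
        eval (fun i => onSet (J.map Fin.castSuccEmb) q i * (Fin.snoc x 0 : Fin (n + 1) → ℂ) i)
          (toVars (n + 1) f)) +
      (X / t) ^ (insert (Fin.last n) (J.map Fin.castSuccEmb)).card *
        (vd (fun i => onSet (insert (Fin.last n) (J.map Fin.castSuccEmb)) t i *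
          (Fin.snoc x 0 : Fin (n + 1) → ℂ) i) *
        eval (fun i => onSet (insert (Fin.last n) (J.map Fin.castSuccEmb)) q i *
          (Fin.snoc x 0 : Fin (n + 1) → ℂ) i) (toVars (n + 1) f)) =
      (1 + X / t) * (∏ i, x i) * (X ^ J.card * (vd (fun i => onSet J t i * x i) *
        eval (fun i => onSet J q i * x i) (toVars n f))) := by
    intro J
    have e1 : ∀ i : Fin n, i.castSucc ∈ J.map Fin.castSuccEmb ↔ i ∈ J := by simp
    have e2 : ∀ i : Fin n, i.castSucc ∈ insert (Fin.last n) (J.map Fin.castSuccEmb) ↔ i ∈ J := by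
      simp [(Fin.castSucc_lt_last _).ne]
    rw [onSet_mul_snoc _ J e1, onSet_mul_snoc _ J e2, onSet_mul_snoc _ J e1, onSet_mul_snoc _ J e2,
      Finset.card_insert_of_notMem (by simp), Finset.card_map, vd_snoc_zero, prod_onSet_mul,
      ← evalAt_eq, evalAt_snoc_zero, ← evalAt_eq, pow_succ, div_pow]
    field_simp
  rw [Finset.sum_congr rfl fun J _ => h2 J, ← Finset.mul_sum] at h1
  have h3 : (1 + X / t) * (∏ i, x i) ≠ 0 := mul_ne_zero hY (Finset.prod_ne_zero_iff.2 fun i _ => hx0 i)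
  refine mul_left_cancel₀ h3 ?_
  rw [eval_macN, h1, map_mul, eval_vdPoly, MvPolynomial.smul_eval, ← evalAt_eq]
  ring

/-- Starting from at least `d` variables, variables are set to zero one at a time; the eigenvalue
descends as long as the last entry of the row exponent is zero. -/
theorem IsMacdonaldDegree.macN_eq {q t : ℂ} (ht0 : t ≠ 0) {d : ℕ} {P : d.Partition → SymFun}
    (h : IsMacdonaldDegree q t P) {n : ℕ} (κ : d.Partition) (hn : Multiset.card κ.parts ≤ n)
    (X : ℂ) : macN q t X (toVars n (P κ)) =
      vdPoly n * (macEps q t X (rowOf n κ) • toVars n (P κ)) := by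
  suffices H : ∀ k n, d ≤ n + k → Multiset.card κ.parts ≤ n → ∀ X, macN q t X (toVars n (P κ)) =
      vdPoly n * (macEps q t X (rowOf n κ) • toVars n (P κ)) from H d n (by omega) hn X
  intro k
  induction k with
  | zero => exact fun n hn _ X => h.eigen n hn X κ
  | succ k ih =>
    intro n hn hκ X
    refine macN_of_snoc_zero ht0 (α := rowOf (n + 1) κ) ?_ (ih (n + 1) (by omega) (by omega)) X
    rw [rowOf_apply, Fin.val_last, List.getD_eq_default]
    rw [length_sort_parts]; exact hκ

/-! ### Eigenfunctions in finitely many variables -/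

/-- `f` is a symmetric eigenfunction of all the operators `macN q t X / vdPoly`, with the
eigenvalues attached to the decreasing sequence `α`. -/
structure IsEigen (q t : ℂ) {n : ℕ} (f : MvPolynomial (Fin n) ℂ) (α : Fin n →₀ ℕ) : Prop where
  symm : f.IsSymmetric
  antitone : Antitone α
  macN_eq : ∀ X, macN q t X f = vdPoly n * (macEps q t X α • f)
  coeff_eq : coeff α f = 1

theorem IsEigen.unique {q : ℝ} (hq0 : 0 < q) (hq1 : q < 1) {t : ℂ} (ht0 : t ≠ 0)
    (ht : ‖t‖ < 1) {n : ℕ} {f g : MvPolynomial (Fin n) ℂ} {α : Fin n →₀ ℕ}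
    (hf : IsEigen q t f α) (hg : IsEigen q t g α) : f = g := by
  by_contra hne
  have h0 : f - g ≠ 0 := sub_ne_zero.2 hne
  have hE : ∀ X, macN q t X (f - g) = vdPoly n * (macEps q t X α • (f - g)) := by
    intro X
    rw [sub_eq_add_neg, ← neg_one_smul ℂ g, macN_add, macN_smul, hf.macN_eq, hg.macN_eq,
      ← mul_smul_comm, ← mul_add, smul_add, smul_comm]
  have hs : (f - g).IsSymmetric := hf.symm.sub hg.symm
  set γ := (MonomialOrder.lex (σ := Fin n)).degree (f - g) with hγ
  have hc : coeff γ (f - g) ≠ 0 := (MonomialOrder.lex).leadingCoeff_ne_zero_iff.2 h0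
  have hαγ : (α : Fin n → ℕ) ≠ γ := by
    intro h
    have : α = γ := DFunLike.coe_injective h
    rw [← this, MvPolynomial.coeff_sub, hf.coeff_eq, hg.coeff_eq, sub_self] at hc
    exact hc rfl
  -- The leading exponent of the difference is not `α`, since the coefficients there cancel; yet its
  -- eigenvalue would have to agree with that of `α` for all `X`.
  obtain ⟨X, hX⟩ := (finite_macEps_eq hq0 hq1 ht0 ht hf.antitone
    (lex_degree_antitone hs) hαγ).exists_notMem
  refine hX ?_
  have h1 := coeff_macN_lex (hE X)
  rw [MvPolynomial.coeff_smul, smul_eq_mul] at h1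
  exact mul_right_cancel₀ hc h1

theorem scaleVars_prod_X {n : ℕ} (c : Fin n → ℂ) :
    scaleVars c (∏ i, MvPolynomial.X i) = (∏ i, c i) • ∏ i, (MvPolynomial.X i : MvPolynomial (Fin n) ℂ) := by
  refine MvPolynomial.funext fun x => ?_
  simp [eval_scaleVars, MvPolynomial.smul_eval, map_prod, Finset.prod_mul_distrib]

/-- Multiplication by `(x₁ ⋯ xₙ)^k` adds a rectangle. -/
theorem IsEigen.boost {q t : ℂ} {n : ℕ} {f : MvPolynomial (Fin n) ℂ} {α : Fin n →₀ ℕ}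
    (hf : IsEigen q t f α) (k : ℕ) {β : Fin n →₀ ℕ} (hβ : ∀ i, β i = k + α i) :
    IsEigen q t ((∏ i, MvPolynomial.X i) ^ k * f) β := by
  have hmon : (∏ i, (MvPolynomial.X i : MvPolynomial (Fin n) ℂ)) ^ k =
      monomial (Finsupp.equivFunOnFinite.symm fun _ => k) 1 := by
    rw [MvPolynomial.monomial_eq, map_one, one_mul, Finsupp.prod_fintype _ _ (by simp),
      ← Finset.prod_pow]
    rfl
  refine ⟨?_, fun i j h => ?_, fun X => ?_, ?_⟩
  · intro σ
    rw [map_mul, hf.symm σ, map_pow, map_prod]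
    simp only [MvPolynomial.rename_X]
    rw [Equiv.prod_comp σ (fun i => (MvPolynomial.X i : MvPolynomial (Fin n) ℂ))]
  · rw [hβ, hβ]; exact Nat.add_le_add_left (hf.antitone h) k
  -- Rescaling by `q` on `I` multiplies the power of `∏ x_i` by `q^{k|I|}`, which amounts to
  -- replacing `X` by `X q^k`.
  · have h1 : macN q t X ((∏ i, MvPolynomial.X i) ^ k * f) =
        (∏ i, MvPolynomial.X i) ^ k * macN q t (X * q ^ k) f := by
      rw [macN, macN, Finset.mul_sum]
      refine Finset.sum_congr rfl fun I _ => ?_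
      rw [map_mul, map_pow (scaleVars (onSet I q)), scaleVars_prod_X]
      have : ∏ i, onSet I q i = q ^ I.card := by
        simpa using prod_onSet_mul I q fun _ => 1
      rw [this, smul_pow, mul_pow, ← pow_mul, ← pow_mul, mul_comm k, MvPolynomial.smul_eq_C_mul,
        map_mul]
      ring
    have h2 : macEps q t X β = macEps q t (X * q ^ k) α := by
      refine Finset.prod_congr rfl fun i _ => ?_
      rw [hβ, pow_add]; ring
    rw [h1, hf.macN_eq, h2, MvPolynomial.smul_eq_C_mul, MvPolynomial.smul_eq_C_mul]
    ring
  · rw [hmon]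
    have : β = (Finsupp.equivFunOnFinite.symm fun _ => k) + α := by
      ext i; rw [hβ]; rfl
    rw [this, MvPolynomial.coeff_monomial_mul, hf.coeff_eq, one_mul]

theorem IsTriangular.coeff_rowOf {d : ℕ} {P : d.Partition → SymFun} (h : IsTriangular P) {n : ℕ}
    (κ : d.Partition) (hn : Multiset.card κ.parts ≤ n) : coeff (rowOf n κ) (toVars n (P κ)) = 1 := by
  obtain ⟨u, hu1, -, hu3⟩ := h
  rw [hu3 κ, toVars_sum, MvPolynomial.coeff_sum, Finset.sum_eq_single κ]
  · rw [toVars_smul, toVars_monoSym, MvPolynomial.coeff_smul, coeff_msymm,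
      if_pos (expParts_rowOf κ hn), hu1, one_smul]
  · intro μ _ hμ
    rw [toVars_smul, toVars_monoSym, MvPolynomial.coeff_smul, coeff_msymm, if_neg, smul_zero]
    rw [expParts_rowOf κ hn]
    exact fun e => hμ (Nat.Partition.ext e.symm)
  · exact fun h => absurd (Finset.mem_univ κ) h

theorem IsMacdonaldDegree.isEigen {q t : ℂ} (ht0 : t ≠ 0) {d : ℕ} {P : d.Partition → SymFun}
    (h : IsMacdonaldDegree q t P) {n : ℕ} (κ : d.Partition) (hn : Multiset.card κ.parts ≤ n) :
    IsEigen q t (toVars n (P κ)) (rowOf n κ) :=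
  ⟨toVars_isSymmetric _ _, antitone_rowOf n κ, fun X => h.macN_eq ht0 κ hn X,
    h.triangular.coeff_rowOf κ hn⟩

/-- In `n` variables, adding a rectangle with `n` rows multiplies by a power of `x₁ ⋯ xₙ`. -/
theorem macdonaldP_boost {q : ℝ} (hq0 : 0 < q) (hq1 : q < 1) {t : ℂ} (ht0 : t ≠ 0)
    (ht : ‖t‖ < 1) {n d e k : ℕ} {κ : d.Partition} {μ : e.Partition}
    (hκ : Multiset.card κ.parts ≤ n) (hμ : Multiset.card μ.parts ≤ n)
    (h : ∀ i, rowOf n μ i = k + rowOf n κ i) (x : Fin n → ℂ) :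
    evalAt (macdonaldP q t e μ) x = (∏ i, x i) ^ k * evalAt (macdonaldP q t d κ) x := by
  have h1 := (macdonaldP_spec hq0 hq1 ht0 ht d).isEigen ht0 κ hκ
  have h2 := (macdonaldP_spec hq0 hq1 ht0 ht e).isEigen ht0 μ hμ
  rw [evalAt_eq, h2.unique hq0 hq1 ht0 ht (h1.boost k h), map_mul, map_pow, map_prod, ← evalAt_eq]
  simp

/-- Symmetric homogeneous polynomials are combinations of Macdonald polynomials. -/
theorem exists_sum_macdonaldP {q t : ℂ} {d : ℕ} {P : d.Partition → SymFun}
    (h : IsMacdonaldDegree q t P) {n : ℕ} {g : MvPolynomial (Fin n) ℂ} (hg : g.IsSymmetric)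
    (hd : g.IsHomogeneous d) : ∃ b : d.Partition → ℂ, g = ∑ κ, b κ • toVars n (P κ) := by
  obtain ⟨b, hb⟩ := h.triangular.exists_expansion
    (HasDegree.sum Finset.univ (f := fun κ : d.Partition => coeff (rowOf n κ) g • monoSym κ)
      fun κ _ => (hasDegree_monoSym κ).smul _)
  refine ⟨b, ?_⟩
  have h1 := congrArg (toVars n) hb
  simp only [toVars_sum, toVars_smul, toVars_monoSym] at h1
  rw [← h1]
  exact eq_sum_msymm hg hd

/-! ### Change of variables in torus integrals -/

theorem piCongrLeft_const_apply {ι ι' : Type} (e : ι ≃ ι') (θ : ι → ℝ) :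
    MeasurableEquiv.piCongrLeft (fun _ : ι' => ℝ) e θ = fun j => θ (e.symm j) := by
  funext j
  obtain ⟨i, rfl⟩ := e.surjective j
  rw [e.symm_apply_apply]
  exact Equiv.piCongrLeft_apply_apply (fun _ : ι' => ℝ) e θ i

theorem piCongrLeft_preimage_Icc {ι ι' : Type} (e : ι ≃ ι') (c : ℝ) :
    MeasurableEquiv.piCongrLeft (fun _ : ι' => ℝ) e ⁻¹' Set.Icc (0 : ι' → ℝ) (fun _ => c) =
      Set.Icc (0 : ι → ℝ) (fun _ => c) := by
  ext θ
  rw [Set.mem_preimage, piCongrLeft_const_apply]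
  simp only [Set.mem_Icc, Pi.le_def, Pi.zero_apply]
  exact and_congr ⟨fun h i => by simpa using h (e i), fun h j => h _⟩
    ⟨fun h i => by simpa using h (e i), fun h j => h _⟩

section TorusChange

variable {ι ι' : Type} [Fintype ι] [Fintype ι']

theorem torusMean_scale (c R : ι → ℝ) (F : (ι → ℂ) → ℂ) :
    torusMean (fun i => c i * R i) F = torusMean R fun y => F fun i => (c i : ℂ) * y i := by
  simp only [torusMean, Complex.ofReal_mul, mul_assoc]

theorem torusMean_reindex (e : ι ≃ ι') (R : ι' → ℝ) (F : (ι' → ℂ) → ℂ) :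
    torusMean (fun i => R (e i)) (fun x => F fun j => x (e.symm j)) = torusMean R F := by
  rw [torusMean_eq, torusMean_eq, Fintype.card_congr e]
  congr 1
  have h := (volume_measurePreserving_piCongrLeft (fun _ : ι' => ℝ) e).setIntegral_preimage_emb
    (MeasurableEquiv.measurableEmbedding _) (fun θ => F (torusPoint R θ))
    (Set.Icc (0 : ι' → ℝ) (fun _ => 2 * Real.pi))
  rw [piCongrLeft_preimage_Icc] at h
  rw [← h]
  refine integral_congr_ae (Eventually.of_forall fun θ => ?_)
  beta_reduce
  rw [piCongrLeft_const_apply]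
  refine congrArg F (funext fun j => ?_)
  simp [torusPoint]

theorem TorusMeanExists.reindex (e : ι ≃ ι') {R : ι' → ℝ} {F : (ι' → ℂ) → ℂ}
    (hF : TorusMeanExists R F) :
    TorusMeanExists (fun i => R (e i)) (fun x => F fun j => x (e.symm j)) := by
  rw [torusMeanExists_iff] at hF ⊢
  have h := ((volume_measurePreserving_piCongrLeft (fun _ : ι' => ℝ) e).integrableOn_comp_preimage
    (MeasurableEquiv.measurableEmbedding _)).2 hF
  rw [piCongrLeft_preimage_Icc] at h
  refine h.congr (Eventually.of_forall fun θ => ?_)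
  simp only [Function.comp_apply]
  rw [piCongrLeft_const_apply]
  refine congrArg F (funext fun j => ?_)
  simp [torusPoint]

theorem torusMean_sum_type {R : ι ⊕ ι' → ℝ} {F : (ι ⊕ ι' → ℂ) → ℂ} (hF : TorusMeanExists R F) :
    torusMean R F = torusMean (fun j => R (Sum.inr j)) fun y =>
      torusMean (fun i => R (Sum.inl i)) fun x => F (Sum.elim x y) := by
  have hset : (MeasurableEquiv.sumPiEquivProdPi (fun _ : ι ⊕ ι' => ℝ)).symm ⁻¹'
      Set.Icc (0 : ι ⊕ ι' → ℝ) (fun _ => 2 * Real.pi) =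
      Set.Icc (0 : ι → ℝ) (fun _ => 2 * Real.pi) ×ˢ Set.Icc (0 : ι' → ℝ) (fun _ => 2 * Real.pi) := by
    ext ⟨θ, θ'⟩
    simp only [Set.mem_preimage, Set.mem_Icc, Set.mem_prod, Pi.le_def, Sum.forall,
      MeasurableEquiv.coe_sumPiEquivProdPi_symm, Equiv.sumPiEquivProdPi_symm_apply, Pi.zero_apply]
    tauto
  have hmp := volume_measurePreserving_sumPiEquivProdPi_symm (fun _ : ι ⊕ ι' => ℝ)
  have hpt : ∀ z : (ι → ℝ) × (ι' → ℝ),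
      torusPoint R ((MeasurableEquiv.sumPiEquivProdPi (fun _ : ι ⊕ ι' => ℝ)).symm z) =
        Sum.elim (torusPoint (fun i => R (Sum.inl i)) z.1)
          (torusPoint (fun j => R (Sum.inr j)) z.2) := by
    intro z
    funext k
    cases k <;> rfl
  have h1 := hmp.setIntegral_preimage_emb (MeasurableEquiv.measurableEmbedding _)
    (fun θ => F (torusPoint R θ)) (Set.Icc (0 : ι ⊕ ι' → ℝ) (fun _ => 2 * Real.pi))
  have h2 := (hmp.integrableOn_comp_preimage (MeasurableEquiv.measurableEmbedding _)).2
    ((torusMeanExists_iff R F).1 hF)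
  rw [hset] at h1 h2
  simp only [Function.comp_def, hpt] at h1 h2
  rw [torusMean_eq, ← h1]
  have h3 : ∫ z in Set.Icc (0 : ι → ℝ) (fun _ => 2 * Real.pi) ×ˢ
      Set.Icc (0 : ι' → ℝ) (fun _ => 2 * Real.pi), F (Sum.elim
        (torusPoint (fun i => R (Sum.inl i)) z.1) (torusPoint (fun j => R (Sum.inr j)) z.2)) =
      ∫ θ' in Set.Icc (0 : ι' → ℝ) (fun _ => 2 * Real.pi),
        ∫ θ in Set.Icc (0 : ι → ℝ) (fun _ => 2 * Real.pi), F (Sum.elim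
        (torusPoint (fun i => R (Sum.inl i)) θ) (torusPoint (fun j => R (Sum.inr j)) θ')) := by
    rw [Measure.volume_eq_prod, ← Measure.prod_restrict]
    rw [Measure.volume_eq_prod, IntegrableOn, ← Measure.prod_restrict] at h2
    exact integral_prod_symm _ h2
  rw [h3]
  simp only [torusMean_eq, Fintype.card_sum, integral_const_mul, pow_add]
  rw [← mul_assoc]
  congr 1
  rw [one_div_mul_one_div, mul_comm]

theorem torusMean_fubini {κ : Type} [Fintype κ] (e : ι ⊕ ι' ≃ κ) {R : κ → ℝ} {F : (κ → ℂ) → ℂ}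
    (hF : TorusMeanExists R F) :
    torusMean R F = torusMean (fun j => R (e (Sum.inr j))) fun y =>
      torusMean (fun i => R (e (Sum.inl i))) fun x => F fun k => Sum.elim x y (e.symm k) := by
  rw [← torusMean_reindex e R F, torusMean_sum_type (hF.reindex e)]

/-- An absolutely convergent Laurent series all of whose coefficients vanish is zero. -/
theorem LaurentOn.eq_zero {R : ι → ℝ} (hR : ∀ i, 0 < R i) {F : (ι → ℂ) → ℂ}
    (hF : LaurentOn {R} F) (h : ∀ β : ι → ℤ, MacdonaldBoson.torusMean R (fun x => F x * ∏ i, x i ^ β i) = 0)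
    (x : ι → ℂ) (hx : ∀ i, ‖x i‖ = R i) : F x = 0 := by
  classical
  obtain ⟨κ, _, c, α, H⟩ := hF
  have hx0 : ∀ i, x i ≠ 0 := fun i h0 => (hR i).ne (by rw [← hx i, h0, norm_zero])
  have hxm : (fun i => ‖x i‖) ∈ ({R} : Set (ι → ℝ)) := funext hx
  -- The indexing family may repeat an exponent, so what vanishes is the sum of the coefficients
  -- carrying it; hence the regrouping by exponent below.
  have hcoef : ∀ β : ι → ℤ, ∑' k, (if α k = β then c k else 0) = 0 := by
    intro β
    have h1 : ∀ y : ι → ℂ, (fun i => ‖y i‖) ∈ ({R} : Set (ι → ℝ)) →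
        HasSum (fun k => c k * ∏ i, y i ^ (α k - β) i) (F y * ∏ i, y i ^ (-β) i) := by
      intro y hy
      have hy0 : ∀ i, y i ≠ 0 := fun i h0 => (hR i).ne (by
        rw [← congrFun (Set.mem_singleton_iff.1 hy) i]; simp [h0])
      refine ((H y hy).mul_right (∏ i, y i ^ (-β) i)).of_eq (fun k => ?_) rfl
      rw [mul_assoc, ← Finset.prod_mul_distrib]
      congr 1
      exact Finset.prod_congr rfl fun i _ => by rw [← zpow_add₀ (hy0 i), Pi.sub_apply, Pi.neg_apply,
        sub_eq_add_neg]
    have h2 := (torusMean_of_hasSum h1 (Set.mem_singleton R) hR).2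
    rw [h (-β)] at h2
    simpa only [sub_eq_zero] using h2.symm
  have hs := H x hxm
  have h3 : HasSum (fun p : Σ β : ι → ℤ, {k // α k = β} => c p.2 * ∏ i, x i ^ α p.2 i) (F x) :=
    ((Equiv.sigmaFiberEquiv α).hasSum_iff (f := fun k => c k * ∏ i, x i ^ α k i)).2 hs
  have hsub : ∀ β, Summable fun k : {k // α k = β} => c k * ∏ i, x i ^ α k i := fun β =>
    hs.summable.subtype _
  have h4 := h3.sigma fun β => (hsub β).hasSum
  have h5 : ∀ β, ∑' k : {k // α k = β}, c k * ∏ i, x i ^ α k i = 0 := by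
    intro β
    have hP : ∏ i, x i ^ β i ≠ 0 := Finset.prod_ne_zero_iff.2 fun i _ => zpow_ne_zero _ (hx0 i)
    have h6 : ∀ k : {k // α k = β}, c k * ∏ i, x i ^ α k i = c k * ∏ i, x i ^ β i :=
      fun k => by rw [k.2]
    rw [tsum_congr h6, tsum_mul_right]
    have h7 : ∑' k : {k // α k = β}, c k = 0 := by
      rw [← hcoef β]
      have := tsum_subtype {k | α k = β} c
      refine this.trans (tsum_congr fun k => ?_)
      simp [Set.indicator_apply]
    rw [h7, zero_mul]
  have h8 : HasSum (fun _ : ι → ℤ => (0 : ℂ)) (F x) := h4.of_eq h5 rfl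
  exact h8.unique hasSum_zero

end TorusChange

/-! ### Self-adjointness on the torus -/

theorem prod_ne_eq_prod_lt {n : ℕ} (f : Fin n → Fin n → ℂ) :
    ∏ i, ∏ j, (if i = j then 1 else f i j) = ∏ i, ∏ j, if i < j then f i j * f j i else 1 := by
  have h1 : ∀ i j : Fin n, (if i = j then 1 else f i j) =
      (if i < j then f i j else 1) * if j < i then f i j else 1 := by
    intro i j
    rcases lt_trichotomy i j with h | h | h
    · simp [h, h.ne, h.not_gt]
    · simp [h]
    · simp [h, h.ne', h.not_gt]
  simp only [h1, Finset.prod_mul_distrib]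
  rw [Finset.prod_comm (f := fun i j => if j < i then f i j else 1)]
  simp only [← Finset.prod_mul_distrib]
  refine Finset.prod_congr rfl fun i _ => Finset.prod_congr rfl fun j _ => ?_
  split_ifs <;> simp

/-- The weight function divided by the two Vandermonde products. -/
def reducedDelta (q t : ℂ) {n : ℕ} (y : Fin n → ℂ) : ℂ :=
  ∏ i, ∏ j, if i = j then 1 else qPoch (q * (y i / y j)) q / qPoch (t * (y i / y j)) q

theorem reducedDelta_inv (q t : ℂ) {n : ℕ} (y : Fin n → ℂ) :
    reducedDelta q t (fun i => (y i)⁻¹) = reducedDelta q t y := by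
  rw [reducedDelta, Finset.prod_comm]
  refine Finset.prod_congr rfl fun i _ => Finset.prod_congr rfl fun j _ => ?_
  simp only [eq_comm (a := j), inv_div_inv]

/-- Splitting off the first factor of each numerator leaves `(1 - y_i / y_j)(1 - y_j / y_i)` for
every pair, a product of one factor from each Vandermonde product. -/
theorem macDelta_eq {q : ℝ} (hq0 : 0 < q) (hq1 : q < 1) (t : ℂ) {n : ℕ} {y : Fin n → ℂ}
    (hy : ∀ i, y i ≠ 0) :
    macDelta q t y = vd y * vd (fun i => (y i)⁻¹) * reducedDelta q t y := by
  rw [macDelta, reducedDelta, prod_ne_eq_prod_lt, prod_ne_eq_prod_lt, vd_eq_prod_ite,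
    vd_eq_prod_ite]
  simp only [← Finset.prod_mul_distrib]
  refine Finset.prod_congr rfl fun i _ => Finset.prod_congr rfl fun j _ => ?_
  by_cases h : i < j
  · simp only [if_pos h]
    rw [qPoch_mul_q hq0 hq1 (y i / y j), qPoch_mul_q hq0 hq1 (y j / y i), mul_comm (y i / y j),
      mul_comm (y j / y i), mul_div_assoc t, mul_div_assoc t]
    have h1 := hy i
    have h2 := hy j
    have : (y i - y j) * ((y i)⁻¹ - (y j)⁻¹) = (1 - y i / y j) * (1 - y j / y i) := by
      field_simp
    rw [this]; ring
  · simp [h]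

/-- The kernel of the `I`-th term of the difference operator. -/
def shiftKernel (q t : ℂ) {n : ℕ} (I : Finset (Fin n)) (y : Fin n → ℂ) : ℂ :=
  (∏ i, ∏ j, if i < j then (if i ∈ I ∧ j ∈ I then t else 1) else 1) *
  ∏ i, ∏ j, if i = j then 1 else
    qPoch ((if i ∉ I ∧ j ∈ I then q else 1) * (y i / y j)) q /
      qPoch (t * (if i ∉ I ∧ j ∈ I then q else 1) * (y i / y j)) q

/-- The Vandermonde factors restore leading factors of numerators. If just one of `i`, `j` lies in
`I`, they supply one such factor and a factor `1 - t u`, which moves the corresponding denominator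
from `t u` to `t q u`. -/
theorem vd_mul_vd_mul_reducedDelta {q : ℝ} (hq0 : 0 < q) (hq1 : q < 1) {t : ℂ} {n : ℕ}
    {y : Fin n → ℂ} (hy : ∀ i, y i ≠ 0) (ht : ∀ i j, 1 - t * (y i / y j) ≠ 0)
    (I : Finset (Fin n)) :
    vd (fun i => onSet I t i * (y i)⁻¹) * vd y * reducedDelta q t y = shiftKernel q t I y := by
  rw [shiftKernel, reducedDelta, prod_ne_eq_prod_lt, prod_ne_eq_prod_lt, vd_eq_prod_ite,
    vd_eq_prod_ite]
  simp only [← Finset.prod_mul_distrib]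
  refine Finset.prod_congr rfl fun i _ => Finset.prod_congr rfl fun j _ => ?_
  by_cases h : i < j
  · simp only [if_pos h]
    have h1 := hy i
    have h2 := hy j
    have e1 : ∀ a b : Fin n, qPoch (y a / y b) q = (1 - y a / y b) * qPoch (q * (y a / y b)) q :=
      fun a b => by rw [qPoch_mul_q hq0 hq1, mul_comm (y a / y b)]
    have e2 : ∀ a b : Fin n, qPoch (t * q * (y a / y b)) q =
        qPoch (t * (y a / y b)) q / (1 - t * (y a / y b)) := by
      intro a b
      rw [qPoch_mul_q hq0 hq1 (t * (y a / y b)), mul_div_cancel_left₀ _ (ht a b)]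
      congr 1; ring
    by_cases hi : i ∈ I <;> by_cases hj : j ∈ I
    · simp only [onSet, hi, hj, if_true, not_true_eq_false, false_and, if_false, one_mul, mul_one,
        and_self, e1]
      have : (t * (y i)⁻¹ - t * (y j)⁻¹) * (y i - y j) =
          t * ((1 - y i / y j) * (1 - y j / y i)) := by
        field_simp
      rw [this]; ring
    · simp only [onSet, hi, hj, if_true, not_true_eq_false, if_false, one_mul, mul_one,
        and_self, and_false, not_false_eq_true, e1, e2]
      have : (t * (y i)⁻¹ - (y j)⁻¹) * (y i - y j) =
          (1 - y i / y j) * (1 - t * (y j / y i)) := by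
        field_simp; ring
      rw [this, div_div_eq_mul_div]; ring
    · simp only [onSet, hi, hj, if_true, not_true_eq_false, false_and, if_false, one_mul, mul_one,
        and_self, not_false_eq_true, e1, e2]
      have : ((y i)⁻¹ - t * (y j)⁻¹) * (y i - y j) =
          (1 - y j / y i) * (1 - t * (y i / y j)) := by
        field_simp
      rw [this, div_div_eq_mul_div]; ring
    · simp only [onSet, hi, hj, if_false, and_false, one_mul, mul_one, e1]
      have : ((y i)⁻¹ - (y j)⁻¹) * (y i - y j) = (1 - y i / y j) * (1 - y j / y i) := by
        field_simp
      rw [this]; ring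
  · simp [h]

/-- Mixed pairs absorb or release one factor `q`, so the shift has the same effect as inverting all
variables. This is the source of self-adjointness. -/
theorem shiftKernel_shift {q : ℂ} (hq : q ≠ 0) (t : ℂ) {n : ℕ} (I : Finset (Fin n)) (y : Fin n → ℂ) :
    shiftKernel q t I (fun i => onSet I q i * y i) = shiftKernel q t I fun i => (y i)⁻¹ := by
  rw [shiftKernel, shiftKernel]
  congr 1
  conv_rhs => rw [Finset.prod_comm]
  refine Finset.prod_congr rfl fun i _ => Finset.prod_congr rfl fun j _ => ?_
  simp only [eq_comm (a := j), inv_div_inv]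
  by_cases h : i = j
  · simp [h]
  rw [if_neg h, if_neg h]
  by_cases hi : i ∈ I <;> by_cases hj : j ∈ I
  · simp only [onSet, hi, hj, if_true, not_true_eq_false, false_and, if_false, one_mul, mul_one,
      mul_div_mul_left _ _ hq]
  · simp only [onSet, hi, hj, if_true, not_true_eq_false, false_and, and_true, if_false, one_mul,
      mul_one, not_false_eq_true, mul_div_assoc, mul_assoc]
  · have : q * (y i / (q * y j)) = y i / y j := by
      rw [mul_div_assoc', mul_div_mul_left _ _ hq]
    simp only [onSet, hi, hj, if_true, not_true_eq_false, and_true, and_false, if_false,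
      one_mul, mul_one, not_false_eq_true, mul_assoc, this]
  · simp only [onSet, hi, hj, if_false, and_false, one_mul, mul_one]

/-- Shrinking the circles of `I` from radius 1 to `q` enlarges the mixed ratios by `1 / q`, but
precisely there the denominators contain the extra factor `q`; all their arguments stay in the open
unit disc. -/
theorem laurentOn_shiftKernel {q : ℝ} (hq0 : 0 < q) (hq1 : q < 1) {t : ℂ} (ht : ‖t‖ < 1) {n : ℕ}
    (I : Finset (Fin n)) :
    LaurentOn {fun _ => (1 : ℝ), fun i => if i ∈ I then q else 1} (shiftKernel q t I) := by
  have hpos : ∀ R ∈ ({fun _ => (1 : ℝ), fun i => if i ∈ I then q else 1} : Set (Fin n → ℝ)),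
      ∀ i, 0 < R i := by
    rintro R (rfl | rfl) i
    · exact one_pos
    · dsimp only; split_ifs <;> [exact hq0; exact one_pos]
  refine LaurentOn.mul hpos (laurentOn_const _ _) ?_
  refine LaurentOn.prod hpos _ fun i _ => LaurentOn.prod hpos _ fun j _ => ?_
  by_cases hij : i = j
  · simp only [if_pos hij]; exact laurentOn_const _ _
  simp only [if_neg hij, div_eq_mul_inv _ (qPoch _ _)]
  refine LaurentOn.mul hpos (laurentOn_qPoch_ratio hq0 hq1 hpos _ i j)
    (laurentOn_qPoch_ratio_inv hq0 hq1 hpos _ i j fun R hR => ?_)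
  have ht0 := norm_nonneg t
  have htq : ‖t‖ * q < 1 := by nlinarith
  rcases hR with rfl | rfl
  · split_ifs <;> simp [abs_of_pos hq0, ht, htq]
  · by_cases hi : i ∈ I <;> by_cases hj : j ∈ I <;>
      simp [hi, hj, abs_of_pos hq0, ht, htq, hq0.ne']

/-! ### The scalar product on the torus -/

/-- The radii of tori on which all coordinates have the same modulus. -/
def constRadii (n : ℕ) : Set (Fin n → ℝ) := {R | ∃ c : ℝ, 0 < c ∧ R = fun _ => c}

theorem constRadii_pos {n : ℕ} : ∀ R ∈ constRadii n, ∀ i, 0 < R i := by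
  rintro R ⟨c, hc, rfl⟩ i; exact hc

theorem const_mem_constRadii {n : ℕ} {c : ℝ} (hc : 0 < c) : (fun _ => c) ∈ constRadii n :=
  ⟨c, hc, rfl⟩

theorem laurentOn_macDelta {q : ℝ} (hq0 : 0 < q) (hq1 : q < 1) {t : ℂ} (ht : ‖t‖ < 1) (n : ℕ) :
    LaurentOn (constRadii n) (macDelta q t) := by
  refine LaurentOn.prod constRadii_pos _ fun i _ => LaurentOn.prod constRadii_pos _ fun j _ => ?_
  by_cases hij : i = j
  · simp only [if_pos hij]; exact laurentOn_const _ _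
  simp only [if_neg hij, div_eq_mul_inv _ (qPoch _ _)]
  have h1 := laurentOn_qPoch_ratio hq0 hq1 (constRadii_pos (n := n)) 1 i j
  have h2 := laurentOn_qPoch_ratio_inv hq0 hq1 (constRadii_pos (n := n)) t i j (by
    rintro R ⟨c, hc, rfl⟩
    rwa [div_self hc.ne', mul_one])
  simp only [one_mul] at h1
  simp only [← mul_div_assoc] at h2
  exact LaurentOn.mul constRadii_pos h1 h2

theorem laurentOn_eval_self {n : ℕ} (f : MvPolynomial (Fin n) ℂ) {Ω : Set (Fin n → ℝ)}
    (hΩ : ∀ R ∈ Ω, ∀ i, 0 < R i) : LaurentOn Ω fun y => eval y f :=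
  laurentOn_eval hΩ f (fun y => y) fun i => laurentOn_coord _ i

theorem laurentOn_eval_inv {n : ℕ} (f : MvPolynomial (Fin n) ℂ) {Ω : Set (Fin n → ℝ)}
    (hΩ : ∀ R ∈ Ω, ∀ i, 0 < R i) : LaurentOn Ω fun y => eval (fun i => (y i)⁻¹) f :=
  laurentOn_eval hΩ f (fun y i => (y i)⁻¹) fun i => laurentOn_coord_inv _ i

/-- The mean of `f(1/y) g(y) Δ(y)` over the unit torus. -/
def innerMean (q t : ℂ) {n : ℕ} (f g : MvPolynomial (Fin n) ℂ) : ℂ :=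
  torusMean (fun _ => (1 : ℝ)) fun y => eval (fun i => (y i)⁻¹) f * eval y g * macDelta q t y

theorem innerPrime_eq (q t : ℂ) (n : ℕ) (f g : SymFun) :
    innerPrime q t n f g = 1 / (n.factorial : ℂ) * innerMean q t (toVars n f) (toVars n g) := rfl

theorem laurentOn_innerMean {q : ℝ} (hq0 : 0 < q) (hq1 : q < 1) {t : ℂ} (ht : ‖t‖ < 1) {n : ℕ}
    (f g : MvPolynomial (Fin n) ℂ) : LaurentOn (constRadii n) fun y =>
      eval (fun i => (y i)⁻¹) f * eval y g * macDelta q t y :=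
  ((laurentOn_eval_inv f constRadii_pos).mul constRadii_pos
    (laurentOn_eval_self g constRadii_pos)).mul constRadii_pos (laurentOn_macDelta hq0 hq1 ht n)

theorem innerMean_sum_smul {q : ℝ} (hq0 : 0 < q) (hq1 : q < 1) {t : ℂ} (ht : ‖t‖ < 1) {n : ℕ}
    (f : MvPolynomial (Fin n) ℂ) {κ : Type*} (s : Finset κ) (b : κ → ℂ)
    (g : κ → MvPolynomial (Fin n) ℂ) :
    innerMean q t f (∑ k ∈ s, b k • g k) = ∑ k ∈ s, b k * innerMean q t f (g k) := by
  have h : ∀ k ∈ s, TorusMeanExists (fun _ : Fin n => (1 : ℝ)) fun y =>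
      b k * (eval (fun i => (y i)⁻¹) f * eval y (g k) * macDelta q t y) := fun k _ =>
    ((laurentOn_innerMean hq0 hq1 ht f (g k)).exists_mean (const_mem_constRadii one_pos)
      fun _ => one_pos).const_mul _
  simp only [innerMean, ← torusMean_const_mul]
  rw [← torusMean_sum s _ _ h]
  congr 1
  funext y
  rw [map_sum, Finset.mul_sum, Finset.sum_mul]
  refine Finset.sum_congr rfl fun k _ => ?_
  rw [MvPolynomial.smul_eval]; ring

/-- The contours of the variables in `I` are moved to radius `q`, and rescaling back transfers the
q-shift from `f` to `g`. -/
theorem innerMean_shift {q : ℝ} (hq0 : 0 < q) (hq1 : q < 1) {t : ℂ} (ht : ‖t‖ < 1) {n : ℕ}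
    (f g : MvPolynomial (Fin n) ℂ) (I : Finset (Fin n)) :
    torusMean (fun _ => (1 : ℝ)) (fun y => shiftKernel q t I y *
      (eval (fun i => onSet I (q : ℂ) i * (y i)⁻¹) f * eval y g)) =
    torusMean (fun _ => (1 : ℝ)) (fun y => shiftKernel q t I (fun i => (y i)⁻¹) *
      (eval (fun i => (y i)⁻¹) f * eval (fun i => onSet I (q : ℂ) i * y i) g)) := by
  set c : Fin n → ℝ := fun i => if i ∈ I then q else 1 with hc
  have hcpos : ∀ i, 0 < c i := fun i => by simp only [hc]; split_ifs <;> [exact hq0; exact one_pos]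
  have hcI : ∀ i, (c i : ℂ) = onSet I (q : ℂ) i := fun i => by
    simp only [hc, onSet]; split_ifs <;> simp
  have hpos : ∀ R ∈ ({fun _ => (1 : ℝ), c} : Set (Fin n → ℝ)), ∀ i, 0 < R i := by
    rintro R (rfl | rfl) i <;> [exact one_pos; exact hcpos i]
  have hL : LaurentOn {fun _ => (1 : ℝ), c} fun y => shiftKernel q t I y *
      (eval (fun i => onSet I (q : ℂ) i * (y i)⁻¹) f * eval y g) := by
    refine (laurentOn_shiftKernel hq0 hq1 ht I).mul hpos (LaurentOn.mul hpos ?_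
      (laurentOn_eval_self g hpos))
    exact laurentOn_eval hpos f (fun y i => onSet I (q : ℂ) i * (y i)⁻¹) fun i =>
      (laurentOn_const _ _).mul hpos (laurentOn_coord_inv _ i)
  rw [hL.mean_eq (R := fun _ => 1) (R' := c) (Set.mem_insert _ _)
    (Set.mem_insert_of_mem _ rfl) (fun _ => one_pos) hcpos]
  have h1 := torusMean_scale c (fun _ => (1 : ℝ)) fun y => shiftKernel q t I y *
      (eval (fun i => onSet I (q : ℂ) i * (y i)⁻¹) f * eval y g)
  simp only [mul_one, hcI] at h1
  rw [h1]
  refine torusMean_congr (fun _ => one_pos) fun y hy => ?_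
  have hq : (q : ℂ) ≠ 0 := by exact_mod_cast hq0.ne'
  have hfun : (fun i => onSet I (q : ℂ) i * (onSet I (q : ℂ) i * y i)⁻¹) = fun i => (y i)⁻¹ := by
    funext i
    have : onSet I (q : ℂ) i ≠ 0 := by simp only [onSet]; split_ifs <;> simp [hq0.ne']
    rw [mul_inv, mul_inv_cancel_left₀ this]
  rw [shiftKernel_shift hq, hfun]

/-- Inserting the operator on `f(1/y)` or on `g(y)` gives equal integrals, term by term in `I`,
while the eigenvalues differ for some `X`. -/
theorem innerMean_eq_zero_of_ne {q : ℝ} (hq0 : 0 < q) (hq1 : q < 1) {t : ℂ} (ht0 : t ≠ 0)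
    (ht : ‖t‖ < 1) {n : ℕ} {f g : MvPolynomial (Fin n) ℂ} {α β : Fin n →₀ ℕ}
    (hf : IsEigen q t f α) (hg : IsEigen q t g β) (hne : α ≠ β) : innerMean q t f g = 0 := by
  obtain ⟨X, hX⟩ := (finite_macEps_eq hq0 hq1 ht0 ht hf.antitone hg.antitone
    (fun h => hne (DFunLike.coe_injective h))).exists_notMem
  have hne0 : ∀ y : Fin n → ℂ, (∀ i, ‖y i‖ = 1) → ∀ i, y i ≠ 0 := fun y hy i h0 => by
    have := hy i
    rw [h0, norm_zero] at this
    exact zero_ne_one this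
  have htu : ∀ y : Fin n → ℂ, (∀ i, ‖y i‖ = 1) → ∀ i j, 1 - t * (y i / y j) ≠ 0 := by
    intro y hy i j
    refine one_sub_ne_zero_of_norm_lt ?_
    rw [norm_mul, norm_div, hy, hy, div_one, mul_one]; exact ht
  have hinv : ∀ y : Fin n → ℂ, (∀ i, ‖y i‖ = 1) → ∀ i, ‖(y i)⁻¹‖ = 1 := fun y hy i => by
    rw [norm_inv, hy, inv_one]
  have hE : ∀ {h : MvPolynomial (Fin n) ℂ} {γ : Fin n →₀ ℕ}, IsEigen q t h γ → ∀ x : Fin n → ℂ,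
      macEps q t X γ * (vd x * eval x h) = ∑ I : Finset (Fin n), X ^ I.card *
      (vd (fun i => onSet I t i * x i) * eval (fun i => onSet I (q : ℂ) i * x i) h) := by
    intro h γ hh x
    rw [← eval_macN, hh.macN_eq, map_mul, eval_vdPoly, MvPolynomial.smul_eval]; ring
  have hone : (fun _ => (1 : ℝ)) ∈ constRadii n := const_mem_constRadii one_pos
  have hS : ∀ I : Finset (Fin n), LaurentOn {fun _ => (1 : ℝ)} (shiftKernel (q : ℂ) t I) := fun I =>
    (laurentOn_shiftKernel hq0 hq1 ht I).mono (by simp)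
  have hpos1 : ∀ R ∈ ({fun _ => (1 : ℝ)} : Set (Fin n → ℝ)), ∀ i, 0 < R i := by
    rintro R rfl i; exact one_pos
  have hA : macEps q t X α * innerMean q t f g = ∑ I : Finset (Fin n), X ^ I.card *
      torusMean (fun _ => (1 : ℝ)) (fun y => shiftKernel q t I y *
      (eval (fun i => onSet I (q : ℂ) i * (y i)⁻¹) f * eval y g)) := by
    have hex : ∀ I ∈ (Finset.univ : Finset (Finset (Fin n))),
        TorusMeanExists (fun _ : Fin n => (1 : ℝ)) fun y => X ^ I.card * (shiftKernel q t I y *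
      (eval (fun i => onSet I (q : ℂ) i * (y i)⁻¹) f * eval y g)) := fun I _ => by
      refine (LaurentOn.exists_mean (Ω := {fun _ => (1 : ℝ)}) ?_ rfl fun _ => one_pos).const_mul _
      refine (hS I).mul hpos1 (LaurentOn.mul hpos1 ?_ (laurentOn_eval_self g hpos1))
      exact laurentOn_eval hpos1 f (fun y i => onSet I (q : ℂ) i * (y i)⁻¹) fun i =>
        (laurentOn_const _ _).mul hpos1 (laurentOn_coord_inv _ i)
    rw [innerMean, ← torusMean_const_mul]
    simp only [← torusMean_const_mul]
    rw [← torusMean_sum _ _ _ hex]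
    refine torusMean_congr (fun _ => one_pos) fun y hy => ?_
    rw [macDelta_eq hq0 hq1 t (hne0 y hy)]
    rw [show macEps (q : ℂ) t X α * (eval (fun i => (y i)⁻¹) f * eval y g *
        (vd y * vd (fun i => (y i)⁻¹) * reducedDelta q t y)) =
      macEps (q : ℂ) t X α * (vd (fun i => (y i)⁻¹) * eval (fun i => (y i)⁻¹) f) *
        (vd y * reducedDelta q t y * eval y g) by ring, hE hf, Finset.sum_mul]
    refine Finset.sum_congr rfl fun I _ => ?_
    rw [← vd_mul_vd_mul_reducedDelta hq0 hq1 (hne0 y hy) (htu y hy)]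
    ring
  have hB : macEps q t X β * innerMean q t f g = ∑ I : Finset (Fin n), X ^ I.card *
      torusMean (fun _ => (1 : ℝ)) (fun y => shiftKernel q t I (fun i => (y i)⁻¹) *
      (eval (fun i => (y i)⁻¹) f * eval (fun i => onSet I (q : ℂ) i * y i) g)) := by
    have key : ∀ y : Fin n → ℂ, (∀ i, ‖y i‖ = 1) → ∀ I : Finset (Fin n),
        shiftKernel q t I (fun i => (y i)⁻¹) =
        vd (fun i => onSet I t i * y i) * vd (fun i => (y i)⁻¹) * reducedDelta q t y := by
      intro y hy I
      rw [← vd_mul_vd_mul_reducedDelta hq0 hq1 (fun i => inv_ne_zero (hne0 y hy i))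
        (htu _ (hinv y hy)), reducedDelta_inv]
      simp only [inv_inv]
    have hex : ∀ I ∈ (Finset.univ : Finset (Finset (Fin n))),
        TorusMeanExists (fun _ : Fin n => (1 : ℝ)) fun y => X ^ I.card *
        (shiftKernel q t I (fun i => (y i)⁻¹) *
      (eval (fun i => (y i)⁻¹) f * eval (fun i => onSet I (q : ℂ) i * y i) g)) := fun I _ => by
      refine (LaurentOn.exists_mean (Ω := {fun _ => (1 : ℝ)}) ?_ rfl fun _ => one_pos).const_mul _
      refine LaurentOn.mul hpos1 ?_ (LaurentOn.mul hpos1 (laurentOn_eval_inv f hpos1) ?_)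
      · obtain ⟨κ, hκ, c, γ, H⟩ := hS I
        refine ⟨κ, hκ, c, fun k i => -γ k i, fun y hy => ?_⟩
        have := H (fun i => (y i)⁻¹) (by
          rw [Set.mem_singleton_iff] at hy ⊢
          funext i
          rw [norm_inv, congrFun hy i, inv_one])
        simpa only [inv_zpow', Pi.neg_apply] using this
      · exact laurentOn_eval hpos1 g (fun y i => onSet I (q : ℂ) i * y i) fun i =>
          (laurentOn_const _ _).mul hpos1 (laurentOn_coord _ i)
    rw [innerMean, ← torusMean_const_mul]
    simp only [← torusMean_const_mul]
    rw [← torusMean_sum _ _ _ hex]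
    refine torusMean_congr (fun _ => one_pos) fun y hy => ?_
    rw [macDelta_eq hq0 hq1 t (hne0 y hy)]
    rw [show macEps (q : ℂ) t X β * (eval (fun i => (y i)⁻¹) f * eval y g *
        (vd y * vd (fun i => (y i)⁻¹) * reducedDelta q t y)) =
      macEps (q : ℂ) t X β * (vd y * eval y g) *
        (vd (fun i => (y i)⁻¹) * reducedDelta q t y * eval (fun i => (y i)⁻¹) f) by ring,
      hE hg, Finset.sum_mul]
    refine Finset.sum_congr rfl fun I _ => ?_
    rw [key y hy]
    ring
  have hAB : macEps q t X α * innerMean q t f g = macEps q t X β * innerMean q t f g := by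
    rw [hA, hB]
    exact Finset.sum_congr rfl fun I _ => by rw [innerMean_shift hq0 hq1 ht]
  have h0 : (macEps q t X α - macEps q t X β) * innerMean q t f g = 0 := by
    rw [sub_mul, hAB, sub_self]
  exact (mul_eq_zero.1 h0).resolve_left (sub_ne_zero.2 hX)

/-! ### Non-vanishing of the torus norm -/

theorem macDelta_perm (q t : ℂ) {n : ℕ} (σ : Equiv.Perm (Fin n)) (y : Fin n → ℂ) :
    macDelta q t (fun i => y (σ i)) = macDelta q t y := by
  rw [macDelta, macDelta]
  conv_rhs => rw [← Equiv.prod_comp σ]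
  refine Finset.prod_congr rfl fun i _ => ?_
  conv_rhs => rw [← Equiv.prod_comp σ]
  exact Finset.prod_congr rfl fun j _ => by simp only [σ.injective.eq_iff]

theorem torusMean_perm {n : ℕ} (σ : Equiv.Perm (Fin n)) (c : ℝ) (F : (Fin n → ℂ) → ℂ) :
    torusMean (fun _ => c) (fun y => F fun i => y (σ i)) = torusMean (fun _ => c) F := by
  have := torusMean_reindex σ.symm (fun _ => c) F
  simpa only [Equiv.symm_symm] using this

theorem eval_perm_of_symm {n : ℕ} {f : MvPolynomial (Fin n) ℂ} (hf : f.IsSymmetric)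
    (σ : Equiv.Perm (Fin n)) (x : Fin n → ℂ) : eval (fun i => x (σ i)) f = eval x f := by
  conv_rhs => rw [← hf σ]
  rw [MvPolynomial.eval_rename]; rfl

theorem innerMean_self_boost (q t : ℂ) {n : ℕ} (f : MvPolynomial (Fin n) ℂ) (k : ℕ) :
    innerMean q t ((∏ i, MvPolynomial.X i) ^ k * f) ((∏ i, MvPolynomial.X i) ^ k * f) =
      innerMean q t f f := by
  refine torusMean_congr (fun _ => one_pos) fun y hy => ?_
  have h1 : (∏ i, y i) ≠ 0 := Finset.prod_ne_zero_iff.2 fun i _ h => by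
    have := hy i
    rw [h, norm_zero] at this
    exact zero_ne_one this
  simp only [map_mul, map_pow, map_prod, MvPolynomial.eval_X, Finset.prod_inv_distrib]
  rw [show ((∏ i, y i)⁻¹ ^ k * eval (fun i => (y i)⁻¹) f * ((∏ i, y i) ^ k * eval y f)) =
    ((∏ i, y i)⁻¹ * ∏ i, y i) ^ k * (eval (fun i => (y i)⁻¹) f * eval y f) by rw [mul_pow]; ring,
    inv_mul_cancel₀ h1, one_pow, one_mul]

theorem infinite_unit_circle : (Metric.sphere (0 : ℂ) 1).Infinite := by
  refine IsPreconnected.infinite_of_nontrivial (isPreconnected_sphere ?_ _ _) ?_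
  · rw [Complex.rank_real_complex]; norm_num
  · exact ⟨1, by simp, -1, by simp, by norm_num⟩

section SelfOrthogonal

variable {q : ℝ} (hq0 : 0 < q) (hq1 : q < 1) {t : ℂ} (ht0 : t ≠ 0) (ht : ‖t‖ < 1) {n : ℕ}
include hq0 hq1 ht0 ht

/-- Eigenfunctions with other exponents are orthogonal to `f` already, so a vanishing norm makes `f`
orthogonal to every Macdonald polynomial, and these span. -/
theorem innerMean_eq_zero_of_symm {f : MvPolynomial (Fin n) ℂ} {α : Fin n →₀ ℕ}
    (hf : IsEigen q t f α) (h0 : innerMean q t f f = 0) {g : MvPolynomial (Fin n) ℂ} {d : ℕ}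
    (hg : g.IsSymmetric) (hd : g.IsHomogeneous d) : innerMean q t f g = 0 := by
  have hP := macdonaldP_spec hq0 hq1 ht0 ht d
  obtain ⟨b, rfl⟩ := exists_sum_macdonaldP hP hg hd
  rw [innerMean_sum_smul hq0 hq1 ht]
  refine Finset.sum_eq_zero fun κ _ => ?_
  by_cases hκ : Multiset.card κ.parts ≤ n
  · have hE := hP.isEigen ht0 κ hκ
    by_cases hα : α = rowOf n κ
    · subst hα
      rw [hE.unique hq0 hq1 ht0 ht hf, h0, mul_zero]
    · rw [innerMean_eq_zero_of_ne hq0 hq1 ht0 ht hf hE hα, mul_zero]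
  · rw [hP.triangular.toVars_eq_zero κ (not_le.1 hκ)]
    have := innerMean_sum_smul hq0 hq1 ht f (∅ : Finset ℕ) (fun _ => 0) (fun _ => 0)
    simp only [Finset.sum_empty] at this
    rw [this, mul_zero]

/-- As `f` and the weight are symmetric, all permutations of a monomial pair equally with `f`, and
their sum is symmetric. -/
theorem innerMean_monomial_eq_zero {f : MvPolynomial (Fin n) ℂ} {α : Fin n →₀ ℕ}
    (hf : IsEigen q t f α) (h0 : innerMean q t f f = 0) (β : Fin n →₀ ℕ) :
    innerMean q t f (monomial β 1) = 0 := by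
  set p : MvPolynomial (Fin n) ℂ := monomial β 1
  have hsum : innerMean q t f (∑ σ : Equiv.Perm (Fin n), rename σ p) =
      (n.factorial : ℂ) * innerMean q t f p := by
    have h1 := innerMean_sum_smul hq0 hq1 ht f (Finset.univ : Finset (Equiv.Perm (Fin n)))
      (fun _ => 1) (fun σ => rename σ p)
    simp only [one_smul, one_mul] at h1
    have h2 : ∀ σ : Equiv.Perm (Fin n), innerMean q t f (rename σ p) = innerMean q t f p := by
      intro σ
      rw [innerMean, innerMean, ← torusMean_perm σ⁻¹]
      congr 1
      funext y
      rw [macDelta_perm, MvPolynomial.eval_rename, eval_perm_of_symm hf.symm σ⁻¹ fun i => (y i)⁻¹]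
      have e : (fun i => y (σ⁻¹ i)) ∘ ⇑σ = y := by funext i; simp
      rw [e]
    rw [h1, Finset.sum_congr rfl fun σ _ => h2 σ, Finset.sum_const, Finset.card_univ,
      Fintype.card_perm, Fintype.card_fin, nsmul_eq_mul]
  have hz : innerMean q t f (∑ σ : Equiv.Perm (Fin n), rename σ p) = 0 := by
    refine innerMean_eq_zero_of_symm hq0 hq1 ht0 ht hf h0 (d := β.degree) (fun τ => ?_) ?_
    · rw [map_sum, ← Equiv.sum_comp (Equiv.mulLeft τ) fun σ => rename σ p]
      refine Finset.sum_congr rfl fun σ _ => ?_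
      rw [MvPolynomial.rename_rename]; rfl
    · refine MvPolynomial.IsHomogeneous.sum _ _ _ fun σ _ => ?_
      exact (MvPolynomial.isHomogeneous_monomial _ rfl).rename_isHomogeneous
  rw [hsum] at hz
  exact (mul_eq_zero.1 hz).resolve_left (by exact_mod_cast n.factorial_ne_zero)

/-- Multiplying `f` by a high power of `x_1 ⋯ x_n` keeps it an eigenfunction of zero norm and clears
the negative exponents. -/
theorem torusMean_zpow_eq_zero {f : MvPolynomial (Fin n) ℂ} {α : Fin n →₀ ℕ}
    (hf : IsEigen q t f α) (h0 : innerMean q t f f = 0) (β : Fin n → ℤ) :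
    torusMean (fun _ => (1 : ℝ)) (fun y => eval (fun i => (y i)⁻¹) f * macDelta q t y *
      ∏ i, y i ^ β i) = 0 := by
  set k : ℕ := ∑ i, (-β i).toNat with hk
  have hkβ : ∀ i, 0 ≤ (k : ℤ) + β i := by
    intro i
    have h1 : (-β i).toNat ≤ k := Finset.single_le_sum (f := fun i => (-β i).toNat)
      (fun _ _ => Nat.zero_le _) (Finset.mem_univ i)
    have h2 := Int.self_le_toNat (-β i)
    omega
  have hE := hf.boost k (β := Finsupp.equivFunOnFinite.symm fun i => k + α i) fun i => rfl
  have h1 := innerMean_monomial_eq_zero hq0 hq1 ht0 ht hE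
    (by rw [innerMean_self_boost]; exact h0)
    (Finsupp.equivFunOnFinite.symm fun i => ((k : ℤ) + β i).toNat)
  rw [← h1]
  refine torusMean_congr (fun _ => one_pos) fun y hy => ?_
  have hy0 : ∀ i, y i ≠ 0 := fun i h => by
    have := hy i
    rw [h, norm_zero] at this
    exact zero_ne_one this
  have h2 : eval y (monomial (Finsupp.equivFunOnFinite.symm fun i => ((k : ℤ) + β i).toNat) 1) =
      (∏ i, y i) ^ k * ∏ i, y i ^ β i := by
    rw [MvPolynomial.eval_monomial, one_mul, Finsupp.prod_fintype _ _ (by simp), ← Finset.prod_pow,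
      ← Finset.prod_mul_distrib]
    refine Finset.prod_congr rfl fun i _ => ?_
    rw [← zpow_natCast, ← zpow_natCast, ← zpow_add₀ (hy0 i)]
    congr 1
    exact Int.toNat_of_nonneg (hkβ i)
  rw [h2]
  simp only [map_mul, map_pow, map_prod, MvPolynomial.eval_X, Finset.prod_inv_distrib]
  have h3 : (∏ i, y i) ^ k ≠ 0 := pow_ne_zero _ (Finset.prod_ne_zero_iff.2 fun i _ => hy0 i)
  rw [inv_pow]
  field_simp

/-- If the norm vanished, so would all Fourier coefficients of `f(1/y) Δ(y)`, hence the function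
itself on the unit torus. There `Δ` is nonzero at distinct coordinates, so `f` times the Vandermonde
product would vanish on a product of infinite sets. -/
theorem innerMean_self_ne_zero {f : MvPolynomial (Fin n) ℂ} {α : Fin n →₀ ℕ}
    (hf : IsEigen q t f α) : innerMean q t f f ≠ 0 := by
  intro h0
  have hone : (fun _ => (1 : ℝ)) ∈ constRadii n := const_mem_constRadii one_pos
  have hL : LaurentOn {fun _ : Fin n => (1 : ℝ)} fun y =>
      eval (fun i => (y i)⁻¹) f * macDelta q t y :=
    ((laurentOn_eval_inv f constRadii_pos).mul constRadii_pos
      (laurentOn_macDelta hq0 hq1 ht n)).mono (by simpa using hone)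
  have hzero := hL.eq_zero (fun _ => one_pos) (torusMean_zpow_eq_zero hq0 hq1 ht0 ht hf h0)
  have hprod : f * vdPoly n = 0 := by
    refine MvPolynomial.funext_set (fun _ => Metric.sphere (0 : ℂ) 1)
      (fun _ => infinite_unit_circle) fun x hx => ?_
    have hx1 : ∀ i, ‖x i‖ = 1 := fun i => by simpa using hx i (Set.mem_univ i)
    rw [map_zero, map_mul, eval_vdPoly]
    by_cases hinj : Function.Injective x
    · have hx0 : ∀ i, x i ≠ 0 := fun i h => by
        have := hx1 i
        rw [h, norm_zero] at this
        exact zero_ne_one this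
      have h1 := hzero (fun i => (x i)⁻¹) fun i => by rw [norm_inv, hx1, inv_one]
      simp only [inv_inv] at h1
      refine mul_eq_zero_of_left ((mul_eq_zero.1 h1).resolve_right ?_) _
      refine Finset.prod_ne_zero_iff.2 fun i _ => Finset.prod_ne_zero_iff.2 fun j _ => ?_
      split_ifs with hij
      · exact one_ne_zero
      have hu : ‖(x i)⁻¹ / (x j)⁻¹‖ = 1 := by rw [norm_div, norm_inv, norm_inv, hx1, hx1]; norm_num
      refine div_ne_zero ?_ (qPoch_ne_zero hq0 hq1 ?_)
      · rw [qPoch_mul_q hq0 hq1]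
        refine mul_ne_zero ?_ (qPoch_ne_zero hq0 hq1 ?_)
        · rw [sub_ne_zero]
          intro h
          have h3 : (x j)⁻¹ = (x i)⁻¹ :=
            ((div_eq_one_iff_eq (inv_ne_zero (hx0 j))).1 h.symm).symm
          exact hij (hinj (inv_injective h3.symm))
        · rw [norm_mul, hu, one_mul, Complex.norm_real, Real.norm_eq_abs, abs_of_pos hq0]
          exact hq1
      · rw [mul_div_assoc, norm_mul, hu, mul_one]; exact ht
    · have : vd x = 0 := by
        by_contra h; exact hinj (vd_ne_zero_iff.1 h)
      rw [this, mul_zero]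
  have hf0 : f = 0 := (mul_eq_zero.1 hprod).resolve_right (vdPoly_ne_zero n)
  have := hf.coeff_eq
  rw [hf0, MvPolynomial.coeff_zero] at this
  exact zero_ne_one this

end SelfOrthogonal

/-! ### Macdonald functions as eigenfunctions of an integral operator -/

theorem hasSum_torusMean {ι κ : Type} [Fintype ι] [Countable κ] {R : ι → ℝ} (hR : ∀ i, 0 < R i)
    {h : (ι → ℂ) → ℂ} {g : κ → (ι → ℂ) → ℂ} {G : (ι → ℂ) → ℂ} {b : κ → ℝ}
    (hh : TorusMeanExists R h) (hhg : ∀ k, TorusMeanExists R fun y => h y * g k y)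
    (hb : Summable b) (hbd : ∀ k y, (∀ i, ‖y i‖ = R i) → ‖g k y‖ ≤ b k)
    (hs : ∀ y, (∀ i, ‖y i‖ = R i) → HasSum (fun k => g k y) (G y)) :
    HasSum (fun k => torusMean R fun y => h y * g k y) (torusMean R fun y => h y * G y) := by
  simp only [torusMean_eq]
  refine HasSum.mul_left _ ?_
  rw [torusMeanExists_iff] at hh
  refine hasSum_integral_of_dominated_convergence (fun k θ => ‖h (torusPoint R θ)‖ * b k)
    (fun k => ((torusMeanExists_iff R _).1 (hhg k)).aestronglyMeasurable)
    (fun k => Eventually.of_forall fun θ => ?_) (Eventually.of_forall fun θ => hb.mul_left _) ?_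
    (Eventually.of_forall fun θ => (hs _ (norm_torusPoint hR θ)).mul_left _)
  · rw [norm_mul]
    exact mul_le_mul_of_nonneg_left (hbd k _ (norm_torusPoint hR θ)) (norm_nonneg _)
  · simp only [tsum_mul_left]
    exact hh.norm.mul_const _

/-- The mean is the same at radius `c` and `2 c`, while homogeneity of degree `k - l` multiplies it
by `2^{k-l}`. The two powers of 2 avoid a signed degree. -/
theorem torusMean_eq_zero_of_degree {n : ℕ} {F : (Fin n → ℂ) → ℂ} (hF : LaurentOn (constRadii n) F)
    {k l : ℕ} (hkl : k ≠ l)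
    (h : ∀ y : Fin n → ℂ, (∀ i, y i ≠ 0) → 2 ^ l * F (fun i => 2 * y i) = 2 ^ k * F y) {c : ℝ}
    (hc : 0 < c) : torusMean (fun _ => c) F = 0 := by
  have h1 := hF.mean_eq (const_mem_constRadii (by positivity : 0 < 2 * c)) (const_mem_constRadii hc)
    (fun _ => by positivity) (fun _ => hc)
  have h2 := torusMean_scale (fun _ : Fin n => (2 : ℝ)) (fun _ => c) F
  rw [h1] at h2
  have h3 : (2 : ℂ) ^ l * torusMean (fun _ : Fin n => c) F = 2 ^ k * torusMean (fun _ => c) F := by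
    conv_lhs => rw [h2]
    rw [← torusMean_const_mul, ← torusMean_const_mul]
    refine torusMean_congr (fun _ => hc) fun y hy => ?_
    have := h y fun i h0 => by
      have := hy i
      rw [h0, norm_zero] at this
      exact hc.ne this
    simpa using this
  have h4 : ((2 : ℂ) ^ l - 2 ^ k) * torusMean (fun _ : Fin n => c) F = 0 := by
    rw [sub_mul, h3, sub_self]
  refine (mul_eq_zero.1 h4).resolve_left (sub_ne_zero.2 fun h5 => hkl ?_)
  have h6 : (2 : ℕ) ^ l = 2 ^ k := by exact_mod_cast h5
  exact (Nat.pow_right_injective le_rfl h6).symm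

theorem norm_powSum_le {n : ℕ} (r : ℕ) {x : Fin n → ℂ} {R : Fin n → ℝ} (h : ∀ i, ‖x i‖ ≤ R i) :
    ‖powSum r x‖ ≤ ‖powSum r fun i => (R i : ℂ)‖ := by
  have h1 : powSum r (fun i => (R i : ℂ)) = ((∑ i, R i ^ r : ℝ) : ℂ) := by simp [powSum]
  have h0 : ∀ i, 0 ≤ R i := fun i => (norm_nonneg _).trans (h i)
  rw [h1, Complex.norm_real, Real.norm_eq_abs,
    abs_of_nonneg (Finset.sum_nonneg fun i _ => pow_nonneg (h0 i) r)]
  refine (norm_sum_le _ _).trans (Finset.sum_le_sum fun i _ => ?_)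
  rw [norm_pow]
  exact pow_le_pow_left₀ (norm_nonneg _) (h i) r

theorem norm_evalAt_monomial_le {n : ℕ} (m : ℕ+ →₀ ℕ) {x : Fin n → ℂ} {R : Fin n → ℝ}
    (h : ∀ i, ‖x i‖ ≤ R i) :
    ‖evalAt (monomial m 1) x‖ ≤ ‖evalAt (monomial m 1) fun i => (R i : ℂ)‖ := by
  rw [evalAt_monomial, evalAt_monomial, Finsupp.prod, Finsupp.prod, norm_prod, norm_prod]
  refine Finset.prod_le_prod (fun _ _ => norm_nonneg _) fun r _ => ?_
  rw [norm_pow, norm_pow]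
  exact pow_le_pow_left₀ (norm_nonneg _) (norm_powSum_le _ h) _

theorem rowOf_injective_of_card {n d : ℕ} {κ μ : d.Partition} (hκ : Multiset.card κ.parts ≤ n)
    (hμ : Multiset.card μ.parts ≤ n) (h : rowOf n κ = rowOf n μ) : κ = μ :=
  Nat.Partition.ext (by rw [← expParts_rowOf κ hκ, h, expParts_rowOf μ hμ])

/-- Integrating the power-sum expansion termwise leaves only degree `d`, by homogeneity. That finite
part is rewritten in the functions `P μ`, and orthogonality on the torus keeps `μ = κ`. -/
theorem torusMean_kernelPi {q : ℝ} (hq0 : 0 < q) (hq1 : q < 1) {t : ℂ} (ht0 : t ≠ 0) (ht : ‖t‖ < 1)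
    {n k d : ℕ} {P : d.Partition → SymFun} (hP : IsMacdonaldDegree q t P) (κ : d.Partition)
    (hκ : Multiset.card κ.parts ≤ n) (x : Fin k → ℂ) {R : ℝ} (hR : 0 < R) (hx : ∀ i, ‖x i‖ < R) :
    torusMean (fun _ : Fin n => R) (fun y => evalAt (P κ) y * macDelta q t y *
      kernelPi q t x fun j => (y j)⁻¹) =
    innerMean q t (toVars n (P κ)) (toVars n (P κ)) / innerQT q t (P κ) (P κ) *
      evalAt (P κ) x := by
  have hRm : (fun _ => R) ∈ constRadii n := const_mem_constRadii hR
  set h : (Fin n → ℂ) → ℂ := fun y => evalAt (P κ) y * macDelta q t y with hh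
  have hhL : LaurentOn (constRadii n) h := (laurentOn_eval_self _ constRadii_pos).mul
    constRadii_pos (laurentOn_macDelta hq0 hq1 ht n)
  set g : (ℕ+ →₀ ℕ) → (Fin n → ℂ) → ℂ := fun m y =>
    evalAt (monomial m 1) x * evalAt (monomial m 1) (fun j => (y j)⁻¹) / zqt q t m with hg
  have hgL : ∀ m, LaurentOn (constRadii n) fun y => h y * g m y := by
    intro m
    refine hhL.mul constRadii_pos ?_
    simp only [hg, div_eq_mul_inv]
    exact ((laurentOn_const _ _).mul constRadii_pos
      (laurentOn_eval_inv _ constRadii_pos)).mul constRadii_pos (laurentOn_const _ _)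
  -- The dominating series is the kernel expansion at the moduli `‖x_i‖` and `R⁻¹`, which still lies
  -- in the domain of convergence.
  have hbound : ∀ (i : Fin k) (_ : Fin n), ‖((‖x i‖ : ℝ) : ℂ) * ((R⁻¹ : ℝ) : ℂ)‖ < 1 := by
    intro i _
    rw [norm_mul, Complex.norm_real, Complex.norm_real, norm_norm, norm_inv, Real.norm_eq_abs,
      abs_of_pos hR, ← div_eq_mul_inv, div_lt_one hR]
    exact hx i
  have hsumb := (hasSum_kernelPi hq0 hq1 ht (x := fun i => ((‖x i‖ : ℝ) : ℂ))
    (y := fun _ : Fin n => ((R⁻¹ : ℝ) : ℂ)) hbound).summable.norm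
  have hbd : ∀ m y, (∀ i, ‖y i‖ = R) → ‖g m y‖ ≤ ‖evalAt (monomial m 1)
      (fun i => ((‖x i‖ : ℝ) : ℂ)) * evalAt (monomial m 1)
      (fun _ : Fin n => ((R⁻¹ : ℝ) : ℂ)) / zqt q t m‖ := by
    intro m y hy
    simp only [hg]
    rw [norm_div, norm_div, norm_mul, norm_mul]
    have h1 := norm_evalAt_monomial_le m (x := x) (R := fun i => ‖x i‖) fun _ => le_rfl
    have h2 := norm_evalAt_monomial_le m (x := fun j => (y j)⁻¹) (R := fun _ => R⁻¹) fun j => by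
      rw [norm_inv, hy]
    gcongr
  have hs : ∀ y : Fin n → ℂ, (∀ i, ‖y i‖ = R) →
      HasSum (fun m => g m y) (kernelPi q t x fun j => (y j)⁻¹) := by
    intro y hy
    refine hasSum_kernelPi hq0 hq1 ht fun i j => ?_
    rw [norm_mul, norm_inv, hy, ← div_eq_mul_inv, div_lt_one hR]
    exact hx i
  have hmain := hasSum_torusMean (fun _ => hR) (hhL.exists_mean hRm fun _ => hR)
    (fun m => (hgL m).exists_mean hRm fun _ => hR) hsumb hbd hs
  have hzero : ∀ m ∉ wtSet d, torusMean (fun _ : Fin n => R) (fun y => h y * g m y) = 0 := by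
    intro m hm
    rw [mem_wtSet] at hm
    refine torusMean_eq_zero_of_degree (hgL m) (k := d)
      (l := Finsupp.weight (fun r : ℕ+ => (r : ℕ)) m) (fun e => hm e.symm) (fun y hy => ?_) hR
    have h1 : macDelta (q : ℂ) t (fun i => 2 * y i) = macDelta q t y := by
      refine Finset.prod_congr rfl fun i _ => Finset.prod_congr rfl fun j _ => ?_
      rw [mul_div_mul_left _ _ two_ne_zero, mul_left_comm, mul_div_mul_left _ _ two_ne_zero]
    have h2 := (hP.triangular.hasDegree κ).evalAt_smul 2 y
    have h3 := evalAt_monomial_smul m (2 : ℂ)⁻¹ fun j => (y j)⁻¹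
    simp only [hh, hg, mul_inv, h1, h2, h3]
    have h4 : (2 : ℂ) ^ Finsupp.weight (fun r : ℕ+ => (r : ℕ)) m *
        (2 : ℂ)⁻¹ ^ Finsupp.weight (fun r : ℕ+ => (r : ℕ)) m = 1 := by
      rw [← mul_pow, mul_inv_cancel₀ two_ne_zero, one_pow]
    linear_combination (2 ^ d * evalAt (P κ) y * macDelta (↑q) t y *
      (evalAt ((monomial m) 1) x * evalAt ((monomial m) 1) (fun j => (y j)⁻¹) / zqt (↑q) t m)) * h4
  have hfin : HasSum (fun m => torusMean (fun _ : Fin n => R) fun y => h y * g m y)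
      (∑ m ∈ wtSet d, torusMean (fun _ : Fin n => R) fun y => h y * g m y) :=
    hasSum_sum_of_ne_finset_zero hzero
  rw [hmain.unique hfin, ← torusMean_sum _ _ _ fun m _ => (hgL m).exists_mean hRm fun _ => hR]
  have hexp : ∀ y : Fin n → ℂ, ∑ m ∈ wtSet d, h y * g m y = ∑ μ, evalAt (P μ) x /
      innerQT q t (P μ) (P μ) * (evalAt (P μ) (fun i => (y i)⁻¹) * evalAt (P κ) y *
        macDelta q t y) := by
    intro y
    rw [← Finset.mul_sum]
    have := hP.triangular.kernelDeg_eq hq0 hq1 ht hP.orthogonal hP.norm_ne_zero x fun j => (y j)⁻¹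
    rw [kernelDeg] at this
    rw [this, Finset.mul_sum]
    exact Finset.sum_congr rfl fun μ _ => by simp only [hh]; ring
  simp only [hexp]
  have hL : ∀ μ, LaurentOn (constRadii n) fun y => evalAt (P μ) (fun i => (y i)⁻¹) *
      evalAt (P κ) y * macDelta q t y := fun μ =>
    laurentOn_innerMean hq0 hq1 ht (toVars n (P μ)) (toVars n (P κ))
  rw [torusMean_sum _ _ _ fun μ _ => ((hL μ).exists_mean hRm fun _ => hR).const_mul _]
  simp only [torusMean_const_mul]
  have hval : ∀ μ, torusMean (fun _ : Fin n => R) (fun y => evalAt (P μ) (fun i => (y i)⁻¹) *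
      evalAt (P κ) y * macDelta q t y) = innerMean q t (toVars n (P μ)) (toVars n (P κ)) := fun μ =>
    (hL μ).mean_eq hRm (const_mem_constRadii one_pos) (fun _ => hR) fun _ => one_pos
  simp only [hval]
  rw [Finset.sum_eq_single κ]
  · ring
  · intro μ _ hμ
    -- Partitions longer than `n` occur in the kernel but vanish in `n` variables, so distinct
    -- surviving partitions have distinct exponents.
    by_cases hc : Multiset.card μ.parts ≤ n
    · rw [innerMean_eq_zero_of_ne hq0 hq1 ht0 ht (hP.isEigen ht0 μ hc) (hP.isEigen ht0 κ hκ)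
        fun e => hμ (rowOf_injective_of_card hc hκ e), mul_zero]
    · rw [evalAt_eq, hP.triangular.toVars_eq_zero μ (not_le.1 hc)]
      have : innerMean q t (0 : MvPolynomial (Fin n) ℂ) (toVars n (P κ)) = 0 := by
        have := torusMean_const_mul (fun _ : Fin n => (1 : ℝ)) 0 fun _ => 0
        simp only [zero_mul] at this
        simpa [innerMean] using this
      rw [this, mul_zero]
  · exact fun hn => absurd (Finset.mem_univ κ) hn

/-! ### Symmetrization -/

/-- Lagrange interpolation at the nodes `y_m`: both sides express the top coefficient of a
polynomial of degree at most `n`. -/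
theorem sum_prod_sub_div {n : ℕ} {y : Fin (n + 1) → ℂ} (hy : Function.Injective y)
    (hy0 : ∀ i, y i ≠ 0) (t : ℂ) :
    (1 - t) * ∑ m, ∏ j ∈ Finset.univ.erase m, (y j - t * y m) / (y j - y m) = 1 - t ^ (n + 1) := by
  set A : ℂ → Polynomial ℂ := fun s =>
    ∏ j : Fin (n + 1), (Polynomial.C (y j) - Polynomial.C s * Polynomial.X) with hA
  have hdeg1 : ∀ s j, (Polynomial.C (y j) - Polynomial.C s * Polynomial.X).natDegree ≤ 1 := by
    intro s j
    refine (Polynomial.natDegree_sub_le _ _).trans (max_le (by simp) ?_)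
    exact (Polynomial.natDegree_C_mul_le _ _).trans Polynomial.natDegree_X_le
  have hcoeff : ∀ s, (A s).coeff (n + 1) = (-s) ^ (n + 1) := by
    intro s
    have := Polynomial.coeff_prod_of_natDegree_le (s := Finset.univ)
      (fun j : Fin (n + 1) => Polynomial.C (y j) - Polynomial.C s * Polynomial.X) 1
      fun j _ => hdeg1 s j
    simpa using this
  have hnat : ∀ s, (A s).natDegree ≤ n + 1 := by
    intro s
    refine (Polynomial.natDegree_prod_le _ _).trans ?_
    refine (Finset.sum_le_sum fun j _ => hdeg1 s j).trans ?_
    simp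
  have heval : ∀ s z, (A s).eval z = ∏ j, (y j - s * z) := by
    intro s z
    simp [hA, Polynomial.eval_prod]
  -- At a node the product with `s = 1` vanishes, and at 0 the two products agree; so `h` is
  -- divisible by the variable, and the quotient has the summands as its Lagrange weights.
  set h := A t - A 1 with hh
  have h0 : h.coeff 0 = 0 := by
    rw [Polynomial.coeff_zero_eq_eval_zero, hh, Polynomial.eval_sub, heval, heval]; simp
  have hmul : Polynomial.X * h.divX = h := by
    have := Polynomial.divX_mul_X_add h
    rw [h0, map_zero, add_zero, mul_comm] at this
    exact this
  have hdeg : h.divX.degree < (Finset.univ : Finset (Fin (n + 1))).card := by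
    rw [Finset.card_univ, Fintype.card_fin, Polynomial.degree_lt_iff_coeff_zero]
    intro m hm
    rw [Polynomial.coeff_divX]
    refine Polynomial.coeff_eq_zero_of_natDegree_lt ?_
    refine lt_of_le_of_lt (Polynomial.natDegree_sub_le _ _) (max_lt ?_ ?_) <;>
    · refine (hnat _).trans_lt ?_
      omega
  have key := Lagrange.coeff_eq_sum (hy.injOn (s := ((Finset.univ : Finset (Fin (n + 1))) : Set _)))
    hdeg
  rw [Finset.card_univ, Fintype.card_fin, Nat.add_sub_cancel, Polynomial.coeff_divX, hh,
    Polynomial.coeff_sub, hcoeff, hcoeff] at key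
  have hterm : ∀ m, h.divX.eval (y m) / ∏ j ∈ Finset.univ.erase m, (y m - y j) =
      (-1) ^ n * ((1 - t) * ∏ j ∈ Finset.univ.erase m, (y j - t * y m) / (y j - y m)) := by
    intro m
    have e1 : y m * h.divX.eval (y m) = y m * ((1 - t) *
        ∏ j ∈ Finset.univ.erase m, (y j - t * y m)) := by
      have := congrArg (Polynomial.eval (y m)) hmul
      rw [Polynomial.eval_mul, Polynomial.eval_X] at this
      rw [this, hh, Polynomial.eval_sub, heval, heval,
        Finset.prod_eq_zero (f := fun j => y j - 1 * y m) (Finset.mem_univ m) (by ring), sub_zero,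
        ← Finset.mul_prod_erase _ _ (Finset.mem_univ m)]
      ring
    rw [mul_left_cancel₀ (hy0 m) e1]
    have e2 : ∏ j ∈ Finset.univ.erase m, (y m - y j) =
        (-1) ^ n * ∏ j ∈ Finset.univ.erase m, (y j - y m) := by
      have : (-1 : ℂ) ^ n = ∏ _j ∈ Finset.univ.erase m, (-1 : ℂ) := by
        rw [Finset.prod_const, Finset.card_erase_of_mem (Finset.mem_univ m)]; simp
      rw [this, ← Finset.prod_mul_distrib]
      exact Finset.prod_congr rfl fun j _ => by ring
    rw [e2, Finset.prod_div_distrib]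
    have e3 : ∏ j ∈ Finset.univ.erase m, (y j - y m) ≠ 0 := Finset.prod_ne_zero_iff.2 fun j hj =>
      sub_ne_zero.2 fun e => Finset.ne_of_mem_erase hj (hy e)
    have e4 : ((-1 : ℂ) ^ n) * (-1) ^ n = 1 := by rw [← mul_pow]; simp
    have e5 : ((-1 : ℂ) ^ n) ≠ 0 := pow_ne_zero _ (by norm_num)
    rw [div_eq_iff (mul_ne_zero e5 e3)]
    field_simp
    linear_combination (-(1 - t) * ∏ x ∈ Finset.univ.erase m, (y x - t * y m)) * e4
  rw [Finset.sum_congr rfl fun m _ => hterm m, ← Finset.mul_sum, ← Finset.mul_sum, neg_pow t,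
    pow_succ (-1 : ℂ)] at key
  have e5 : ((-1 : ℂ) ^ n) ≠ 0 := pow_ne_zero _ (by norm_num)
  refine mul_left_cancel₀ e5 (key.symm.trans ?_)
  ring

theorem prod_erase_eq_prod_swap {n : ℕ} (p : Fin (n + 1)) (F : Fin (n + 1) → ℂ) :
    ∏ k ∈ Finset.univ.erase p, F k = ∏ j : Fin n, F (Equiv.swap 0 p j.succ) := by
  have h0 : (Finset.univ : Finset (Fin (n + 1))).erase p =
      (Finset.univ : Finset (Fin n)).map ((Fin.succEmb n).trans (Equiv.swap 0 p).toEmbedding) := by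
    ext k
    simp only [Finset.mem_erase, Finset.mem_univ, and_true, Finset.mem_map, true_and,
      Function.Embedding.trans_apply, Equiv.coe_toEmbedding, Fin.coe_succEmb]
    constructor
    · intro hk
      have h1 : Equiv.swap 0 p k ≠ 0 := fun e => hk (by
        have := congrArg (Equiv.swap 0 p) e
        rwa [Equiv.swap_apply_self, Equiv.swap_apply_left] at this)
      obtain ⟨j, hj⟩ := Fin.exists_succ_eq.2 h1
      exact ⟨j, by rw [hj, Equiv.swap_apply_self]⟩
    · rintro ⟨j, rfl⟩ e
      have := congrArg (Equiv.swap 0 p) e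
      rw [Equiv.swap_apply_self, Equiv.swap_apply_right] at this
      exact Fin.succ_ne_zero j this
  rw [h0, Finset.prod_map]; rfl

/-- `∑_σ ∏_{i < j} (y_{σ j} - t y_{σ i}) / (y_{σ j} - y_{σ i}) = ∏_k (1 - t^k) / (1 - t)`. -/
theorem sum_perm_prod {t : ℂ} (ht : t ≠ 1) {n : ℕ} {y : Fin n → ℂ} (hy : Function.Injective y)
    (hy0 : ∀ i, y i ≠ 0) :
    ∑ σ : Equiv.Perm (Fin n), ∏ i, ∏ j,
      (if i < j then (y (σ j) - t * y (σ i)) / (y (σ j) - y (σ i)) else 1) =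
    ∏ k ∈ Finset.Icc 1 n, (1 - t ^ k) / (1 - t) := by
  induction n with
  | zero => simp
  | succ n ih =>
    -- A permutation is split into the image `p` of 0 and an ordering of the rest. The factors with
    -- `i = 0` depend on `p` alone, and the remaining ones are the case of `n` variables.
    rw [← Equiv.sum_comp Equiv.Perm.decomposeFin.symm, Fintype.sum_prod_type]
    have h1 : ∀ (p : Fin (n + 1)) (e : Equiv.Perm (Fin n)), ∏ i, ∏ j,
        (if i < j then (y (Equiv.Perm.decomposeFin.symm (p, e) j) -
          t * y (Equiv.Perm.decomposeFin.symm (p, e) i)) /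
          (y (Equiv.Perm.decomposeFin.symm (p, e) j) - y (Equiv.Perm.decomposeFin.symm (p, e) i))
          else 1) =
        (∏ k ∈ Finset.univ.erase p, (y k - t * y p) / (y k - y p)) * ∏ i, ∏ j,
          (if i < j then (y (Equiv.swap 0 p (e j).succ) - t * y (Equiv.swap 0 p (e i).succ)) /
            (y (Equiv.swap 0 p (e j).succ) - y (Equiv.swap 0 p (e i).succ)) else 1) := by
      intro p e
      rw [Fin.prod_univ_succ]
      simp only [Fin.prod_univ_succ (n := n), Fin.succ_pos, if_true,
        Equiv.Perm.decomposeFin_symm_apply_zero, Equiv.Perm.decomposeFin_symm_apply_succ,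
        Fin.succ_lt_succ_iff, lt_irrefl, if_false, one_mul, Fin.not_lt_zero]
      rw [prod_erase_eq_prod_swap p fun k => (y k - t * y p) / (y k - y p),
        Equiv.prod_comp e fun j => (y (Equiv.swap 0 p j.succ) - t * y p) /
          (y (Equiv.swap 0 p j.succ) - y p)]
    simp only [h1, ← Finset.mul_sum]
    have h2 : ∀ p : Fin (n + 1), ∑ e : Equiv.Perm (Fin n), ∏ i, ∏ j,
          (if i < j then (y (Equiv.swap 0 p (e j).succ) - t * y (Equiv.swap 0 p (e i).succ)) /
            (y (Equiv.swap 0 p (e j).succ) - y (Equiv.swap 0 p (e i).succ)) else 1) =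
          ∏ k ∈ Finset.Icc 1 n, (1 - t ^ k) / (1 - t) := fun p =>
      ih (y := fun j => y (Equiv.swap 0 p j.succ))
        (hy.comp ((Equiv.swap 0 p).injective.comp (Fin.succ_injective n))) fun i => hy0 _
    simp only [h2]
    rw [← Finset.sum_mul, Finset.prod_Icc_succ_top (by omega), mul_comm]
    congr 1
    rw [eq_div_iff (sub_ne_zero.2 ht.symm), mul_comm]
    exact sum_prod_sub_div hy hy0 t

/-- The diagonal factors give the power of `(q;q)_∞ / (tq;q)_∞`. For `i < j`, one numerator and one
denominator start at `q u` instead of `u = y_i / y_j`, so the pair differs from that of `Δ` by `(1 -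
t u) / (1 - u)`. -/
theorem triKernel_eq {q : ℝ} (hq0 : 0 < q) (hq1 : q < 1) {t : ℂ} (ht : ‖t‖ < 1) {n : ℕ}
    {y : Fin n → ℂ} (hy : Function.Injective y) {c : ℝ} (hc : 0 < c) (hyc : ∀ i, ‖y i‖ = c) :
    triKernel q t y = (qPoch q q / qPoch (t * q) q) ^ n * (macDelta q t y *
      ∏ i, ∏ j, if i < j then (y j - t * y i) / (y j - y i) else 1) := by
  have hy0 : ∀ i, y i ≠ 0 := fun i h => by
    have := hyc i
    rw [h, norm_zero] at this
    exact hc.ne this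
  have hu : ∀ i j, ‖y i / y j‖ = 1 := fun i j => by rw [norm_div, hyc, hyc, div_self hc.ne']
  have e2 : ∀ a b : Fin n, qPoch (t * (q * (y a / y b))) q =
      qPoch (t * (y a / y b)) q / (1 - t * (y a / y b)) := by
    intro a b
    have : 1 - t * (y a / y b) ≠ 0 :=
      one_sub_ne_zero_of_norm_lt (by rw [norm_mul, hu, mul_one]; exact ht)
    rw [qPoch_mul_q hq0 hq1 (t * (y a / y b)), mul_div_cancel_left₀ _ this]
    congr 1; ring
  have h1 : triKernel q t y = (∏ i : Fin n, qPoch q q / qPoch (t * q) q) *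
      ∏ i, ∏ j, if i = j then 1 else
        if i < j then qPoch (y j / y i) q / qPoch (t * (y j / y i)) q
        else qPoch (q * (y j / y i)) q / qPoch (t * (q * (y j / y i))) q := by
    rw [triKernel, ← Finset.prod_mul_distrib]
    refine Finset.prod_congr rfl fun i _ => ?_
    rw [← Finset.mul_prod_erase _ _ (Finset.mem_univ i),
      ← Finset.mul_prod_erase (Finset.univ : Finset (Fin n)) (fun j => if i = j then (1 : ℂ) else _)
        (Finset.mem_univ i), if_neg (lt_irrefl i), if_pos rfl, div_self (hy0 i), mul_one, one_mul]
    congr 1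
    exact Finset.prod_congr rfl fun j hj => by rw [if_neg (Finset.ne_of_mem_erase hj).symm]
  rw [h1, Finset.prod_const, Finset.card_univ, Fintype.card_fin]
  congr 1
  rw [macDelta, prod_ne_eq_prod_lt, prod_ne_eq_prod_lt]
  simp only [← Finset.prod_mul_distrib]
  refine Finset.prod_congr rfl fun i _ => Finset.prod_congr rfl fun j _ => ?_
  by_cases h : i < j
  · simp only [if_pos h, if_neg h.not_gt]
    rw [e2, mul_div_assoc, mul_div_assoc, qPoch_mul_q hq0 hq1 (y i / y j), mul_comm (y i / y j) (q : ℂ),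
      div_div_eq_mul_div]
    have h3 := hy0 i
    have h4 := hy0 j
    have h5 : y j - y i ≠ 0 := sub_ne_zero.2 fun e => h.ne' (hy e)
    have h6 : 1 - t * (y i / y j) = (1 - y i / y j) * ((y j - t * y i) / (y j - y i)) := by
      have : 1 - y i / y j = (y j - y i) / y j := by field_simp
      rw [this]
      field_simp
    rw [h6]
    ring
  · simp [h]

theorem macDelta_eq_zero {q : ℝ} (hq0 : 0 < q) (hq1 : q < 1) (t : ℂ) {n : ℕ} {y : Fin n → ℂ}
    (hy : ∀ i, y i ≠ 0) (h : ¬ Function.Injective y) : macDelta q t y = 0 := by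
  rw [macDelta_eq hq0 hq1 t hy]
  have : vd y = 0 := by
    by_contra h'; exact h (vd_ne_zero_iff.1 h')
  rw [this, zero_mul, zero_mul]

theorem triKernel_eq_zero {q : ℝ} (hq0 : 0 < q) (hq1 : q < 1) (t : ℂ) {n : ℕ} {y : Fin n → ℂ}
    (hy : ∀ i, y i ≠ 0) (h : ¬ Function.Injective y) : triKernel q t y = 0 := by
  simp only [Function.Injective] at h
  push Not at h
  obtain ⟨a, b, hab, hne⟩ := h
  have key : ∀ i j : Fin n, i < j → y i = y j → triKernel q t y = 0 := by
    intro i j hij e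
    refine Finset.prod_eq_zero (Finset.mem_univ i) (Finset.prod_eq_zero (Finset.mem_univ j) ?_)
    rw [if_pos hij, e, div_self (hy j), qPoch_mul_q hq0 hq1 1, sub_self, zero_mul, zero_div]
  rcases lt_or_gt_of_ne hne with h' | h'
  · exact key a b h' hab
  · exact key b a h' hab.symm

theorem sum_perm_triKernel {q : ℝ} (hq0 : 0 < q) (hq1 : q < 1) {t : ℂ} (ht : ‖t‖ < 1) {n : ℕ}
    {y : Fin n → ℂ} {c : ℝ} (hc : 0 < c) (hyc : ∀ i, ‖y i‖ = c) :
    ∑ σ : Equiv.Perm (Fin n), triKernel q t (fun i => y (σ i)) =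
      (qPoch q q / qPoch (t * q) q) ^ n * (∏ k ∈ Finset.Icc 1 n, (1 - t ^ k) / (1 - t)) *
        macDelta q t y := by
  have hy0 : ∀ i, y i ≠ 0 := fun i h => by
    have := hyc i
    rw [h, norm_zero] at this
    exact hc.ne this
  have ht1 : t ≠ 1 := fun h => by rw [h, norm_one] at ht; exact lt_irrefl _ ht
  by_cases hy : Function.Injective y
  · have h1 : ∀ σ : Equiv.Perm (Fin n), triKernel q t (fun i => y (σ i)) =
        (qPoch q q / qPoch (t * q) q) ^ n * macDelta q t y * ∏ i, ∏ j,
          if i < j then (y (σ j) - t * y (σ i)) / (y (σ j) - y (σ i)) else 1 := by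
      intro σ
      rw [triKernel_eq (y := fun i => y (σ i)) hq0 hq1 ht (hy.comp σ.injective) hc fun i => hyc _,
        macDelta_perm, mul_assoc]
    rw [Finset.sum_congr rfl fun σ _ => h1 σ, ← Finset.mul_sum, sum_perm_prod ht1 hy hy0]
    ring
  · rw [macDelta_eq_zero hq0 hq1 t hy0 hy, mul_zero]
    refine Finset.sum_eq_zero fun σ _ => triKernel_eq_zero hq0 hq1 t (fun i => hy0 _) fun h => hy ?_
    have := h.comp σ⁻¹.injective
    simpa [Function.comp_def] using this

/-- Symmetrization of the kernel under the torus integral. -/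
theorem torusMean_mul_triKernel {q : ℝ} (hq0 : 0 < q) (hq1 : q < 1) {t : ℂ} (ht : ‖t‖ < 1) {n : ℕ}
    {F : (Fin n → ℂ) → ℂ} (hF : ∀ (σ : Equiv.Perm (Fin n)) y, F (fun i => y (σ i)) = F y) {c : ℝ}
    (hc : 0 < c) (hex : TorusMeanExists (fun _ => c) fun y => F y * triKernel q t y) :
    (n.factorial : ℂ) * torusMean (fun _ => c) (fun y => F y * triKernel q t y) =
      (qPoch q q / qPoch (t * q) q) ^ n * (∏ k ∈ Finset.Icc 1 n, (1 - t ^ k) / (1 - t)) *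
        torusMean (fun _ => c) fun y => F y * macDelta q t y := by
  -- All variables run over the same circle, so permuting them preserves the integral.
  have h1 : ∀ σ : Equiv.Perm (Fin n), torusMean (fun _ => c) (fun y => F y * triKernel q t y) =
      torusMean (fun _ => c) fun y => F y * triKernel q t fun i => y (σ i) := by
    intro σ
    rw [← torusMean_perm σ]
    simp only [hF]
  have h2 : ∀ σ ∈ (Finset.univ : Finset (Equiv.Perm (Fin n))),
      TorusMeanExists (fun _ => c) fun y => F y * triKernel q t fun i => y (σ i) := by
    intro σ _
    have := hex.reindex σ.symm
    simpa only [Equiv.symm_symm, hF] using this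
  have h3 : (n.factorial : ℂ) * torusMean (fun _ => c) (fun y => F y * triKernel q t y) =
      ∑ σ : Equiv.Perm (Fin n), torusMean (fun _ => c) fun y => F y * triKernel q t fun i => y (σ i) := by
    rw [← Finset.sum_congr rfl fun σ _ => h1 σ, Finset.sum_const, Finset.card_univ,
      Fintype.card_perm, Fintype.card_fin, nsmul_eq_mul]
  rw [h3, ← torusMean_sum _ _ _ h2, ← torusMean_const_mul]
  refine torusMean_congr (fun _ => hc) fun y hy => ?_
  rw [← Finset.mul_sum, sum_perm_triKernel hq0 hq1 ht hc hy]
  ring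

/-! ### The integral over one block of variables -/

section LaurentFactors

variable {ι : Type} [Fintype ι] {q : ℝ} (hq0 : 0 < q) (hq1 : q < 1)

theorem prod_zpow_neg_single [DecidableEq ι] (x : ι → ℂ) (j : ι) :
    ∏ l, x l ^ ((-Pi.single j 1 : ι → ℤ) l) = (x j)⁻¹ := by
  rw [Finset.prod_eq_single j]
  · simp
  · intro l _ hl
    simp [Pi.single_eq_of_ne hl]
  · exact fun h => absurd (Finset.mem_univ j) h

include hq0 hq1

theorem laurentOn_qPoch_div (Ω : Set (ι → ℝ)) (a : ℂ) (j : ι) :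
    LaurentOn Ω fun x => qPoch (a / x j) q := by
  classical
  obtain ⟨c, hc⟩ := qPoch_powerSeries hq0 hq1
  refine (laurentOn_powerSeries (fun u => qPoch u q) c a (-Pi.single j 1) fun x _ => hc _).congr
    fun x _ => ?_
  rw [prod_zpow_neg_single, div_eq_mul_inv]

theorem laurentOn_qPoch_div_inv {Ω : Set (ι → ℝ)} (hΩ : ∀ R ∈ Ω, ∀ i, 0 < R i) (a : ℂ) (j : ι)
    (h : ∀ R ∈ Ω, ‖a‖ < R j) : LaurentOn Ω fun x => (qPoch (a / x j) q)⁻¹ := by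
  classical
  obtain ⟨c, hc⟩ := qPoch_inv_powerSeries hq0 hq1
  refine (laurentOn_powerSeries (fun u => (qPoch u q)⁻¹) c a (-Pi.single j 1) fun x hx =>
    hc _ ?_).congr fun x _ => ?_
  · have h1 := hΩ _ hx j
    rw [prod_zpow_neg_single, norm_mul, norm_inv, ← div_eq_mul_inv, div_lt_one h1]
    exact h _ hx
  · rw [prod_zpow_neg_single, div_eq_mul_inv]

theorem laurentOn_cauchyFactor {Ω : Set (ι → ℝ)} (hΩ : ∀ R ∈ Ω, ∀ i, 0 < R i) (t w : ℂ) {n : ℕ}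
    (v : Fin n → ι) (h : ∀ R ∈ Ω, ∀ j, ‖w‖ < R (v j)) :
    LaurentOn Ω fun x => cauchyFactor q t w fun j => x (v j) := by
  refine LaurentOn.prod hΩ _ fun j _ => ?_
  simp only [← mul_div_assoc, div_eq_mul_inv _ (qPoch _ _)]
  exact (laurentOn_qPoch_div hq0 hq1 Ω _ _).mul hΩ
    (laurentOn_qPoch_div_inv hq0 hq1 hΩ _ _ fun R hR => h R hR j)

theorem laurentOn_cauchyFactor_coord {Ω : Set (ι → ℝ)} (hΩ : ∀ R ∈ Ω, ∀ i, 0 < R i) {t : ℂ}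
    (i : ι) {n : ℕ} (v : Fin n → ι) (h : ∀ R ∈ Ω, ∀ j, R i < R (v j)) :
    LaurentOn Ω fun x => cauchyFactor q t (x i) fun j => x (v j) := by
  refine LaurentOn.prod hΩ _ fun j _ => ?_
  simp only [div_eq_mul_inv _ (qPoch _ _)]
  have h2 := laurentOn_qPoch_ratio_inv hq0 hq1 hΩ 1 i (v j) fun R hR => by
    rw [norm_one, one_mul, div_lt_one (hΩ R hR _)]
    exact h R hR j
  simp only [one_mul] at h2
  exact (laurentOn_qPoch_ratio hq0 hq1 hΩ t i (v j)).mul hΩ h2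

/-- The numerators are entire and every denominator carries a factor `t`, so non-strict inequalities
between the radii suffice; in particular all circles may coincide. -/
theorem laurentOn_triKernel {Ω : Set (ι → ℝ)} (hΩ : ∀ R ∈ Ω, ∀ i, 0 < R i) {t : ℂ} (ht : ‖t‖ < 1)
    {n : ℕ} (v : Fin n → ι)
    (h : ∀ R ∈ Ω, ∀ i j, i < j → q * R (v i) ≤ R (v j) ∧ R (v j) ≤ R (v i)) :
    LaurentOn Ω fun x => triKernel q t fun j => x (v j) := by
  have hle : ∀ a b : ℝ, 0 < b → a ≤ b → ‖t‖ * (a / b) < 1 := by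
    intro a b hb hab
    have h1 : a / b ≤ 1 := (div_le_one hb).2 hab
    nlinarith [norm_nonneg t]
  refine LaurentOn.prod hΩ _ fun i _ => LaurentOn.prod hΩ _ fun j _ => ?_
  by_cases hij : i < j
  · simp only [if_pos hij, div_eq_mul_inv _ (qPoch _ _)]
    have h1 := laurentOn_qPoch_ratio hq0 hq1 hΩ 1 (v j) (v i)
    simp only [one_mul] at h1
    exact h1.mul hΩ (laurentOn_qPoch_ratio_inv hq0 hq1 hΩ t _ _ fun R hR =>
      hle _ _ (hΩ R hR _) (h R hR i j hij).2)
  · simp only [if_neg hij, div_eq_mul_inv _ (qPoch _ _), ← mul_assoc t]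
    refine (laurentOn_qPoch_ratio hq0 hq1 hΩ _ (v j) (v i)).mul hΩ
      (laurentOn_qPoch_ratio_inv hq0 hq1 hΩ _ _ _ fun R hR => ?_)
    rw [norm_mul, Complex.norm_real, Real.norm_eq_abs, abs_of_pos hq0, mul_assoc, ← mul_div_assoc]
    refine hle _ _ (hΩ R hR _) ?_
    rcases (not_lt.1 hij).eq_or_lt with e | hlt
    · rw [e]
      nlinarith [hΩ R hR (v i)]
    · exact (h R hR j i hlt).1

end LaurentFactors

theorem prod_cauchyFactor (q t : ℂ) {n k : ℕ} (x : Fin k → ℂ) (z : Fin n → ℂ) :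
    ∏ l, cauchyFactor q t (x l) z = kernelPi q t x fun j => (z j)⁻¹ := by
  simp only [cauchyFactor, kernelPi, div_eq_mul_inv]

/-- The integral over one block reproduces the Macdonald function in the next variables. -/
theorem torusMean_block {q : ℝ} (hq0 : 0 < q) (hq1 : q < 1) {t : ℂ} (ht0 : t ≠ 0) (ht : ‖t‖ < 1)
    {n k d : ℕ} {P : d.Partition → SymFun} (hP : IsMacdonaldDegree q t P) (κ : d.Partition)
    (hκ : Multiset.card κ.parts ≤ n) (x : Fin k → ℂ) {ρ : Fin n → ℝ} (hρ : ∀ i, 0 < ρ i)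
    (hρ' : ∀ i j, i < j → q * ρ i ≤ ρ j ∧ ρ j ≤ ρ i) (hx : ∀ l i, ‖x l‖ < ρ i) :
    torusMean ρ (fun y => evalAt (P κ) y * (triKernel q t y * ∏ l, cauchyFactor q t (x l) y)) =
    (qPoch q q / qPoch (t * q) q) ^ n * (∏ k ∈ Finset.Icc 1 n, (1 - t ^ k) / (1 - t)) *
      (innerPrime q t n (P κ) (P κ) / innerQT q t (P κ) (P κ)) * evalAt (P κ) x := by
  -- A common radius exceeding all `‖x_l‖`, so that the Cauchy factors are still expanded in the
  -- same region.
  set c : ℝ := 1 + ∑ l, ‖x l‖ with hcdef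
  have hc : 0 < c := by positivity
  have hxc : ∀ l, ‖x l‖ < c := fun l => by
    have : ‖x l‖ ≤ ∑ l, ‖x l‖ :=
      Finset.single_le_sum (f := fun l => ‖x l‖) (fun _ _ => norm_nonneg _) (Finset.mem_univ l)
    linarith
  set Ω : Set (Fin n → ℝ) := {ρ, fun _ => c} with hΩdef
  have hΩ : ∀ R ∈ Ω, ∀ i, 0 < R i := by
    rintro R (rfl | rfl) i <;> [exact hρ i; exact hc]
  have hL : LaurentOn Ω fun y => evalAt (P κ) y *
      (triKernel q t y * ∏ l, cauchyFactor q t (x l) y) := by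
    refine (laurentOn_eval_self _ hΩ).mul hΩ (LaurentOn.mul hΩ ?_ (LaurentOn.prod hΩ _ fun l _ => ?_))
    · refine laurentOn_triKernel hq0 hq1 hΩ ht (fun i => i) ?_
      rintro R (rfl | rfl) i j hij
      · exact hρ' i j hij
      · exact ⟨by nlinarith, le_rfl⟩
    · refine laurentOn_cauchyFactor hq0 hq1 hΩ t (x l) (fun i => i) ?_
      rintro R (rfl | rfl) i <;> [exact hx l i; exact hxc l]
  have hcΩ : (fun _ => c) ∈ Ω := Set.mem_insert_of_mem _ rfl
  -- Only on a torus with equal radii can `triKernel` be symmetrized.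
  rw [hL.mean_eq (R := ρ) (R' := fun _ => c) (Set.mem_insert _ _) hcΩ hρ fun _ => hc]
  have hex := hL.exists_mean hcΩ fun _ => hc
  have hcomm : ∀ y : Fin n → ℂ, evalAt (P κ) y *
      (triKernel q t y * ∏ l, cauchyFactor q t (x l) y) =
      (evalAt (P κ) y * kernelPi q t x fun j => (y j)⁻¹) * triKernel q t y := fun y => by
    rw [prod_cauchyFactor]; ring
  simp only [hcomm] at hex ⊢
  have hsymm : ∀ (σ : Equiv.Perm (Fin n)) (y : Fin n → ℂ),
      (evalAt (P κ) (fun i => y (σ i)) * kernelPi q t x fun j => (y (σ j))⁻¹) =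
      evalAt (P κ) y * kernelPi q t x fun j => (y j)⁻¹ := by
    intro σ y
    rw [evalAt_perm]
    congr 1
    refine Finset.prod_congr rfl fun i _ => ?_
    exact Equiv.prod_comp σ fun j => qPoch (t * (x i * (y j)⁻¹)) q / qPoch (x i * (y j)⁻¹) q
  have h1 := torusMean_mul_triKernel hq0 hq1 ht
    (F := fun y => evalAt (P κ) y * kernelPi q t x fun j => (y j)⁻¹) hsymm hc hex
  have h2 := torusMean_kernelPi hq0 hq1 ht0 ht hP κ hκ x hc hxc
  have h3 : ∀ y : Fin n → ℂ, (evalAt (P κ) y * kernelPi q t x fun j => (y j)⁻¹) * macDelta q t y =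
      evalAt (P κ) y * macDelta q t y * kernelPi q t x fun j => (y j)⁻¹ := fun y => by ring
  simp only [h3, h2] at h1
  have h4 : (n.factorial : ℂ) ≠ 0 := by exact_mod_cast n.factorial_ne_zero
  refine mul_left_cancel₀ h4 (h1.trans ?_)
  rw [innerPrime_eq]
  field_simp

/-! ### Rows of sums of rectangles -/

/-- The length of row `i` of `∑_{a ∈ S} (s_a^{r_a})`. -/
def rectRow {N : ℕ} (r s : Fin N → ℕ) (S : Finset (Fin N)) (i : ℕ) : ℕ :=
  ∑ a ∈ S, if i < r a then s a else 0

theorem rectRow_antitone {N : ℕ} (r s : Fin N → ℕ) (S : Finset (Fin N)) :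
    Antitone (rectRow r s S) := by
  intro i j hij
  refine Finset.sum_le_sum fun a _ => ?_
  split_ifs <;> omega

theorem rectRow_eq_zero {N : ℕ} {r s : Fin N → ℕ} {S : Finset (Fin N)} {i : ℕ} (h : S.sup r ≤ i) :
    rectRow r s S i = 0 :=
  Finset.sum_eq_zero fun _ ha => if_neg (not_lt.2 ((Finset.le_sup ha).trans h))

theorem filter_map_range_eq {g : ℕ → ℕ} {m n : ℕ} (hmn : m ≤ n) (hg : ∀ i, m ≤ i → g i = 0) :
    ((Multiset.range n).map g).filter (· ≠ 0) = ((Multiset.range m).map g).filter (· ≠ 0) := by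
  obtain ⟨k, rfl⟩ := Nat.exists_eq_add_of_le hmn
  induction k with
  | zero => rfl
  | succ k ih =>
    rw [← Nat.add_assoc, Multiset.range_succ, Multiset.map_cons, hg _ (Nat.le_add_right m k),
      Multiset.filter_cons_of_neg _ (by simp), ih (Nat.le_add_right m k)]

/-- The partition `∑_{a ∈ S} (s_a^{r_a})`. -/
def rectPartition {N : ℕ} (r s : Fin N → ℕ) (S : Finset (Fin N)) :
    (rectRows r s S).sum.Partition :=
  Nat.Partition.ofSums _ (rectRows r s S) rfl

theorem macdonaldRect_eq (q t : ℂ) {N : ℕ} (r s : Fin N → ℕ) (S : Finset (Fin N)) :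
    macdonaldRect q t r s S = macdonaldP q t _ (rectPartition r s S) := rfl

theorem parts_rectPartition {N : ℕ} (r s : Fin N → ℕ) (S : Finset (Fin N)) :
    (rectPartition r s S).parts =
      ((Multiset.range (S.sup r)).map (rectRow r s S)).filter (· ≠ 0) := rfl

theorem card_rectPartition_le {N : ℕ} {r s : Fin N → ℕ} {S : Finset (Fin N)} {n : ℕ}
    (h : S.sup r ≤ n) : Multiset.card (rectPartition r s S).parts ≤ n := by
  rw [parts_rectPartition]
  refine (Multiset.card_le_card (Multiset.filter_le _ _)).trans ?_
  rwa [Multiset.card_map, Multiset.card_range]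

theorem rowOf_rectPartition {N : ℕ} {r s : Fin N → ℕ} {S : Finset (Fin N)} {n : ℕ}
    (h : S.sup r ≤ n) (i : Fin n) : rowOf n (rectPartition r s S) i = rectRow r s S i := by
  refine congrFun (eq_of_antitone_of_expParts (antitone_rowOf n _)
    (β := fun i : Fin n => rectRow r s S i) (fun i j hij => rectRow_antitone r s S hij) ?_) i
  rw [expParts_rowOf _ (card_rectPartition_le h), parts_rectPartition,
    ← filter_map_range_eq h fun i hi => rectRow_eq_zero hi, expParts]
  congr 1
  have := Fin.univ_val_map (fun i : Fin n => rectRow r s S i)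
  rw [this, ← Multiset.coe_range, Multiset.map_coe, List.ofFn_eq_map, ← List.map_coe_finRange_eq_range,
    List.map_map]
  rfl

theorem rectRows_map_castSucc {N : ℕ} (r s : Fin (N + 1) → ℕ) (S : Finset (Fin N)) :
    rectRows r s (S.map Fin.castSuccEmb) =
      rectRows (fun a => r a.castSucc) (fun a => s a.castSucc) S := by
  rw [rectRows, rectRows, Finset.sup_map]
  simp only [Finset.sum_map]
  rfl

theorem macdonaldRect_map_castSucc (q t : ℂ) {N : ℕ} (r s : Fin (N + 1) → ℕ) (S : Finset (Fin N)) :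
    macdonaldRect q t r s (S.map Fin.castSuccEmb) =
      macdonaldRect q t (fun a => r a.castSucc) (fun a => s a.castSucc) S := by
  -- The degree is itself the sum of the rows, so equality of the rows is transported in degree and
  -- partition together.
  have key : ∀ m m' : Multiset ℕ, m = m' → macdonaldP q t m.sum (Nat.Partition.ofSums _ m rfl) =
      macdonaldP q t m'.sum (Nat.Partition.ofSums _ m' rfl) := by
    rintro m _ rfl; rfl
  exact key _ _ (rectRows_map_castSucc r s S)

theorem sup_univ_le {N : ℕ} {r : Fin (N + 1) → ℕ} (hr : StrictMono r) (S : Finset (Fin (N + 1))) :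
    S.sup r ≤ r (Fin.last N) := Finset.sup_le fun a _ => hr.monotone (Fin.le_last a)

/-- Adding the rectangle of the last block of variables. -/
theorem evalAt_macdonaldRect_succ {q : ℝ} (hq0 : 0 < q) (hq1 : q < 1) {t : ℂ} (ht0 : t ≠ 0)
    (ht : ‖t‖ < 1) {N : ℕ} {r : Fin (N + 1) → ℕ} (hr : StrictMono r) (s : Fin (N + 1) → ℕ)
    (y : Fin (r (Fin.last N)) → ℂ) :
    evalAt (macdonaldRect q t r s Finset.univ) y = (∏ i, y i) ^ s (Fin.last N) *
      evalAt (macdonaldRect q t (fun a => r a.castSucc) (fun a => s a.castSucc) Finset.univ) y := by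
  have h1 : (Finset.univ : Finset (Fin N)).sup (fun a => r a.castSucc) ≤ r (Fin.last N) :=
    Finset.sup_le fun a _ => hr.monotone (Fin.le_last _)
  have h2 := sup_univ_le hr Finset.univ
  rw [macdonaldRect_eq, macdonaldRect_eq]
  refine macdonaldP_boost hq0 hq1 ht0 ht (card_rectPartition_le h1) (card_rectPartition_le h2)
    (fun i => ?_) y
  rw [rowOf_rectPartition h1, rowOf_rectPartition h2, rectRow, rectRow, Fin.sum_univ_castSucc,
    if_pos i.2, add_comm]

theorem macdonaldP_eq_one {q : ℝ} (hq0 : 0 < q) (hq1 : q < 1) {t : ℂ} (ht0 : t ≠ 0)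
    (ht : ‖t‖ < 1) {d : ℕ} (hd : d = 0) (κ : d.Partition) {n : ℕ} (x : Fin n → ℂ) :
    evalAt (macdonaldP q t d κ) x = 1 := by
  subst hd
  have hP := (macdonaldP_spec hq0 hq1 ht0 ht 0).triangular
  have h1 := hP.coeff_rowOf (n := n) κ ((card_parts_le κ).trans (Nat.zero_le n))
  have h2 := (hP.hasDegree κ).isHomogeneous n
  have h3 : rowOf n κ = 0 := by
    ext i
    have h4 : κ.parts = 0 := Multiset.card_eq_zero.1 (Nat.le_zero.1 (card_parts_le κ))
    rw [rowOf_apply, h4]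
    simp
  rw [h3] at h1
  have h5 := MvPolynomial.totalDegree_eq_zero_iff_eq_C.1 (Nat.le_zero.1 h2.totalDegree_le)
  rw [evalAt_eq, h5, MvPolynomial.eval_C, h1]

/-! ### Iterating over the blocks -/

/-- The trace of the vertex operators without the constant prefactor. -/
def blockProd (q t : ℂ) {N n : ℕ} (r : Fin N → ℕ) (x : Fin n → ℂ) (X : VarIdx r → ℂ) : ℂ :=
  ∏ a, (triKernel q t (fun j => X ⟨a, j⟩) *
    ((nextVars r x X a).map fun w => cauchyFactor q t w fun j => X ⟨a, j⟩).prod)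

theorem laurentOn_blockProd {q : ℝ} (hq0 : 0 < q) (hq1 : q < 1) {t : ℂ} (ht : ‖t‖ < 1) {N n : ℕ}
    {r : Fin N → ℕ} {x : Fin n → ℂ} {ρ : VarIdx r → ℝ} (hρ : AdmissibleRadii q r x ρ) :
    LaurentOn {ρ} (blockProd q t r x) := by
  have hΩ : ∀ R ∈ ({ρ} : Set (VarIdx r → ℝ)), ∀ i, 0 < R i := by
    rintro R rfl i; exact hρ.pos i
  refine LaurentOn.prod hΩ _ fun a _ => LaurentOn.mul hΩ ?_ ?_
  · refine laurentOn_triKernel hq0 hq1 hΩ ht (fun j => (⟨a, j⟩ : VarIdx r)) ?_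
    rintro R rfl i j hij
    have h1 := hρ.pos ⟨a, i⟩
    obtain ⟨h2, h3⟩ := hρ.same a i j hij
    rw [lt_div_iff₀ h1] at h2
    rw [div_lt_one h1] at h3
    exact ⟨h2.le, h3.le⟩
  · by_cases h : (a : ℕ) + 1 < N
    · simp only [nextVars, dif_pos h, List.map_ofFn, List.prod_ofFn, Function.comp_def]
      refine LaurentOn.prod hΩ _ fun i _ => ?_
      refine laurentOn_cauchyFactor_coord hq0 hq1 hΩ (⟨⟨(a : ℕ) + 1, h⟩, i⟩ : VarIdx r)
        (fun j => (⟨a, j⟩ : VarIdx r)) ?_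
      rintro R rfl j
      exact hρ.next a ⟨(a : ℕ) + 1, h⟩ rfl i j
    · simp only [nextVars, dif_neg h, List.map_ofFn, List.prod_ofFn, Function.comp_def]
      refine LaurentOn.prod hΩ _ fun i _ => ?_
      refine laurentOn_cauchyFactor hq0 hq1 hΩ t (x i) (fun j => (⟨a, j⟩ : VarIdx r)) ?_
      rintro R rfl j
      exact hρ.last a (by omega) i j

theorem exists_mean_blockProd {q : ℝ} (hq0 : 0 < q) (hq1 : q < 1) {t : ℂ} (ht : ‖t‖ < 1) {N n : ℕ}
    {r : Fin N → ℕ} (s : Fin N → ℕ) {x : Fin n → ℂ} {ρ : VarIdx r → ℝ}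
    (hρ : AdmissibleRadii q r x ρ) :
    TorusMeanExists ρ fun X => (∏ p : VarIdx r, X p ^ s p.1) * blockProd q t r x X := by
  have hΩ : ∀ R ∈ ({ρ} : Set (VarIdx r → ℝ)), ∀ i, 0 < R i := by
    rintro R rfl i; exact hρ.pos i
  exact ((LaurentOn.prod hΩ _ fun p _ => laurentOn_coord_pow _ p _).mul hΩ
    (laurentOn_blockProd hq0 hq1 ht hρ)).exists_mean rfl hρ.pos

/-- The variables of the first `N` blocks together with those of the last block. -/
def splitLast {N : ℕ} (r : Fin (N + 1) → ℕ) :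
    VarIdx (fun a : Fin N => r a.castSucc) ⊕ Fin (r (Fin.last N)) ≃ VarIdx r :=
  Equiv.ofBijective (Sum.elim (fun p => ⟨p.1.castSucc, p.2⟩) fun j => ⟨Fin.last N, j⟩) (by
    constructor
    · rintro (⟨a, i⟩ | i) (⟨b, j⟩ | j) h
      · simp only [Sum.elim_inl, Sigma.mk.injEq, Fin.castSucc_inj] at h
        obtain ⟨rfl, h⟩ := h
        rw [eq_of_heq h]
      · simp only [Sum.elim_inl, Sum.elim_inr, Sigma.mk.injEq] at h
        exact absurd h.1 (Fin.castSucc_lt_last a).ne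
      · simp only [Sum.elim_inl, Sum.elim_inr, Sigma.mk.injEq] at h
        exact absurd h.1.symm (Fin.castSucc_lt_last b).ne
      · simp only [Sum.elim_inr, Sigma.mk.injEq, true_and] at h
        rw [eq_of_heq h]
    · rintro ⟨a, j⟩
      induction a using Fin.lastCases with
      | last => exact ⟨Sum.inr j, rfl⟩
      | cast a => exact ⟨Sum.inl ⟨a, j⟩, rfl⟩)

theorem splitLast_inl {N : ℕ} (r : Fin (N + 1) → ℕ) (a : Fin N) (j : Fin (r a.castSucc)) :
    splitLast r (Sum.inl ⟨a, j⟩) = ⟨a.castSucc, j⟩ := rfl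

theorem splitLast_inr {N : ℕ} (r : Fin (N + 1) → ℕ) (j : Fin (r (Fin.last N))) :
    splitLast r (Sum.inr j) = ⟨Fin.last N, j⟩ := rfl

theorem nextVars_castSucc {N n : ℕ} (r : Fin (N + 1) → ℕ) (x : Fin n → ℂ) (X : VarIdx r → ℂ)
    (a : Fin N) : nextVars r x X a.castSucc = nextVars (fun a : Fin N => r a.castSucc)
      (fun j => X ⟨Fin.last N, j⟩) (fun p => X ⟨p.1.castSucc, p.2⟩) a := by
  have h1 : (a.castSucc : ℕ) + 1 < N + 1 := by simp
  rw [nextVars, dif_pos h1, nextVars]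
  by_cases h : (a : ℕ) + 1 < N
  · rw [dif_pos h]; rfl
  · rw [dif_neg h]
    have key : ∀ b : Fin (N + 1), b = Fin.last N →
        List.ofFn (fun j : Fin (r b) => X ⟨b, j⟩) = List.ofFn fun j => X ⟨Fin.last N, j⟩ := by
      rintro _ rfl; rfl
    refine key _ (Fin.ext ?_)
    have := a.2
    simp only [Fin.val_castSucc, Fin.val_last]
    omega

theorem nextVars_last {N n : ℕ} (r : Fin (N + 1) → ℕ) (x : Fin n → ℂ) (X : VarIdx r → ℂ) :
    nextVars r x X (Fin.last N) = List.ofFn x := by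
  rw [nextVars, dif_neg (by simp)]

theorem blockProd_succ (q t : ℂ) {N n : ℕ} (r : Fin (N + 1) → ℕ) (x : Fin n → ℂ)
    (X : VarIdx r → ℂ) : blockProd q t r x X =
      blockProd q t (fun a : Fin N => r a.castSucc) (fun j => X ⟨Fin.last N, j⟩)
        (fun p => X ⟨p.1.castSucc, p.2⟩) *
      (triKernel q t (fun j => X ⟨Fin.last N, j⟩) *
        ∏ l, cauchyFactor q t (x l) fun j => X ⟨Fin.last N, j⟩) := by
  rw [blockProd, blockProd, Fin.prod_univ_castSucc, nextVars_last, List.map_ofFn, List.prod_ofFn]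
  simp only [nextVars_castSucc]
  rfl

/-- Once fixed, the variables of the last block play the part of the external variables for the
earlier blocks. -/
theorem AdmissibleRadii.castSucc {q : ℝ} {N n : ℕ} {r : Fin (N + 1) → ℕ} {x : Fin n → ℂ}
    {ρ : VarIdx r → ℝ} (h : AdmissibleRadii q r x ρ) {y : Fin (r (Fin.last N)) → ℂ}
    (hy : ∀ j, ‖y j‖ = ρ ⟨Fin.last N, j⟩) :
    AdmissibleRadii q (fun a : Fin N => r a.castSucc) y fun p => ρ ⟨p.1.castSucc, p.2⟩ where
  pos p := h.pos _
  same a i j hij := h.same a.castSucc i j hij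
  next a b hab i j := h.next a.castSucc b.castSucc (by simpa using hab) i j
  last a ha i j := by
    rw [hy]
    exact h.next a.castSucc (Fin.last N) (by simp [ha]) i j

/-- The contribution of block `a` to the integral. -/
def blockConst (q t : ℂ) {N : ℕ} (r s : Fin N → ℕ) (a : Fin N) : ℂ :=
  (qPoch q q / qPoch (t * q) q) ^ r a * (∏ k ∈ Finset.Icc 1 (r a), (1 - t ^ k) / (1 - t)) *
    (innerPrime q t (r a) (macdonaldRect q t r s (Finset.Iic a))
        (macdonaldRect q t r s (Finset.Iic a)) /
      innerQT q t (macdonaldRect q t r s (Finset.Iic a)) (macdonaldRect q t r s (Finset.Iic a)))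

theorem blockConst_castSucc (q t : ℂ) {N : ℕ} (r s : Fin (N + 1) → ℕ) (a : Fin N) :
    blockConst q t r s a.castSucc =
      blockConst q t (fun a => r a.castSucc) (fun a => s a.castSucc) a := by
  rw [blockConst, blockConst, ← Fin.map_castSuccEmb_Iic, macdonaldRect_map_castSucc]

/-- The blocks are integrated from the first outwards: for fixed variables of the last block the
earlier integrals give a Macdonald polynomial in them, the power of their product adds the last
rectangle, and the kernel carries the result to `x`. The induction starts from the empty partition,
whose function is 1. -/
theorem torusMean_blockProd {q : ℝ} (hq0 : 0 < q) (hq1 : q < 1) {t : ℂ} (ht0 : t ≠ 0) (ht : ‖t‖ < 1)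
    {N : ℕ} {r : Fin N → ℕ} (s : Fin N → ℕ) (hr : StrictMono r) {n : ℕ} (x : Fin n → ℂ)
    {ρ : VarIdx r → ℝ} (hρ : AdmissibleRadii q r x ρ) :
    torusMean ρ (fun X => (∏ p : VarIdx r, X p ^ s p.1) * blockProd q t r x X) =
      (∏ a, blockConst q t r s a) * evalAt (macdonaldRect q t r s Finset.univ) x := by
  induction N generalizing n with
  | zero =>
    have h1 := torusMean_monomial ρ 0
    rw [if_pos rfl] at h1
    have h2 : (fun X : VarIdx r → ℂ => (∏ p : VarIdx r, X p ^ s p.1) * blockProd q t r x X) =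
        fun X => ∏ i, X i ^ (0 : VarIdx r → ℤ) i := by
      funext X
      simp [blockProd]
    rw [h2, h1, Finset.univ_eq_empty, Finset.prod_empty, one_mul, macdonaldRect_eq,
      macdonaldP_eq_one hq0 hq1 ht0 ht (by simp [rectRows])]
  | succ N ih =>
    have hr' : StrictMono fun a : Fin N => r a.castSucc := hr.comp Fin.strictMono_castSucc
    set ρL : Fin (r (Fin.last N)) → ℝ := fun j => ρ ⟨Fin.last N, j⟩ with hρL
    have hρLpos : ∀ j, 0 < ρL j := fun j => hρ.pos _
    rw [torusMean_fubini (splitLast r) (exists_mean_blockProd hq0 hq1 ht s hρ)]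
    -- The induction hypothesis is used with as many external variables as the last block has; the
    -- factors depending on `y` only leave the inner integral.
    have hinner : ∀ y : Fin (r (Fin.last N)) → ℂ, (∀ j, ‖y j‖ = ρL j) →
        torusMean (fun i => ρ (splitLast r (Sum.inl i))) (fun X =>
          (∏ p : VarIdx r, (fun k => Sum.elim X y ((splitLast r).symm k)) p ^ s p.1) *
            blockProd q t r x fun k => Sum.elim X y ((splitLast r).symm k)) =
        (∏ a : Fin N, blockConst q t r s a.castSucc) *
          (evalAt (macdonaldRect q t r s Finset.univ) y * (triKernel q t y *
            ∏ l, cauchyFactor q t (x l) y)) := by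
      intro y hy
      have h1 := ih (fun a => s a.castSucc) hr' y (hρ.castSucc hy)
      have h2 : ∀ X : VarIdx (fun a : Fin N => r a.castSucc) → ℂ,
          (∏ p : VarIdx r, (fun k => Sum.elim X y ((splitLast r).symm k)) p ^ s p.1) *
            blockProd q t r x (fun k => Sum.elim X y ((splitLast r).symm k)) =
          ((∏ j, y j) ^ s (Fin.last N) * (triKernel q t y * ∏ l, cauchyFactor q t (x l) y)) *
          ((∏ p : VarIdx (fun a : Fin N => r a.castSucc), X p ^ s p.1.castSucc) *
            blockProd q t (fun a : Fin N => r a.castSucc) y X) := by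
        intro X
        have e1 : ∀ j, Sum.elim X y ((splitLast r).symm ⟨Fin.last N, j⟩) = y j := fun j => by
          rw [← splitLast_inr, Equiv.symm_apply_apply, Sum.elim_inr]
        have e2 : ∀ p : VarIdx (fun a : Fin N => r a.castSucc),
            Sum.elim X y ((splitLast r).symm ⟨p.1.castSucc, p.2⟩) = X p := fun p => by
          rw [← splitLast_inl, Equiv.symm_apply_apply, Sum.elim_inl]
        rw [blockProd_succ]
        simp only [e1, e2]
        rw [← Equiv.prod_comp (splitLast r), Fintype.prod_sum_type]
        simp only [Equiv.symm_apply_apply, Sum.elim_inl, Sum.elim_inr]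
        have e3 : ∏ j, y j ^ s (splitLast r (Sum.inr j)).1 = (∏ j, y j) ^ s (Fin.last N) :=
          Finset.prod_pow Finset.univ (s (Fin.last N)) y
        have e4 : ∏ p, X p ^ s (splitLast r (Sum.inl p)).1 =
          ∏ p : VarIdx (fun a : Fin N => r a.castSucc), X p ^ s p.1.castSucc := rfl
        rw [e3, e4]
        ring
      simp only [h2]
      rw [torusMean_const_mul, evalAt_macdonaldRect_succ hq0 hq1 ht0 ht hr]
      have h3 : torusMean (fun i => ρ (splitLast r (Sum.inl i))) (fun X =>
          (∏ p : VarIdx (fun a : Fin N => r a.castSucc), X p ^ s p.1.castSucc) *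
            blockProd q t (fun a : Fin N => r a.castSucc) y X) =
          (∏ a, blockConst q t (fun a : Fin N => r a.castSucc) (fun a => s a.castSucc) a) *
            evalAt (macdonaldRect q t (fun a : Fin N => r a.castSucc) (fun a => s a.castSucc)
              Finset.univ) y := h1
      rw [h3]
      simp only [blockConst_castSucc]
      ring
    have houter : torusMean (fun j => ρ (splitLast r (Sum.inr j))) (fun y =>
        torusMean (fun i => ρ (splitLast r (Sum.inl i))) (fun X =>
          (∏ p : VarIdx r, (fun k => Sum.elim X y ((splitLast r).symm k)) p ^ s p.1) *
            blockProd q t r x fun k => Sum.elim X y ((splitLast r).symm k))) =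
        (∏ a : Fin N, blockConst q t r s a.castSucc) * torusMean ρL (fun y =>
          evalAt (macdonaldRect q t r s Finset.univ) y * (triKernel q t y *
            ∏ l, cauchyFactor q t (x l) y)) := by
      rw [← torusMean_const_mul]
      exact torusMean_congr hρLpos hinner
    refine houter.trans ?_
    rw [macdonaldRect_eq, torusMean_block hq0 hq1 ht0 ht (macdonaldP_spec hq0 hq1 ht0 ht _)
      (rectPartition r s Finset.univ) (card_rectPartition_le (sup_univ_le hr _)) x hρLpos
      (fun i j hij => ?_) (fun l i => hρ.last (Fin.last N) (by simp) l i), Fin.prod_univ_castSucc]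
    · have h4 : Finset.Iic (Fin.last N) = Finset.univ := by
        ext a; simp [Fin.le_last]
      rw [blockConst, h4, macdonaldRect_eq]
      ring
    · have h1 := hρ.pos ⟨Fin.last N, i⟩
      obtain ⟨h2, h3⟩ := hρ.same (Fin.last N) i j hij
      rw [lt_div_iff₀ h1] at h2
      rw [div_lt_one h1] at h3
      exact ⟨h2.le, h3.le⟩

/-! ### The constants -/

/-- The lower bound `q < ρ_j / ρ_i` for `i < j` is needed exactly for the thermal contractions in
the reversed order. -/
theorem AdmissibleRadii.radiallyOrdered {q : ℝ} (hq0 : 0 < q) (hq1 : q < 1) {N n : ℕ}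
    {r : Fin N → ℕ} {x : Fin n → ℂ} {ρ : VarIdx r → ℝ} (h : AdmissibleRadii q r x ρ)
    {X : VarIdx r → ℂ} (hX : ∀ p, ‖X p‖ = ρ p) : RadiallyOrdered q r x X where
  lt a i j hij := by
    rw [norm_div, hX, hX]
    exact (h.same a i j hij).2
  lt_inv a i j := by
    have hi := h.pos ⟨a, i⟩
    have hj := h.pos ⟨a, j⟩
    rw [norm_mul, norm_div, hX, hX, Complex.norm_real, Real.norm_eq_abs, abs_of_pos hq0]
    rcases lt_trichotomy i j with hij | rfl | hij
    · have := (h.same a i j hij).2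
      have h0 : 0 < ρ ⟨a, j⟩ / ρ ⟨a, i⟩ := by positivity
      nlinarith
    · rw [div_self hi.ne', mul_one]; exact hq1
    · have := (h.same a j i hij).1
      rw [lt_div_iff₀ hj] at this
      rw [← mul_div_assoc, div_lt_one hi]
      exact this
  next a w hw j := by
    have hj := h.pos ⟨a, j⟩
    rw [norm_div, hX, div_lt_one hj]
    by_cases ha : (a : ℕ) + 1 < N
    · rw [nextVars, dif_pos ha, List.mem_ofFn] at hw
      obtain ⟨i, rfl⟩ := hw
      rw [hX]
      exact h.next a ⟨(a : ℕ) + 1, ha⟩ rfl i j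
    · rw [nextVars, dif_neg ha, List.mem_ofFn] at hw
      obtain ⟨i, rfl⟩ := hw
      exact h.last a (by omega) i j

theorem one_sub_pow_ne_zero {t : ℂ} (ht : ‖t‖ < 1) {k : ℕ} (hk : k ≠ 0) : 1 - t ^ k ≠ 0 :=
  one_sub_ne_zero_of_norm_lt (by rw [norm_pow]; exact pow_lt_one₀ (norm_nonneg t) ht hk)

/-- The prefactor of the theorem is the inverse of the block constants; cancelling requires both
norms of the Macdonald function to be nonzero. -/
theorem mul_blockConst {q : ℝ} (hq0 : 0 < q) (hq1 : q < 1) {t : ℂ} (ht0 : t ≠ 0) (ht : ‖t‖ < 1)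
    {N : ℕ} {r : Fin N → ℕ} (s : Fin N → ℕ) (hr : StrictMono r) (a : Fin N) :
    innerQT q t (macdonaldRect q t r s (Finset.Iic a)) (macdonaldRect q t r s (Finset.Iic a)) /
      (((r a).factorial : ℂ) * innerPrime q t (r a) (macdonaldRect q t r s (Finset.Iic a))
          (macdonaldRect q t r s (Finset.Iic a))) * (qPoch q q ^ r a)⁻¹ * qPoch (t * q) q ^ r a *
      (((r a).factorial : ℂ) * ∏ k ∈ Finset.Icc 1 (r a), (1 - t) / (1 - t ^ k)) *
      blockConst q t r s a = 1 := by
  have hsup : (Finset.Iic a).sup r ≤ r a :=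
    Finset.sup_le fun b hb => hr.monotone (Finset.mem_Iic.1 hb)
  have hP := macdonaldP_spec hq0 hq1 ht0 ht (rectRows r s (Finset.Iic a)).sum
  have h1 : innerQT q t (macdonaldRect q t r s (Finset.Iic a))
      (macdonaldRect q t r s (Finset.Iic a)) ≠ 0 := hP.norm_ne_zero _
  have h2 : innerPrime q t (r a) (macdonaldRect q t r s (Finset.Iic a))
      (macdonaldRect q t r s (Finset.Iic a)) ≠ 0 := by
    rw [innerPrime_eq]
    refine mul_ne_zero (one_div_ne_zero (by exact_mod_cast (r a).factorial_ne_zero)) ?_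
    exact innerMean_self_ne_zero hq0 hq1 ht0 ht
      (hP.isEigen ht0 (rectPartition r s (Finset.Iic a)) (card_rectPartition_le hsup))
  have hq : ‖(q : ℂ)‖ < 1 := by
    rw [Complex.norm_real, Real.norm_eq_abs, abs_of_pos hq0]; exact hq1
  have h3 : qPoch (q : ℂ) q ≠ 0 := qPoch_ne_zero hq0 hq1 hq
  have h4 : qPoch (t * q) q ≠ 0 := qPoch_ne_zero hq0 hq1 (by
    rw [norm_mul]; nlinarith [norm_nonneg t, norm_nonneg (q : ℂ)])
  have h5 : ((r a).factorial : ℂ) ≠ 0 := by exact_mod_cast (r a).factorial_ne_zero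
  have h6 : (∏ k ∈ Finset.Icc 1 (r a), (1 - t) / (1 - t ^ k)) *
      ∏ k ∈ Finset.Icc 1 (r a), (1 - t ^ k) / (1 - t) = 1 := by
    rw [← Finset.prod_mul_distrib]
    refine Finset.prod_eq_one fun k hk => ?_
    have e1 : 1 - t ≠ 0 := one_sub_ne_zero_of_norm_lt ht
    have e2 : 1 - t ^ k ≠ 0 := one_sub_pow_ne_zero ht (by have := (Finset.mem_Icc.1 hk).1; omega)
    field_simp
  rw [blockConst, div_pow]
  generalize innerQT (q : ℂ) t _ _ = A at *
  generalize innerPrime (q : ℂ) t _ _ _ = B at *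
  generalize (∏ k ∈ Finset.Icc 1 (r a), (1 - t) / (1 - t ^ k)) = C at *
  generalize (∏ k ∈ Finset.Icc 1 (r a), (1 - t ^ k) / (1 - t)) = D at *
  field_simp
  linear_combination h6

end MacdonaldBoson

end

/-! ### The trace formula for Macdonald functions. -/

theorem proposition4p2 (q : ℝ) (hq0 : 0 < q) (hq1 : q < 1)
    (β : ℂ) (hβ : 0 < β.re) (t : ℂ) (ht : t = (q : ℂ) ^ β)
    (N : ℕ) (r s : Fin N → ℕ) (hr : StrictMono r) (hr0 : ∀ a, 0 < r a) (hs : ∀ a, 0 < s a)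
    (n : ℕ) (x : Fin n → ℂ) (ρ : VarIdx r → ℝ) (hρ : AdmissibleRadii q r x ρ) :
    (∀ X : VarIdx r → ℂ, (∀ p, ‖X p‖ = ρ p) → BosonTraceConverges q t r x X) ∧
    TorusMeanExists ρ
      (fun X => (∏ p : VarIdx r, X p ^ s p.1) * bosonTrace q t r x X) ∧
    evalAt (macdonaldRect (q : ℂ) t r s Finset.univ) x =
      Cplus (q : ℂ) t r s
        * qPoch (q : ℂ) (q : ℂ) ^ ((N : ℤ) - ∑ a, (r a : ℤ))
        * qPoch (t * (q : ℂ)) (q : ℂ) ^ (∑ a, r a)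
        * (∏ a : Fin N, ((r a).factorial : ℂ) *
            ∏ k ∈ Finset.Icc 1 (r a), (1 - t) / (1 - t ^ k))
        * torusMean ρ
            (fun X => (∏ p : VarIdx r, X p ^ s p.1) * bosonTrace q t r x X) := by
  have ht0 : t ≠ 0 := by
    rw [ht]
    exact fun h => (Complex.ofReal_ne_zero.2 hq0.ne') ((Complex.cpow_eq_zero_iff _ _).1 h).1
  have ht1 : ‖t‖ < 1 := by
    rw [ht, Complex.norm_cpow_eq_rpow_re_of_pos hq0]
    exact Real.rpow_lt_one hq0.le hq1 hβ
  have hspec := fun X hX => bosonTrace_spec hq0 hq1 ht1 (hρ.radiallyOrdered hq0 hq1 (X := X) hX)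
  have htrace : ∀ X : VarIdx r → ℂ, (∀ p, ‖X p‖ = ρ p) →
      (∏ p : VarIdx r, X p ^ s p.1) * bosonTrace q t r x X =
        ((qPoch q q)⁻¹) ^ N * ((∏ p : VarIdx r, X p ^ s p.1) * blockProd q t r x X) := by
    intro X hX
    rw [(hspec X hX).2, blockProd]
    ring
  have hex := (exists_mean_blockProd hq0 hq1 ht1 s hρ).const_mul (((qPoch q q)⁻¹) ^ N)
  refine ⟨fun X hX => (hspec X hX).1, hex.congr hρ.pos fun X hX => (htrace X hX).symm, ?_⟩
  rw [torusMean_congr hρ.pos htrace, torusMean_const_mul,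
    torusMean_blockProd hq0 hq1 ht0 ht1 s hr x hρ]
  have hq : ‖(q : ℂ)‖ < 1 := by
    rw [Complex.norm_real, Real.norm_eq_abs, abs_of_pos hq0]; exact hq1
  have hqq : qPoch (q : ℂ) q ≠ 0 := qPoch_ne_zero hq0 hq1 hq
  -- The integer exponent may be negative; it is split into `N` positive powers, which cancel the
  -- prefactor of the trace, and `r a` inverse powers for each block.
  have hpow : qPoch (q : ℂ) (q : ℂ) ^ ((N : ℤ) - ∑ a, (r a : ℤ)) =
      qPoch (q : ℂ) q ^ N * ∏ a, (qPoch (q : ℂ) q ^ r a)⁻¹ := by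
    rw [zpow_sub₀ hqq, zpow_natCast, ← Nat.cast_sum, zpow_natCast, div_eq_mul_inv,
      Finset.prod_inv_distrib, Finset.prod_pow_eq_pow_sum]
  have hprod := Finset.prod_congr rfl fun a (_ : a ∈ (Finset.univ : Finset (Fin N))) =>
    mul_blockConst hq0 hq1 ht0 ht1 s hr a
  simp only [Finset.prod_mul_distrib (s := (Finset.univ : Finset (Fin N))),
    Finset.prod_const_one] at hprod
  rw [hpow, Cplus, ← Finset.prod_pow_eq_pow_sum]
  simp only [Finset.prod_mul_distrib (s := (Finset.univ : Finset (Fin N)))]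
  have hN : qPoch (q : ℂ) q ^ N * ((qPoch (q : ℂ) q)⁻¹) ^ N = 1 := by
    rw [← mul_pow, mul_inv_cancel₀ hqq, one_pow]
  linear_combination (-(evalAt (macdonaldRect (q : ℂ) t r s Finset.univ) x) *
      (qPoch (q : ℂ) q ^ N * ((qPoch (q : ℂ) q)⁻¹) ^ N)) * hprod -
    (evalAt (macdonaldRect (q : ℂ) t r s Finset.univ) x) * hN
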